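/- Let $k$ be a commutative $\mathbb{Q}$-algebra. \textbf{Potentials.} A potential $(x,W)$ is a polynomial $W\in k[x]=k[x_1,\ldots,x_n]$ such that the partial derivatives $\partial_{x_i}W$ form a quasi-regular sequence, $J_W=k[x]/(\partial_{x_1}W,\ldots,\partial_{x_n}W)$ is a finitely generated free $k$-module, and the Koszul complex of the $\partial_{x_i}W$ is exact except in degree zero. \textbf{The category $\mathcal{C}(W,V)$.} For potentials $(x,W)$ and $(y,V)$ let $\mathcal{C}(W,V)$ be the Clifford thickening of the idempotent completion of the homotopy category of finite rank matrix factorisations of $V(y)-W(x)$ over $k[x,y]$. Here an operator $f$ of degree $p$ between matrix factorisations is closed if $df=(-1)^pfd$, and null-homotopic if $f=dh+(-1)^phd$ for an operator $h$ of degree $p+1$. Concretely, an object is a finite rank $\mathbb{Z}_2$-graded free $k[x,y]$-module $X$ (given with a homogeneous basis), an odd operator $d_X$ with $d_X^2=V-W$, an even closed operator $e$, an integer $s\ge 0$ and odd closed operators $\gamma_i,\gamma_i^\dagger$ $(1\le i\le s)$ such that, up to homotopy, $e^2=e$, $\gamma_ie=\gamma_i=e\gamma_i$, $\gamma_i^\dagger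 e=\gamma_i^\dagger=e\gamma_i^\dagger$, and the relations of the Clifford algebra $C_s$ hold: $\gamma_i\gamma_j+\gamma_j\gamma_i=0$, $\gamma^\dagger_i\gamma^\dagger_j+\gamma^\dagger_j\gamma^\dagger_i=0$, $\gamma_i\gamma^\dagger_j+\gamma^\dagger_j\gamma_i=\delta_{ij}e$. A morphism is a homotopy class of even closed operators $\phi$ with $\phi e=\phi=e\phi$, $\phi\gamma_i^\dagger=0$ and $\gamma_j\phi=0$ up to homotopy; composition is that of operators, and the identity is the class of $e_s=\gamma_1\cdots\gamma_s\gamma^\dagger_s\cdots\gamma^\dagger_1$ (which is $e$ if $s=0$). This is a $k$-linear supercategory: $\Psi$ shifts the grading, changes the signs of $d_X,\gamma_i,\gamma_i^\dagger$ and does not change the operators $e$ and $\phi$, and $\xi:\Psi^2\cong 1$ is given by the identity operator. \textbf{The cut.} Let $(x,W),(y,V),(z,U)$ be potentials, $y=(y_1,\ldots,y_m)$, $t_i=\partial_{y_i}V$. Choose a $k$-basis of $J_V$ and a flat $k$-linear connection over $k[t]$ on the $(t)$-adic completion $\widehat{k[y]}$ of $k[y]$, that is, commuting $k$-linear operators $\partial_{t_1},\ldots,\partial_{t_m}$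 on $\widehat{k[y]}$ with $\partial_{t_i}(f(t)h)=\frac{\partial f}{\partial t_i}(t)\,h+f(t)\,\partial_{t_i}(h)$ for polynomials $f$. For $Y\in\mathcal{C}(V,U)$ and $X\in\mathcal{C}(W,V)$ put $Y\,|\,X=Y\otimes_{k[y]}J_V\otimes_{k[y]}X$, a finite rank free $k[x,z]$-module, with differential $d_Y\otimes 1+1\otimes d_X$. If $g$ and $f$ are operators on $Y$ and $X$, let $g\,|\,f$ be the operator on $Y\,|\,X$ induced by $g\otimes f$ (with the Koszul sign). Extending $\partial_{t_i}$ to $Y\otimes_{k[y]}\widehat{k[y]}\otimes_{k[y]}X$ by means of the homogeneous bases, let $\mathrm{At}_i$ be the operator on $Y\,|\,X$ induced by $[d_Y\otimes 1+1\otimes d_X,\partial_{t_i}]$, and let $$\gamma_i=\mathrm{At}_i,\qquad \gamma_i^\dagger=-\,1\otimes\partial_{y_i}(d_X)-\tfrac12\sum_q\partial_{y_q}\partial_{y_i}(V)\,\mathrm{At}_q\qquad(1\le i\le m).$$ \textbf{Proposition.} The basis of $J_V$ and the connection exist for every potential $V$. For every such choice (one for each potential), the following holds. 1. Let $Y\in\mathcal{C}(V,U)$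 have idempotent $e_Y$ and an action $\rho_j,\rho_j^\dagger$ of $C_r$, and let $X\in\mathcal{C}(W,V)$ have idempotent $e_X$ and an action $\tau_l,\tau_l^\dagger$ of $C_s$. Then the matrix factorisation $Y\,|\,X$ of $U-W$ with the idempotent $e=e_Y\,|\,e_X$ and with the operators $$\rho_j\,|\,e_X,\ \rho_j^\dagger\,|\,e_X;\qquad \gamma_ie,\ \gamma^\dagger_ie;\qquad e_Y\,|\,\tau_l,\ e_Y\,|\,\tau_l^\dagger,$$ in this order, as generators of $C_r\otimes C_m\otimes C_s\cong C_{r+m+s}$, is an object of $\mathcal{C}(W,U)$. 2. With $e_m=\gamma_1\cdots\gamma_m\gamma^\dagger_m\cdots\gamma^\dagger_1$, the assignments $(Y,X)\mapsto Y\,|\,X$ and $([\psi],[\phi])\mapsto[e_m\circ(\psi\,|\,\phi)]$ are a well-defined $k$-linear functor $\mathcal{C}(V,U)\otimes_k\mathcal{C}(W,V)\to\mathcal{C}(W,U)$. 3. For a composable triple $W\xrightarrow{X}V\xrightarrow{Y}U\xrightarrow{Z}Q$, with $V$ in $m$ and $U$ in $p$ variables, the map $\alpha:(Z\,|\,Y)\,|\,X\to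 Z\,|\,(Y\,|\,X)$, $(z\otimes y)\otimes x\mapsto z\otimes(y\otimes x)$, is closed and commutes up to homotopy with the idempotents and with all Clifford generators; in particular it is $C_m\otimes C_p$-linear for the actions of $C_m$ and $C_p$ that come from the two cuts. 4. The potentials, the supercategories $\mathcal{C}(W,V)$, the functors of 2, the associator induced by $\alpha$ (the class of $\alpha$ composed with the identity morphism), and the isomorphisms $\tau:\Psi Y\,|\,X\cong\Psi(Y\,|\,X)$, $\tau:Y\,|\,\Psi X\cong\Psi(Y\,|\,X)$ induced by $y\otimes x\mapsto y\otimes x$ and $y\otimes x\mapsto(-1)^{|y|}y\otimes x$ form a superbicategory without units: the associator is a natural isomorphism which satisfies the pentagon identity, the $\tau$ are natural isomorphisms compatible with $\xi:\Psi^2\cong 1$, the two resulting isomorphisms $\Psi Y\,|\,\Psi X\cong\Psi^2(Y\,|\,X)$ differ by the sign $-1$, and the associator is compatible with $\tau$ in each of its three arguments. -/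

import Mathlib

open CategoryTheory

universe u v w

namespace CutSystem

/-! ## Supercategories and superbicategories without units -/

/-- A `k`-linear supercategory: a `k`-linear category with a `k`-linear endofunctor `Ψ` and a
natural isomorphism `ξ : Ψ² ≅ 1` such that `ξ * 1_Ψ = 1_Ψ * ξ`. -/
class Supercategory (k : Type u) [CommRing k] (T : Type w) [Category.{v} T] [Preadditive T]
    [Linear k T] where
  Ψ : T ⥤ T
  map_add : ∀ {X Y : T} (f g : X ⟶ Y), Ψ.map (f + g) = Ψ.map f + Ψ.map g
  map_smul : ∀ {X Y : T} (c : k) (f : X ⟶ Y), Ψ.map (c • f) = c • Ψ.map f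
  ξ : Ψ ⋙ Ψ ≅ 𝟭 T
  ξ_comm : ∀ X : T, ξ.hom.app (Ψ.obj X) = Ψ.map (ξ.hom.app X)

/-- The endofunctor `Ψ` of a supercategory. -/
abbrev shift (k : Type u) [CommRing k] {T : Type w} [Category.{v} T] [Preadditive T]
    [Linear k T] [Supercategory k T] : T ⥤ T := Supercategory.Ψ k

/-- The component `Ψ Ψ X ⟶ X` of `ξ`. -/
abbrev shiftShift (k : Type u) [CommRing k] {T : Type w} [Category.{v} T] [Preadditive T]
    [Linear k T] [Supercategory k T] (X : T) : (shift k).obj ((shift k).obj X) ⟶ X :=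
  (Supercategory.ξ (k := k) (T := T)).hom.app X

/-- The structure of a superbicategory without units, with prescribed objects `Ob`, prescribed
supercategories `Hom a b` of `1`- and `2`-morphisms, and prescribed composition `comp Y X` of
`1`-morphisms (first `X`, then `Y`; written `Y | X` in the comments). It consists of

* the action `ψ | φ` of composition on `2`-morphisms, making composition a `k`-bilinear functor,
  that is, a `k`-linear functor `Hom b c ⊗ Hom a b ⥤ Hom a c`;
* a natural associator satisfying the pentagon identity;
* natural isomorphisms `τ : ΨY | X ≅ Ψ(Y | X)` and `τ : Y | ΨX ≅ Ψ(Y | X)`, which make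
  composition a superfunctor (compatibility with `ξ`, and the two ways to pull out both copies of
  `Ψ` from `ΨY | ΨX` differ by the sign `-1`), and with which the associator is compatible. -/
structure SuperbicategoryWithoutUnits (k : Type u) [CommRing k] (Ob : Type*)
    (Hom : Ob → Ob → Type w) [∀ a b, Category.{v} (Hom a b)] [∀ a b, Preadditive (Hom a b)]
    [∀ a b, Linear k (Hom a b)] [∀ a b, Supercategory k (Hom a b)]
    (comp : ∀ {a b c : Ob}, Hom b c → Hom a b → Hom a c) where
  /-- composition on `2`-morphisms -/
  hcomp : ∀ {a b c : Ob} {Y Y' : Hom b c} {X X' : Hom a b},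
    (Y ⟶ Y') → (X ⟶ X') → (comp Y X ⟶ comp Y' X')
  hcomp_id : ∀ {a b c : Ob} (Y : Hom b c) (X : Hom a b), hcomp (𝟙 Y) (𝟙 X) = 𝟙 (comp Y X)
  hcomp_comp : ∀ {a b c : Ob} {Y Y' Y'' : Hom b c} {X X' X'' : Hom a b}
    (ψ : Y ⟶ Y') (ψ' : Y' ⟶ Y'') (φ : X ⟶ X') (φ' : X' ⟶ X''),
    hcomp (ψ ≫ ψ') (φ ≫ φ') = hcomp ψ φ ≫ hcomp ψ' φ'
  hcomp_add_left : ∀ {a b c : Ob} {Y Y' : Hom b c} {X X' : Hom a b} (ψ ψ' : Y ⟶ Y')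
    (φ : X ⟶ X'), hcomp (ψ + ψ') φ = hcomp ψ φ + hcomp ψ' φ
  hcomp_add_right : ∀ {a b c : Ob} {Y Y' : Hom b c} {X X' : Hom a b} (ψ : Y ⟶ Y')
    (φ φ' : X ⟶ X'), hcomp ψ (φ + φ') = hcomp ψ φ + hcomp ψ φ'
  hcomp_smul_left : ∀ {a b c : Ob} {Y Y' : Hom b c} {X X' : Hom a b} (s : k) (ψ : Y ⟶ Y')
    (φ : X ⟶ X'), hcomp (s • ψ) φ = s • hcomp ψ φ
  hcomp_smul_right : ∀ {a b c : Ob} {Y Y' : Hom b c} {X X' : Hom a b} (s : k) (ψ : Y ⟶ Y')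
    (φ : X ⟶ X'), hcomp ψ (s • φ) = s • hcomp ψ φ
  /-- the associator `(Z | Y) | X ≅ Z | (Y | X)` -/
  assoc : ∀ {a b c d : Ob} (Z : Hom c d) (Y : Hom b c) (X : Hom a b),
    comp (comp Z Y) X ≅ comp Z (comp Y X)
  assoc_naturality : ∀ {a b c d : Ob} {Z Z' : Hom c d} {Y Y' : Hom b c} {X X' : Hom a b}
    (ζ : Z ⟶ Z') (ψ : Y ⟶ Y') (φ : X ⟶ X'),
    hcomp (hcomp ζ ψ) φ ≫ (assoc Z' Y' X').hom = (assoc Z Y X).hom ≫ hcomp ζ (hcomp ψ φ)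
  pentagon : ∀ {a b c d e : Ob} (V : Hom d e) (Z : Hom c d) (Y : Hom b c) (X : Hom a b),
    hcomp (assoc V Z Y).hom (𝟙 X) ≫ (assoc V (comp Z Y) X).hom ≫ hcomp (𝟙 V) (assoc Z Y X).hom
      = (assoc (comp V Z) Y X).hom ≫ (assoc V Z (comp Y X)).hom
  /-- `ΨY | X ≅ Ψ(Y | X)` -/
  τl : ∀ {a b c : Ob} (Y : Hom b c) (X : Hom a b),
    comp ((shift k).obj Y) X ≅ (shift k).obj (comp Y X)
  τl_naturality : ∀ {a b c : Ob} {Y Y' : Hom b c} {X X' : Hom a b} (ψ : Y ⟶ Y') (φ : X ⟶ X'),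
    hcomp ((shift k).map ψ) φ ≫ (τl Y' X').hom = (τl Y X).hom ≫ (shift k).map (hcomp ψ φ)
  /-- `Y | ΨX ≅ Ψ(Y | X)` -/
  τr : ∀ {a b c : Ob} (Y : Hom b c) (X : Hom a b),
    comp Y ((shift k).obj X) ≅ (shift k).obj (comp Y X)
  τr_naturality : ∀ {a b c : Ob} {Y Y' : Hom b c} {X X' : Hom a b} (ψ : Y ⟶ Y') (φ : X ⟶ X'),
    hcomp ψ ((shift k).map φ) ≫ (τr Y' X').hom = (τr Y X).hom ≫ (shift k).map (hcomp ψ φ)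
  τl_ξ : ∀ {a b c : Ob} (Y : Hom b c) (X : Hom a b),
    (τl ((shift k).obj Y) X).hom ≫ (shift k).map (τl Y X).hom ≫ shiftShift k (comp Y X)
      = hcomp (shiftShift k Y) (𝟙 X)
  τr_ξ : ∀ {a b c : Ob} (Y : Hom b c) (X : Hom a b),
    (τr Y ((shift k).obj X)).hom ≫ (shift k).map (τr Y X).hom ≫ shiftShift k (comp Y X)
      = hcomp (𝟙 Y) (shiftShift k X)
  τr_τl : ∀ {a b c : Ob} (Y : Hom b c) (X : Hom a b),
    (τr ((shift k).obj Y) X).hom ≫ (shift k).map (τl Y X).hom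
      = - ((τl Y ((shift k).obj X)).hom ≫ (shift k).map (τr Y X).hom)
  assoc_τ₁ : ∀ {a b c d : Ob} (Z : Hom c d) (Y : Hom b c) (X : Hom a b),
    (assoc Z Y ((shift k).obj X)).hom ≫ hcomp (𝟙 Z) (τr Y X).hom ≫ (τr Z (comp Y X)).hom
      = (τr (comp Z Y) X).hom ≫ (shift k).map (assoc Z Y X).hom
  assoc_τ₂ : ∀ {a b c d : Ob} (Z : Hom c d) (Y : Hom b c) (X : Hom a b),
    (assoc Z ((shift k).obj Y) X).hom ≫ hcomp (𝟙 Z) (τl Y X).hom ≫ (τr Z (comp Y X)).hom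
      = hcomp (τr Z Y).hom (𝟙 X) ≫ (τl (comp Z Y) X).hom ≫ (shift k).map (assoc Z Y X).hom
  assoc_τ₃ : ∀ {a b c d : Ob} (Z : Hom c d) (Y : Hom b c) (X : Hom a b),
    (assoc ((shift k).obj Z) Y X).hom ≫ (τl Z (comp Y X)).hom
      = hcomp (τl Z Y).hom (𝟙 X) ≫ (τl (comp Z Y) X).hom ≫ (shift k).map (assoc Z Y X).hom

/-! ## Matrix factorisations up to homotopy -/

/-- The sign `(-1)^p`. -/
def sgn (R : Type u) [CommRing R] (p : ZMod 2) : R := if p = 0 then 1 else -1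

/-- A `ℤ/2`-graded free `R`-module with a finite homogeneous basis indexed by `ι`, the basis
element `i` having degree `par i`, together with an endomorphism `d`, given by its matrix. -/
structure GradedOp (R : Type u) [CommRing R] where
  ι : Type
  [fintype : Fintype ι]
  [decEq : DecidableEq ι]
  par : ι → ZMod 2
  d : Matrix ι ι R

attribute [instance] GradedOp.fintype GradedOp.decEq

section Operators

variable {R : Type u} [CommRing R]

/-- `R`-linear maps `M → N`, as matrices. -/
abbrev Op (M N : GradedOp R) : Type u := Matrix N.ι M.ι R

/-- The linear map `f : M → N` is homogeneous of degree `p`. -/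
def HasDeg {M N : GradedOp R} (p : ZMod 2) (f : Op M N) : Prop :=
  ∀ i j, N.par i ≠ M.par j + p → f i j = 0

/-- `f` is homogeneous of degree `p` and closed: the graded commutator with `d` vanishes. -/
def IsClosedOp {M N : GradedOp R} (p : ZMod 2) (f : Op M N) : Prop :=
  HasDeg p f ∧ N.d * f = sgn R p • (f * M.d)

/-- `f`, of degree `p`, is null-homotopic: `f = d h - (-1)^|h| h d` with `h` of degree `p + 1`. -/
def IsNull {M N : GradedOp R} (p : ZMod 2) (f : Op M N) : Prop :=
  ∃ h : Op M N, HasDeg (p + 1) h ∧ f = N.d * h + sgn R p • (h * M.d)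

/-- Two operators of degree `p` are homotopic. -/
def Htpy {M N : GradedOp R} (p : ZMod 2) (f g : Op M N) : Prop := IsNull p (f - g)

end Operators

/-- The data underlying a representation of a Clifford algebra on an object of the idempotent
completion of a homotopy category of matrix factorisations: operators `e` (the idempotent) and
`γ i`, `γd i` (the generators of the Clifford algebra `C_n`; `γd` stands for `γ†`). -/
structure CliffordData (R : Type u) [CommRing R] extends GradedOp R where
  e : Matrix ι ι R
  n : ℕ
  γ : Fin n → Matrix ι ι R
  γd : Fin n → Matrix ι ι R

/-- `M` is a finite rank matrix factorisation of `W`, `e` is an idempotent in the homotopy category,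
and `γ`, `γd` are odd closed operators on `(M, e)` which up to homotopy satisfy the Clifford
relations. -/
structure CliffordData.IsRep {R : Type u} [CommRing R] (W : R) (M : CliffordData R) : Prop where
  d_deg : HasDeg 1 M.d
  d_sq : M.d * M.d = W • (1 : Matrix M.ι M.ι R)
  e_closed : IsClosedOp 0 M.e
  e_idem : Htpy 0 (M.e * M.e) M.e
  γ_closed : ∀ i, IsClosedOp 1 (M.γ i)
  γd_closed : ∀ i, IsClosedOp 1 (M.γd i)
  γ_e : ∀ i, Htpy 1 (M.γ i * M.e) (M.γ i)
  e_γ : ∀ i, Htpy 1 (M.e * M.γ i) (M.γ i)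
  γd_e : ∀ i, Htpy 1 (M.γd i * M.e) (M.γd i)
  e_γd : ∀ i, Htpy 1 (M.e * M.γd i) (M.γd i)
  γ_γ : ∀ i j, Htpy 0
    (M.γ i * M.γ j + M.γ j * M.γ i) 0
  γd_γd : ∀ i j, Htpy 0
    (M.γd i * M.γd j + M.γd j * M.γd i) 0
  γ_γd : ∀ i j, Htpy 0
    (M.γ i * M.γd j + M.γd j * M.γ i) (if i = j then M.e else 0)

/-- The nested product `γ 0 ⋯ γ (n-1) * x * γd (n-1) ⋯ γd 0`. -/
def nest {ι R : Type*} [CommRing R] [Fintype ι] {n : ℕ} (γ γd : Fin n → Matrix ι ι R)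
    (x : Matrix ι ι R) : Matrix ι ι R :=
  (List.finRange n).foldr (fun i y => γ i * y * γd i) x

/-- The action of `e_n = γ₁ ⋯ γₙ γ†ₙ ⋯ γ†₁ ∈ C_n` on `(M, e)`; for `n = 0` this is `e`, the identity
of the object in the idempotent completion. -/
def CliffordData.unit {R : Type u} [CommRing R] (M : CliffordData R) : Matrix M.ι M.ι R :=
  nest M.γ M.γd M.e


/-! ### The category of Clifford representations -/

section Toolkit

variable {R : Type u} [CommRing R]

theorem sgn_add (p q : ZMod 2) : sgn R (p + q) = sgn R p * sgn R q := by
  have h : ∀ p q : ZMod 2, (p = 0 ∧ q = 0 ∧ p + q = 0) ∨ (p = 0 ∧ q ≠ 0 ∧ p + q ≠ 0) ∨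
      (p ≠ 0 ∧ q = 0 ∧ p + q ≠ 0) ∨ (p ≠ 0 ∧ q ≠ 0 ∧ p + q = 0) := by decide
  rcases h p q with ⟨a, b, c⟩ | ⟨a, b, c⟩ | ⟨a, b, c⟩ | ⟨a, b, c⟩ <;> simp [sgn, a, b, c]

theorem sgn_mul_self (p : ZMod 2) : sgn R p * sgn R p = 1 := by
  unfold sgn; split_ifs <;> simp

theorem sgn_zero : sgn R 0 = 1 := by simp [sgn]

theorem sgn_one : sgn R 1 = -1 := by simp [sgn]

variable {M N P : GradedOp R}

theorem HasDeg.zero (p : ZMod 2) : HasDeg p (0 : Op M N) := fun _ _ _ => rfl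

theorem HasDeg.add {p : ZMod 2} {f g : Op M N} (hf : HasDeg p f) (hg : HasDeg p g) :
    HasDeg p (f + g) := fun i j h => by simp [hf i j h, hg i j h]

theorem HasDeg.smul {p : ZMod 2} {f : Op M N} (r : R) (hf : HasDeg p f) :
    HasDeg p (r • f) := fun i j h => by simp [hf i j h]

theorem HasDeg.mul {p q : ZMod 2} {g : Op N P} {f : Op M N} (hg : HasDeg q g) (hf : HasDeg p f) :
    HasDeg (p + q) (g * f : Op M P) := fun i j h => by
  rw [Matrix.mul_apply]
  refine Finset.sum_eq_zero fun l _ => ?_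
  by_cases h1 : N.par l = M.par j + p
  · rw [hg i l, zero_mul]
    rw [h1, add_assoc]; exact h
  · rw [hf l j h1, mul_zero]

theorem HasDeg.one : HasDeg 0 (1 : Op M M) := fun i j h => by
  rw [Matrix.one_apply_ne]
  rintro rfl
  simp at h

theorem IsNull.zero (p : ZMod 2) : IsNull p (0 : Op M N) := ⟨0, HasDeg.zero _, by simp⟩

theorem IsNull.add {p : ZMod 2} {f g : Op M N} (hf : IsNull p f) (hg : IsNull p g) :
    IsNull p (f + g) := by
  obtain ⟨h, hh, rfl⟩ := hf
  obtain ⟨l, hl, rfl⟩ := hg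
  refine ⟨h + l, hh.add hl, ?_⟩
  rw [Matrix.mul_add, Matrix.add_mul, smul_add]; abel

theorem IsNull.smul {p : ZMod 2} {f : Op M N} (r : R) (hf : IsNull p f) : IsNull p (r • f) := by
  obtain ⟨h, hh, rfl⟩ := hf
  refine ⟨r • h, hh.smul r, ?_⟩
  rw [Matrix.mul_smul, Matrix.smul_mul, smul_add, smul_comm r]

theorem IsNull.neg {p : ZMod 2} {f : Op M N} (hf : IsNull p f) : IsNull p (-f) := by
  have := hf.smul (-1); simpa using this

theorem IsNull.sub {p : ZMod 2} {f g : Op M N} (hf : IsNull p f) (hg : IsNull p g) :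
    IsNull p (f - g) := by
  rw [sub_eq_add_neg]; exact hf.add hg.neg

theorem IsNull.mul_left {p q : ZMod 2} {g : Op N P} {f : Op M N} (hg : IsClosedOp q g)
    (hf : IsNull p f) : IsNull (p + q) (g * f : Op M P) := by
  obtain ⟨h, hh, rfl⟩ := hf
  obtain ⟨hg1, hg2⟩ := hg
  have hg3 : g * N.d = sgn R q • (P.d * g) := by
    rw [hg2, smul_smul, sgn_mul_self, one_smul]
  refine ⟨sgn R q • (g * h), ?_, ?_⟩
  · have := (hg1.mul hh).smul (sgn R q)
    rwa [show p + 1 + q = p + q + 1 by ring] at this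
  · rw [Matrix.mul_add, ← Matrix.mul_assoc, hg3, Matrix.smul_mul, Matrix.mul_smul, Matrix.mul_smul,
      Matrix.smul_mul, smul_smul, sgn_add, mul_assoc, sgn_mul_self, mul_one, Matrix.mul_assoc,
      Matrix.mul_assoc]

theorem IsNull.mul_right {p q : ZMod 2} {g : Op N P} {f : Op M N} (hg : IsNull q g)
    (hf : IsClosedOp p f) : IsNull (p + q) (g * f : Op M P) := by
  obtain ⟨h, hh, rfl⟩ := hg
  obtain ⟨hf1, hf2⟩ := hf
  refine ⟨h * f, ?_, ?_⟩
  · have := hh.mul hf1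
    rwa [← add_assoc] at this
  · rw [Matrix.add_mul, Matrix.smul_mul, Matrix.mul_assoc, Matrix.mul_assoc, hf2, Matrix.mul_smul,
      smul_smul, sgn_add, mul_comm (sgn R p), Matrix.mul_assoc]

theorem IsClosedOp.mul {p q : ZMod 2} {g : Op N P} {f : Op M N} (hg : IsClosedOp q g)
    (hf : IsClosedOp p f) : IsClosedOp (p + q) (g * f : Op M P) := by
  refine ⟨hg.1.mul hf.1, ?_⟩
  rw [← Matrix.mul_assoc, hg.2, Matrix.smul_mul, Matrix.mul_assoc, hf.2, Matrix.mul_smul,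
    smul_smul, sgn_add, mul_comm (sgn R p), Matrix.mul_assoc]

theorem IsClosedOp.zero (p : ZMod 2) : IsClosedOp p (0 : Op M N) :=
  ⟨HasDeg.zero _, by simp⟩

theorem IsClosedOp.add {p : ZMod 2} {f g : Op M N} (hf : IsClosedOp p f) (hg : IsClosedOp p g) :
    IsClosedOp p (f + g) :=
  ⟨hf.1.add hg.1, by rw [Matrix.mul_add, Matrix.add_mul, hf.2, hg.2, smul_add]⟩

theorem IsClosedOp.smul {p : ZMod 2} {f : Op M N} (r : R) (hf : IsClosedOp p f) :
    IsClosedOp p (r • f) :=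
  ⟨hf.1.smul r, by rw [Matrix.mul_smul, Matrix.smul_mul, hf.2, smul_comm]⟩

theorem IsClosedOp.one : IsClosedOp 0 (1 : Op M M) :=
  ⟨HasDeg.one, by simp [sgn]⟩

/-- A null-homotopic operator of degree `p` is closed. -/
theorem IsNull.isClosedOp {W : R} (hM : HasDeg (M := M) (N := M) 1 M.d)
    (hN : HasDeg (M := N) (N := N) 1 N.d) (hM2 : M.d * M.d = W • (1 : Matrix M.ι M.ι R))
    (hN2 : N.d * N.d = W • (1 : Matrix N.ι N.ι R)) {p : ZMod 2} {f : Op M N} (hf : IsNull p f) :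
    IsClosedOp p f := by
  obtain ⟨h, hh, rfl⟩ := hf
  have h2 : p + 1 + 1 = p := by
    rw [add_assoc, show (1 : ZMod 2) + 1 = 0 by decide, add_zero]
  refine ⟨HasDeg.add ?_ (HasDeg.smul _ ?_), ?_⟩
  · have := hN.mul hh; rwa [h2] at this
  · have := hh.mul hM; rwa [add_comm 1, h2] at this
  · rw [Matrix.mul_add, Matrix.add_mul, smul_add, Matrix.smul_mul, Matrix.mul_smul, smul_smul,
      sgn_mul_self, one_smul, ← Matrix.mul_assoc, hN2, Matrix.mul_assoc h, hM2, Matrix.smul_mul,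
      Matrix.one_mul, Matrix.mul_smul, Matrix.mul_one, ← Matrix.mul_assoc, add_comm]

theorem Htpy.refl {p : ZMod 2} (f : Op M N) : Htpy p f f := by
  unfold Htpy; rw [sub_self]; exact IsNull.zero p

theorem htpy_of_eq {p : ZMod 2} {f g : Op M N} (h : f = g) : Htpy p f g := by
  subst h; exact Htpy.refl f

theorem Htpy.symm {p : ZMod 2} {f g : Op M N} (h : Htpy p f g) : Htpy p g f := by
  have := IsNull.neg h; rwa [neg_sub] at this

theorem Htpy.trans {p : ZMod 2} {f g l : Op M N} (h : Htpy p f g) (h' : Htpy p g l) :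
    Htpy p f l := by
  have := IsNull.add h h'; rwa [sub_add_sub_cancel] at this

theorem Htpy.add {p : ZMod 2} {f g f' g' : Op M N} (h : Htpy p f g) (h' : Htpy p f' g') :
    Htpy p (f + f') (g + g') := by
  have := IsNull.add h h'; rwa [sub_add_sub_comm] at this

theorem Htpy.neg {p : ZMod 2} {f g : Op M N} (h : Htpy p f g) : Htpy p (-f) (-g) := by
  have := IsNull.neg h; rwa [neg_sub, ← neg_sub_neg] at this

theorem Htpy.mul_left {p q : ZMod 2} {g : Op N P} {f f' : Op M N} (hg : IsClosedOp q g)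
    (h : Htpy p f f') : Htpy (p + q) (g * f : Op M P) (g * f') := by
  have := IsNull.mul_left hg h; rwa [Matrix.mul_sub] at this

theorem Htpy.mul_right {p q : ZMod 2} {g g' : Op N P} {f : Op M N} (hf : IsClosedOp p f)
    (h : Htpy q g g') : Htpy (p + q) (g * f : Op M P) (g' * f) := by
  have := IsNull.mul_right h hf; rwa [Matrix.sub_mul] at this

theorem htpy_zero_iff {p : ZMod 2} {f : Op M N} : Htpy p f 0 ↔ IsNull p f := by
  unfold Htpy; rw [sub_zero]

end Toolkit


section Unit

variable {R : Type u} [CommRing R]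

/-- The nested product over a list of indices, starting from `e`. -/
def CliffordData.nestList (M : CliffordData R) (L : List (Fin M.n)) : Op M.toGradedOp M.toGradedOp :=
  L.foldr (fun i y => M.γ i * y * M.γd i) M.e

variable {W : R} {M : CliffordData R}

theorem htpy_neg_of_add {N P : GradedOp R} {p : ZMod 2} {f g : Op N P}
    (h : Htpy p (f + g) 0) : Htpy p f (-g) := by
  unfold Htpy at *; rwa [sub_neg_eq_add, ← sub_zero (f + g)]

theorem nestList_closed (hM : M.IsRep W) (L : List (Fin M.n)) : IsClosedOp 0 (M.nestList L) := by
  induction L with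
  | nil => exact hM.e_closed
  | cons i L ih =>
    have h : IsClosedOp 1 (M.γ i * M.nestList L) :=
      IsClosedOp.mul (q := 1) (p := 0) (hM.γ_closed i) ih
    exact IsClosedOp.mul (q := 1) (p := 1) h (hM.γd_closed i)

theorem γ_nestList_comm (hM : M.IsRep W) (L : List (Fin M.n)) (j : Fin M.n) (hj : j ∉ L) :
    Htpy 1 (M.γ j * M.nestList L) (M.nestList L * M.γ j) := by
  induction L with
  | nil => exact (hM.γ_e j).trans (hM.e_γ j).symm
  | cons i L ih =>
    simp only [List.mem_cons, not_or] at hj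
    have ih := ih hj.2
    change Htpy 1 (M.γ j * (M.γ i * M.nestList L * M.γd i))
      ((M.γ i * M.nestList L * M.γd i) * M.γ j)
    have c := nestList_closed hM L
    have h1 : Htpy (0 + 1) (M.γ j * M.γ i * (M.nestList L * M.γd i))
        (-(M.γ i * M.γ j) * (M.nestList L * M.γd i)) :=
      Htpy.mul_right (p := 1) (IsClosedOp.mul (p := 1) (q := 0) c (hM.γd_closed i))
        (htpy_neg_of_add (hM.γ_γ j i))
    have h2 : Htpy (1 + 1 + 1) (M.γ i * (M.γ j * M.nestList L * M.γd i))
        (M.γ i * (M.nestList L * M.γ j * M.γd i)) :=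
      Htpy.mul_left (p := 1 + 1) (hM.γ_closed i) (Htpy.mul_right (hM.γd_closed i) ih)
    have h3 : Htpy (0 + 1) (M.γ i * M.nestList L * (M.γ j * M.γd i))
        (M.γ i * M.nestList L * -(M.γd i * M.γ j)) := by
      refine Htpy.mul_left (p := 0) (q := 1) (IsClosedOp.mul (p := 0) (q := 1) (hM.γ_closed i) c)
        (htpy_neg_of_add ?_)
      have := hM.γ_γd j i
      rwa [if_neg hj.1] at this
    have h1' : Htpy 1 (M.γ j * M.γ i * (M.nestList L * M.γd i))
        (-(M.γ i * M.γ j) * (M.nestList L * M.γd i)) := h1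
    have h2' : Htpy 1 (M.γ i * (M.γ j * M.nestList L * M.γd i))
        (M.γ i * (M.nestList L * M.γ j * M.γd i)) := h2
    have h3' : Htpy 1 (M.γ i * M.nestList L * (M.γ j * M.γd i))
        (M.γ i * M.nestList L * -(M.γd i * M.γ j)) := h3
    simp only [Matrix.mul_assoc, Matrix.neg_mul, Matrix.mul_neg] at h1' h2' h3' ⊢
    have := h1'.trans (h2'.trans h3').neg
    rwa [neg_neg] at this

theorem nestList_γd_comm (hM : M.IsRep W) (L : List (Fin M.n)) (j : Fin M.n) (hj : j ∉ L) :
    Htpy 1 (M.nestList L * M.γd j) (M.γd j * M.nestList L) := by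
  induction L with
  | nil => exact (hM.e_γd j).trans (hM.γd_e j).symm
  | cons i L ih =>
    simp only [List.mem_cons, not_or] at hj
    have ih := ih hj.2
    change Htpy 1 ((M.γ i * M.nestList L * M.γd i) * M.γd j)
      (M.γd j * (M.γ i * M.nestList L * M.γd i))
    have c := nestList_closed hM L
    have h1 : Htpy (0 + 1) (M.γ i * M.nestList L * (M.γd i * M.γd j))
        (M.γ i * M.nestList L * -(M.γd j * M.γd i)) :=
      Htpy.mul_left (p := 0) (q := 1) (IsClosedOp.mul (p := 0) (q := 1) (hM.γ_closed i) c)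
        (htpy_neg_of_add (hM.γd_γd i j))
    have h2 : Htpy (1 + 1 + 1) (M.γ i * (M.nestList L * M.γd j * M.γd i))
        (M.γ i * (M.γd j * M.nestList L * M.γd i)) :=
      Htpy.mul_left (p := 1 + 1) (hM.γ_closed i) (Htpy.mul_right (hM.γd_closed i) ih)
    have h3 : Htpy (0 + 1) (M.γ i * M.γd j * (M.nestList L * M.γd i))
        (-(M.γd j * M.γ i) * (M.nestList L * M.γd i)) := by
      have := hM.γ_γd i j
      rw [if_neg (Ne.symm hj.1)] at this
      exact Htpy.mul_right (p := 1) (q := 0) (IsClosedOp.mul (p := 1) (q := 0) c (hM.γd_closed i))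
        (htpy_neg_of_add this)
    have h1' : Htpy 1 (M.γ i * M.nestList L * (M.γd i * M.γd j))
        (M.γ i * M.nestList L * -(M.γd j * M.γd i)) := h1
    have h2' : Htpy 1 (M.γ i * (M.nestList L * M.γd j * M.γd i))
        (M.γ i * (M.γd j * M.nestList L * M.γd i)) := h2
    have h3' : Htpy 1 (M.γ i * M.γd j * (M.nestList L * M.γd i))
        (-(M.γd j * M.γ i) * (M.nestList L * M.γd i)) := h3
    simp only [Matrix.mul_assoc, Matrix.neg_mul, Matrix.mul_neg] at h1' h2' h3' ⊢
    have := h1'.trans (h2'.trans h3').neg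
    rwa [neg_neg] at this

theorem mul_nestList (hM : M.IsRep W) {N : GradedOp R} {f : Op M.toGradedOp N}
    (hf : IsClosedOp 0 f) (he : Htpy 0 (f * M.e) f) (hd : ∀ i, IsNull 1 (f * M.γd i))
    (L : List (Fin M.n)) (hL : L.Nodup) : Htpy 0 (f * M.nestList L) f := by
  induction L with
  | nil => exact he
  | cons i L ih =>
    rw [List.nodup_cons] at hL
    have ih := ih hL.2
    have c := nestList_closed hM L
    change Htpy 0 (f * (M.γ i * M.nestList L * M.γd i)) f
    have h1 : Htpy 0 (f * M.γ i * (M.nestList L * M.γd i)) (f * M.γ i * (M.γd i * M.nestList L)) :=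
      Htpy.mul_left (p := 1) (q := 1) (IsClosedOp.mul (p := 1) (q := 0) hf (hM.γ_closed i))
        (nestList_γd_comm hM L i hL.1)
    have h2 : Htpy 0 (f * (M.γ i * M.γd i + M.γd i * M.γ i) * M.nestList L)
        (f * M.e * M.nestList L) := by
      have := hM.γ_γd i i
      rw [if_pos rfl] at this
      exact Htpy.mul_right (p := 0) (q := 0) c (Htpy.mul_left (p := 0) (q := 0) hf this)
    have h3 : Htpy 0 (f * M.e * M.nestList L) (f * M.nestList L) :=
      Htpy.mul_right (p := 0) (q := 0) c he
    have h4 : Htpy 0 (f * M.γd i * (M.γ i * M.nestList L)) 0 :=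
      htpy_zero_iff.2 (IsNull.mul_right (p := 1) (q := 1) (hd i)
        (IsClosedOp.mul (p := 0) (q := 1) (hM.γ_closed i) c))
    simp only [Matrix.mul_assoc, Matrix.mul_add, Matrix.add_mul] at h1 h2 h3 h4 ⊢
    have h5 := (h2.add h4.neg).trans ((by simpa using h3.trans ih) : Htpy 0 _ f)
    rw [add_neg_cancel_right] at h5
    exact h1.trans h5

theorem nestList_mul (hM : M.IsRep W) {N : GradedOp R} {f : Op N M.toGradedOp}
    (hf : IsClosedOp 0 f) (he : Htpy 0 (M.e * f) f) (hd : ∀ i, IsNull 1 (M.γ i * f))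
    (L : List (Fin M.n)) (hL : L.Nodup) : Htpy 0 (M.nestList L * f) f := by
  induction L with
  | nil => exact he
  | cons i L ih =>
    rw [List.nodup_cons] at hL
    have ih := ih hL.2
    have c := nestList_closed hM L
    change Htpy 0 ((M.γ i * M.nestList L * M.γd i) * f) f
    have h1 : Htpy 0 (M.γ i * M.nestList L * (M.γd i * f)) (M.nestList L * M.γ i * (M.γd i * f)) :=
      Htpy.mul_right (p := 1) (q := 1) (IsClosedOp.mul (p := 0) (q := 1) (hM.γd_closed i) hf)
        (γ_nestList_comm hM L i hL.1)
    have h2 : Htpy 0 (M.nestList L * ((M.γ i * M.γd i + M.γd i * M.γ i) * f))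
        (M.nestList L * (M.e * f)) := by
      have := hM.γ_γd i i
      rw [if_pos rfl] at this
      exact Htpy.mul_left (p := 0) (q := 0) c (Htpy.mul_right (p := 0) (q := 0) hf this)
    have h3 : Htpy 0 (M.nestList L * (M.e * f)) (M.nestList L * f) :=
      Htpy.mul_left (p := 0) (q := 0) c he
    have h4 : Htpy 0 (M.nestList L * M.γd i * (M.γ i * f)) 0 :=
      htpy_zero_iff.2 (IsNull.mul_left (p := 1) (q := 1)
        (IsClosedOp.mul (p := 1) (q := 0) c (hM.γd_closed i)) (hd i))
    simp only [Matrix.mul_assoc, Matrix.mul_add, Matrix.add_mul] at h1 h2 h3 h4 ⊢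
    have h5 := (h2.add h4.neg).trans ((by simpa using h3.trans ih) : Htpy 0 _ f)
    rw [add_neg_cancel_right] at h5
    exact h1.trans h5

theorem isNull_of_two [Algebra ℚ R] {N P : GradedOp R} {p : ZMod 2} {f : Op N P}
    (h : Htpy p (f + f) 0) : IsNull p f := by
  have h1 := (htpy_zero_iff.1 h).smul (algebraMap ℚ R (1 / 2))
  rwa [← two_smul R f, smul_smul, show (2 : R) = algebraMap ℚ R 2 from (map_ofNat (algebraMap ℚ R) 2).symm, ← map_mul,
    show (1 / 2 : ℚ) * 2 = 1 by norm_num, map_one, one_smul] at h1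

theorem γ_nestList [Algebra ℚ R] (hM : M.IsRep W) (L : List (Fin M.n)) (j : Fin M.n) (hj : j ∈ L) :
    IsNull 1 (M.γ j * M.nestList L) := by
  induction L with
  | nil => simp at hj
  | cons i L ih =>
    have c := nestList_closed hM L
    change IsNull 1 (M.γ j * (M.γ i * M.nestList L * M.γd i))
    by_cases hji : j = i
    · subst hji
      have h0 : IsNull 0 (M.γ j * M.γ j) := isNull_of_two (hM.γ_γ j j)
      have : IsNull 1 (M.γ j * M.γ j * (M.nestList L * M.γd j)) :=
        IsNull.mul_right (p := 1) (q := 0) h0 (IsClosedOp.mul (p := 1) (q := 0) c (hM.γd_closed j))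
      simpa only [Matrix.mul_assoc] using this
    · have hj' : j ∈ L := by simpa [hji] using hj
      have h1 : Htpy 1 (M.γ j * M.γ i * (M.nestList L * M.γd i))
          (-(M.γ i * M.γ j) * (M.nestList L * M.γd i)) :=
        Htpy.mul_right (p := 1) (q := 0) (IsClosedOp.mul (p := 1) (q := 0) c (hM.γd_closed i))
          (htpy_neg_of_add (hM.γ_γ j i))
      have h2 : IsNull 1 (M.γ i * (M.γ j * M.nestList L * M.γd i)) :=
        IsNull.mul_left (p := 0) (q := 1) (hM.γ_closed i)
          (IsNull.mul_right (p := 1) (q := 1) (ih hj') (hM.γd_closed i))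
      simp only [Matrix.mul_assoc, Matrix.neg_mul] at h1 h2 ⊢
      exact htpy_zero_iff.1 (h1.trans (htpy_zero_iff.2 h2.neg))

theorem nestList_γd [Algebra ℚ R] (hM : M.IsRep W) (L : List (Fin M.n)) (j : Fin M.n)
    (hj : j ∈ L) : IsNull 1 (M.nestList L * M.γd j) := by
  induction L with
  | nil => simp at hj
  | cons i L ih =>
    have c := nestList_closed hM L
    change IsNull 1 ((M.γ i * M.nestList L * M.γd i) * M.γd j)
    by_cases hji : j = i
    · subst hji
      have h0 : IsNull 0 (M.γd j * M.γd j) := isNull_of_two (hM.γd_γd j j)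
      have : IsNull 1 (M.γ j * M.nestList L * (M.γd j * M.γd j)) :=
        IsNull.mul_left (p := 0) (q := 1) (IsClosedOp.mul (p := 0) (q := 1) (hM.γ_closed j) c) h0
      simpa only [Matrix.mul_assoc] using this
    · have hj' : j ∈ L := by simpa [hji] using hj
      have h1 : Htpy 1 (M.γ i * M.nestList L * (M.γd i * M.γd j))
          (M.γ i * M.nestList L * -(M.γd j * M.γd i)) :=
        Htpy.mul_left (p := 0) (q := 1) (IsClosedOp.mul (p := 0) (q := 1) (hM.γ_closed i) c)
          (htpy_neg_of_add (hM.γd_γd i j))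
      have h2 : IsNull 1 (M.γ i * (M.nestList L * M.γd j * M.γd i)) :=
        IsNull.mul_left (p := 0) (q := 1) (hM.γ_closed i)
          (IsNull.mul_right (p := 1) (q := 1) (ih hj') (hM.γd_closed i))
      simp only [Matrix.mul_assoc, Matrix.mul_neg] at h1 h2 ⊢
      exact htpy_zero_iff.1 (h1.trans (htpy_zero_iff.2 h2.neg))

theorem e_nestList (hM : M.IsRep W) (L : List (Fin M.n)) :
    Htpy 0 (M.e * M.nestList L) (M.nestList L) := by
  cases L with
  | nil => exact hM.e_idem
  | cons i L =>
    have c := nestList_closed hM L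
    have h : Htpy 0 (M.e * M.γ i * (M.nestList L * M.γd i)) (M.γ i * (M.nestList L * M.γd i)) :=
      Htpy.mul_right (p := 1) (q := 1) (IsClosedOp.mul (p := 1) (q := 0) c (hM.γd_closed i))
        (hM.e_γ i)
    change Htpy 0 (M.e * (M.γ i * M.nestList L * M.γd i)) (M.γ i * M.nestList L * M.γd i)
    simpa only [Matrix.mul_assoc] using h

theorem nestList_e (hM : M.IsRep W) (L : List (Fin M.n)) :
    Htpy 0 (M.nestList L * M.e) (M.nestList L) := by
  cases L with
  | nil => exact hM.e_idem
  | cons i L =>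
    have c := nestList_closed hM L
    have h : Htpy 0 (M.γ i * M.nestList L * (M.γd i * M.e)) (M.γ i * M.nestList L * M.γd i) :=
      Htpy.mul_left (p := 1) (q := 1) (IsClosedOp.mul (p := 0) (q := 1) (hM.γ_closed i) c)
        (hM.γd_e i)
    change Htpy 0 ((M.γ i * M.nestList L * M.γd i) * M.e) (M.γ i * M.nestList L * M.γd i)
    simpa only [Matrix.mul_assoc] using h

end Unit


section HomCategory

variable {R : Type u} [CommRing R]

/-- Even closed operators `f : M → N` which up to homotopy satisfy `f e = f = e f`, `f γ† = 0` and
`γ f = 0`. -/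
def cycles (M N : CliffordData R) : Submodule R (Op M.toGradedOp N.toGradedOp) where
  carrier := {f | IsClosedOp 0 f ∧ Htpy 0 (f * M.e) f ∧ Htpy 0 (N.e * f) f ∧
    (∀ i, IsNull 1 (f * M.γd i)) ∧ ∀ i, IsNull 1 (N.γ i * f)}
  zero_mem' := ⟨IsClosedOp.zero 0, by rw [Matrix.zero_mul]; exact Htpy.refl _,
    by rw [Matrix.mul_zero]; exact Htpy.refl _, fun i => by rw [Matrix.zero_mul]; exact IsNull.zero _,
    fun i => by rw [Matrix.mul_zero]; exact IsNull.zero _⟩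
  add_mem' := by
    rintro f g ⟨h1, h2, h3, h4, h5⟩ ⟨k1, k2, k3, k4, k5⟩
    refine ⟨h1.add k1, ?_, ?_, fun i => ?_, fun i => ?_⟩
    · rw [Matrix.add_mul]; exact h2.add k2
    · rw [Matrix.mul_add]; exact h3.add k3
    · rw [Matrix.add_mul]; exact (h4 i).add (k4 i)
    · rw [Matrix.mul_add]; exact (h5 i).add (k5 i)
  smul_mem' := by
    rintro r f ⟨h1, h2, h3, h4, h5⟩
    refine ⟨h1.smul r, ?_, ?_, fun i => ?_, fun i => ?_⟩
    · have := IsNull.smul r h2; rwa [smul_sub, ← Matrix.smul_mul] at this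
    · have := IsNull.smul r h3; rwa [smul_sub, ← Matrix.mul_smul] at this
    · rw [Matrix.smul_mul]; exact (h4 i).smul r
    · rw [Matrix.mul_smul]; exact (h5 i).smul r

/-- Null-homotopic even operators. -/
def boundaries (M N : GradedOp R) : Submodule R (Op M N) where
  carrier := {f | IsNull 0 f}
  zero_mem' := IsNull.zero 0
  add_mem' := fun h h' => IsNull.add h h'
  smul_mem' := fun r _ h => IsNull.smul r h

/-- Elements of `cycles M N` modulo homotopy. -/
abbrev TwoMor (M N : CliffordData R) : Type u :=
  ↥(cycles M N) ⧸ (boundaries M.toGradedOp N.toGradedOp).comap (cycles M N).subtype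

/-- The homotopy class of an operator. -/
def TwoMor.mk {M N : CliffordData R} (f : Op M.toGradedOp N.toGradedOp) (hf : f ∈ cycles M N) :
    TwoMor M N := Submodule.Quotient.mk ⟨f, hf⟩

theorem TwoMor.mk_eq_mk {M N : CliffordData R} {f g : Op M.toGradedOp N.toGradedOp}
    (hf : f ∈ cycles M N) (hg : g ∈ cycles M N) : TwoMor.mk f hf = TwoMor.mk g hg ↔ Htpy 0 f g :=
  Submodule.Quotient.eq _

theorem TwoMor.ind {M N : CliffordData R} {P : TwoMor M N → Prop}
    (h : ∀ f hf, P (TwoMor.mk f hf)) (x : TwoMor M N) : P x := by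
  obtain ⟨⟨f, hf⟩, rfl⟩ := Submodule.Quotient.mk_surjective _ x
  exact h f hf

theorem mul_mem_cycles {M N P : CliffordData R} {f : Op M.toGradedOp N.toGradedOp}
    {g : Op N.toGradedOp P.toGradedOp} (hf : f ∈ cycles M N) (hg : g ∈ cycles N P) :
    (g * f : Op M.toGradedOp P.toGradedOp) ∈ cycles M P := by
  obtain ⟨h1, h2, h3, h4, h5⟩ := hf
  obtain ⟨k1, k2, k3, k4, k5⟩ := hg
  refine ⟨IsClosedOp.mul (p := 0) (q := 0) k1 h1, ?_, ?_, fun i => ?_, fun i => ?_⟩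
  · rw [Matrix.mul_assoc]; exact Htpy.mul_left (p := 0) (q := 0) k1 h2
  · rw [← Matrix.mul_assoc]; exact Htpy.mul_right (p := 0) (q := 0) h1 k3
  · rw [Matrix.mul_assoc]; exact IsNull.mul_left (p := 1) (q := 0) k1 (h4 i)
  · rw [← Matrix.mul_assoc]; exact IsNull.mul_right (p := 0) (q := 1) (k5 i) h1

/-- Composition: first `x`, then `y`. -/
def TwoMor.comp {M N P : CliffordData R} (x : TwoMor M N) (y : TwoMor N P) : TwoMor M P :=
  Quotient.map₂ (fun f g => ⟨g.1 * f.1, mul_mem_cycles f.2 g.2⟩) (by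
    rintro ⟨f, hf⟩ ⟨f', hf'⟩ h ⟨g, hg⟩ ⟨g', hg'⟩ k
    have h : Htpy 0 f f' := (Submodule.quotientRel_def _).1 h
    have k : Htpy 0 g g' := (Submodule.quotientRel_def _).1 k
    exact (Submodule.quotientRel_def _).2 ((Htpy.mul_left (p := 0) (q := 0) hg.1 h).trans
      (Htpy.mul_right (p := 0) (q := 0) hf'.1 k))) x y

theorem TwoMor.mk_comp_mk {M N P : CliffordData R} {f : Op M.toGradedOp N.toGradedOp}
    {g : Op N.toGradedOp P.toGradedOp} (hf : f ∈ cycles M N) (hg : g ∈ cycles N P) :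
    (TwoMor.mk f hf).comp (TwoMor.mk g hg) = TwoMor.mk (g * f) (mul_mem_cycles hf hg) := rfl

theorem CliffordData.unit_eq (M : CliffordData R) : M.unit = M.nestList (List.finRange M.n) := rfl

theorem unit_mem_cycles [Algebra ℚ R] {W : R} {M : CliffordData R} (hM : M.IsRep W) :
    M.unit ∈ cycles M M :=
  ⟨nestList_closed hM _, nestList_e hM _, e_nestList hM _,
    fun i => nestList_γd hM _ i (List.mem_finRange i),
    fun i => γ_nestList hM _ i (List.mem_finRange i)⟩

/-- A finite rank matrix factorisation of `W` over `R` with an idempotent up to homotopy and a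
Clifford action up to homotopy: an object of the Clifford thickening of the idempotent completion
of the homotopy category of finite rank matrix factorisations of `W`. -/
structure CliffordRep (R : Type u) [CommRing R] (W : R) where
  data : CliffordData R
  isRep : data.IsRep W

/-- The Clifford thickening of the idempotent completion of the homotopy category of finite rank
matrix factorisations of `W` over `R`. Morphisms are homotopy classes of morphisms `f` of matrix
factorisations with `f e = f = e f`, `f γ† = 0` and `γ f = 0` up to homotopy, composed as operators;
the identity is the class of `e_n = γ₁ ⋯ γₙ γ†ₙ ⋯ γ†₁`. -/
instance CliffordRep.category [Algebra ℚ R] (W : R) : Category (CliffordRep R W) where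
  Hom M N := TwoMor M.data N.data
  id M := TwoMor.mk M.data.unit (unit_mem_cycles M.isRep)
  comp x y := TwoMor.comp x y
  id_comp {M N} x := by
    revert x
    refine TwoMor.ind fun f hf => ?_
    rw [TwoMor.mk_comp_mk, TwoMor.mk_eq_mk]
    exact mul_nestList M.isRep hf.1 hf.2.1 hf.2.2.2.1 _ (List.nodup_finRange _)
  comp_id {M N} x := by
    revert x
    refine TwoMor.ind fun f hf => ?_
    rw [TwoMor.mk_comp_mk, TwoMor.mk_eq_mk]
    exact nestList_mul N.isRep hf.1 hf.2.2.1 hf.2.2.2.2 _ (List.nodup_finRange _)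
  assoc x y z := by
    revert x y z
    refine TwoMor.ind fun f hf => TwoMor.ind fun g hg => TwoMor.ind fun h hh => ?_
    simp only [TwoMor.mk_comp_mk, Matrix.mul_assoc]

instance CliffordRep.preadditive [Algebra ℚ R] (W : R) : Preadditive (CliffordRep R W) where
  homGroup M N := inferInstanceAs (AddCommGroup (TwoMor M.data N.data))
  add_comp M N P x x' y := by
    revert x x' y
    refine TwoMor.ind fun f hf => TwoMor.ind fun f' hf' => TwoMor.ind fun g hg => ?_
    exact (TwoMor.mk_eq_mk (mul_mem_cycles (add_mem hf hf') hg)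
      (add_mem (mul_mem_cycles hf hg) (mul_mem_cycles hf' hg))).2
      (by rw [Matrix.mul_add]; exact Htpy.refl _)
  comp_add M N P x y y' := by
    revert x y y'
    refine TwoMor.ind fun f hf => TwoMor.ind fun g hg => TwoMor.ind fun g' hg' => ?_
    exact (TwoMor.mk_eq_mk (mul_mem_cycles hf (add_mem hg hg'))
      (add_mem (mul_mem_cycles hf hg) (mul_mem_cycles hf hg'))).2
      (by rw [Matrix.add_mul]; exact Htpy.refl _)

instance CliffordRep.linear {k : Type*} [CommRing k] [Algebra k R] [Algebra ℚ R] (W : R) :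
    Linear k (CliffordRep R W) where
  homModule M N := inferInstanceAs (Module k (TwoMor M.data N.data))
  smul_comp M N P c x y := by
    revert x y
    refine TwoMor.ind fun f hf => TwoMor.ind fun g hg => ?_
    exact (TwoMor.mk_eq_mk (mul_mem_cycles (Submodule.smul_of_tower_mem _ c hf) hg)
      (Submodule.smul_of_tower_mem _ c (mul_mem_cycles hf hg))).2
      (by rw [Matrix.mul_smul]; exact Htpy.refl _)
  comp_smul M N P x c y := by
    revert x y
    refine TwoMor.ind fun f hf => TwoMor.ind fun g hg => ?_
    exact (TwoMor.mk_eq_mk (mul_mem_cycles hf (Submodule.smul_of_tower_mem _ c hg))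
      (Submodule.smul_of_tower_mem _ c (mul_mem_cycles hf hg))).2
      (by rw [Matrix.smul_mul]; exact Htpy.refl _)

theorem mat_neg_mul_neg {l m n : Type*} [Fintype m] (A : Matrix l m R) (B : Matrix m n R) :
    (-A) * (-B) = A * B := by rw [Matrix.neg_mul, Matrix.mul_neg, neg_neg]

/-- The shift: the grading is shifted by one and the differential changes sign. -/
def GradedOp.shift (M : GradedOp R) : GradedOp R where
  ι := M.ι
  par i := M.par i + 1
  d := -M.d

/-- The shift: the grading is shifted by one, the differential changes sign, and the odd generators
of the Clifford algebra act with the opposite sign. -/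
def CliffordData.shift (M : CliffordData R) : CliffordData R where
  toGradedOp := M.toGradedOp.shift
  e := M.e
  n := M.n
  γ i := -M.γ i
  γd i := -M.γd i

theorem HasDeg.shift {M N : GradedOp R} {p : ZMod 2} {f : Op M N} (h : HasDeg p f) :
    HasDeg (M := M.shift) (N := N.shift) p f := fun i j hij => h i j fun h' => hij (by
  change N.par i + 1 = M.par j + 1 + p
  rw [h']; ring)

theorem IsClosedOp.shift {M N : GradedOp R} {p : ZMod 2} {f : Op M N} (h : IsClosedOp p f) :
    IsClosedOp (M := M.shift) (N := N.shift) p f :=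
  ⟨h.1.shift, by
    change (-N.d) * f = sgn R p • (f * (-M.d))
    rw [Matrix.neg_mul, h.2, Matrix.mul_neg, smul_neg]⟩

theorem IsNull.shift {M N : GradedOp R} {p : ZMod 2} {f : Op M N} (h : IsNull p f) :
    IsNull (M := M.shift) (N := N.shift) p f := by
  obtain ⟨l, hl, rfl⟩ := h
  refine ⟨-l, by simpa using HasDeg.shift (hl.smul (-1)), ?_⟩
  change _ = (-N.d) * (-l) + sgn R p • ((-l) * (-M.d))
  rw [mat_neg_mul_neg, mat_neg_mul_neg]

theorem CliffordData.IsRep.shift {W : R} {M : CliffordData R} (h : M.IsRep W) :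
    M.shift.IsRep W where
  d_deg := by
    have := h.d_deg.smul (-1); rw [neg_one_smul] at this; exact HasDeg.shift this
  d_sq := by
    change (-M.d) * (-M.d) = _
    rw [mat_neg_mul_neg]; exact h.d_sq
  e_closed := h.e_closed.shift
  e_idem := IsNull.shift h.e_idem
  γ_closed i := by
    have := (h.γ_closed i).smul (-1); rw [neg_one_smul] at this; exact this.shift
  γd_closed i := by
    have := (h.γd_closed i).smul (-1); rw [neg_one_smul] at this; exact this.shift
  γ_e i := by
    have := (h.γ_e i).neg; rw [← Matrix.neg_mul] at this; exact IsNull.shift this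
  e_γ i := by
    have := (h.e_γ i).neg; rw [← Matrix.mul_neg] at this; exact IsNull.shift this
  γd_e i := by
    have := (h.γd_e i).neg; rw [← Matrix.neg_mul] at this; exact IsNull.shift this
  e_γd i := by
    have := (h.e_γd i).neg; rw [← Matrix.mul_neg] at this; exact IsNull.shift this
  γ_γ i j := by
    have := h.γ_γ i j
    rw [← mat_neg_mul_neg (M.γ i), ← mat_neg_mul_neg (M.γ j)] at this; exact IsNull.shift this
  γd_γd i j := by
    have := h.γd_γd i j
    rw [← mat_neg_mul_neg (M.γd i), ← mat_neg_mul_neg (M.γd j)] at this; exact IsNull.shift this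
  γ_γd i j := by
    have := h.γ_γd i j
    rw [← mat_neg_mul_neg (M.γ i), ← mat_neg_mul_neg (M.γd j)] at this; exact IsNull.shift this

theorem nestList_shift (M : CliffordData R) (L : List (Fin M.n)) :
    (M.shift.nestList L : Matrix M.ι M.ι R) = M.nestList L := by
  induction L with
  | nil => rfl
  | cons i L ih =>
    have key : ∀ X Y : Matrix M.ι M.ι R, X = Y →
        (-M.γ i) * X * (-M.γd i) = M.γ i * Y * M.γd i := by
      rintro X Y rfl
      rw [Matrix.mul_neg, Matrix.neg_mul, Matrix.neg_mul, neg_neg]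
    exact key _ _ ih

theorem unit_shift (M : CliffordData R) : (M.shift.unit : Matrix M.ι M.ι R) = M.unit :=
  nestList_shift M _

theorem shift_mem_cycles {M N : CliffordData R} {f : Op M.toGradedOp N.toGradedOp}
    (hf : f ∈ cycles M N) : f ∈ cycles M.shift N.shift := by
  obtain ⟨h1, h2, h3, h4, h5⟩ := hf
  refine ⟨h1.shift, IsNull.shift h2, IsNull.shift h3, fun i => ?_, fun i => ?_⟩
  · have := (h4 i).neg; rw [← Matrix.mul_neg] at this; exact IsNull.shift this
  · have := (h5 i).neg; rw [← Matrix.neg_mul] at this; exact IsNull.shift this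

theorem unit_mem_shiftShift [Algebra ℚ R] {W : R} {M : CliffordData R} (hM : M.IsRep W) :
    (M.unit : Matrix M.ι M.ι R) ∈ cycles M.shift.shift M ∧
      (M.unit : Matrix M.ι M.ι R) ∈ cycles M M.shift.shift := by
  have key : M.shift.shift = M := by
    obtain ⟨⟨ι, par, d⟩, e, n, γ, γd⟩ := M
    have h2 : (1 : ZMod 2) + 1 = 0 := by decide
    have gen : ∀ (par' : ι → ZMod 2) (d' : Matrix ι ι R) (γ' γd' : Fin n → Matrix ι ι R),
        par' = par → d' = d → γ' = γ → γd' = γd →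
        (⟨⟨ι, par', d'⟩, e, n, γ', γd'⟩ : CliffordData R) = ⟨⟨ι, par, d⟩, e, n, γ, γd⟩ := by
      rintro _ _ _ _ rfl rfl rfl rfl; rfl
    exact gen (fun i => par i + 1 + 1) (- -d) (fun i => - -γ i) (fun i => - -γd i)
      (by funext i; rw [add_assoc, h2, add_zero]) (neg_neg _) (by funext i; exact neg_neg _)
      (by funext i; exact neg_neg _)
  have gen : ∀ N : CliffordData R, N = M → ∀ (a : Matrix N.ι M.ι R) (b : Matrix M.ι N.ι R),
      HEq a M.unit → HEq b M.unit → b ∈ cycles N M ∧ a ∈ cycles M N := by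
    rintro N rfl a b ha hb
    rw [eq_of_heq ha, eq_of_heq hb]
    exact ⟨unit_mem_cycles hM, unit_mem_cycles hM⟩
  exact gen _ key _ _ HEq.rfl HEq.rfl

/-- The action of the shift on morphisms, which does not change the matrix. -/
def TwoMor.shift {M N : CliffordData R} (x : TwoMor M N) : TwoMor M.shift N.shift :=
  Quotient.map (fun f => (⟨f.1, shift_mem_cycles f.2⟩ : ↥(cycles M.shift N.shift))) (by
    rintro ⟨f, hf⟩ ⟨f', hf'⟩ h
    have h : Htpy 0 f f' := (Submodule.quotientRel_def _).1 h
    exact (Submodule.quotientRel_def _).2 (IsNull.shift h)) x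

theorem TwoMor.mk_shift {M N : CliffordData R} {f : Op M.toGradedOp N.toGradedOp}
    (hf : f ∈ cycles M N) : (TwoMor.mk f hf).shift = TwoMor.mk (M := M.shift) (N := N.shift) f
      (shift_mem_cycles hf) := rfl

theorem TwoMor.mk_congr {M N : CliffordData R} {f g : Op M.toGradedOp N.toGradedOp}
    (hf : f ∈ cycles M N) (hg : g ∈ cycles M N) (h : f = g) : TwoMor.mk f hf = TwoMor.mk g hg := by
  subst h; rfl

/-- The shift functor. -/
def CliffordRep.shiftFunctor [Algebra ℚ R] (W : R) : CliffordRep R W ⥤ CliffordRep R W where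
  obj M := ⟨M.data.shift, M.isRep.shift⟩
  map x := TwoMor.shift x
  map_id M := TwoMor.mk_congr (shift_mem_cycles (unit_mem_cycles M.isRep))
    (unit_mem_cycles M.isRep.shift) (unit_shift M.data).symm
  map_comp x y := by
    revert x y
    exact TwoMor.ind fun f hf => TwoMor.ind fun g hg => rfl

theorem unit_mul_unit [Algebra ℚ R] {W : R} {M : CliffordData R} (hM : M.IsRep W) :
    Htpy 0 (M.unit * M.unit) M.unit :=
  mul_nestList hM (unit_mem_cycles hM).1 (unit_mem_cycles hM).2.1 (unit_mem_cycles hM).2.2.2.1 _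
    (List.nodup_finRange _)

/-- The isomorphism `Ψ Ψ M ≅ M` given by the identity operator (that is, by `M.unit`). -/
def CliffordRep.ξApp [Algebra ℚ R] {W : R} (M : CliffordRep R W) :
    (shiftFunctor W).obj ((shiftFunctor W).obj M) ≅ M where
  hom := TwoMor.mk (M := M.data.shift.shift) (N := M.data) M.data.unit
    (unit_mem_shiftShift M.isRep).1
  inv := TwoMor.mk (M := M.data) (N := M.data.shift.shift) M.data.unit
    (unit_mem_shiftShift M.isRep).2
  hom_inv_id := by
    refine (TwoMor.mk_eq_mk (mul_mem_cycles (unit_mem_shiftShift M.isRep).1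
      (unit_mem_shiftShift M.isRep).2) (unit_mem_cycles M.isRep.shift.shift)).2 ?_
    exact Htpy.trans (IsNull.shift (IsNull.shift (unit_mul_unit M.isRep)))
      (htpy_of_eq ((unit_shift M.data.shift).trans (unit_shift M.data)).symm)
  inv_hom_id := (TwoMor.mk_eq_mk (mul_mem_cycles (unit_mem_shiftShift M.isRep).2
      (unit_mem_shiftShift M.isRep).1) (unit_mem_cycles M.isRep)).2 (unit_mul_unit M.isRep)

instance CliffordRep.supercategory {k : Type*} [CommRing k] [Algebra k R] [Algebra ℚ R] (W : R) :
    Supercategory k (CliffordRep R W) where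
  Ψ := shiftFunctor W
  map_add x y := by
    revert x y
    exact TwoMor.ind fun f hf => TwoMor.ind fun g hg => rfl
  map_smul c x := by
    revert x
    exact TwoMor.ind fun f hf => rfl
  ξ := NatIso.ofComponents (fun M => CliffordRep.ξApp M) (by
    intro M N x
    revert x
    refine TwoMor.ind fun f hf => ?_
    have h1 : Htpy 0 (N.data.unit * f) f :=
      nestList_mul N.isRep hf.1 hf.2.2.1 hf.2.2.2.2 _ (List.nodup_finRange _)
    have h2 : Htpy 0 (f * M.data.unit) f :=
      mul_nestList M.isRep hf.1 hf.2.1 hf.2.2.2.1 _ (List.nodup_finRange _)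
    obtain ⟨l, hl, hl'⟩ := h1.trans h2.symm
    refine (TwoMor.mk_eq_mk
      (mul_mem_cycles (shift_mem_cycles (shift_mem_cycles hf)) (unit_mem_shiftShift N.isRep).1)
      (mul_mem_cycles (unit_mem_shiftShift M.isRep).1 hf)).2 ⟨l, ?_, ?_⟩
    · intro i j hij
      refine hl i j fun h => hij ?_
      change N.data.par i = M.data.par j + 1 + 1 + (0 + 1)
      rw [h, add_assoc (M.data.par j), show (1 : ZMod 2) + 1 = 0 by decide, add_zero]
    · refine hl'.trans ?_
      change _ = N.data.d * l + sgn R 0 • (l * (- -M.data.d))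
      rw [neg_neg])
  ξ_comm M := TwoMor.mk_congr (unit_mem_shiftShift M.isRep.shift).1
    (shift_mem_cycles (unit_mem_shiftShift M.isRep).1) (unit_shift M.data)

end HomCategory


/-- `f` is an even closed operator which commutes up to homotopy with the idempotents and with the
generators of the Clifford algebra `C_n` acting on `M` and `N`. -/
def IsCliffordLinear {R : Type u} [CommRing R] {M N : CliffordData R} (hn : M.n = N.n)
    (f : Op M.toGradedOp N.toGradedOp) : Prop :=
  IsClosedOp 0 f ∧ Htpy 0 (f * M.e) (N.e * f) ∧
    (∀ i : Fin M.n, Htpy 1 (f * M.γ i) (N.γ (Fin.cast hn i) * f)) ∧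
    ∀ i : Fin M.n, Htpy 1 (f * M.γd i) (N.γd (Fin.cast hn i) * f)

/-- The `2`-morphism represented by an operator. -/
def CliffordRep.homMk {R : Type u} [CommRing R] [Algebra ℚ R] {W : R} {M N : CliffordRep R W}
    (f : Op M.data.toGradedOp N.data.toGradedOp) (hf : f ∈ cycles M.data N.data) : M ⟶ N :=
  TwoMor.mk f hf

/-! ## Potentials -/

open MvPolynomial

/-- The sequence `t` is quasi-regular: with `I = (t)`, the map `(R/I)[T] → gr_I R` is injective
(it is always surjective). -/
def IsQuasiRegular {R : Type u} [CommRing R] {n : ℕ} (t : Fin n → R) : Prop :=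
  ∀ (d : ℕ) (F : MvPolynomial (Fin n) R), F.IsHomogeneous d →
    eval t F ∈ Ideal.span (Set.range t) ^ (d + 1) →
    ∀ s, coeff s F ∈ Ideal.span (Set.range t)

/-- The Koszul complex of `t`, the exterior algebra of `R^n` with the contraction by the linear form
`(r_i) ↦ ∑ r_i t_i` as differential, is exact except in degree zero. -/
def IsKoszulAcyclic {R : Type u} [CommRing R] {n : ℕ} (t : Fin n → R) : Prop :=
  let δ : ExteriorAlgebra R (Fin n → R) →ₗ[R] ExteriorAlgebra R (Fin n → R) :=
    CliffordAlgebra.contractLeft (∑ i, t i • (LinearMap.proj i : (Fin n → R) →ₗ[R] R))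
  ∀ j : ℕ, 1 ≤ j → ∀ x ∈ ⋀[R]^j (Fin n → R), δ x = 0 → ∃ y ∈ ⋀[R]^(j + 1) (Fin n → R), δ y = x

/-- The ideal generated by the partial derivatives. -/
noncomputable def jacobiIdeal {k : Type u} [CommRing k] {n : ℕ} (W : MvPolynomial (Fin n) k) :
    Ideal (MvPolynomial (Fin n) k) := Ideal.span (Set.range fun i => pderiv i W)

/-- A potential `(x, W)`, `x = (x_1, …, x_n)`, `W ∈ k[x]`. -/
structure Potential (k : Type u) [CommRing k] where
  n : ℕ
  W : MvPolynomial (Fin n) k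
  quasiRegular : IsQuasiRegular fun i => pderiv i W
  free : Module.Free k (MvPolynomial (Fin n) k ⧸ jacobiIdeal W)
  finite : Module.Finite k (MvPolynomial (Fin n) k ⧸ jacobiIdeal W)
  koszul : IsKoszulAcyclic fun i => pderiv i W

section Cut

variable {k : Type u} [CommRing k]

/-- `k[y]` for a potential `(y, V)`. -/
abbrev Potential.Poly (V : Potential k) : Type u := MvPolynomial (Fin V.n) k

/-- The Jacobi algebra `J_V = k[y] / (∂V)`. -/
abbrev Potential.Jac (V : Potential k) : Type u := V.Poly ⧸ jacobiIdeal V.W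

/-- The completion of `k[y]` in the ideal `(∂V)`. -/
abbrev Potential.Hat (V : Potential k) : Type u := AdicCompletion (jacobiIdeal V.W) V.Poly

/-- The quotient map from the completion to `J_V`. -/
noncomputable abbrev Potential.hatToJac (V : Potential k) : V.Hat →ₐ[V.Poly] V.Jac :=
  AdicCompletion.evalOneₐ (jacobiIdeal V.W)

/-- The image of `f ∈ k[t_1, …, t_m]` in the completion, for `t_i = ∂V/∂y_i`. -/
noncomputable def Potential.evalT (V : Potential k) : MvPolynomial (Fin V.n) k →ₐ[k] V.Hat :=
  aeval fun i => algebraMap V.Poly V.Hat (pderiv i V.W)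

/-- A flat `k`-linear connection `∇` on the completion of `k[y]` over `k[t]`, where `t_i = ∂V/∂y_i`,
given by its components `nabla i = ∂_{t_i}`. -/
structure Connection (V : Potential k) where
  nabla : Fin V.n → V.Hat →ₗ[k] V.Hat
  leibniz : ∀ (i : Fin V.n) (f : MvPolynomial (Fin V.n) k) (h : V.Hat),
    nabla i (V.evalT f * h) = V.evalT (pderiv i f) * h + V.evalT f * nabla i h
  flat : ∀ (i j : Fin V.n) (h : V.Hat), nabla i (nabla j h) = nabla j (nabla i h)

/-- The choices on which the cut at `V` depends: a `k`-basis of `J_V` and a flat connection. -/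
structure CutChoice (V : Potential k) where
  m : ℕ
  basis : Module.Basis (Fin m) k V.Jac
  conn : Connection V

/-- `k[x, y]`, for potentials `(x, W)` and `(y, V)`. -/
abbrev PolyRing (W V : Potential k) : Type u := MvPolynomial (Fin W.n ⊕ Fin V.n) k

/-- `V(y) - W(x) ∈ k[x, y]`. -/
noncomputable def potDiff (W V : Potential k) : PolyRing W V :=
  rename Sum.inr V.W - rename Sum.inl W.W

/-- The category `𝒞(W, V)` of `1`-morphisms `W → V`. -/
abbrev OneMor [Algebra ℚ k] (W V : Potential k) : Type (max 1 u) :=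
  CliffordRep (PolyRing W V) (potDiff W V)

section Tensor

variable {W V U : Potential k} {S : Type u} [CommRing S] (c : V.Poly →+* S)

/-- The map `k[y, z] → k[x, z] ⊗ S = S[x, z]`, for a `k[y]`-algebra `S`. -/
noncomputable def leftScalars (W V U : Potential k) (c : V.Poly →+* S) :
    PolyRing V U →+* MvPolynomial (Fin W.n ⊕ Fin U.n) S :=
  eval₂Hom (C.comp (c.comp C)) (Sum.elim (fun i => C (c (X i))) (fun j => X (Sum.inr j)))

/-- The map `k[x, y] → k[x, z] ⊗ S = S[x, z]`, for a `k[y]`-algebra `S`. -/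
noncomputable def rightScalars (W V U : Potential k) (c : V.Poly →+* S) :
    PolyRing W V →+* MvPolynomial (Fin W.n ⊕ Fin U.n) S :=
  eval₂Hom (C.comp (c.comp C)) (Sum.elim (fun i => X (Sum.inl i)) (fun j => C (c (X j))))

/-- For a `k[y]`-algebra `S`, the matrix over `S[x, z]` of the operator `g ⊗ f` from
`Y ⊗_{k[y]} S ⊗_{k[y]} X` to `Y' ⊗_{k[y]} S ⊗_{k[y]} X'` in the bases `e_a ⊗ 1 ⊗ f_b`, where `f` has
degree `p`; by the Koszul rule `(g ⊗ f)(e_a ⊗ f_b) = (-1)^(p |e_a|) g(e_a) ⊗ f(f_b)`. -/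
noncomputable def tensorOp {Y Y' : GradedOp (PolyRing V U)} {X X' : GradedOp (PolyRing W V)}
    (p : ZMod 2) (g : Op Y Y') (f : Op X X') :
    Matrix (Y'.ι × X'.ι) (Y.ι × X.ι) (MvPolynomial (Fin W.n ⊕ Fin U.n) S) :=
  fun a b => sgn _ (p * Y.par b.1) * leftScalars W V U c (g a.1 b.1)
    * rightScalars W V U c (f a.2 b.2)

/-- The differential `d_Y ⊗ 1 + 1 ⊗ d_X` on `Y ⊗_{k[y]} S ⊗_{k[y]} X`. -/
noncomputable def tensorD (Y : GradedOp (PolyRing V U)) (X : GradedOp (PolyRing W V)) :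
    Matrix (Y.ι × X.ι) (Y.ι × X.ι) (MvPolynomial (Fin W.n ⊕ Fin U.n) S) :=
  tensorOp c 0 Y.d (1 : Op X X) + tensorOp c 1 (1 : Op Y Y) X.d

end Tensor

section CutOperation

variable {W V U : Potential k}

/-- Let `A` be a matrix over `S[σ]`, and suppose that every `s : S` determines a `k`-linear operator on
`J_V`, with matrix entries `φ i j s` in a fixed basis of `J_V`, additively in `s`. This is the matrix
over `k[σ]` obtained from `A` by replacing every coefficient `s` by its matrix `(φ i j s)`. -/
noncomputable def inflate {S : Type u} [CommRing S] {σ α α' β β' : Type} {m : ℕ}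
    (φ : Fin m → Fin m → S →+ k) (A : Matrix (α' × β') (α × β) (MvPolynomial σ S)) :
    Matrix (α' × Fin m × β') (α × Fin m × β) (MvPolynomial σ k) :=
  fun a b => AddMonoidAlgebra.map (φ a.2.1 b.2.1) (A (a.1, a.2.2) (b.1, b.2.2))

namespace CutChoice

variable (c : CutChoice V)

/-- The matrix entries of multiplication by an element of `J_V`. -/
noncomputable def mulEntry (i j : Fin c.m) : V.Jac →+ k :=
  (c.basis.coord i).toAddMonoidHom.comp (AddMonoidHom.mulRight (c.basis j))

/-- A lift to the completion of the `j`-th basis element of `J_V`. -/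
noncomputable def lift (j : Fin c.m) : V.Hat :=
  algebraMap V.Poly V.Hat (Quotient.out (c.basis j))

/-- The matrix entries of the commutator `[s, ∂_{t_q}] = s ∂_{t_q} - ∂_{t_q} s`, for `s` in the
completion of `k[y]`. This commutator is `k[t]`-linear, and is regarded as an operator on the
quotient `J_V` of the completion by `(t)`. -/
noncomputable def commEntry (q : Fin V.n) (i j : Fin c.m) : V.Hat →+ k :=
  (c.basis.coord i).toAddMonoidHom.comp <| V.hatToJac.toAddMonoidHom.comp <|
    AddMonoidHom.mulRight (c.conn.nabla q (c.lift j)) -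
      (c.conn.nabla q).toAddMonoidHom.comp (AddMonoidHom.mulRight (c.lift j))

/-- The matrix of the operator `g | f : Y | X → Y' | X'` induced by `g ⊗ f` on
`Y | X = Y ⊗_{k[y]} J_V ⊗_{k[y]} X`, where `f` has degree `p`, in the bases
`e_a ⊗ v_j ⊗ f_b`. -/
noncomputable def cutOp {Y Y' : GradedOp (PolyRing V U)} {X X' : GradedOp (PolyRing W V)}
    (p : ZMod 2) (g : Op Y Y') (f : Op X X') :
    Matrix (Y'.ι × Fin c.m × X'.ι) (Y.ι × Fin c.m × X.ι) (PolyRing W U) :=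
  inflate c.mulEntry (tensorOp (Ideal.Quotient.mk (jacobiIdeal V.W)) p g f)

variable (Y : GradedOp (PolyRing V U)) (X : GradedOp (PolyRing W V))

/-- The Atiyah class `At_q = [d_Y ⊗ 1 + 1 ⊗ d_X, ∂_{t_q}]` on `Y | X`. -/
noncomputable def atiyah (q : Fin V.n) :
    Matrix (Y.ι × Fin c.m × X.ι) (Y.ι × Fin c.m × X.ι) (PolyRing W U) :=
  inflate (c.commEntry q) (tensorD (algebraMap V.Poly V.Hat) Y X)

/-- Multiplication by `f ∈ k[y]` on `Y | X`. -/
noncomputable def scalar (f : V.Poly) :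
    Matrix (Y.ι × Fin c.m × X.ι) (Y.ι × Fin c.m × X.ι) (PolyRing W U) :=
  c.cutOp 0 ((rename Sum.inl f : PolyRing V U) • (1 : Op Y Y)) (1 : Op X X)

/-- `γ†_i = - 1 ⊗ ∂_{y_i}(d_X) - 1/2 ∑_q ∂_{y_q} ∂_{y_i}(V) At_q` on `Y | X`. -/
noncomputable def gammaDagger [Algebra ℚ k] (i : Fin V.n) :
    Matrix (Y.ι × Fin c.m × X.ι) (Y.ι × Fin c.m × X.ι) (PolyRing W U) :=
  - c.cutOp 1 (1 : Op Y Y) (X.d.map (pderiv (Sum.inr i)) : Op X X)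
    - (1 / 2 : ℚ) • ∑ q, c.scalar Y X (pderiv q (pderiv i V.W)) * c.atiyah Y X q

/-- The action of `e_m ∈ C_m` on `Y | X`, for the action of `C_m` by `At_i` and `γ†_i`. -/
noncomputable def cutIdem [Algebra ℚ k] :
    Matrix (Y.ι × Fin c.m × X.ι) (Y.ι × Fin c.m × X.ι) (PolyRing W U) :=
  nest (c.atiyah Y X) (c.gammaDagger Y X) 1

end CutChoice

/-- The cut `Y | X` of `(Y, e_Y)` with an action of `C_r` and `(X, e_X)` with an action of `C_s`: the
matrix factorisation `Y ⊗_{k[y]} J_V ⊗_{k[y]} X` with differential `d_Y ⊗ 1 + 1 ⊗ d_X`, the idempotent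
`e_Y | e_X`, and the action of `C_r ⊗ C_m ⊗ C_s ≅ C_{r + m + s}` in which `C_r` and `C_s` act
on `Y` and `X` (with the Koszul sign) and `C_m` acts by `At_i` and `γ†_i`, all restricted to
the image of the idempotent. -/
noncomputable def cut [Algebra ℚ k] (c : CutChoice V) (Y : CliffordData (PolyRing V U))
    (X : CliffordData (PolyRing W V)) : CliffordData (PolyRing W U) where
  ι := Y.ι × Fin c.m × X.ι
  par a := Y.par a.1 + X.par a.2.2
  d := c.cutOp 0 Y.d (1 : Op X.toGradedOp X.toGradedOp)
    + c.cutOp 1 (1 : Op Y.toGradedOp Y.toGradedOp) X.d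
  e := c.cutOp 0 Y.e X.e
  n := Y.n + V.n + X.n
  γ := Fin.append
    (Fin.append (fun j => c.cutOp 0 (Y.γ j) X.e)
      (fun i => c.atiyah Y.toGradedOp X.toGradedOp i * c.cutOp 0 Y.e X.e))
    (fun l => c.cutOp 1 Y.e (X.γ l))
  γd := Fin.append
    (Fin.append (fun j => c.cutOp 0 (Y.γd j) X.e)
      (fun i => c.gammaDagger Y.toGradedOp X.toGradedOp i * c.cutOp 0 Y.e X.e))
    (fun l => c.cutOp 1 Y.e (X.γd l))

end CutOperation

section Associator

variable {W V U Q : Potential k} [Algebra ℚ k]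

theorem cut_assoc_n (cV : CutChoice V) (cU : CutChoice U) (Z : CliffordData (PolyRing U Q))
    (Y : CliffordData (PolyRing V U)) (X : CliffordData (PolyRing W V)) :
    (cut cV (cut cU Z Y) X).n = (cut cU Z (cut cV Y X)).n := by
  change Z.n + U.n + Y.n + V.n + X.n = Z.n + U.n + (Y.n + V.n + X.n)
  omega

/-- The matrix of the map `(Z | Y) | X → Z | (Y | X)`, `(z ⊗ y) ⊗ x ↦ z ⊗ (y ⊗ x)`. -/
noncomputable def assocMatrix (cV : CutChoice V) (cU : CutChoice U) (Z : CliffordData (PolyRing U Q))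
    (Y : CliffordData (PolyRing V U)) (X : CliffordData (PolyRing W V)) :
    Op (cut cV (cut cU Z Y) X).toGradedOp (cut cU Z (cut cV Y X)).toGradedOp :=
  fun (a : Z.ι × Fin cU.m × (Y.ι × Fin cV.m × X.ι))
      (b : (Z.ι × Fin cU.m × Y.ι) × Fin cV.m × X.ι) =>
    if a = (b.1.1, b.1.2.1, b.1.2.2, b.2.1, b.2.2) then 1 else 0

/-- The matrix of the map `Y | ΨX → Ψ(Y | X)`, `y ⊗ x ↦ (-1)^|y| y ⊗ x`. -/
noncomputable def signMatrix (cV : CutChoice V) (Y : CliffordData (PolyRing V U))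
    (X : CliffordData (PolyRing W V)) :
    Op (cut cV Y X.shift).toGradedOp (cut cV Y X).toGradedOp.shift :=
  fun (a b : Y.ι × Fin cV.m × X.ι) => if a = b then sgn _ (Y.par a.1) else 0

end Associator

end Cut

end CutSystem

open CutSystem

namespace CutSystem

open MvPolynomial

/-! Closed operators modulo homotopy form a preadditive category, so every relation that holds up to
homotopy becomes an equation in an endomorphism ring. The statements about Clifford generators are
then plain ring theory: `cliffordRel_of_half` produces an action, `CliffordRel.prod` multiplies
commuting actions, and `ringNest_prod` shows that the unit of a product is the product of the units.

The action of C_m on a cut comes from differentiating the equation of a matrix factorisation. Let D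
= d_Y ⊗ 1 + 1 ⊗ d_X over the completion of k[y]. Operators on the completion that commute with the
t_i descend to J_V. Multiplication by s is such an operator, and so are [s, ∂_q] and [[s, ∂_q],
∂_r], although ∂_q is not. Inflating a matrix by one of these three families turns it into an
operator on Y | X, and the inflations obey Leibniz rules of order 0, 1 and 2 (`infl_hat_mul`,
`infl_comm_mul`, `infl_comm₂_mul`). As D² = U - W is free of y, its commutators with ∂_q vanish. The
first order gives that At_q is closed, and the second that At_q and At_r anticommute up to the
homotopy -[[D, ∂_q], ∂_r].

Let λ_i = 1 ⊗ ∂_{y_i}(d_X). Differentiating d_X² = V - W gives {D, λ_i} = t_i, which is zero on J_V,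
so λ_i is closed. The commutator of this identity with ∂_q gives {At_q, λ_i} ≃ -δ, and a second
y-derivative gives {λ_i, λ_j} ≃ ∂_i∂_j V. Hence -λ_i is dual to At_i but its square may fail to
vanish, and subtracting half the Hessian times At repairs this. The same differentiations, applied
to a closed operator, show that At_i and γ†_i commute with ψ | φ up to homotopy and sign.

This naturality carries parts 1 and 2. It makes the actions of C_r, C_m and C_s commute in the
graded sense (`cut_isRep`), and it lets e_m pass ψ | φ, so that e_m(ψ | φ) is a 2-morphism and
composition is preserved (`cutIdem_mul_cutOp_mem`, `cutIdem_mul_cutOp_comp`).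

The associator is a permutation matrix, and the data of the two iterated cuts correspond under it
strictly: contracting the y-variables and the u-variables are independent operations
(`contract_assoc`), and the connection of one cut has zero commutator with the differential of the
factor not adjacent to it. Only the exchange of the two idempotents e_m and e_p needs a homotopy.
The isomorphisms τ are signed permutation matrices, so the pentagon and the coherence of τ reduce to
comparing index maps and signs (`monOp_mul`, `cutOp_monOp`). The sign -1 arises because shifting y
changes |y| by one.

The choices exist because quasi-regularity identifies the completion with J_V[[t]], by means of a
k-linear section of k[y] → J_V (`expand_bijective`). The partial derivatives of power series are
transported along this isomorphism. -/

/-! ## Closed operators modulo homotopy, as a category -/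

section HomotopyCategory

variable {R : Type u} [CommRing R]

/-- Sums of an even and an odd closed operator. -/
def closedOps (M N : GradedOp R) : Submodule R (Op M N) where
  carrier := {f | ∃ a b, IsClosedOp 0 a ∧ IsClosedOp 1 b ∧ f = a + b}
  zero_mem' := ⟨0, 0, IsClosedOp.zero 0, IsClosedOp.zero 1, by simp⟩
  add_mem' := by
    rintro _ _ ⟨a, b, ha, hb, rfl⟩ ⟨a', b', ha', hb', rfl⟩
    exact ⟨a + a', b + b', ha.add ha', hb.add hb', add_add_add_comm _ _ _ _⟩
  smul_mem' := by
    rintro r _ ⟨a, b, ha, hb, rfl⟩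
    exact ⟨r • a, r • b, ha.smul r, hb.smul r, smul_add _ _ _⟩

/-- Sums of an even and an odd null-homotopic operator. -/
def nullOps (M N : GradedOp R) : Submodule R (Op M N) where
  carrier := {f | ∃ a b, IsNull 0 a ∧ IsNull 1 b ∧ f = a + b}
  zero_mem' := ⟨0, 0, IsNull.zero 0, IsNull.zero 1, by simp⟩
  add_mem' := by
    rintro _ _ ⟨a, b, ha, hb, rfl⟩ ⟨a', b', ha', hb', rfl⟩
    exact ⟨a + a', b + b', ha.add ha', hb.add hb', add_add_add_comm _ _ _ _⟩
  smul_mem' := by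
    rintro r _ ⟨a, b, ha, hb, rfl⟩
    exact ⟨r • a, r • b, ha.smul r, hb.smul r, smul_add _ _ _⟩

variable {M N P : GradedOp R}

theorem zmod_two_cases (p : ZMod 2) : p = 0 ∨ p = 1 := by revert p; decide

theorem IsClosedOp.mem {p : ZMod 2} {f : Op M N} (hf : IsClosedOp p f) : f ∈ closedOps M N := by
  rcases zmod_two_cases p with rfl | rfl
  · exact ⟨f, 0, hf, IsClosedOp.zero 1, by simp⟩
  · exact ⟨0, f, IsClosedOp.zero 0, hf, by simp⟩

theorem IsNull.mem {p : ZMod 2} {f : Op M N} (hf : IsNull p f) : f ∈ nullOps M N := by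
  rcases zmod_two_cases p with rfl | rfl
  · exact ⟨f, 0, hf, IsNull.zero 1, by simp⟩
  · exact ⟨0, f, IsNull.zero 0, hf, by simp⟩

theorem closedOps_mul {g : Op N P} {f : Op M N} (hg : g ∈ closedOps N P) (hf : f ∈ closedOps M N) :
    (g * f : Op M P) ∈ closedOps M P := by
  obtain ⟨a, b, ha, hb, rfl⟩ := hg
  obtain ⟨a', b', ha', hb', rfl⟩ := hf
  rw [Matrix.add_mul, Matrix.mul_add, Matrix.mul_add]
  exact add_mem (add_mem (ha.mul ha').mem (ha.mul hb').mem)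
    (add_mem (hb.mul ha').mem (hb.mul hb').mem)

theorem nullOps_mul {g : Op N P} {f : Op M N} (hg : g ∈ nullOps N P) (hf : f ∈ closedOps M N) :
    (g * f : Op M P) ∈ nullOps M P := by
  obtain ⟨a, b, ha, hb, rfl⟩ := hg
  obtain ⟨a', b', ha', hb', rfl⟩ := hf
  rw [Matrix.add_mul, Matrix.mul_add, Matrix.mul_add]
  exact add_mem (add_mem (ha.mul_right ha').mem (ha.mul_right hb').mem)
    (add_mem (hb.mul_right ha').mem (hb.mul_right hb').mem)

theorem mul_nullOps {g : Op N P} {f : Op M N} (hg : g ∈ closedOps N P) (hf : f ∈ nullOps M N) :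
    (g * f : Op M P) ∈ nullOps M P := by
  obtain ⟨a, b, ha, hb, rfl⟩ := hg
  obtain ⟨a', b', ha', hb', rfl⟩ := hf
  rw [Matrix.add_mul, Matrix.mul_add, Matrix.mul_add]
  exact add_mem (add_mem (IsNull.mul_left ha ha').mem (IsNull.mul_left ha hb').mem)
    (add_mem (IsNull.mul_left hb ha').mem (IsNull.mul_left hb hb').mem)

/-- Closed operators modulo homotopy. -/
abbrev HoOp (M N : GradedOp R) : Type u :=
  ↥(closedOps M N) ⧸ (nullOps M N).comap (closedOps M N).subtype

/-- The homotopy class of a closed operator. -/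
def cls (f : Op M N) (hf : f ∈ closedOps M N) : HoOp M N := Submodule.Quotient.mk ⟨f, hf⟩

theorem cls_eq_iff {f g : Op M N} (hf : f ∈ closedOps M N) (hg : g ∈ closedOps M N) :
    cls f hf = cls g hg ↔ f - g ∈ nullOps M N :=
  Submodule.Quotient.eq _

theorem HoOp.ind {P : HoOp M N → Prop} (h : ∀ f hf, P (cls f hf)) (x : HoOp M N) : P x := by
  obtain ⟨⟨f, hf⟩, rfl⟩ := Submodule.Quotient.mk_surjective _ x
  exact h f hf

theorem cls_congr {f g : Op M N} (hf : f ∈ closedOps M N) (h : f = g) :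
    cls f hf = cls g (h ▸ hf) := by subst h; rfl

theorem one_mem_closedOps (M : GradedOp R) : (1 : Op M M) ∈ closedOps M M := IsClosedOp.one.mem

/-- Closed operators up to homotopy are the morphisms of a category. -/
instance hoCategory : Category (GradedOp R) where
  Hom M N := HoOp M N
  id M := cls 1 (one_mem_closedOps M)
  comp {M N P} x y := Quotient.map₂ (fun f g => ⟨g.1 * f.1, closedOps_mul g.2 f.2⟩) (by
    rintro ⟨f, hf⟩ ⟨f', hf'⟩ h ⟨g, hg⟩ ⟨g', hg'⟩ k
    have h : f - f' ∈ nullOps M N := (Submodule.quotientRel_def ((nullOps M N).comap (closedOps M N).subtype)).1 h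
    have k : g - g' ∈ nullOps N P :=
      (Submodule.quotientRel_def ((nullOps N P).comap (closedOps N P).subtype)).1 k
    refine (Submodule.quotientRel_def _).2 ?_
    -- Decomposition g f - g' f' = g (f - f') + (g - g') f'.
    have := add_mem (mul_nullOps hg h) (nullOps_mul k hf')
    rwa [Matrix.mul_sub, Matrix.sub_mul, sub_add_sub_cancel] at this) x y
  id_comp x := by
    revert x
    exact HoOp.ind fun f hf => cls_congr (closedOps_mul hf (one_mem_closedOps _)) (Matrix.mul_one f)
  comp_id x := by
    revert x
    exact HoOp.ind fun f hf => cls_congr (closedOps_mul (one_mem_closedOps _) hf) (Matrix.one_mul f)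
  assoc x y z := by
    revert x y z
    exact HoOp.ind fun f hf => HoOp.ind fun g hg => HoOp.ind fun h hh =>
      cls_congr (closedOps_mul hh (closedOps_mul hg hf)) (Matrix.mul_assoc h g f).symm

/-- The morphism represented by a closed operator. -/
def hoMk (f : Op M N) (hf : f ∈ closedOps M N) : M ⟶ N := cls f hf

instance hoPreadditive : Preadditive (GradedOp R) where
  homGroup M N := inferInstanceAs (AddCommGroup (HoOp M N))
  add_comp M N P x x' y := by
    revert x x' y
    exact HoOp.ind fun f hf => HoOp.ind fun f' hf' => HoOp.ind fun g hg =>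
      cls_congr (closedOps_mul hg (add_mem hf hf')) (Matrix.mul_add g f f')
  comp_add M N P x y y' := by
    revert x y y'
    exact HoOp.ind fun f hf => HoOp.ind fun g hg => HoOp.ind fun g' hg' =>
      cls_congr (closedOps_mul (add_mem hg hg') hf) (Matrix.add_mul g g' f)

theorem hoMk_add {f g : Op M N} (hf : f ∈ closedOps M N) (hg : g ∈ closedOps M N) :
    hoMk f hf + hoMk g hg = hoMk (f + g) (add_mem hf hg) := rfl

theorem hoMk_sum {ι : Type*} (s : Finset ι) (f : ι → Op M N) (hf : ∀ i, f i ∈ closedOps M N) :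
    ∑ i ∈ s, hoMk (f i) (hf i) = hoMk (∑ i ∈ s, f i) (sum_mem fun i _ => hf i) := by
  classical
  induction s using Finset.induction_on with
  | empty => rfl
  | insert a s ha ih =>
    rw [Finset.sum_insert ha, ih, hoMk_add]
    exact cls_congr _ (Finset.sum_insert ha).symm

/-- The position (i, j) of a matrix entry has one well-defined degree, which cannot be both p and p
+ 1. -/
theorem HasDeg.eq_zero {p : ZMod 2} {f : Op M N} (h : HasDeg p f) (h' : HasDeg (p + 1) f) :
    f = 0 := by
  ext i j
  by_cases hij : N.par i = M.par j + p
  · refine h' i j fun h2 => ?_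
    rw [hij, ← add_assoc] at h2
    exact absurd (left_eq_add.1 h2) (by decide)
  · exact h i j hij

theorem IsNull.hasDeg (hM : HasDeg (M := M) (N := M) 1 M.d) (hN : HasDeg (M := N) (N := N) 1 N.d)
    {p : ZMod 2} {f : Op M N} (h : IsNull p f) : HasDeg p f := by
  obtain ⟨l, hl, rfl⟩ := h
  have h2 : p + 1 + 1 = p := by rw [add_assoc, show (1 : ZMod 2) + 1 = 0 by decide, add_zero]
  refine HasDeg.add ?_ (HasDeg.smul _ ?_)
  · have := hN.mul hl; rwa [h2] at this
  · have := hl.mul hM; rwa [add_comm 1, h2] at this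

/-- Since the differentials are odd, null-homotopic operators are homogeneous. Comparing degrees,
the summand of the wrong parity is homogeneous of both degrees and therefore zero. -/
theorem isNull_of_mem (hM : HasDeg (M := M) (N := M) 1 M.d) (hN : HasDeg (M := N) (N := N) 1 N.d)
    {p : ZMod 2} {f : Op M N} (hf : HasDeg p f) (h : f ∈ nullOps M N) : IsNull p f := by
  obtain ⟨a, b, ha, hb, rfl⟩ := h
  have sub : ∀ {q : ZMod 2} {x y : Op M N}, HasDeg q x → HasDeg q y → HasDeg q (x - y) :=
    fun hx hy => by
      have := hx.add (hy.smul (-1))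
      rwa [neg_one_smul, ← sub_eq_add_neg] at this
  rcases zmod_two_cases p with rfl | rfl
  · have : HasDeg 0 b := by simpa using sub hf (ha.hasDeg hM hN)
    rw [this.eq_zero (hb.hasDeg hM hN), add_zero]; exact ha
  · have : HasDeg 1 a := by simpa using sub hf (hb.hasDeg hM hN)
    rw [(ha.hasDeg hM hN).eq_zero this, zero_add]; exact hb

theorem Htpy.cl_eq {p : ZMod 2} {f g : Op M N} (h : Htpy p f g) (hf : f ∈ closedOps M N)
    (hg : g ∈ closedOps M N) : hoMk f hf = hoMk g hg :=
  (cls_eq_iff hf hg).2 (IsNull.mem h)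

/-- The way back from equations of classes to homotopies of a definite degree; `Htpy.cl_eq` is the
way there. -/
theorem htpy_of_hoMk_eq (hM : HasDeg (M := M) (N := M) 1 M.d)
    (hN : HasDeg (M := N) (N := N) 1 N.d) {p : ZMod 2} {f g : Op M N} (hf : HasDeg p f)
    (hg : HasDeg p g) {hf' : f ∈ closedOps M N} {hg' : g ∈ closedOps M N}
    (h : hoMk f hf' = hoMk g hg') : Htpy p f g := by
  refine isNull_of_mem hM hN ?_ ((cls_eq_iff hf' hg').1 h)
  have := hf.add (hg.smul (-1))
  rwa [neg_one_smul, ← sub_eq_add_neg] at this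

end HomotopyCategory

/-! ## Clifford relations in a ring -/

section CliffordRelations

variable {A : Type*} [Ring A]

/-- The elements `γ i`, `γd i` of the ring `A` satisfy the relations of the Clifford algebra, with
unit the idempotent `e`. -/
structure CliffordRel {n : ℕ} (e : A) (γ γd : Fin n → A) : Prop where
  e_e : e * e = e
  γ_e : ∀ i, γ i * e = γ i
  e_γ : ∀ i, e * γ i = γ i
  γd_e : ∀ i, γd i * e = γd i
  e_γd : ∀ i, e * γd i = γd i
  γ_γ : ∀ i j, γ i * γ j + γ j * γ i = 0
  γd_γd : ∀ i j, γd i * γd j + γd j * γd i = 0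
  γ_γd : ∀ i j, γ i * γd j + γd j * γ i = if i = j then e else 0

/-- The nested product `γ 0 ⋯ γ (n-1) * x * γd (n-1) ⋯ γd 0` in a ring. -/
def ringNest {n : ℕ} (γ γd : Fin n → A) (x : A) : A :=
  (List.finRange n).foldr (fun i y => γ i * y * γd i) x

/-- Two families of Clifford generators commute in the graded sense. -/
structure CliffordCommute {m n : ℕ} (e : A) (γ γd : Fin m → A) (e' : A) (γ' γd' : Fin n → A) :
    Prop where
  e_e : e * e' = e' * e
  e_γ : ∀ j, e * γ' j = γ' j * e
  e_γd : ∀ j, e * γd' j = γd' j * e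
  γ_e : ∀ i, γ i * e' = e' * γ i
  γd_e : ∀ i, γd i * e' = e' * γd i
  γ_γ : ∀ i j, γ i * γ' j + γ' j * γ i = 0
  γ_γd : ∀ i j, γ i * γd' j + γd' j * γ i = 0
  γd_γ : ∀ i j, γd i * γ' j + γ' j * γd i = 0
  γd_γd : ∀ i j, γd i * γd' j + γd' j * γd i = 0

/-- In the tensor product of two Clifford actions, the generators of each factor are multiplied by
the idempotent of the other. -/
def prodGen {m n : ℕ} (e : A) (γ : Fin m → A) (e' : A) (γ' : Fin n → A) : Fin (m + n) → A :=
  Fin.append (fun i => γ i * e') (fun j => γ' j * e)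

variable {m n : ℕ} {e e' : A} {γ γd : Fin m → A} {γ' γd' : Fin n → A}

theorem absorb_comm {a b f : A} (hf : f * f = f) (hb : b * f = f * b) :
    a * f * (b * f) = a * b * f := by
  rw [mul_assoc, ← mul_assoc f, ← hb, mul_assoc b, hf, mul_assoc]

theorem prod_same {a b f x : A} (hf : f * f = f) (ha : a * f = f * a) (hb : b * f = f * b)
    (h : a * b + b * a = x) : a * f * (b * f) + b * f * (a * f) = x * f := by
  rw [absorb_comm hf hb, absorb_comm hf ha, ← add_mul, h]

/-- Here g is a two-sided unit for a, and f is one for b. Each can be absorbed after a and b have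
been exchanged at the cost of a sign, so a f b g = a b and b g a f = b a. -/
theorem prod_mixed {a b f g : A} (haf : a * g = a) (hgb : g * a = a) (hb : f * b = b)
    (hbf : b * f = b) (h : a * b + b * a = 0) : a * f * (b * g) + b * g * (a * f) = 0 := by
  have h' : b * a = -(a * b) := by rw [eq_neg_iff_add_eq_zero, add_comm]; exact h
  have e1 : a * f * (b * g) = a * b := by
    rw [mul_assoc, ← mul_assoc f, hb, ← mul_assoc, ← neg_neg (a * b), ← h', neg_mul, mul_assoc, haf]
  have e2 : b * g * (a * f) = b * a := by
    rw [mul_assoc, ← mul_assoc g, hgb, ← mul_assoc, h', neg_mul, mul_assoc, hbf]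
  rw [e1, e2, h]

/-- The tensor product of two Clifford actions. -/
theorem CliffordRel.prod (h : CliffordRel e γ γd) (h' : CliffordRel e' γ' γd')
    (c : CliffordCommute e γ γd e' γ' γd') :
    CliffordRel (e * e') (prodGen e γ e' γ') (prodGen e γd e' γd') := by
  have l : ∀ a : A, a * e = a → a * e' = e' * a → a * e' * (e * e') = a * e' := fun a h1 h2 => by
    rw [c.e_e, mul_assoc, ← mul_assoc e', h'.e_e, ← c.e_e, ← mul_assoc, h1]
  have r : ∀ a : A, e * a = a → a * e' = e' * a → e * e' * (a * e') = a * e' := fun a h1 h2 => by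
    rw [h2, mul_assoc, ← mul_assoc e', h'.e_e, ← h2, ← mul_assoc, h1]
  have l' : ∀ a : A, a * e' = a → e * a = a * e → a * e * (e * e') = a * e := fun a h1 h2 => by
    rw [mul_assoc, ← mul_assoc e, h.e_e, c.e_e, ← mul_assoc, h1]
  have r' : ∀ a : A, e' * a = a → e * a = a * e → e * e' * (a * e) = a * e := fun a h1 h2 => by
    rw [c.e_e, ← h2, mul_assoc, ← mul_assoc e, h.e_e, h2, ← mul_assoc, h1]
  constructor
  · exact r e h.e_e c.e_e
  · refine Fin.addCases (fun i => ?_) fun i => ?_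
    · simp only [prodGen, Fin.append_left]; exact l _ (h.γ_e i) (c.γ_e i)
    · simp only [prodGen, Fin.append_right]; exact l' _ (h'.γ_e i) (c.e_γ i)
  · refine Fin.addCases (fun i => ?_) fun i => ?_
    · simp only [prodGen, Fin.append_left]; exact r _ (h.e_γ i) (c.γ_e i)
    · simp only [prodGen, Fin.append_right]; exact r' _ (h'.e_γ i) (c.e_γ i)
  · refine Fin.addCases (fun i => ?_) fun i => ?_
    · simp only [prodGen, Fin.append_left]; exact l _ (h.γd_e i) (c.γd_e i)
    · simp only [prodGen, Fin.append_right]; exact l' _ (h'.γd_e i) (c.e_γd i)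
  · refine Fin.addCases (fun i => ?_) fun i => ?_
    · simp only [prodGen, Fin.append_left]; exact r _ (h.e_γd i) (c.γd_e i)
    · simp only [prodGen, Fin.append_right]; exact r' _ (h'.e_γd i) (c.e_γd i)
  · refine Fin.addCases (fun i => ?_) fun i => ?_ <;> refine Fin.addCases (fun j => ?_) fun j => ?_
    all_goals simp only [prodGen, Fin.append_left, Fin.append_right]
    · rw [prod_same h'.e_e (c.γ_e i) (c.γ_e j) (h.γ_γ i j), zero_mul]
    · exact prod_mixed (h.γ_e i) (h.e_γ i) (h'.e_γ j) (h'.γ_e j) (c.γ_γ i j)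
    · rw [add_comm]
      exact prod_mixed (h.γ_e j) (h.e_γ j) (h'.e_γ i) (h'.γ_e i) (c.γ_γ j i)
    · rw [prod_same h.e_e (c.e_γ i).symm (c.e_γ j).symm (h'.γ_γ i j), zero_mul]
  · refine Fin.addCases (fun i => ?_) fun i => ?_ <;> refine Fin.addCases (fun j => ?_) fun j => ?_
    all_goals simp only [prodGen, Fin.append_left, Fin.append_right]
    · rw [prod_same h'.e_e (c.γd_e i) (c.γd_e j) (h.γd_γd i j), zero_mul]
    · exact prod_mixed (h.γd_e i) (h.e_γd i) (h'.e_γd j) (h'.γd_e j) (c.γd_γd i j)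
    · rw [add_comm]
      exact prod_mixed (h.γd_e j) (h.e_γd j) (h'.e_γd i) (h'.γd_e i) (c.γd_γd j i)
    · rw [prod_same h.e_e (c.e_γd i).symm (c.e_γd j).symm (h'.γd_γd i j), zero_mul]
  · refine Fin.addCases (fun i => ?_) fun i => ?_ <;> refine Fin.addCases (fun j => ?_) fun j => ?_
    all_goals simp only [prodGen, Fin.append_left, Fin.append_right]
    · rw [prod_same h'.e_e (c.γ_e i) (c.γd_e j) (h.γ_γd i j)]
      simp only [Fin.castAdd_inj]
      split_ifs <;> simp
    · rw [prod_mixed (h.γ_e i) (h.e_γ i) (h'.e_γd j) (h'.γd_e j) (c.γ_γd i j), if_neg]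
      intro h0; have := congrArg Fin.val h0; simp at this; have := i.2; omega
    · rw [add_comm, prod_mixed (h.γd_e j) (h.e_γd j) (h'.e_γ i) (h'.γ_e i) (c.γd_γ j i), if_neg]
      intro h0; have := congrArg Fin.val h0; simp at this; have := j.2; omega
    · rw [prod_same h.e_e (c.e_γ i).symm (c.e_γd j).symm (h'.γ_γd i j), c.e_e]
      simp only [Fin.natAdd_inj]
      split_ifs <;> simp

theorem foldr_finRange_add {α : Type*} (m n : ℕ) (f : Fin (m + n) → α → α) (x : α) :
    (List.finRange (m + n)).foldr f x = (List.finRange m).foldr (fun i => f (Fin.castAdd n i))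
      ((List.finRange n).foldr (fun i => f (Fin.natAdd m i)) x) := by
  have : List.finRange (m + n) =
      (List.finRange m).map (Fin.castAdd n) ++ (List.finRange n).map (Fin.natAdd m) := by
    rw [List.finRange, List.finRange, List.finRange, List.ofFn_add, List.map_ofFn, List.map_ofFn]
    rfl
  rw [this, List.foldr_append, List.foldr_map, List.foldr_map]

/-- An idempotent that commutes with all generators can be collected from every layer into one copy
on the right. The second assertion is carried along because the induction needs it to move f past
the inner nest. -/
theorem ringNest_mul_right (f : A) (hf : f * f = f) (hγ : ∀ i, f * γ i = γ i * f)
    (hγd : ∀ i, f * γd i = γd i * f) (x : A) (hx : f * x = x * f) :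
    ringNest (fun i => γ i * f) (fun i => γd i * f) (x * f) = ringNest γ γd x * f ∧
      f * ringNest γ γd x = ringNest γ γd x * f := by
  unfold ringNest
  induction List.finRange m with
  | nil => exact ⟨rfl, hx⟩
  | cons i L ih =>
    obtain ⟨ih1, ih2⟩ := ih
    simp only [List.foldr_cons] at ih1 ih2 ⊢
    rw [ih1]
    generalize List.foldr (fun i y => γ i * y * γd i) x L = y at ih2
    constructor
    · rw [absorb_comm hf ih2.symm, absorb_comm hf (hγd i).symm]
    · rw [mul_assoc, ← mul_assoc f, hγ, mul_assoc (γ i), ← mul_assoc f, ih2, mul_assoc y, hγd,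
        mul_assoc, mul_assoc]

/-- From the centre, u only has to travel outwards through the γd; it never meets a γ. -/
theorem ringNest_mul_even (u x : A) (hu : ∀ i, u * γd i = γd i * u) :
    ringNest γ γd (x * u) = ringNest γ γd x * u := by
  unfold ringNest
  induction List.finRange m with
  | nil => rfl
  | cons i L ih =>
    simp only [List.foldr_cons] at ih ⊢
    rw [ih, ← mul_assoc, mul_assoc _ u, hu, mul_assoc, mul_assoc, mul_assoc]

/-- Each layer contributes two sign changes, one from its γ and one from its γd, and they cancel. -/
theorem ringNest_comm_odd (x a : A) (hx : a * x = x * a) (hγ : ∀ i, a * γ i + γ i * a = 0)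
    (hγd : ∀ i, a * γd i + γd i * a = 0) : a * ringNest γ γd x = ringNest γ γd x * a := by
  unfold ringNest
  induction List.finRange m with
  | nil => exact hx
  | cons i L ih =>
    simp only [List.foldr_cons] at ih ⊢
    generalize List.foldr (fun i y => γ i * y * γd i) x L = y at ih
    have h1 : a * γ i = -(γ i * a) := eq_neg_iff_add_eq_zero.2 (hγ i)
    have h2 : a * γd i = -(γd i * a) := eq_neg_iff_add_eq_zero.2 (hγd i)
    rw [← mul_assoc, ← mul_assoc, h1, neg_mul, mul_assoc (γ i), ih, neg_mul, ← mul_assoc,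
      mul_assoc _ a, h2, mul_neg, neg_neg, mul_assoc, mul_assoc, mul_assoc]

theorem CliffordRel.e_ringNest (h : CliffordRel e γ γd) :
    e * ringNest γ γd e = ringNest γ γd e ∧ ringNest γ γd e * e = ringNest γ γd e := by
  unfold ringNest
  cases List.finRange m with
  | nil => exact ⟨h.e_e, h.e_e⟩
  | cons i L =>
    simp only [List.foldr_cons]
    constructor
    · rw [← mul_assoc, ← mul_assoc, h.e_γ]
    · rw [mul_assoc, h.γd_e]

/-- The unit of a tensor product is the product of the units. -/
theorem ringNest_prod (h : CliffordRel e γ γd) (h' : CliffordRel e' γ' γd')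
    (c : CliffordCommute e γ γd e' γ' γd') :
    ringNest (prodGen e γ e' γ') (prodGen e γd e' γd') (e * e') =
      ringNest γ γd e * ringNest γ' γd' e' := by
  have h1 := ringNest_mul_right (γ := γ') (γd := γd') e h.e_e c.e_γ c.e_γd e' c.e_e
  have key : ringNest (prodGen e γ e' γ') (prodGen e γd e' γd') (e * e') =
      ringNest (fun i => γ i * e') (fun i => γd i * e')
        (ringNest (fun i => γ' i * e) (fun i => γd' i * e) (e * e')) := by
    unfold ringNest
    rw [foldr_finRange_add]
    simp only [prodGen, Fin.append_left, Fin.append_right]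
  set u := ringNest γ' γd' e' with hu
  obtain ⟨hu1, hu2⟩ := h'.e_ringNest
  rw [← hu] at hu1 hu2
  rw [key, c.e_e, h1.1, ← h1.2]
  -- The inner unit is even for the first family: it may leave the outer nest through the γd.
  have hγu : ∀ i, γd i * u = u * γd i := fun i =>
    ringNest_comm_odd e' (γd i) (c.γd_e i) (c.γd_γ i) (c.γd_γd i)
  -- Inserting e' makes the centre e * e' times u. Once u has been moved out, the remaining nest has
  -- the shape required by `ringNest_mul_right` with f = e'.
  have hs : e * u = e * e' * u := by rw [mul_assoc, hu1]
  rw [hs, ringNest_mul_even (γ := fun i => γ i * e') (γd := fun i => γd i * e') u (e * e')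
    (fun i => by rw [← mul_assoc, ← hγu, mul_assoc, hu2, mul_assoc, hu1])]
  rw [(ringNest_mul_right (γ := γ) (γd := γd) e' h'.e_e (fun i => (c.γ_e i).symm)
    (fun i => (c.γd_e i).symm) e c.e_e.symm).1, mul_assoc, hu1]

/-- Commutation with a tensor product. -/
theorem CliffordCommute.prod_left {l : ℕ} {e'' : A} {γ'' γd'' : Fin l → A}
    (c : CliffordCommute e γ γd e'' γ'' γd'') (c' : CliffordCommute e' γ' γd' e'' γ'' γd'') :
    CliffordCommute (e * e') (prodGen e γ e' γ') (prodGen e γd e' γd') e'' γ'' γd'' := by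
  have comm : ∀ {a b x : A}, a * x = x * a → b * x = x * b → a * b * x = x * (a * b) :=
    fun h1 h2 => by rw [mul_assoc, h2, ← mul_assoc, h1, mul_assoc]
  have anti : ∀ {a b x : A}, a * x + x * a = 0 → b * x = x * b → a * b * x + x * (a * b) = 0 :=
    fun h1 h2 => by rw [mul_assoc, h2, ← mul_assoc, ← mul_assoc, ← add_mul, h1, zero_mul]
  constructor
  · exact comm c.e_e c'.e_e
  · exact fun j => comm (c.e_γ j) (c'.e_γ j)
  · exact fun j => comm (c.e_γd j) (c'.e_γd j)
  · refine Fin.addCases (fun i => ?_) fun i => ?_ <;>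
      simp only [prodGen, Fin.append_left, Fin.append_right]
    exacts [comm (c.γ_e i) c'.e_e, comm (c'.γ_e i) c.e_e]
  · refine Fin.addCases (fun i => ?_) fun i => ?_ <;>
      simp only [prodGen, Fin.append_left, Fin.append_right]
    exacts [comm (c.γd_e i) c'.e_e, comm (c'.γd_e i) c.e_e]
  · intro i j; revert i
    refine Fin.addCases (fun i => ?_) fun i => ?_ <;>
      simp only [prodGen, Fin.append_left, Fin.append_right]
    exacts [anti (c.γ_γ i j) (c'.e_γ j), anti (c'.γ_γ i j) (c.e_γ j)]
  · intro i j; revert i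
    refine Fin.addCases (fun i => ?_) fun i => ?_ <;>
      simp only [prodGen, Fin.append_left, Fin.append_right]
    exacts [anti (c.γ_γd i j) (c'.e_γd j), anti (c'.γ_γd i j) (c.e_γd j)]
  · intro i j; revert i
    refine Fin.addCases (fun i => ?_) fun i => ?_ <;>
      simp only [prodGen, Fin.append_left, Fin.append_right]
    exacts [anti (c.γd_γ i j) (c'.e_γ j), anti (c'.γd_γ i j) (c.e_γ j)]
  · intro i j; revert i
    refine Fin.addCases (fun i => ?_) fun i => ?_ <;>
      simp only [prodGen, Fin.append_left, Fin.append_right]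
    exacts [anti (c.γd_γd i j) (c'.e_γd j), anti (c'.γd_γd i j) (c.e_γd j)]

/-- The Clifford relations for `γ† = -L - ∑ s A`. -/
theorem cliffordRel_of_half {A : Type*} [Ring A] {n : ℕ} (a L : Fin n → A) (s : Fin n → Fin n → A)
    (haa : ∀ i j, a i * a j + a j * a i = 0) (hsa : ∀ q i j, s i j * a q = a q * s i j)
    (hsL : ∀ q i j, s i j * L q = L q * s i j)
    (hss : ∀ i j p q, s i j * s p q = s p q * s i j)
    (haL : ∀ i j, a i * L j + L j * a i = if i = j then -1 else 0)
    (hLL : ∀ i j, L i * L j + L j * L i = s i j + s j i) :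
    CliffordRel 1 a (fun i => -L i - ∑ q, s q i * a q) := by
  have haS : ∀ i j, a i * (∑ q, s q j * a q) + (∑ q, s q j * a q) * a i = 0 := fun i j => by
    rw [Finset.mul_sum, Finset.sum_mul, ← Finset.sum_add_distrib]
    refine Finset.sum_eq_zero fun q _ => ?_
    rw [← mul_assoc, ← hsa, mul_assoc, mul_assoc, ← mul_add, haa, mul_zero]
  -- The anticommutator of L i with a q is -1 for q = i and zero otherwise, so one coefficient
  -- survives.
  have hLS : ∀ i j, L i * (∑ q, s q j * a q) + (∑ q, s q j * a q) * L i = - s i j := fun i j => by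
    rw [Finset.mul_sum, Finset.sum_mul, ← Finset.sum_add_distrib, Finset.sum_eq_single i]
    · rw [← mul_assoc, ← hsL, mul_assoc, mul_assoc, ← mul_add, add_comm, haL, if_pos rfl, mul_neg,
        mul_one]
    · intro q _ hq
      rw [← mul_assoc, ← hsL, mul_assoc, mul_assoc, ← mul_add, add_comm, haL, if_neg hq, mul_zero]
    · exact fun h => absurd (Finset.mem_univ i) h
  have hSS : ∀ i j, (∑ q, s q i * a q) * (∑ q, s q j * a q) +
      (∑ q, s q j * a q) * (∑ q, s q i * a q) = 0 := fun i j => by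
    conv_lhs => enter [1]; rw [Finset.sum_mul]
    conv_lhs => enter [2]; rw [Finset.mul_sum]
    rw [← Finset.sum_add_distrib]
    refine Finset.sum_eq_zero fun q _ => ?_
    have : (∑ p, s p j * a p) * (s q i * a q) = s q i * ((∑ p, s p j * a p) * a q) := by
      rw [← mul_assoc, ← mul_assoc, Finset.sum_mul, Finset.mul_sum]
      congr 1
      refine Finset.sum_congr rfl fun p _ => ?_
      rw [mul_assoc, ← hsa, ← mul_assoc, hss, mul_assoc]
    rw [this, mul_assoc, ← mul_add, haS, mul_zero]
  constructor
  · exact mul_one 1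
  · exact fun i => mul_one _
  · exact fun i => one_mul _
  · exact fun i => mul_one _
  · exact fun i => one_mul _
  · exact haa
  · intro i j
    have h1 := hLL i j
    have h2 := hLS i j
    have h3 := hLS j i
    have h4 := hSS i j
    generalize (∑ q, s q i * a q) = x at *
    generalize (∑ q, s q j * a q) = y at *
    -- The cross terms contribute -s i j and -s j i. They cancel the anticommutator of the L's; this
    -- is what the correction term is for.
    have : (-L i - x) * (-L j - y) + (-L j - y) * (-L i - x) =
      (L i * L j + L j * L i) + (L i * y + y * L i) + (L j * x + x * L j) + (x * y + y * x) := by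
      noncomm_ring
    rw [this, h1, h2, h3, h4]; abel
  · intro i j
    have h1 := haL i j
    have h2 := haS i j
    generalize (∑ q, s q j * a q) = y at *
    have : a i * (-L j - y) + (-L j - y) * a i =
      -(a i * L j + L j * a i) - (a i * y + y * a i) := by noncomm_ring
    rw [this, h1, h2]
    split_ifs <;> simp

end CliffordRelations

/-! ## Inflation of matrices -/

section Inflate

variable {k : Type u} [CommRing k] {S : Type u} [CommRing S] {σ : Type} {m : ℕ}

theorem coeff_map_addHom (f : S →+ k) (P : MvPolynomial σ S) (s : σ →₀ ℕ) :
    coeff s (AddMonoidAlgebra.map f P : MvPolynomial σ k) = f (coeff s P) := rfl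

theorem map_addHom_add (f : S →+ k) (P Q : MvPolynomial σ S) :
    (AddMonoidAlgebra.map f (P + Q) : MvPolynomial σ k) =
      (AddMonoidAlgebra.map f P : MvPolynomial σ k) + AddMonoidAlgebra.map f Q := by
  refine MvPolynomial.ext _ _ fun s => ?_
  rw [coeff_map_addHom, coeff_add, coeff_add, map_add, coeff_map_addHom, coeff_map_addHom]

/-- Application of an additive map to the coefficients of a polynomial. -/
noncomputable def coeffMap (σ : Type) (f : S →+ k) : MvPolynomial σ S →+ MvPolynomial σ k where
  toFun P := AddMonoidAlgebra.map f P
  map_zero' := by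
    refine MvPolynomial.ext _ _ fun s => ?_
    rw [coeff_map_addHom, coeff_zero, coeff_zero, map_zero]
  map_add' := map_addHom_add f

theorem coeff_coeffMap (f : S →+ k) (P : MvPolynomial σ S) (s : σ →₀ ℕ) :
    coeff s (coeffMap σ f P) = f (coeff s P) := rfl

theorem coeffMap_monomial (f : S →+ k) (s : σ →₀ ℕ) (a : S) :
    coeffMap σ f (monomial s a) = monomial s (f a) := by
  classical
  refine MvPolynomial.ext _ _ fun t => ?_
  rw [coeff_coeffMap, coeff_monomial, coeff_monomial]
  split_ifs <;> simp

/-- If `f (s s')` is a sum of products, then so is the induced map on polynomials. -/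
theorem coeffMap_mul {T : Type*} [Fintype T] (f : S →+ k) (g h : T → S →+ k)
    (H : ∀ s s', f (s * s') = ∑ t, g t s * h t s') (P Q : MvPolynomial σ S) :
    coeffMap σ f (P * Q) = ∑ t, coeffMap σ (g t) P * coeffMap σ (h t) Q := by
  classical
  refine MvPolynomial.ext _ _ fun s => ?_
  simp only [coeff_coeffMap, coeff_sum, coeff_mul, map_sum, H]
  exact Finset.sum_comm

/-- Polynomials with coefficients in k pass through a k-linear map of coefficients. This makes
inflation linear over k[x, z]. -/
theorem coeffMap_base_mul (b : k →+* S) (f : S →+ k) (H : ∀ a s, f (b a * s) = a * f s)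
    (P : MvPolynomial σ k) (Q : MvPolynomial σ S) :
    coeffMap σ f (MvPolynomial.map b P * Q) = P * coeffMap σ f Q := by
  classical
  refine MvPolynomial.ext _ _ fun s => ?_
  simp only [coeff_coeffMap, coeff_mul, map_sum, coeff_map, H]

theorem inflate_apply {α α' β β' : Type} (φ : Fin m → Fin m → S →+ k)
    (A : Matrix (α' × β') (α × β) (MvPolynomial σ S)) (a : α' × Fin m × β') (b : α × Fin m × β) :
    inflate φ A a b = coeffMap σ (φ a.2.1 b.2.1) (A (a.1, a.2.2) (b.1, b.2.2)) := rfl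

variable {α α' α'' β β' β'' : Type}

theorem inflate_add (φ : Fin m → Fin m → S →+ k)
    (A B : Matrix (α' × β') (α × β) (MvPolynomial σ S)) :
    inflate φ (A + B) = inflate φ A + inflate φ B := by
  ext1 a b; simp only [inflate_apply, Matrix.add_apply, map_add]

theorem inflate_neg (φ : Fin m → Fin m → S →+ k)
    (A : Matrix (α' × β') (α × β) (MvPolynomial σ S)) :
    inflate φ (-A) = -inflate φ A := by
  ext1 a b; simp only [inflate_apply, Matrix.neg_apply, map_neg]

theorem inflate_sgn_smul (φ : Fin m → Fin m → S →+ k) (p : ZMod 2)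
    (A : Matrix (α' × β') (α × β) (MvPolynomial σ S)) :
    inflate φ (sgn (MvPolynomial σ S) p • A) = sgn (MvPolynomial σ k) p • inflate φ A := by
  unfold sgn
  split_ifs
  · rw [one_smul, one_smul]
  · rw [neg_one_smul, neg_one_smul, inflate_neg]

theorem inflate_base_smul (b : k →+* S) (φ : Fin m → Fin m → S →+ k)
    (H : ∀ i j a s, φ i j (b a * s) = a * φ i j s) (P : MvPolynomial σ k)
    (A : Matrix (α' × β') (α × β) (MvPolynomial σ S)) :
    inflate φ (MvPolynomial.map b P • A) = P • inflate φ A := by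
  ext1 x y
  simp only [inflate_apply, Matrix.smul_apply, smul_eq_mul]
  exact coeffMap_base_mul b _ (H _ _) P _

variable [Fintype α] [Fintype β]

/-- A product rule for the coefficients, in which each term composes two matrices over k, is
inherited by matrices of polynomials, because the convolution of coefficients and the matrix product
merely add further summations. One, two and four terms give multiplicativity and the Leibniz rules
of first and second order. -/
theorem inflate_mul {T : Type*} [Fintype T] (φ : Fin m → Fin m → S →+ k)
    (φ₁ φ₂ : T → Fin m → Fin m → S →+ k)
    (H : ∀ i j s s', φ i j (s * s') = ∑ t, ∑ l, φ₁ t i l s * φ₂ t l j s')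
    (A : Matrix (α'' × β'') (α × β) (MvPolynomial σ S))
    (B : Matrix (α × β) (α' × β') (MvPolynomial σ S)) :
    inflate φ (A * B) = ∑ t, inflate (φ₁ t) A * inflate (φ₂ t) B := by
  ext1 x y
  rw [Matrix.sum_apply]
  simp only [Matrix.mul_apply, inflate_apply, map_sum, Fintype.sum_prod_type]
  have : ∀ P Q : MvPolynomial σ S, coeffMap σ (φ x.2.1 y.2.1) (P * Q) =
      ∑ t, ∑ l, coeffMap σ (φ₁ t x.2.1 l) P * coeffMap σ (φ₂ t l y.2.1) Q := fun P Q => by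
    rw [coeffMap_mul (T := T × Fin m) (φ x.2.1 y.2.1) (fun t => φ₁ t.1 x.2.1 t.2)
      (fun t => φ₂ t.1 t.2 y.2.1), Fintype.sum_prod_type]
    intro s s'
    rw [H, Fintype.sum_prod_type]
  simp only [this]
  rw [Finset.sum_comm' (t' := Finset.univ) (s' := fun _ => Finset.univ) (by simp)]
  have key : ∀ F : α → β → T → Fin m → MvPolynomial σ k,
      ∑ b, ∑ a, ∑ t, ∑ l, F a b t l = ∑ t, ∑ a, ∑ l, ∑ b, F a b t l := fun F => by
    have h1 : ∀ b, ∑ a, ∑ t, ∑ l, F a b t l = ∑ t, ∑ a, ∑ l, F a b t l :=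
      fun b => Finset.sum_comm
    simp only [h1]
    rw [Finset.sum_comm]
    refine Finset.sum_congr rfl fun t _ => ?_
    rw [Finset.sum_comm]
    refine Finset.sum_congr rfl fun a _ => ?_
    rw [Finset.sum_comm]
  exact key _

end Inflate

/-! ## Tensor products over `S` -/

section TensorOp

variable {k : Type u} [CommRing k] {W V U : Potential k} {S : Type u} [CommRing S]
  (c : V.Poly →+* S)

/-- The map `k[x, z] → S[x, z]`. -/
noncomputable abbrev baseScalars (W V U : Potential k) (c : V.Poly →+* S) :
    PolyRing W U →+* MvPolynomial (Fin W.n ⊕ Fin U.n) S :=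
  MvPolynomial.map (c.comp C)

theorem leftScalars_inl (f : V.Poly) :
    leftScalars W V U c (rename Sum.inl f) = C (c f) := by
  have : (leftScalars W V U c).comp (rename Sum.inl : V.Poly →ₐ[k] _).toRingHom
      = (C : S →+* _).comp c := by
    refine MvPolynomial.ringHom_ext (fun a => ?_) fun i => ?_ <;> simp [leftScalars]
  exact congrArg (fun h => h f) this

theorem rightScalars_inr (f : V.Poly) :
    rightScalars W V U c (rename Sum.inr f) = C (c f) := by
  have : (rightScalars W V U c).comp (rename Sum.inr : V.Poly →ₐ[k] _).toRingHom
      = (C : S →+* _).comp c := by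
    refine MvPolynomial.ringHom_ext (fun a => ?_) fun i => ?_ <;> simp [rightScalars]
  exact congrArg (fun h => h f) this

theorem leftScalars_inr (f : U.Poly) :
    leftScalars W V U c (rename Sum.inr f) = baseScalars W V U c (rename Sum.inr f) := by
  have : (leftScalars W V U c).comp (rename Sum.inr : U.Poly →ₐ[k] _).toRingHom
      = (baseScalars W V U c).comp (rename Sum.inr : U.Poly →ₐ[k] _).toRingHom := by
    refine MvPolynomial.ringHom_ext (fun a => ?_) fun i => ?_ <;> simp [leftScalars]
  exact congrArg (fun h => h f) this

theorem rightScalars_inl (f : W.Poly) :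
    rightScalars W V U c (rename Sum.inl f) = baseScalars W V U c (rename Sum.inl f) := by
  have : (rightScalars W V U c).comp (rename Sum.inl : W.Poly →ₐ[k] _).toRingHom
      = (baseScalars W V U c).comp (rename Sum.inl : W.Poly →ₐ[k] _).toRingHom := by
    refine MvPolynomial.ringHom_ext (fun a => ?_) fun i => ?_ <;> simp [rightScalars]
  exact congrArg (fun h => h f) this

/-- Used to compare coefficients in the completion with coefficients in J_V. -/
theorem leftScalars_comp {S' : Type u} [CommRing S'] (h : S →+* S') (f : PolyRing V U) :
    leftScalars W V U (h.comp c) f = MvPolynomial.map h (leftScalars W V U c f) := by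
  have : leftScalars W V U (h.comp c) = (MvPolynomial.map h).comp (leftScalars W V U c) := by
    refine MvPolynomial.ringHom_ext (fun a => ?_) ?_
    · simp [leftScalars]
    · rintro (i | i) <;> simp [leftScalars]
  rw [this]; rfl

theorem rightScalars_comp {S' : Type u} [CommRing S'] (h : S →+* S') (f : PolyRing W V) :
    rightScalars W V U (h.comp c) f = MvPolynomial.map h (rightScalars W V U c f) := by
  have : rightScalars W V U (h.comp c) = (MvPolynomial.map h).comp (rightScalars W V U c) := by
    refine MvPolynomial.ringHom_ext (fun a => ?_) ?_
    · simp [rightScalars]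
    · rintro (i | i) <;> simp [rightScalars]
  rw [this]; rfl

theorem map_sgn {R R' : Type*} [CommRing R] [CommRing R'] (h : R →+* R') (p : ZMod 2) :
    h (sgn R p) = sgn R' p := by unfold sgn; split_ifs <;> simp

variable {Y Y' Y'' : GradedOp (PolyRing V U)} {X X' X'' : GradedOp (PolyRing W V)}

theorem tensorOp_apply (p : ZMod 2) (g : Op Y Y') (f : Op X X') (a : Y'.ι × X'.ι)
    (b : Y.ι × X.ι) : tensorOp c p g f a b = sgn _ (p * Y.par b.1) *
      leftScalars W V U c (g a.1 b.1) * rightScalars W V U c (f a.2 b.2) := rfl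

theorem tensorOp_comp {S' : Type u} [CommRing S'] (h : S →+* S') (p : ZMod 2) (g : Op Y Y')
    (f : Op X X') : tensorOp (h.comp c) p g f = (tensorOp c p g f).map (MvPolynomial.map h) := by
  ext1 a b
  rw [Matrix.map_apply, tensorOp_apply, tensorOp_apply, map_mul, map_mul, map_sgn,
    leftScalars_comp, rightScalars_comp]

theorem tensorOp_add_left (p : ZMod 2) (g g' : Op Y Y') (f : Op X X') :
    tensorOp c p (g + g') f = tensorOp c p g f + tensorOp c p g' f := by
  ext1 a b
  simp only [tensorOp_apply, Matrix.add_apply, map_add]; ring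

theorem tensorOp_add_right (p : ZMod 2) (g : Op Y Y') (f f' : Op X X') :
    tensorOp c p g (f + f') = tensorOp c p g f + tensorOp c p g f' := by
  ext1 a b
  simp only [tensorOp_apply, Matrix.add_apply, map_add]; ring

theorem tensorOp_smul_left (p : ZMod 2) (r : PolyRing V U) (g : Op Y Y') (f : Op X X') :
    tensorOp c p (r • g) f = leftScalars W V U c r • tensorOp c p g f := by
  ext1 a b
  simp only [tensorOp_apply, Matrix.smul_apply, smul_eq_mul, map_mul]; ring

theorem tensorOp_smul_right (p : ZMod 2) (r : PolyRing W V) (g : Op Y Y') (f : Op X X') :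
    tensorOp c p g (r • f) = rightScalars W V U c r • tensorOp c p g f := by
  ext1 a b
  simp only [tensorOp_apply, Matrix.smul_apply, smul_eq_mul, map_mul]; ring

theorem tensorOp_sgn_left (p q : ZMod 2) (g : Op Y Y') (f : Op X X') :
    tensorOp c p (sgn (PolyRing V U) q • g) f =
      sgn (MvPolynomial (Fin W.n ⊕ Fin U.n) S) q • tensorOp c p g f := by
  rw [tensorOp_smul_left, map_sgn]

theorem tensorOp_sgn_right (p q : ZMod 2) (g : Op Y Y') (f : Op X X') :
    tensorOp c p g (sgn (PolyRing W V) q • f) =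
      sgn (MvPolynomial (Fin W.n ⊕ Fin U.n) S) q • tensorOp c p g f := by
  rw [tensorOp_smul_right, map_sgn]

theorem tensorOp_one_one :
    tensorOp c 0 (1 : Op Y Y) (1 : Op X X) = 1 := by
  ext1 ⟨a, a'⟩ ⟨b, b'⟩
  rw [tensorOp_apply]
  by_cases h : a = b
  · subst h
    by_cases h' : a' = b'
    · subst h'
      simp [sgn_zero]
    · rw [Matrix.one_apply_ne h', map_zero, mul_zero, Matrix.one_apply_ne]
      exact fun e => h' (congrArg Prod.snd e)
  · rw [Matrix.one_apply_ne h, map_zero, mul_zero, zero_mul, Matrix.one_apply_ne]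
    exact fun e => h (congrArg Prod.fst e)

/-- The sign arises from moving f, of degree p, past g', of degree q'. In the matrix product the
sign of the left factor refers to an intermediate basis vector of Y'; homogeneity of g' ties its
parity to that of the column, and the other terms vanish. -/
theorem tensorOp_mul {p p' q' : ZMod 2} {g : Op Y' Y''} {f : Op X' X''} {g' : Op Y Y'}
    {f' : Op X X'} (hg : HasDeg q' g') :
    tensorOp c p g f * tensorOp c p' g' f' =
      sgn (MvPolynomial (Fin W.n ⊕ Fin U.n) S) (p * q') •
        tensorOp c (p + p') (g * g' : Op Y Y'') (f * f' : Op X X'') := by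
  ext1 a b
  rw [Matrix.smul_apply, tensorOp_apply, Matrix.mul_apply, Matrix.mul_apply, Matrix.mul_apply,
    map_sum, map_sum, Fintype.sum_prod_type, smul_eq_mul, mul_assoc (sgn _ _) (Finset.sum _ _),
    Finset.sum_mul_sum, Finset.mul_sum, Finset.mul_sum]
  refine Finset.sum_congr rfl fun i _ => ?_
  rw [Finset.mul_sum, Finset.mul_sum]
  refine Finset.sum_congr rfl fun j _ => ?_
  rw [tensorOp_apply, tensorOp_apply, map_mul, map_mul]
  by_cases h : Y'.par i = Y.par b.1 + q'
  · dsimp only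
    rw [h, mul_add, add_mul, sgn_add, sgn_add]; ring
  · dsimp only
    rw [hg i b.1 h, map_zero]; ring

/-- The tensor product over `k[y]`, with coefficients in `S`. -/
noncomputable abbrev tensorGr (Y : GradedOp (PolyRing V U)) (X : GradedOp (PolyRing W V)) :
    GradedOp (MvPolynomial (Fin W.n ⊕ Fin U.n) S) where
  ι := Y.ι × X.ι
  par a := Y.par a.1 + X.par a.2
  d := tensorD c Y X

variable {c}

theorem HasDeg.tensor {p q : ZMod 2} {g : Op Y Y'} {f : Op X X'} (hg : HasDeg q g)
    (hf : HasDeg p f) :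
    HasDeg (M := tensorGr c Y X) (N := tensorGr c Y' X') (q + p) (tensorOp c p g f) := by
  intro a b h
  rw [tensorOp_apply]
  by_cases h1 : Y'.par a.1 = Y.par b.1 + q
  · rw [hf a.2 b.2, map_zero, mul_zero]
    intro h2
    refine h ?_
    change Y'.par a.1 + X'.par a.2 = Y.par b.1 + X.par b.2 + (q + p)
    rw [h1, h2]; ring
  · rw [hg a.1 b.1 h1, map_zero, mul_zero, zero_mul]

theorem hasDeg_tensorD (hY : HasDeg (M := Y) (N := Y) 1 Y.d) (hX : HasDeg (M := X) (N := X) 1 X.d) :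
    HasDeg (M := tensorGr c Y X) (N := tensorGr c Y X) 1 (tensorD c Y X) := by
  have h1 := HasDeg.tensor (c := c) hY (HasDeg.one (M := X))
  have h2 := HasDeg.tensor (c := c) (HasDeg.one (M := Y)) hX
  exact HasDeg.add h1 h2

theorem tensorD_mul {p q : ZMod 2} {g : Op Y Y'} {f : Op X X'} (hg : HasDeg q g) :
    tensorD c Y' X' * tensorOp c p g f = tensorOp c p (Y'.d * g : Op Y Y') f +
      sgn (MvPolynomial (Fin W.n ⊕ Fin U.n) S) q •
        tensorOp c (1 + p) g (X'.d * f : Op X X') := by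
  unfold tensorD
  rw [Matrix.add_mul, tensorOp_mul c hg, tensorOp_mul c hg, zero_mul, one_mul, zero_add, sgn_zero,
    one_smul, Matrix.one_mul, Matrix.one_mul]

theorem mul_tensorD {p : ZMod 2} {g : Op Y Y'} {f : Op X X'}
    (hY : HasDeg (M := Y) (N := Y) 1 Y.d) :
    tensorOp c p g f * tensorD c Y X = sgn (MvPolynomial (Fin W.n ⊕ Fin U.n) S) p •
        tensorOp c p (g * Y.d : Op Y Y') f + tensorOp c (p + 1) g (f * X.d : Op X X') := by
  unfold tensorD
  rw [Matrix.mul_add, tensorOp_mul c hY, tensorOp_mul c (HasDeg.one (M := Y)), mul_zero, mul_one,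
    add_zero, sgn_zero, one_smul, Matrix.mul_one, Matrix.mul_one]

theorem sgn_sq_smul {R A : Type*} [CommRing R] [AddCommGroup A] [Module R A] (p : ZMod 2) (a : A) :
    sgn R p • sgn R p • a = a := by rw [smul_smul, sgn_mul_self, one_smul]

theorem IsClosedOp.tensor {p q : ZMod 2} {g : Op Y Y'} {f : Op X X'}
    (hY : HasDeg (M := Y) (N := Y) 1 Y.d) (hg : IsClosedOp q g) (hf : IsClosedOp p f) :
    IsClosedOp (M := tensorGr c Y X) (N := tensorGr c Y' X') (q + p) (tensorOp c p g f) := by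
  refine ⟨hg.1.tensor hf.1, ?_⟩
  change tensorD c Y' X' * tensorOp c p g f = _ • (tensorOp c p g f * tensorD c Y X)
  rw [tensorD_mul hg.1, mul_tensorD hY, hg.2, hf.2, tensorOp_sgn_left, tensorOp_sgn_right, sgn_add,
    smul_add, mul_smul, mul_smul, sgn_sq_smul, add_comm 1 p]

theorem zmod_two_add_one_add_one (p : ZMod 2) : p + 1 + 1 = p := by
  rw [add_assoc, show (1 : ZMod 2) + 1 = 0 by decide, add_zero]

theorem IsNull.tensor_right {p q : ZMod 2} {g : Op Y Y'} {f : Op X X'}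
    (hY : HasDeg (M := Y) (N := Y) 1 Y.d) (hg : IsClosedOp q g) (hf : IsNull p f) :
    IsNull (M := tensorGr c Y X) (N := tensorGr c Y' X') (q + p) (tensorOp c p g f) := by
  obtain ⟨h, hh, rfl⟩ := hf
  -- The factor (-1)^q compensates for 1 ⊗ d_X passing g. No such factor is needed when the homotopy
  -- is on the left.
  refine ⟨sgn _ q • tensorOp c (p + 1) g h, HasDeg.smul _ ?_, ?_⟩
  · have := HasDeg.tensor (c := c) hg.1 hh
    rwa [← add_assoc] at this
  · change _ = tensorD c Y' X' * (sgn _ q • tensorOp c (p + 1) g h) +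
      sgn _ (q + p) • ((sgn _ q • tensorOp c (p + 1) g h) * tensorD c Y X)
    rw [Matrix.mul_smul, Matrix.smul_mul, tensorD_mul hg.1, mul_tensorD hY, hg.2, tensorOp_sgn_left,
      sgn_add, sgn_add, sgn_one, add_comm 1 (p + 1), zmod_two_add_one_add_one, tensorOp_add_right,
      tensorOp_sgn_right, smul_add, sgn_sq_smul, sgn_sq_smul, mul_smul, smul_comm (sgn _ p),
      sgn_sq_smul, smul_add, smul_smul (sgn _ p), ← mul_assoc, sgn_mul_self]
    simp only [one_mul, neg_smul, one_smul]; abel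

theorem IsNull.tensor_left {p q : ZMod 2} {g : Op Y Y'} {f : Op X X'}
    (hY : HasDeg (M := Y) (N := Y) 1 Y.d) (hg : IsNull q g) (hf : IsClosedOp p f) :
    IsNull (M := tensorGr c Y X) (N := tensorGr c Y' X') (q + p) (tensorOp c p g f) := by
  obtain ⟨h, hh, rfl⟩ := hg
  refine ⟨tensorOp c p h f, ?_, ?_⟩
  · have := HasDeg.tensor (c := c) hh hf.1
    rwa [add_right_comm] at this
  · change _ = tensorD c Y' X' * tensorOp c p h f +
      sgn _ (q + p) • (tensorOp c p h f * tensorD c Y X)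
    rw [tensorD_mul hh, mul_tensorD hY, hf.2, tensorOp_sgn_right, tensorOp_add_left,
      tensorOp_sgn_left, sgn_add, sgn_add, sgn_one, smul_add, add_comm 1 p]
    simp only [mul_smul, sgn_sq_smul, neg_smul, one_smul, smul_neg]; abel

/-- The square of the differential. -/
theorem tensorD_mul_tensorD (hY : HasDeg (M := Y) (N := Y) 1 Y.d)
    (hY2 : Y.d * Y.d = potDiff V U • (1 : Matrix Y.ι Y.ι (PolyRing V U)))
    (hX2 : X.d * X.d = potDiff W V • (1 : Matrix X.ι X.ι (PolyRing W V))) :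
    tensorD c Y X * tensorD c Y X = baseScalars W V U c (potDiff W U) •
      (1 : Matrix (Y.ι × X.ι) (Y.ι × X.ι) (MvPolynomial (Fin W.n ⊕ Fin U.n) S)) := by
  conv_lhs => enter [2]; unfold tensorD
  rw [Matrix.mul_add, tensorD_mul hY, tensorD_mul (HasDeg.one (M := Y)), hY2, hX2, Matrix.mul_one,
    Matrix.mul_one, tensorOp_smul_left, tensorOp_smul_right, sgn_one, sgn_zero, add_zero,
    show (1 : ZMod 2) + 1 = 0 by decide, tensorOp_one_one, potDiff, potDiff, potDiff, map_sub,
    map_sub, map_sub, leftScalars_inl, leftScalars_inr, rightScalars_inl, rightScalars_inr]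
  -- The mixed terms d_Y ⊗ d_X cancel by the Koszul sign. The two copies of V cancel because y acts
  -- in the same way from the left and from the right.
  simp only [neg_smul, one_smul, sub_smul]; abel

/-- The scalar operators. -/
theorem tensor_scalar (f : V.Poly) :
    tensorOp c 0 ((rename Sum.inl f : PolyRing V U) • (1 : Op Y Y)) (1 : Op X X) =
      (C (c f) : MvPolynomial (Fin W.n ⊕ Fin U.n) S) •
        (1 : Matrix (Y.ι × X.ι) (Y.ι × X.ι) _) := by
  rw [tensorOp_smul_left, leftScalars_inl, tensorOp_one_one]

end TensorOp

/-! ## `k[t]`-linear operators on the completion -/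

section HatOperators

variable {k : Type u} [CommRing k] {V : Potential k}

/-- The element `t_i` of the completion. -/
noncomputable def Potential.tHat (V : Potential k) (i : Fin V.n) : V.Hat :=
  algebraMap V.Poly V.Hat (pderiv i V.W)

/-- Operators on the completion which commute with multiplication by the `t_i`. -/
def IsTLinear (β : V.Hat →ₗ[k] V.Hat) : Prop := ∀ i h, β (V.tHat i * h) = V.tHat i * β h

theorem hatToJac_algebraMap (f : V.Poly) :
    V.hatToJac (algebraMap V.Poly V.Hat f) = Ideal.Quotient.mk (jacobiIdeal V.W) f := rfl

theorem hatToJac_tHat (i : Fin V.n) : V.hatToJac (V.tHat i) = 0 :=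
  Ideal.Quotient.eq_zero_iff_mem.2 (Ideal.subset_span ⟨i, rfl⟩)

/-- The ideal (t) is finitely generated, so the kernel of the map from the completion to J_V is
generated by the t_i. An operator commuting with them preserves this kernel and hence acts on J_V.
-/
theorem IsTLinear.hatToJac_eq_zero {β : V.Hat →ₗ[k] V.Hat} (hβ : IsTLinear β) {h : V.Hat}
    (hh : V.hatToJac h = 0) : V.hatToJac (β h) = 0 := by
  have fg : (jacobiIdeal V.W).FG := Submodule.fg_span (Set.finite_range _)
  have h1 : h ∈ RingHom.ker (AdicCompletion.evalOneₐ (jacobiIdeal V.W)).toRingHom := hh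
  rw [AdicCompletion.ker_evalOneₐ_eq_map _ fg] at h1
  change h ∈ Ideal.map (algebraMap V.Poly V.Hat) (Ideal.span _) at h1
  rw [Ideal.map_span, ← Set.range_comp] at h1
  obtain ⟨a, rfl⟩ := (Submodule.mem_span_range_iff_exists_fun _).1 h1
  rw [map_sum, map_sum]
  refine Finset.sum_eq_zero fun i _ => ?_
  have : a i • ((algebraMap V.Poly V.Hat) ∘ fun i => pderiv i V.W) i = V.tHat i * a i := by
    rw [smul_eq_mul, mul_comm]; rfl
  rw [this, hβ, map_mul, hatToJac_tHat, zero_mul]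

/-- Multiplication operators. -/
noncomputable def mulHat (s : V.Hat) : V.Hat →ₗ[k] V.Hat := LinearMap.mulLeft k s

theorem mulHat_apply (s h : V.Hat) : mulHat s h = s * h := rfl

theorem isTLinear_mulHat (s : V.Hat) : IsTLinear (mulHat s) := fun i x => by
  rw [mulHat_apply, mulHat_apply, mul_left_comm]

namespace Connection

variable (D : Connection V)

/-- The commutator `[β, ∂_{t_q}]`. -/
noncomputable def bracket (q : Fin V.n) (β : V.Hat →ₗ[k] V.Hat) : V.Hat →ₗ[k] V.Hat :=
  β ∘ₗ D.nabla q - D.nabla q ∘ₗ β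

theorem bracket_apply (q : Fin V.n) (β : V.Hat →ₗ[k] V.Hat) (h : V.Hat) :
    D.bracket q β h = β (D.nabla q h) - D.nabla q (β h) := rfl

/-- The Leibniz rule for the polynomial X i: the canonical commutation relation between ∂_{t_q} and
t_i. -/
theorem nabla_tHat_mul (q i : Fin V.n) (h : V.Hat) :
    D.nabla q (V.tHat i * h) = (if i = q then h else 0) + V.tHat i * D.nabla q h := by
  have := D.leibniz q (X i) h
  rw [pderiv_X] at this
  simp only [Potential.evalT, aeval_X] at this
  change D.nabla q (V.tHat i * h) = _ + V.tHat i * D.nabla q h at this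
  rw [this]
  congr 1
  by_cases hi : i = q
  · subst hi; simp
  · simp [hi]

/-- The derivative of t_i contributes the same term δ β(h) to β ∂_q and to ∂_q β, so it drops out of
the commutator. -/
theorem isTLinear_bracket (q : Fin V.n) {β : V.Hat →ₗ[k] V.Hat} (hβ : IsTLinear β) :
    IsTLinear (D.bracket q β) := fun i h => by
  rw [bracket_apply, bracket_apply, nabla_tHat_mul, hβ, nabla_tHat_mul, map_add, hβ]
  split_ifs
  · ring
  · rw [map_zero]; ring

/-- The commutator with a fixed operator is a derivation; all Leibniz rules below come from this. -/
theorem bracket_comp (q : Fin V.n) (β β' : V.Hat →ₗ[k] V.Hat) :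
    D.bracket q (β ∘ₗ β') = D.bracket q β ∘ₗ β' + β ∘ₗ D.bracket q β' := by
  refine LinearMap.ext fun h => ?_
  simp only [bracket_apply, LinearMap.comp_apply, LinearMap.add_apply, map_sub]
  abel

theorem bracket_add (q : Fin V.n) (β β' : V.Hat →ₗ[k] V.Hat) :
    D.bracket q (β + β') = D.bracket q β + D.bracket q β' := by
  refine LinearMap.ext fun h => ?_
  simp only [bracket_apply, LinearMap.add_apply, map_add]
  abel

theorem bracket_smul (q : Fin V.n) (a : k) (β : V.Hat →ₗ[k] V.Hat) :
    D.bracket q (a • β) = a • D.bracket q β := by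
  refine LinearMap.ext fun h => ?_
  simp only [bracket_apply, LinearMap.smul_apply, map_smul, smul_sub]

theorem bracket_zero (q : Fin V.n) : D.bracket q 0 = 0 := by
  refine LinearMap.ext fun h => ?_
  simp only [bracket_apply, LinearMap.zero_apply, map_zero, sub_zero]

theorem bracket_tHat (q i : Fin V.n) : D.bracket q (mulHat (V.tHat i)) =
    if i = q then -LinearMap.id else 0 := by
  refine LinearMap.ext fun h => ?_
  rw [bracket_apply, mulHat_apply, mulHat_apply, nabla_tHat_mul]
  split_ifs
  · rw [LinearMap.neg_apply, LinearMap.id_apply]; abel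
  · rw [LinearMap.zero_apply, zero_add, sub_self]

end Connection

namespace CutChoice

variable (c : CutChoice V)

theorem hatToJac_lift (j : Fin c.m) : V.hatToJac (c.lift j) = c.basis j := by
  rw [lift, hatToJac_algebraMap]; exact Quotient.out_eq _

/-- The matrix entries of the operator on `J_V` induced by a `k[t]`-linear operator. -/
noncomputable def opEntry (i j : Fin c.m) : (V.Hat →ₗ[k] V.Hat) →ₗ[k] k where
  toFun β := c.basis.coord i (V.hatToJac (β (c.lift j)))
  map_add' β β' := by simp
  map_smul' a β := by
    have : V.hatToJac (a • β (c.lift j)) = a • V.hatToJac (β (c.lift j)) :=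
      map_smul (V.hatToJac.restrictScalars k) a _
    simp [this]

/-- The element β'(v_j) equals its expansion in the lifted basis only up to the kernel of the map to
J_V. Linearity of the outer operator β over t makes the error harmless; nothing is required of β'.
-/
theorem opEntry_comp {β β' : V.Hat →ₗ[k] V.Hat} (h : IsTLinear β)
    (i j : Fin c.m) : c.opEntry i j (β ∘ₗ β') = ∑ l, c.opEntry i l β * c.opEntry l j β' := by
  have h0 : V.hatToJac (β' (c.lift j) - ∑ l, c.opEntry l j β' • c.lift l) = 0 := by
    have e : ∀ l, V.hatToJac (c.opEntry l j β' • c.lift l) =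
        c.opEntry l j β' • c.basis l := fun l => by
      rw [← hatToJac_lift]; exact map_smul (V.hatToJac.restrictScalars k) _ _
    rw [map_sub, map_sum]
    simp only [e]
    rw [sub_eq_zero]
    exact (c.basis.sum_repr (V.hatToJac (β' (c.lift j)))).symm
  have h1 := h.hatToJac_eq_zero h0
  rw [map_sub, map_sub, sub_eq_zero] at h1
  change c.basis.coord i (V.hatToJac (β (β' (c.lift j)))) = _
  rw [h1, map_sum, map_sum, map_sum]
  refine Finset.sum_congr rfl fun l _ => ?_
  rw [map_smul]
  have : V.hatToJac (c.opEntry l j β' • β (c.lift l)) =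
      c.opEntry l j β' • V.hatToJac (β (c.lift l)) := map_smul (V.hatToJac.restrictScalars k) _ _
  rw [this, map_smul, smul_eq_mul, mul_comm]
  rfl

theorem opEntry_id (i j : Fin c.m) :
    c.opEntry i j LinearMap.id = if i = j then 1 else 0 := by
  change c.basis.coord i (V.hatToJac (c.lift j)) = _
  rw [hatToJac_lift, Module.Basis.coord_apply, Module.Basis.repr_self, Finsupp.single_apply]
  simp only [eq_comm]

theorem mulHat_zero : mulHat (0 : V.Hat) = 0 :=
  LinearMap.ext fun h => by rw [mulHat_apply, zero_mul, LinearMap.zero_apply]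

theorem mulHat_add (s s' : V.Hat) : mulHat (s + s') = mulHat s + mulHat s' :=
  LinearMap.ext fun h => by
    rw [mulHat_apply, add_mul, LinearMap.add_apply, mulHat_apply, mulHat_apply]

theorem mulHat_one : mulHat (1 : V.Hat) = LinearMap.id :=
  LinearMap.ext fun h => by rw [mulHat_apply, one_mul, LinearMap.id_apply]

/-- The matrix entries of multiplication by an element of the completion, as an operator on `J_V`. -/
noncomputable def hatEntry (i j : Fin c.m) : V.Hat →+ k where
  toFun s := c.opEntry i j (mulHat s)
  map_zero' := by rw [mulHat_zero, map_zero]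
  map_add' s s' := by rw [mulHat_add, map_add]

/-- The matrix entries of the iterated commutator `[[s, ∂_{t_q}], ∂_{t_r}]`. -/
noncomputable def commEntry₂ (q r : Fin V.n) (i j : Fin c.m) : V.Hat →+ k where
  toFun s := c.opEntry i j (c.conn.bracket r (c.conn.bracket q (mulHat s)))
  map_zero' := by
    rw [mulHat_zero, Connection.bracket_zero, Connection.bracket_zero, map_zero]
  map_add' s s' := by
    rw [mulHat_add, Connection.bracket_add, Connection.bracket_add, map_add]

theorem hatEntry_apply (i j : Fin c.m) (s : V.Hat) :
    c.hatEntry i j s = c.opEntry i j (mulHat s) := rfl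

theorem commEntry_apply (q : Fin V.n) (i j : Fin c.m) (s : V.Hat) :
    c.commEntry q i j s = c.opEntry i j (c.conn.bracket q (mulHat s)) := rfl

theorem commEntry₂_apply (q r : Fin V.n) (i j : Fin c.m) (s : V.Hat) :
    c.commEntry₂ q r i j s = c.opEntry i j (c.conn.bracket r (c.conn.bracket q (mulHat s))) := rfl

/-- Multiplication on J_V may be computed after lifting to the completion, where it can be compared
with the connection. -/
theorem mulEntry_hatToJac (i j : Fin c.m) (s : V.Hat) :
    c.mulEntry i j (V.hatToJac s) = c.hatEntry i j s := by
  change c.basis.coord i (V.hatToJac s * c.basis j) = c.basis.coord i (V.hatToJac (s * c.lift j))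
  rw [map_mul V.hatToJac, hatToJac_lift]

theorem mulHat_mul (s s' : V.Hat) : mulHat (s * s') = mulHat s ∘ₗ mulHat s' :=
  LinearMap.ext fun h => by
    rw [mulHat_apply, mul_assoc, LinearMap.comp_apply, mulHat_apply, mulHat_apply]

theorem mulHat_base_mul (a : k) (s : V.Hat) :
    mulHat (algebraMap V.Poly V.Hat (C a) * s) = a • mulHat s := by
  refine LinearMap.ext fun h => ?_
  rw [mulHat_apply, LinearMap.smul_apply, mulHat_apply, mul_assoc,
    ← Algebra.smul_def, ← MvPolynomial.algebraMap_eq, algebraMap_smul]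

theorem hatEntry_mul (i j : Fin c.m) (s s' : V.Hat) :
    c.hatEntry i j (s * s') = ∑ l, c.hatEntry i l s * c.hatEntry l j s' := by
  rw [hatEntry_apply, mulHat_mul, opEntry_comp _ (isTLinear_mulHat s)]; rfl

theorem commEntry_mul (q : Fin V.n) (i j : Fin c.m) (s s' : V.Hat) :
    c.commEntry q i j (s * s') = ∑ l, c.commEntry q i l s * c.hatEntry l j s' +
      ∑ l, c.hatEntry i l s * c.commEntry q l j s' := by
  simp only [commEntry_apply, hatEntry_apply]
  rw [mulHat_mul, Connection.bracket_comp, map_add, opEntry_comp _ (isTLinear_mulHat s),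
    opEntry_comp _ (c.conn.isTLinear_bracket q (isTLinear_mulHat s))]

/-- The derivation property applied twice. All four terms descend to J_V because every iterated
commutator is again linear over t. -/
theorem commEntry₂_mul (q r : Fin V.n) (i j : Fin c.m) (s s' : V.Hat) :
    c.commEntry₂ q r i j (s * s') =
      (∑ l, c.commEntry₂ q r i l s * c.hatEntry l j s' +
      ∑ l, c.commEntry q i l s * c.commEntry r l j s') +
      (∑ l, c.commEntry r i l s * c.commEntry q l j s' +
      ∑ l, c.hatEntry i l s * c.commEntry₂ q r l j s') := by
  simp only [commEntry_apply, hatEntry_apply, commEntry₂_apply]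
  have h := isTLinear_mulHat s
  rw [mulHat_mul, Connection.bracket_comp, Connection.bracket_add, Connection.bracket_comp,
    Connection.bracket_comp, map_add, map_add, map_add, opEntry_comp _ h,
    opEntry_comp _ (c.conn.isTLinear_bracket q h), opEntry_comp _ (c.conn.isTLinear_bracket r h),
    opEntry_comp _ (c.conn.isTLinear_bracket r (c.conn.isTLinear_bracket q h))]

theorem hatEntry_base_mul (i j : Fin c.m) (a : k) (s : V.Hat) :
    c.hatEntry i j (((algebraMap V.Poly V.Hat).comp C) a * s) = a * c.hatEntry i j s := by
  rw [RingHom.comp_apply, hatEntry_apply, mulHat_base_mul, map_smul]; rfl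

theorem commEntry_base_mul (q : Fin V.n) (i j : Fin c.m) (a : k) (s : V.Hat) :
    c.commEntry q i j (((algebraMap V.Poly V.Hat).comp C) a * s) = a * c.commEntry q i j s := by
  rw [RingHom.comp_apply, commEntry_apply, mulHat_base_mul, Connection.bracket_smul, map_smul,
    commEntry_apply]; rfl

theorem commEntry₂_base_mul (q r : Fin V.n) (i j : Fin c.m) (a : k) (s : V.Hat) :
    c.commEntry₂ q r i j (((algebraMap V.Poly V.Hat).comp C) a * s) =
      a * c.commEntry₂ q r i j s := by
  rw [RingHom.comp_apply, commEntry₂_apply, mulHat_base_mul, Connection.bracket_smul,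
    Connection.bracket_smul, map_smul]; rfl

theorem hatEntry_one (i j : Fin c.m) : c.hatEntry i j 1 = if i = j then 1 else 0 := by
  rw [hatEntry_apply, mulHat_one, opEntry_id]

theorem bracket_one (q : Fin V.n) : c.conn.bracket q (mulHat 1) = 0 := by
  refine LinearMap.ext fun h => ?_
  rw [mulHat_one, Connection.bracket_apply, LinearMap.id_apply, LinearMap.id_apply, sub_self,
    LinearMap.zero_apply]

theorem commEntry_one (q : Fin V.n) (i j : Fin c.m) : c.commEntry q i j 1 = 0 := by
  rw [commEntry_apply, bracket_one, map_zero]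

theorem commEntry₂_one (q r : Fin V.n) (i j : Fin c.m) : c.commEntry₂ q r i j 1 = 0 := by
  rw [commEntry₂_apply, bracket_one, Connection.bracket_zero, map_zero]

theorem hatEntry_tHat (i j : Fin c.m) (l : Fin V.n) : c.hatEntry i j (V.tHat l) = 0 := by
  rw [← mulEntry_hatToJac, hatToJac_tHat, map_zero]

/-- On J_V the element t_l itself acts as zero, but its commutator with ∂_{t_q} survives as the
scalar -δ. The constant of the Clifford relations originates here. -/
theorem commEntry_tHat (q : Fin V.n) (i j : Fin c.m) (l : Fin V.n) :
    c.commEntry q i j (V.tHat l) = if i = j then (if l = q then -1 else 0) else 0 := by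
  rw [commEntry_apply, Connection.bracket_tHat]
  split_ifs with h1 h2 h2
  · rw [map_neg, opEntry_id, if_pos h2]
  · rw [map_neg, opEntry_id, if_neg h2, neg_zero]
  · rw [map_zero]
  · rw [map_zero]

end CutChoice

end HatOperators

/-! ## The matrix factorisation `Y | X` -/

section CutGraded

variable {k : Type u} [CommRing k] {W V U : Potential k} (c : CutChoice V)

/-- The `k[y]`-algebra structure of the completion. -/
noncomputable abbrev hatMap (V : Potential k) : V.Poly →+* V.Hat := algebraMap V.Poly V.Hat

/-- The graded module with differential underlying `Y | X`. -/
noncomputable abbrev cutGr (Y : GradedOp (PolyRing V U)) (X : GradedOp (PolyRing W V)) :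
    GradedOp (PolyRing W U) where
  ι := Y.ι × Fin c.m × X.ι
  par a := Y.par a.1 + X.par a.2.2
  d := c.cutOp 0 Y.d (1 : Op X X) + c.cutOp 1 (1 : Op Y Y) X.d

variable {Y Y' Y'' : GradedOp (PolyRing V U)} {X X' X'' : GradedOp (PolyRing W V)}

/-- Inflation of operators between tensor products over the completion. -/
noncomputable abbrev infl (φ : Fin c.m → Fin c.m → V.Hat →+ k)
    (A : Op (tensorGr (hatMap V) Y X) (tensorGr (hatMap V) Y' X')) :
    Op (cutGr c Y X) (cutGr c Y' X') :=
  inflate (S := V.Hat) (σ := Fin W.n ⊕ Fin U.n) (α := Y.ι) (β := X.ι) (α' := Y'.ι) (β' := X'.ι) φ A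

/-- With coefficients in the completion instead of J_V, the same matrix can be inflated by
multiplications as well as by commutators. -/
theorem cutOp_eq_infl (p : ZMod 2) (g : Op Y Y') (f : Op X X') :
    c.cutOp p g f = infl c c.hatEntry (tensorOp (hatMap V) p g f) := by
  have : Ideal.Quotient.mk (jacobiIdeal V.W) =
    (V.hatToJac : V.Hat →+* V.Jac).comp (hatMap V) := rfl
  ext1 a b
  rw [CutChoice.cutOp, inflate_apply, this, tensorOp_comp, infl, inflate_apply, Matrix.map_apply]
  refine MvPolynomial.ext _ _ fun s => ?_
  rw [coeff_coeffMap, coeff_map, coeff_coeffMap]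
  exact c.mulEntry_hatToJac _ _ _

theorem cutGr_d : (cutGr c Y X).d = infl c c.hatEntry (tensorD (hatMap V) Y X) := by
  rw [tensorD, infl, inflate_add]
  exact congrArg₂ (· + ·) (cutOp_eq_infl c 0 Y.d (1 : Op X X))
    (cutOp_eq_infl c 1 (1 : Op Y Y) X.d)

theorem infl_hat_mul (A : Op (tensorGr (hatMap V) Y' X') (tensorGr (hatMap V) Y'' X''))
    (B : Op (tensorGr (hatMap V) Y X) (tensorGr (hatMap V) Y' X')) :
    infl c c.hatEntry (A * B : Op (tensorGr (hatMap V) Y X) (tensorGr (hatMap V) Y'' X'')) =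
      infl c c.hatEntry A * infl c c.hatEntry B := by
  have := inflate_mul (T := Unit) c.hatEntry (fun _ => c.hatEntry) (fun _ => c.hatEntry)
    (by simpa using c.hatEntry_mul) A B
  simpa using this

/-- The first-order rule: in a product, ∂_{t_q} is commuted with one of the two factors at a time.
-/
theorem infl_comm_mul (q : Fin V.n)
    (A : Op (tensorGr (hatMap V) Y' X') (tensorGr (hatMap V) Y'' X''))
    (B : Op (tensorGr (hatMap V) Y X) (tensorGr (hatMap V) Y' X')) :
    infl c (c.commEntry q) (A * B : Op (tensorGr (hatMap V) Y X) (tensorGr (hatMap V) Y'' X'')) =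
      infl c (c.commEntry q) A * infl c c.hatEntry B +
        infl c c.hatEntry A * infl c (c.commEntry q) B := by
  have := inflate_mul (T := Fin 2) (c.commEntry q) ![c.commEntry q, c.hatEntry]
    ![c.hatEntry, c.commEntry q]
    (fun i j s s' => by rw [Fin.sum_univ_two]; exact c.commEntry_mul q i j s s') A B
  rwa [Fin.sum_univ_two] at this

/-- The second-order rule, whose middle terms contain the products of two first commutators. For D
times D these are the products of two Atiyah classes. -/
theorem infl_comm₂_mul (q r : Fin V.n)
    (A : Op (tensorGr (hatMap V) Y' X') (tensorGr (hatMap V) Y'' X''))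
    (B : Op (tensorGr (hatMap V) Y X) (tensorGr (hatMap V) Y' X')) :
    infl c (c.commEntry₂ q r)
      (A * B : Op (tensorGr (hatMap V) Y X) (tensorGr (hatMap V) Y'' X'')) =
      (infl c (c.commEntry₂ q r) A * infl c c.hatEntry B +
        infl c (c.commEntry q) A * infl c (c.commEntry r) B) +
      (infl c (c.commEntry r) A * infl c (c.commEntry q) B +
        infl c c.hatEntry A * infl c (c.commEntry₂ q r) B) := by
  have := inflate_mul (T := Fin 4) (c.commEntry₂ q r)
    ![c.commEntry₂ q r, c.commEntry q, c.commEntry r, c.hatEntry]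
    ![c.hatEntry, c.commEntry r, c.commEntry q, c.commEntry₂ q r]
    (fun i j s s' => by
      rw [Fin.sum_univ_four]
      exact (c.commEntry₂_mul q r i j s s').trans (add_assoc _ _ _).symm) A B
  rw [Fin.sum_univ_four] at this
  exact this.trans (add_assoc _ _ _)

theorem infl_one (φ : Fin c.m → Fin c.m → V.Hat →+ k) (s : V.Hat) :
    infl c φ ((C s : MvPolynomial (Fin W.n ⊕ Fin U.n) V.Hat) •
      (1 : Op (tensorGr (hatMap V) Y X) (tensorGr (hatMap V) Y X))) =
    fun a b => if a.1 = b.1 ∧ a.2.2 = b.2.2 then C (φ a.2.1 b.2.1 s) else 0 := by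
  ext1 a b
  rw [infl, inflate_apply, Matrix.smul_apply, Matrix.one_apply]
  simp only [Prod.mk.injEq, smul_eq_mul, mul_ite, mul_one, mul_zero]
  split_ifs
  · exact coeffMap_monomial _ _ _
  · exact map_zero _

theorem infl_hat_one :
    infl c c.hatEntry (1 : Op (tensorGr (hatMap V) Y X) (tensorGr (hatMap V) Y X)) = 1 := by
  have := infl_one (Y := Y) (X := X) c c.hatEntry 1
  rw [map_one, one_smul] at this
  rw [this]
  ext1 ⟨a, i, a'⟩ ⟨b, j, b'⟩
  simp only [Matrix.one_apply, Prod.mk.injEq, CutChoice.hatEntry_one]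
  by_cases h1 : a = b <;> by_cases h2 : i = j <;> by_cases h3 : a' = b' <;> simp [h1, h2, h3]

theorem infl_comm_one (q : Fin V.n) :
    infl c (c.commEntry q) (1 : Op (tensorGr (hatMap V) Y X) (tensorGr (hatMap V) Y X)) = 0 := by
  have := infl_one (Y := Y) (X := X) c (c.commEntry q) 1
  rw [map_one, one_smul] at this
  rw [this]
  ext1 a b
  simp [CutChoice.commEntry_one]

theorem infl_comm₂_one (q r : Fin V.n) :
    infl c (c.commEntry₂ q r) (1 : Op (tensorGr (hatMap V) Y X) (tensorGr (hatMap V) Y X)) = 0 := by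
  have := infl_one (Y := Y) (X := X) c (c.commEntry₂ q r) 1
  rw [map_one, one_smul] at this
  rw [this]
  ext1 a b
  simp [CutChoice.commEntry₂_one]

theorem infl_hat_tHat (l : Fin V.n) :
    infl c c.hatEntry ((C (V.tHat l) : MvPolynomial (Fin W.n ⊕ Fin U.n) V.Hat) •
      (1 : Op (tensorGr (hatMap V) Y X) (tensorGr (hatMap V) Y X))) = 0 := by
  rw [infl_one]
  ext1 a b
  simp [CutChoice.hatEntry_tHat]

theorem infl_comm_tHat (q l : Fin V.n) :
    infl c (c.commEntry q) ((C (V.tHat l) : MvPolynomial (Fin W.n ⊕ Fin U.n) V.Hat) •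
      (1 : Op (tensorGr (hatMap V) Y X) (tensorGr (hatMap V) Y X))) = if l = q then -1 else 0 := by
  rw [infl_one]
  ext1 ⟨a, i, a'⟩ ⟨b, j, b'⟩
  simp only [CutChoice.commEntry_tHat]
  by_cases h0 : l = q
  · rw [if_pos h0, if_pos h0, Matrix.neg_apply, Matrix.one_apply]
    by_cases h1 : a = b <;> by_cases h2 : i = j <;> by_cases h3 : a' = b' <;> simp [h1, h2, h3]
  · rw [if_neg h0, if_neg h0]
    simp

theorem HasDeg.infl (φ : Fin c.m → Fin c.m → V.Hat →+ k) {p : ZMod 2}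
    {A : Op (tensorGr (hatMap V) Y X) (tensorGr (hatMap V) Y' X')}
    (hA : HasDeg (M := tensorGr (hatMap V) Y X) (N := tensorGr (hatMap V) Y' X') p A) :
    HasDeg (M := cutGr c Y X) (N := cutGr c Y' X') p (infl c φ A) := by
  intro a b h
  have : A (a.1, a.2.2) (b.1, b.2.2) = 0 := hA _ _ h
  change coeffMap _ _ (A (a.1, a.2.2) (b.1, b.2.2)) = 0
  rw [this, map_zero]

theorem IsClosedOp.infl {p : ZMod 2}
    {A : Op (tensorGr (hatMap V) Y X) (tensorGr (hatMap V) Y' X')}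
    (hA : IsClosedOp (M := tensorGr (hatMap V) Y X) (N := tensorGr (hatMap V) Y' X') p A) :
    IsClosedOp (M := cutGr c Y X) (N := cutGr c Y' X') p (infl c c.hatEntry A) := by
  refine ⟨hA.1.infl c _, ?_⟩
  rw [cutGr_d, cutGr_d, ← infl_hat_mul, ← infl_hat_mul]
  have := congrArg (CutSystem.infl c c.hatEntry) hA.2
  rwa [CutSystem.infl, CutSystem.infl, inflate_sgn_smul] at this

theorem IsNull.infl {p : ZMod 2}
    {A : Op (tensorGr (hatMap V) Y X) (tensorGr (hatMap V) Y' X')}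
    (hA : IsNull (M := tensorGr (hatMap V) Y X) (N := tensorGr (hatMap V) Y' X') p A) :
    IsNull (M := cutGr c Y X) (N := cutGr c Y' X') p (infl c c.hatEntry A) := by
  obtain ⟨h, hh, rfl⟩ := hA
  refine ⟨CutSystem.infl c c.hatEntry h, hh.infl c _, ?_⟩
  rw [cutGr_d, cutGr_d, ← infl_hat_mul, ← infl_hat_mul, CutSystem.infl, inflate_add,
    inflate_sgn_smul]

end CutGraded

/-! ### Homotopies for At_q and for 1 ⊗ ∂_{y_i}(d_X) -/

section CutHomotopies

variable {k : Type u} [CommRing k] {W V U : Potential k} (c : CutChoice V)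

variable {Y Y' Y'' : GradedOp (PolyRing V U)} {X X' X'' : GradedOp (PolyRing W V)}

theorem atiyah_eq_infl (q : Fin V.n) :
    c.atiyah Y X q = infl c (c.commEntry q) (tensorD (hatMap V) Y X) := rfl

theorem infl_add (φ : Fin c.m → Fin c.m → V.Hat →+ k)
    (A B : Op (tensorGr (hatMap V) Y X) (tensorGr (hatMap V) Y' X')) :
    infl c φ (A + B) = infl c φ A + infl c φ B := inflate_add φ A B

theorem infl_sgn_smul (φ : Fin c.m → Fin c.m → V.Hat →+ k) (p : ZMod 2)
    (A : Op (tensorGr (hatMap V) Y X) (tensorGr (hatMap V) Y' X')) :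
    infl c φ (sgn (MvPolynomial (Fin W.n ⊕ Fin U.n) V.Hat) p • A) =
      sgn (PolyRing W U) p • infl c φ A := inflate_sgn_smul φ p A

theorem infl_base_smul (φ : Fin c.m → Fin c.m → V.Hat →+ k)
    (H : ∀ i j a s, φ i j (((hatMap V).comp C) a * s) = a * φ i j s) (P : PolyRing W U)
    (A : Op (tensorGr (hatMap V) Y X) (tensorGr (hatMap V) Y' X')) :
    infl c φ (baseScalars W V U (hatMap V) P • A) = P • infl c φ A :=
  inflate_base_smul _ φ H P A

theorem IsClosedOp.cut {p q : ZMod 2} {g : Op Y Y'} {f : Op X X'}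
    (hY : HasDeg (M := Y) (N := Y) 1 Y.d) (hg : IsClosedOp q g) (hf : IsClosedOp p f) :
    IsClosedOp (M := cutGr c Y X) (N := cutGr c Y' X') (q + p) (c.cutOp p g f) := by
  rw [cutOp_eq_infl]; exact (hg.tensor hY hf).infl c

theorem HasDeg.cut {p q : ZMod 2} {g : Op Y Y'} {f : Op X X'} (hg : HasDeg q g)
    (hf : HasDeg p f) :
    HasDeg (M := cutGr c Y X) (N := cutGr c Y' X') (q + p) (c.cutOp p g f) := by
  rw [cutOp_eq_infl]; exact (hg.tensor hf).infl c _

theorem IsNull.cut_left {p q : ZMod 2} {g : Op Y Y'} {f : Op X X'}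
    (hY : HasDeg (M := Y) (N := Y) 1 Y.d) (hg : IsNull q g) (hf : IsClosedOp p f) :
    IsNull (M := cutGr c Y X) (N := cutGr c Y' X') (q + p) (c.cutOp p g f) := by
  rw [cutOp_eq_infl]; exact (hg.tensor_left hY hf).infl c

theorem IsNull.cut_right {p q : ZMod 2} {g : Op Y Y'} {f : Op X X'}
    (hY : HasDeg (M := Y) (N := Y) 1 Y.d) (hg : IsClosedOp q g) (hf : IsNull p f) :
    IsNull (M := cutGr c Y X) (N := cutGr c Y' X') (q + p) (c.cutOp p g f) := by
  rw [cutOp_eq_infl]; exact (hf.tensor_right hY hg).infl c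

theorem cutOp_mul {p p' q' : ZMod 2} {g : Op Y' Y''} {f : Op X' X''} {g' : Op Y Y'} {f' : Op X X'}
    (hg : HasDeg q' g') :
    c.cutOp p g f * c.cutOp p' g' f' = sgn (PolyRing W U) (p * q') •
      c.cutOp (p + p') (g * g' : Op Y Y'') (f * f' : Op X X'') := by
  rw [cutOp_eq_infl, cutOp_eq_infl, cutOp_eq_infl, ← infl_sgn_smul, ← tensorOp_mul _ hg]
  exact (infl_hat_mul c _ _).symm

theorem cutOp_one : c.cutOp 0 (1 : Op Y Y) (1 : Op X X) = 1 := by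
  rw [cutOp_eq_infl, tensorOp_one_one]; exact infl_hat_one c

theorem cutOp_add_left (p : ZMod 2) (g g' : Op Y Y') (f : Op X X') :
    c.cutOp p (g + g') f = c.cutOp p g f + c.cutOp p g' f := by
  rw [cutOp_eq_infl, cutOp_eq_infl, cutOp_eq_infl, tensorOp_add_left]; exact infl_add c _ _ _

theorem cutOp_add_right (p : ZMod 2) (g : Op Y Y') (f f' : Op X X') :
    c.cutOp p g (f + f') = c.cutOp p g f + c.cutOp p g f' := by
  rw [cutOp_eq_infl, cutOp_eq_infl, cutOp_eq_infl, tensorOp_add_right]; exact infl_add c _ _ _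

theorem hasDeg_cutGr_d (hY : HasDeg (M := Y) (N := Y) 1 Y.d)
    (hX : HasDeg (M := X) (N := X) 1 X.d) :
    HasDeg (M := cutGr c Y X) (N := cutGr c Y X) 1 (cutGr c Y X).d := by
  rw [cutGr_d]; exact (hasDeg_tensorD hY hX).infl c _

theorem cutGr_d_sq (hY : HasDeg (M := Y) (N := Y) 1 Y.d)
    (hY2 : Y.d * Y.d = potDiff V U • (1 : Matrix Y.ι Y.ι (PolyRing V U)))
    (hX2 : X.d * X.d = potDiff W V • (1 : Matrix X.ι X.ι (PolyRing W V))) :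
    (cutGr c Y X).d * (cutGr c Y X).d = potDiff W U •
      (1 : Matrix (Y.ι × Fin c.m × X.ι) (Y.ι × Fin c.m × X.ι) (PolyRing W U)) := by
  rw [cutGr_d, ← infl_hat_mul, tensorD_mul_tensorD hY hY2 hX2, infl_base_smul, infl_hat_one]
  exact c.hatEntry_base_mul

/-- The square D² is a scalar from k[x, z], whose commutator with ∂_{t_q} is zero. Expanding [D²,
∂_{t_q}] leaves the anticommutator of D with At_q. -/
theorem isClosedOp_atiyah (q : Fin V.n) (hY : HasDeg (M := Y) (N := Y) 1 Y.d)
    (hX : HasDeg (M := X) (N := X) 1 X.d)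
    (hY2 : Y.d * Y.d = potDiff V U • (1 : Matrix Y.ι Y.ι (PolyRing V U)))
    (hX2 : X.d * X.d = potDiff W V • (1 : Matrix X.ι X.ι (PolyRing W V))) :
    IsClosedOp (M := cutGr c Y X) (N := cutGr c Y X) 1 (c.atiyah Y X q) := by
  refine ⟨(hasDeg_tensorD hY hX).infl c _, ?_⟩
  have h := infl_comm_mul c q (tensorD (hatMap V) Y X) (tensorD (hatMap V) Y X)
  rw [tensorD_mul_tensorD hY hY2 hX2, infl_base_smul _ _ (c.commEntry_base_mul q), infl_comm_one,
    smul_zero] at h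
  rw [cutGr_d, atiyah_eq_infl, sgn_one, neg_one_smul, ← add_eq_zero_iff_eq_neg, add_comm]
  exact h.symm

/-- The iterated commutator of D² vanishes as well. Its expansion consists of the anticommutator of
the two Atiyah classes and that of D with [[D, ∂_q], ∂_r], so the negative of the latter operator is
the homotopy. -/
theorem atiyah_atiyah (q r : Fin V.n) (hY : HasDeg (M := Y) (N := Y) 1 Y.d)
    (hX : HasDeg (M := X) (N := X) 1 X.d)
    (hY2 : Y.d * Y.d = potDiff V U • (1 : Matrix Y.ι Y.ι (PolyRing V U)))
    (hX2 : X.d * X.d = potDiff W V • (1 : Matrix X.ι X.ι (PolyRing W V))) :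
    IsNull (M := cutGr c Y X) (N := cutGr c Y X) 0
      (c.atiyah Y X q * c.atiyah Y X r + c.atiyah Y X r * c.atiyah Y X q) := by
  have h := infl_comm₂_mul c q r (tensorD (hatMap V) Y X) (tensorD (hatMap V) Y X)
  rw [tensorD_mul_tensorD hY hY2 hX2, infl_base_smul _ _ (c.commEntry₂_base_mul q r),
    infl_comm₂_one, smul_zero] at h
  refine ⟨-infl c (c.commEntry₂ q r) (tensorD (hatMap V) Y X), ?_, ?_⟩
  · have := ((hasDeg_tensorD hY hX).infl c (c.commEntry₂ q r)).smul (-1)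
    rwa [neg_one_smul] at this
  · rw [cutGr_d, atiyah_eq_infl, atiyah_eq_infl, sgn_zero, one_smul, Matrix.mul_neg, Matrix.neg_mul,
      ← sub_eq_zero]
    refine Eq.trans ?_ h.symm
    abel

/-- The Atiyah classes commute up to homotopy with the operators that come from closed operators
over the completion. -/
theorem atiyah_comm (q : Fin V.n) {p : ZMod 2}
    {F : Op (tensorGr (hatMap V) Y X) (tensorGr (hatMap V) Y' X')}
    (hF : IsClosedOp (M := tensorGr (hatMap V) Y X) (N := tensorGr (hatMap V) Y' X') p F) :
    IsNull (M := cutGr c Y X) (N := cutGr c Y' X') (p + 1)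
      (c.atiyah Y' X' q * infl c c.hatEntry F -
        sgn (PolyRing W U) p • (infl c c.hatEntry F * c.atiyah Y X q)) := by
  have h := congrArg (infl c (c.commEntry q)) hF.2
  rw [infl_sgn_smul, infl_comm_mul, infl_comm_mul] at h
  -- The relation obtained by commuting the closedness of F with ∂_{t_q} has two kinds of terms:
  -- those with At_q, and those in which D meets [F, ∂_{t_q}]. The latter exhibit -[F, ∂_{t_q}] as
  -- the homotopy.
  refine ⟨-infl c (c.commEntry q) F, ?_, ?_⟩
  · rw [zmod_two_add_one_add_one]
    have := (hF.1.infl c (c.commEntry q)).smul (-1)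
    rwa [neg_one_smul] at this
  · rw [cutGr_d, cutGr_d, atiyah_eq_infl, atiyah_eq_infl, sgn_add, sgn_one, mul_neg, mul_one,
      Matrix.mul_neg, Matrix.neg_mul, neg_smul, smul_neg, neg_neg]
    rw [smul_add] at h
    rw [sub_eq_iff_eq_add, add_assoc, ← sub_eq_iff_eq_add', sub_neg_eq_add]
    rw [h, add_comm]

/-- The operator `1 ⊗ ∂_{y_i}(d_X)`. -/
noncomputable def lam (Y : GradedOp (PolyRing V U)) (X : GradedOp (PolyRing W V)) (i : Fin V.n) :
    Op (cutGr c Y X) (cutGr c Y X) :=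
  c.cutOp 1 (1 : Op Y Y) (X.d.map (pderiv (Sum.inr i)) : Op X X)

/-- The entrywise derivative of an operator. -/
noncomputable def dOp (i : Fin V.n) (f : Op X X') : Op X X' := f.map (pderiv (Sum.inr i))

theorem dOp_mul (i : Fin V.n) (g : Op X' X'') (f : Op X X') :
    dOp i (g * f : Op X X'') = dOp i g * f + g * dOp i f := by
  ext1 a b
  simp only [dOp, Matrix.map_apply, Matrix.mul_apply, Matrix.add_apply, map_sum,
    Derivation.leibniz, smul_eq_mul, ← Finset.sum_add_distrib]
  exact Finset.sum_congr rfl fun _ _ => by ring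

theorem dOp_sgn_smul (i : Fin V.n) (p : ZMod 2) (f : Op X X') :
    dOp i (sgn (PolyRing W V) p • f) = sgn (PolyRing W V) p • dOp i f := by
  ext1 a b
  simp only [dOp, Matrix.map_apply, Matrix.smul_apply, smul_eq_mul]
  unfold sgn; split_ifs <;> simp

theorem dOp_add (i : Fin V.n) (f f' : Op X X') : dOp i (f + f') = dOp i f + dOp i f' := by
  ext1 a b; simp [dOp]

theorem HasDeg.dOp {p : ZMod 2} {f : Op X X'} (i : Fin V.n) (h : HasDeg p f) :
    HasDeg p (dOp i f) := fun a b hab => by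
  change pderiv _ (f a b) = 0
  rw [h a b hab, map_zero]

theorem pderiv_inr_potDiff (i : Fin V.n) :
    pderiv (Sum.inr i) (potDiff W V) = rename Sum.inr (pderiv i V.W) := by
  rw [potDiff, map_sub, pderiv_rename Sum.inr_injective]
  have : pderiv (Sum.inr i) (rename (Sum.inl : Fin W.n → Fin W.n ⊕ Fin V.n) W.W) = 0 := by
    refine pderiv_eq_zero_of_notMem_vars fun h => ?_
    classical
    have := vars_rename _ _ h
    simp at this
  rw [this, sub_zero]

theorem dOp_smul_one (i : Fin V.n) (P : PolyRing W V) :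
    dOp i (P • (1 : Op X X)) = pderiv (Sum.inr i) P • (1 : Op X X) := by
  ext1 a b
  simp only [dOp, Matrix.map_apply, Matrix.smul_apply, Matrix.one_apply, smul_eq_mul]
  split_ifs <;> simp

/-- The derivative of d_X² = V(y) - W(x) with respect to y_i, to which W does not contribute. -/
theorem dOp_d_sq (i : Fin V.n)
    (hX2 : X.d * X.d = potDiff W V • (1 : Matrix X.ι X.ι (PolyRing W V))) :
    dOp i (X := X) (X' := X) X.d * X.d + X.d * dOp i (X := X) (X' := X) X.d =
      (rename Sum.inr (pderiv i V.W) : PolyRing W V) • (1 : Op X X) := by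
  have h := congrArg (dOp (X := X) (X' := X) i) hX2
  rwa [dOp_mul (X := X) (X' := X) (X'' := X), dOp_smul_one, pderiv_inr_potDiff] at h

theorem dOp_dOp_d_sq (i j : Fin V.n)
    (hX2 : X.d * X.d = potDiff W V • (1 : Matrix X.ι X.ι (PolyRing W V))) :
    dOp i (X := X) (X' := X) X.d * dOp j (X := X) (X' := X) X.d +
        dOp j (X := X) (X' := X) X.d * dOp i (X := X) (X' := X) X.d =
      (rename Sum.inr (pderiv i (pderiv j V.W)) : PolyRing W V) • (1 : Op X X) -
        (dOp i (dOp j (X := X) (X' := X) X.d) * X.d +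
          X.d * dOp i (dOp j (X := X) (X' := X) X.d)) := by
  have h := congrArg (dOp (X := X) (X' := X) i) (dOp_d_sq j hX2)
  rw [dOp_add, dOp_mul (X := X) (X' := X) (X'' := X), dOp_mul (X := X) (X' := X) (X'' := X),
    dOp_smul_one, pderiv_rename Sum.inr_injective] at h
  rw [← h]; abel

/-- The operator 1 ⊗ κ is odd and anticommutes with d_Y ⊗ 1, so only d_X contributes, and the
right-hand side acts through the coefficients. -/
theorem tensor_lam_comm {X : GradedOp (PolyRing W V)} (κ : Op X X)
    {P : V.Poly} {S : Type u} [CommRing S] (s : V.Poly →+* S)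
    (hY : HasDeg (M := Y) (N := Y) 1 Y.d)
    (h : κ * X.d + X.d * κ = (rename Sum.inr P : PolyRing W V) • (1 : Op X X)) :
    tensorOp s 1 (1 : Op Y Y) κ * tensorD s Y X + tensorD s Y X * tensorOp s 1 (1 : Op Y Y) κ =
      (C (s P) : MvPolynomial (Fin W.n ⊕ Fin U.n) S) •
        (1 : Op (tensorGr s Y X) (tensorGr s Y X)) := by
  rw [tensorD_mul (HasDeg.one (M := Y)), mul_tensorD hY, Matrix.mul_one, Matrix.one_mul, sgn_one,
    sgn_zero, one_smul, neg_one_smul, ← rightScalars_inr (W := W) (V := V) (U := U)]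
  have h2 := congrArg (tensorOp s 0 (1 : Op Y Y)) h
  rw [tensorOp_add_right, tensorOp_smul_right, tensorOp_one_one] at h2
  rw [← h2, show (1 : ZMod 2) + 1 = 0 by decide]; abel

/-- Over the completion the anticommutator with D is t_i. It becomes zero only on J_V. -/
theorem isClosedOp_lam (i : Fin V.n) (hY : HasDeg (M := Y) (N := Y) 1 Y.d)
    (hX : HasDeg (M := X) (N := X) 1 X.d)
    (hX2 : X.d * X.d = potDiff W V • (1 : Matrix X.ι X.ι (PolyRing W V))) :
    IsClosedOp (M := cutGr c Y X) (N := cutGr c Y X) 1 (lam c Y X i) := by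
  refine ⟨HasDeg.cut c (HasDeg.one (M := Y)) (hX.dOp i), ?_⟩
  have h := tensor_lam_comm (Y := Y) (dOp i (X := X) (X' := X) X.d) (hatMap V) hY
    (dOp_d_sq i hX2)
  have h2 := congrArg (infl c c.hatEntry) h
  rw [infl_add, infl_hat_mul, infl_hat_mul] at h2
  rw [lam, cutOp_eq_infl, cutGr_d, sgn_one, neg_one_smul, ← add_eq_zero_iff_eq_neg, add_comm]
  exact h2.trans (infl_hat_tHat c i)

/-- The commutator of the identity {D, λ_i} = t_i with ∂_{t_q}, taken over the completion before
passing to J_V. The right-hand side becomes -δ, and the terms in which D meets [λ_i, ∂_{t_q}] form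
the homotopy. -/
theorem atiyah_lam (q i : Fin V.n) (hY : HasDeg (M := Y) (N := Y) 1 Y.d)
    (hX : HasDeg (M := X) (N := X) 1 X.d)
    (hX2 : X.d * X.d = potDiff W V • (1 : Matrix X.ι X.ι (PolyRing W V))) :
    Htpy (M := cutGr c Y X) (N := cutGr c Y X) 0
      (c.atiyah Y X q * lam c Y X i + lam c Y X i * c.atiyah Y X q)
      (if q = i then -1 else 0) := by
  set L := tensorOp (hatMap V) 1 (1 : Op Y Y) (dOp i (X := X) (X' := X) X.d) with hL
  have h := tensor_lam_comm (Y := Y) (dOp i (X := X) (X' := X) X.d) (hatMap V) hY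
    (dOp_d_sq i hX2)
  have h2 := congrArg (infl c (c.commEntry q)) h
  rw [infl_add, infl_comm_mul, infl_comm_mul] at h2
  have h3 := h2.trans (infl_comm_tHat c q i)
  have hdeg : HasDeg (M := tensorGr (hatMap V) Y X) (N := tensorGr (hatMap V) Y X) 1 L :=
    HasDeg.tensor (HasDeg.one (M := Y)) (hX.dOp i)
  refine ⟨-infl c (c.commEntry q) L, ?_, ?_⟩
  · have := (hdeg.infl c (c.commEntry q)).smul (-1)
    rwa [neg_one_smul] at this
  · have e : lam c Y X i = infl c c.hatEntry L := by rw [lam, cutOp_eq_infl]; rfl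
    have e2 : (if q = i then (-1 : Op (cutGr c Y X) (cutGr c Y X)) else 0) =
      if i = q then -1 else 0 := by simp only [eq_comm]
    rw [e, e2, ← h3, atiyah_eq_infl, cutGr_d, sgn_zero, one_smul, Matrix.mul_neg, Matrix.neg_mul]
    abel

/-- The tensor product is taken over k[y], so a polynomial in y may be moved from X to Y. -/
theorem cutOp_scalar (f : V.Poly) :
    c.cutOp 0 (1 : Op Y Y) ((rename Sum.inr f : PolyRing W V) • (1 : Op X X)) =
      c.scalar Y X f := by
  rw [CutChoice.scalar, cutOp_eq_infl, cutOp_eq_infl, tensor_scalar, tensorOp_smul_right,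
    rightScalars_inr, tensorOp_one_one]

theorem cutD_mul {p q : ZMod 2} {g : Op Y Y'} {f : Op X X'} (hg : HasDeg q g) :
    (cutGr c Y' X').d * c.cutOp p g f = c.cutOp p (Y'.d * g : Op Y Y') f +
      sgn (PolyRing W U) q • c.cutOp (1 + p) g (X'.d * f : Op X X') := by
  rw [show (cutGr c Y' X').d = c.cutOp 0 Y'.d (1 : Op X' X') + c.cutOp 1 (1 : Op Y' Y') X'.d
    from rfl, Matrix.add_mul, cutOp_mul c hg, cutOp_mul c hg, zero_mul, one_mul, zero_add, sgn_zero,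
    one_smul, Matrix.one_mul, Matrix.one_mul]

theorem mul_cutD {p : ZMod 2} {g : Op Y Y'} {f : Op X X'}
    (hY : HasDeg (M := Y) (N := Y) 1 Y.d) :
    c.cutOp p g f * (cutGr c Y X).d = sgn (PolyRing W U) p •
        c.cutOp p (g * Y.d : Op Y Y') f + c.cutOp (p + 1) g (f * X.d : Op X X') := by
  rw [show (cutGr c Y X).d = c.cutOp 0 Y.d (1 : Op X X) + c.cutOp 1 (1 : Op Y Y) X.d
    from rfl, Matrix.mul_add, cutOp_mul c hY, cutOp_mul c (HasDeg.one (M := Y)), mul_zero, mul_one,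
    add_zero, sgn_zero, one_smul, Matrix.mul_one, Matrix.mul_one]

theorem cutOp_sgn_left (p q : ZMod 2) (g : Op Y Y') (f : Op X X') :
    c.cutOp p (sgn (PolyRing V U) q • g) f = sgn (PolyRing W U) q • c.cutOp p g f := by
  rw [cutOp_eq_infl, tensorOp_sgn_left, cutOp_eq_infl]
  exact infl_sgn_smul c _ q _

theorem cutOp_sgn_right (p q : ZMod 2) (g : Op Y Y') (f : Op X X') :
    c.cutOp p g (sgn (PolyRing W V) q • f) = sgn (PolyRing W U) q • c.cutOp p g f := by
  rw [cutOp_eq_infl, tensorOp_sgn_right, cutOp_eq_infl]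
  exact infl_sgn_smul c _ q _

theorem cutOp_neg_left (p : ZMod 2) (g : Op Y Y') (f : Op X X') :
    c.cutOp p (-g) f = -c.cutOp p g f := by
  have := cutOp_sgn_left c p 1 g f
  rwa [sgn_one, sgn_one, neg_one_smul, neg_one_smul] at this

theorem cutOp_neg_right (p : ZMod 2) (g : Op Y Y') (f : Op X X') :
    c.cutOp p g (-f) = -c.cutOp p g f := by
  have := cutOp_sgn_right c p 1 g f
  rwa [sgn_one, sgn_one, neg_one_smul, neg_one_smul] at this

theorem cutOp_sub_right (p : ZMod 2) (g : Op Y Y') (f f' : Op X X') :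
    c.cutOp p g (f - f') = c.cutOp p g f - c.cutOp p g f' := by
  rw [sub_eq_add_neg, cutOp_add_right, cutOp_neg_right, sub_eq_add_neg]

/-- Differentiating d_X² = V - W twice, the mixed products of first derivatives differ from ∂_i∂_j V
by the anticommutator of d_X with ∂_i∂_j d_X. The latter operator, with a minus sign, gives the
homotopy. -/
theorem lam_lam (i j : Fin V.n) (hY : HasDeg (M := Y) (N := Y) 1 Y.d)
    (hX : HasDeg (M := X) (N := X) 1 X.d)
    (hX2 : X.d * X.d = potDiff W V • (1 : Matrix X.ι X.ι (PolyRing W V))) :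
    Htpy (M := cutGr c Y X) (N := cutGr c Y X) 0
      (lam c Y X i * lam c Y X j + lam c Y X j * lam c Y X i)
      (c.scalar Y X (pderiv i (pderiv j V.W))) := by
  have h2 : (1 : ZMod 2) + 1 = 0 := by decide
  have h1 := congrArg (c.cutOp 0 (1 : Op Y Y)) (dOp_dOp_d_sq i j hX2)
  rw [cutOp_sub_right, cutOp_add_right, cutOp_scalar] at h1
  have hl : ∀ i j, lam c Y X i * lam c Y X j = c.cutOp 0 (1 : Op Y Y)
      (dOp i (X := X) (X' := X) X.d * dOp j (X := X) (X' := X) X.d) := fun i j => by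
    rw [lam, lam, cutOp_mul c (HasDeg.one (M := Y)), mul_zero, sgn_zero, one_smul, h2,
      Matrix.one_mul]
    rfl
  have hκd : HasDeg 1 (dOp i (dOp j (X := X) (X' := X) X.d)) := (hX.dOp j).dOp i
  rw [hl, hl, h1]
  generalize dOp i (dOp j (X := X) (X' := X) X.d) = κ at *
  refine ⟨-c.cutOp 1 (1 : Op Y Y) κ, ?_, ?_⟩
  · have := (HasDeg.cut c (HasDeg.one (M := Y)) hκd).smul (-1)
    rwa [neg_one_smul] at this
  · rw [sgn_zero, one_smul, Matrix.mul_neg, Matrix.neg_mul, cutD_mul c (HasDeg.one (M := Y)),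
      mul_cutD c hY, cutOp_add_right, Matrix.mul_one, Matrix.one_mul, sgn_one,
      sgn_zero, one_smul, neg_one_smul, h2]
    abel

/-- The operators `1 ⊗ ∂_{y_i}(d_X)` commute up to homotopy with closed operators. -/
theorem lam_comm (i : Fin V.n) {p q : ZMod 2} {g : Op Y Y'} {f : Op X X'}
    (hY : HasDeg (M := Y) (N := Y) 1 Y.d) (hg : IsClosedOp q g) (hf : IsClosedOp p f) :
    IsNull (M := cutGr c Y X) (N := cutGr c Y' X') (q + p + 1)
      (lam c Y' X' i * c.cutOp p g f -
        sgn (PolyRing W U) (q + p) • (c.cutOp p g f * lam c Y X i)) := by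
  have h1 := congrArg (dOp (X := X) (X' := X') i) hf.2
  rw [dOp_sgn_smul, dOp_mul (X := X) (X' := X') (X'' := X'),
    dOp_mul (X := X) (X' := X) (X'' := X')] at h1
  have h2 := congrArg (c.cutOp (1 + p) g) h1
  rw [cutOp_sgn_right, cutOp_add_right, cutOp_add_right] at h2
  -- The homotopy comes from the derivative of the relation d f = (-1)^p f d. Only f is
  -- differentiated, since λ_i does not involve d_Y.
  refine ⟨-c.cutOp p g (dOp i f), ?_, ?_⟩
  · have := (HasDeg.cut c hg.1 (hf.1.dOp i)).smul (-1)
    rwa [neg_one_smul, ← zmod_two_add_one_add_one (q + p)] at this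
  · rw [sgn_add _ 1, sgn_one, Matrix.mul_neg, Matrix.neg_mul, cutD_mul c hg.1, mul_cutD c hY, hg.2,
      cutOp_sgn_left, lam, lam, cutOp_mul c hg.1, cutOp_mul c (HasDeg.one (M := Y)), mul_zero,
      sgn_zero, one_smul, one_mul, Matrix.one_mul, Matrix.mul_one, add_comm p 1, sgn_add q p]
    change sgn _ q • c.cutOp (1 + p) g (dOp i (X := X') (X' := X') X'.d * f) -
      (sgn _ q * sgn _ p) • c.cutOp (1 + p) g (f * dOp i (X := X) (X' := X) X.d) = _
    rw [← sub_eq_zero]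
    have h3 := congrArg (sgn (PolyRing W U) q • ·) h2
    simp only [smul_add, mul_smul, sgn_sq_smul, mul_neg, mul_one, neg_smul, smul_neg] at h3 ⊢
    rw [← sub_eq_zero] at h3
    refine Eq.trans ?_ h3
    abel

end CutHomotopies

/-! ### Passage between operators and endomorphism rings -/

section EndMk

variable {R : Type u} [CommRing R] {M N : GradedOp R}

/-- The class of a closed operator in the endomorphism ring. -/
def endMk (f : Op M M) (hf : f ∈ closedOps M M) : End M := hoMk f hf

theorem endMk_mul {f g : Op M M} (hf : f ∈ closedOps M M) (hg : g ∈ closedOps M M) :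
    endMk g hg * endMk f hf = endMk (g * f : Op M M) (closedOps_mul hg hf) := rfl

theorem endMk_add {f g : Op M M} (hf : f ∈ closedOps M M) (hg : g ∈ closedOps M M) :
    endMk f hf + endMk g hg = endMk (f + g) (add_mem hf hg) := rfl

theorem endMk_zero : (0 : End M) = endMk (0 : Op M M) (zero_mem _) := rfl

theorem endMk_congr {f g : Op M M} (hf : f ∈ closedOps M M) (hg : g ∈ closedOps M M) (h : f = g) :
    endMk f hf = endMk g hg := by subst h; rfl

theorem endMk_sum {ι : Type*} (s : Finset ι) (f : ι → Op M M) (hf : ∀ i, f i ∈ closedOps M M) :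
    ∑ i ∈ s, endMk (f i) (hf i) = endMk (∑ i ∈ s, f i) (sum_mem fun i _ => hf i) :=
  hoMk_sum s f hf

theorem Htpy.endMk_eq {p : ZMod 2} {f g : Op M M} (h : Htpy p f g) (hf : f ∈ closedOps M M)
    (hg : g ∈ closedOps M M) : endMk f hf = endMk g hg := h.cl_eq hf hg

theorem endMk_comm_of_null {p : ZMod 2} {f g : Op M M} (hf : f ∈ closedOps M M)
    (hg : g ∈ closedOps M M) (h : IsNull p (f * g - g * f : Op M M)) :
    endMk f hf * endMk g hg = endMk g hg * endMk f hf :=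
  Htpy.endMk_eq (f := f * g) (g := g * f) h _ _

theorem endMk_anti_of_null {p : ZMod 2} {f g : Op M M} (hf : f ∈ closedOps M M)
    (hg : g ∈ closedOps M M) (h : IsNull p (f * g + g * f : Op M M)) :
    endMk f hf * endMk g hg + endMk g hg * endMk f hf = 0 :=
  Htpy.endMk_eq (htpy_zero_iff.2 h) (add_mem (closedOps_mul hf hg) (closedOps_mul hg hf))
    (zero_mem _)

theorem IsClosedOp.nest {n : ℕ} {γ γd : Fin n → Op M M} {x : Op M M}
    (hγ : ∀ i, IsClosedOp 1 (γ i)) (hγd : ∀ i, IsClosedOp 1 (γd i)) (hx : IsClosedOp 0 x) :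
    IsClosedOp (M := M) (N := M) 0 (nest γ γd x) := by
  unfold CutSystem.nest
  induction List.finRange n with
  | nil => exact hx
  | cons i L ih =>
    exact IsClosedOp.mul (p := 1) (q := 1) (IsClosedOp.mul (p := 0) (q := 1) (hγ i) ih) (hγd i)

theorem endMk_nest {n : ℕ} {γ γd : Fin n → Op M M} {x : Op M M}
    (hγ : ∀ i, γ i ∈ closedOps M M) (hγd : ∀ i, γd i ∈ closedOps M M) (hx : x ∈ closedOps M M)
    (h : (nest γ γd x : Op M M) ∈ closedOps M M) :
    endMk (nest γ γd x) h = ringNest (fun i => endMk (γ i) (hγ i))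
      (fun i => endMk (γd i) (hγd i)) (endMk x hx) := by
  have : ∀ L : List (Fin n), ∃ h, endMk (M := M) (L.foldr (fun i y => γ i * y * γd i) x) h =
      L.foldr (fun i y => endMk (γ i) (hγ i) * y * endMk (γd i) (hγd i)) (endMk x hx) := by
    intro L
    induction L with
    | nil => exact ⟨hx, rfl⟩
    | cons i L ih =>
      obtain ⟨h1, h2⟩ := ih
      refine ⟨closedOps_mul (closedOps_mul (hγ i) h1) (hγd i), ?_⟩
      exact congrArg (fun z => endMk (γ i) (hγ i) * z * endMk (γd i) (hγd i)) h2
  exact (this _).2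

/-- Closedness fixes the parity of every operator, so each ring equation lifts to a homotopy of the
prescribed degree. -/
theorem isRep_of_rel {W : R} {M : CliffordData R} (hd : HasDeg 1 M.d)
    (hsq : M.d * M.d = W • (1 : Matrix M.ι M.ι R)) (he : IsClosedOp 0 M.e)
    (hγ : ∀ i, IsClosedOp 1 (M.γ i)) (hγd : ∀ i, IsClosedOp 1 (M.γd i))
    (h : CliffordRel (endMk (M := M.toGradedOp) M.e he.mem)
      (fun i => endMk (M := M.toGradedOp) (M.γ i) (hγ i).mem)
      (fun i => endMk (M := M.toGradedOp) (M.γd i) (hγd i).mem)) : M.IsRep W where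
  d_deg := hd
  d_sq := hsq
  e_closed := he
  γ_closed := hγ
  γd_closed := hγd
  e_idem := htpy_of_hoMk_eq hd hd (IsClosedOp.mul (p := 0) (q := 0) he he).1 he.1 h.e_e
  γ_e i := htpy_of_hoMk_eq hd hd (IsClosedOp.mul (p := 0) (q := 1) (hγ i) he).1 (hγ i).1 (h.γ_e i)
  e_γ i := htpy_of_hoMk_eq hd hd (IsClosedOp.mul (p := 1) (q := 0) he (hγ i)).1 (hγ i).1 (h.e_γ i)
  γd_e i :=
    htpy_of_hoMk_eq hd hd (IsClosedOp.mul (p := 0) (q := 1) (hγd i) he).1 (hγd i).1 (h.γd_e i)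
  e_γd i :=
    htpy_of_hoMk_eq hd hd (IsClosedOp.mul (p := 1) (q := 0) he (hγd i)).1 (hγd i).1 (h.e_γd i)
  γ_γ i j := htpy_of_hoMk_eq hd hd ((IsClosedOp.mul (p := 1) (q := 1) (hγ i) (hγ j)).1.add
    (IsClosedOp.mul (p := 1) (q := 1) (hγ j) (hγ i)).1) (HasDeg.zero 0) (h.γ_γ i j)
  γd_γd i j := htpy_of_hoMk_eq hd hd ((IsClosedOp.mul (p := 1) (q := 1) (hγd i) (hγd j)).1.add
    (IsClosedOp.mul (p := 1) (q := 1) (hγd j) (hγd i)).1) (HasDeg.zero 0) (h.γd_γd i j)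
  γ_γd i j := by
    have hc := (IsClosedOp.mul (p := 1) (q := 1) (hγ i) (hγd j)).1.add
      (IsClosedOp.mul (p := 1) (q := 1) (hγd j) (hγ i)).1
    have h := h.γ_γd i j
    by_cases hij : i = j
    · rw [if_pos hij] at h ⊢
      exact htpy_of_hoMk_eq hd hd hc he.1 h
    · rw [if_neg hij] at h ⊢
      exact htpy_of_hoMk_eq hd hd hc (HasDeg.zero 0) h

/-- Transport of the Clifford relations along a map `T` of operators which is compatible with
products, sums and homotopies. -/
theorem CliffordData.IsRep.map_rel {R' : Type u} [CommRing R'] {W : R} {M : CliffordData R}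
    (hM : M.IsRep W) {P : GradedOp R'} (T : ZMod 2 → Op M.toGradedOp M.toGradedOp → Op P P)
    (hadd : ∀ p f g, T p (f + g) = T p f + T p g)
    (hsub : ∀ p f g, T p (f - g) = T p f - T p g)
    (hmul : ∀ p q f g, HasDeg q g → T p f * T q g = T (p + q) (f * g))
    (hcl : ∀ p f, IsClosedOp p f → IsClosedOp p (T p f))
    (hnull : ∀ p f, IsNull p f → IsNull p (T p f)) :
    CliffordRel (endMk (T 0 M.e) (hcl 0 _ hM.e_closed).mem)
      (fun i => endMk (T 1 (M.γ i)) (hcl 1 _ (hM.γ_closed i)).mem)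
      (fun i => endMk (T 1 (M.γd i)) (hcl 1 _ (hM.γd_closed i)).mem) := by
  have hz : ∀ p, T p 0 = 0 := fun p => by simpa using hsub p 0 0
  have hh : ∀ {p f g}, Htpy p f g → Htpy p (T p f) (T p g) := fun {p f g} h => by
    have := hnull p _ h; rwa [hsub] at this
  have e1 := hM.e_closed.1
  have g1 := fun i => (hM.γ_closed i).1
  have gd1 := fun i => (hM.γd_closed i).1
  have H : ∀ {p q f g x}, IsClosedOp p f → IsClosedOp q g → Htpy (p + q) (f * g : Op _ _) x →
      IsNull (p + q) (T p f * T q g - T (p + q) x) := fun {p q f g x} hf hg h => by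
    rw [hmul p q f g hg.1]; exact hh h
  have H2 : ∀ {f g x}, IsClosedOp 1 f → IsClosedOp 1 g → Htpy 0 (f * g + g * f : Op _ _) x →
      IsNull 0 (T 1 f * T 1 g + T 1 g * T 1 f - T 0 x) := fun {f g x} hf hg h => by
    rw [hmul 1 1 f g hg.1, hmul 1 1 g f hf.1, ← hadd]; exact hh h
  constructor
  · exact Htpy.endMk_eq (H (p := 0) (q := 0) hM.e_closed hM.e_closed hM.e_idem) _ _
  · exact fun i => Htpy.endMk_eq (H (p := 1) (q := 0) (hM.γ_closed i) hM.e_closed (hM.γ_e i)) _ _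
  · exact fun i => Htpy.endMk_eq (H (p := 0) (q := 1) hM.e_closed (hM.γ_closed i) (hM.e_γ i)) _ _
  · exact fun i => Htpy.endMk_eq (H (p := 1) (q := 0) (hM.γd_closed i) hM.e_closed (hM.γd_e i)) _ _
  · exact fun i => Htpy.endMk_eq (H (p := 0) (q := 1) hM.e_closed (hM.γd_closed i) (hM.e_γd i)) _ _
  · intro i j
    have := H2 (hM.γ_closed i) (hM.γ_closed j) (hM.γ_γ i j)
    rw [hz, sub_zero] at this
    exact endMk_anti_of_null _ _ this
  · intro i j
    have := H2 (hM.γd_closed i) (hM.γd_closed j) (hM.γd_γd i j)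
    rw [hz, sub_zero] at this
    exact endMk_anti_of_null _ _ this
  · intro i j
    have := H2 (hM.γ_closed i) (hM.γd_closed j) (hM.γ_γd i j)
    by_cases hij : i = j
    · rw [if_pos hij] at this ⊢
      exact Htpy.endMk_eq this (add_mem (closedOps_mul (hcl 1 _ (hM.γ_closed i)).mem
        (hcl 1 _ (hM.γd_closed j)).mem) (closedOps_mul (hcl 1 _ (hM.γd_closed j)).mem
        (hcl 1 _ (hM.γ_closed i)).mem)) _
    · rw [if_neg hij] at this ⊢
      rw [hz, sub_zero] at this
      exact endMk_anti_of_null _ _ this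

/-- Transport of the nested product. -/
theorem map_nest {R' : Type u} [CommRing R'] {M : GradedOp R} {P : GradedOp R'}
    (T : ZMod 2 → Op M M → Op P P)
    (hmul : ∀ p q f g, HasDeg q g → T p f * T q g = T (p + q) (f * g)) {n : ℕ}
    {γ γd : Fin n → Op M M} {x : Op M M} (hγ : ∀ i, HasDeg 1 (γ i)) (hγd : ∀ i, HasDeg 1 (γd i))
    (hx : HasDeg 0 x) : nest (fun i => T 1 (γ i)) (fun i => T 1 (γd i)) (T 0 x) =
      T 0 (nest γ γd x) := by
  unfold nest
  suffices h : ∀ L : List (Fin n), HasDeg (M := M) (N := M) 0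
      (L.foldr (fun i y => γ i * y * γd i) x) ∧
      L.foldr (fun i y => T 1 (γ i) * y * T 1 (γd i)) (T 0 x) =
        T 0 (L.foldr (fun i y => γ i * y * γd i) x) from (h _).2
  intro L
  induction L with
  | nil => exact ⟨hx, rfl⟩
  | cons i L ih =>
    refine ⟨HasDeg.mul (p := 1) (q := 1) (HasDeg.mul (p := 0) (q := 1) (hγ i) ih.1) (hγd i), ?_⟩
    rw [List.foldr_cons, ih.2, hmul 1 0 _ _ ih.1, hmul (1 + 0) 1 _ _ (hγd i)]
    rfl

end EndMk

/-! ### The cut of two matrix factorisations and the naturality of At_q -/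

section CutRep

variable {k : Type u} [CommRing k] {W V U : Potential k} (c : CutChoice V)

/-- Matrix factorisations of `W`. -/
structure IsMF {R : Type u} [CommRing R] (W : R) (M : GradedOp R) : Prop where
  d_deg : HasDeg (M := M) (N := M) 1 M.d
  d_sq : M.d * M.d = W • (1 : Matrix M.ι M.ι R)

theorem CliffordData.IsRep.isMF {R : Type u} [CommRing R] {W : R} {M : CliffordData R}
    (h : M.IsRep W) : IsMF W M.toGradedOp := ⟨h.d_deg, h.d_sq⟩

variable {Y Y' Y'' : GradedOp (PolyRing V U)} {X X' X'' : GradedOp (PolyRing W V)}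

theorem IsMF.cut (hY : IsMF (potDiff V U) Y) (hX : IsMF (potDiff W V) X) :
    IsMF (potDiff W U) (cutGr c Y X) :=
  ⟨hasDeg_cutGr_d c hY.d_deg hX.d_deg, cutGr_d_sq c hY.d_deg hY.d_sq hX.d_sq⟩

theorem isClosedOp_scalar (hY : HasDeg (M := Y) (N := Y) 1 Y.d) (f : V.Poly) :
    IsClosedOp (M := cutGr c Y X) (N := cutGr c Y X) 0 (c.scalar Y X f) :=
  IsClosedOp.cut c hY (IsClosedOp.smul _ IsClosedOp.one) IsClosedOp.one

theorem atiyah_natural (q : Fin V.n) {p r : ZMod 2} {g : Op Y Y'} {f : Op X X'}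
    (hY : HasDeg (M := Y) (N := Y) 1 Y.d) (hg : IsClosedOp r g) (hf : IsClosedOp p f) :
    IsNull (M := cutGr c Y X) (N := cutGr c Y' X') (r + p + 1)
      (c.atiyah Y' X' q * c.cutOp p g f -
        sgn (PolyRing W U) (r + p) • (c.cutOp p g f * c.atiyah Y X q)) := by
  rw [cutOp_eq_infl]
  exact atiyah_comm c q (hg.tensor hY hf)

/-- Scalars commute with every g | f strictly. The Hessian coefficients of γ† therefore cost no
homotopies. -/
theorem scalar_mul_cutOp (P : V.Poly) (p : ZMod 2) (g : Op Y Y') (f : Op X X') :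
    c.scalar Y' X' P * c.cutOp p g f = c.cutOp p g f * c.scalar Y X P := by
  rw [CutChoice.scalar, CutChoice.scalar, cutOp_eq_infl, cutOp_eq_infl, cutOp_eq_infl,
    tensor_scalar, tensor_scalar, ← infl_hat_mul, ← infl_hat_mul, Matrix.smul_mul,
    Matrix.mul_smul, Matrix.one_mul, Matrix.mul_one]

/-- The commutator of two derivations is a derivation, and this one kills the variables. -/
theorem pderiv_comm {σ : Type*} (i j : σ) (f : MvPolynomial σ k) :
    pderiv i (pderiv j f) = pderiv j (pderiv i f) := by
  have h : ⁅(pderiv i : Derivation k (MvPolynomial σ k) (MvPolynomial σ k)),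
      (pderiv j : Derivation k (MvPolynomial σ k) (MvPolynomial σ k))⁆ = 0 := by
    refine derivation_ext fun l => ?_
    classical
    rw [Derivation.commutator_apply, pderiv_X, pderiv_X]
    simp only [Pi.single_apply]
    split_ifs <;> simp
  have := congrArg (fun D : Derivation k (MvPolynomial σ k) (MvPolynomial σ k) => D f) h
  simpa [Derivation.commutator_apply, sub_eq_zero] using this

/-- Multiplication by polynomials, as an additive map. -/
noncomputable def scalarHom (Y : GradedOp (PolyRing V U)) (X : GradedOp (PolyRing W V)) :
    V.Poly →+ Op (cutGr c Y X) (cutGr c Y X) :=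
  AddMonoidHom.mk' (c.scalar Y X) fun f g => by
    simp only [CutChoice.scalar, map_add, add_smul, cutOp_add_left]

theorem scalar_add (f g : V.Poly) : c.scalar Y X (f + g) = c.scalar Y X f + c.scalar Y X g :=
  map_add (scalarHom c Y X) f g

end CutRep

/-! ### The operators γ† and the action of C_m on a cut -/

section CutClifford

variable {k : Type u} [CommRing k] [Algebra ℚ k] {W V U : Potential k} (c : CutChoice V)

variable {Y Y' Y'' : GradedOp (PolyRing V U)} {X X' X'' : GradedOp (PolyRing W V)}

theorem rat_smul_scalar (r : ℚ) (f : V.Poly) : r • c.scalar Y X f = c.scalar Y X (r • f) :=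
  (map_rat_smul (scalarHom c Y X) r f).symm

/-- `∂_{y_q} ∂_{y_i} V / 2`. -/
noncomputable def halfHess (V : Potential k) (q i : Fin V.n) : V.Poly :=
  (1 / 2 : ℚ) • pderiv q (pderiv i V.W)

/-- The Hessian is symmetric, so two halves add up to the anticommutator of λ_i and λ_j. Division by
2 is where k has to be a ℚ-algebra. -/
theorem halfHess_add (i j : Fin V.n) :
    halfHess V i j + halfHess V j i = pderiv i (pderiv j V.W) := by
  rw [halfHess, halfHess, pderiv_comm j i, ← add_smul]
  norm_num

/-- Absorbing 1/2 into the scalar gives γ† the form treated by `cliffordRel_of_half`. -/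
theorem gammaDagger_eq (i : Fin V.n) : c.gammaDagger Y X i = -lam c Y X i -
    ∑ q, c.scalar Y X (halfHess V q i) * c.atiyah Y X q := by
  rw [CutChoice.gammaDagger, lam, Finset.smul_sum]
  simp only [← Matrix.smul_mul, rat_smul_scalar]
  rfl

theorem isClosedOp_gammaDagger (i : Fin V.n) (hY : IsMF (potDiff V U) Y)
    (hX : IsMF (potDiff W V) X) :
    IsClosedOp (M := cutGr c Y X) (N := cutGr c Y X) 1 (c.gammaDagger Y X i) := by
  have h1 := (isClosedOp_lam c i hY.d_deg hX.d_deg hX.d_sq).smul (-1)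
  have h2 : ∀ s : Finset (Fin V.n), IsClosedOp (M := cutGr c Y X) (N := cutGr c Y X) 1
      (∑ q ∈ s, c.scalar Y X (halfHess V q i) * c.atiyah Y X q) := fun s => by
    classical
    induction s using Finset.induction_on with
    | empty => rw [Finset.sum_empty]; exact IsClosedOp.zero 1
    | insert a s ha ih =>
      rw [Finset.sum_insert ha]
      exact IsClosedOp.add (IsClosedOp.mul (p := 1) (q := 0) (isClosedOp_scalar c hY.d_deg _)
        (isClosedOp_atiyah c a hY.d_deg hX.d_deg hY.d_sq hX.d_sq)) ih
  have h3 := h1.add ((h2 Finset.univ).smul (-1))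
  rwa [neg_one_smul, neg_one_smul, ← sub_eq_add_neg, ← gammaDagger_eq] at h3

/-- Both λ_i and the At_q have this property, and the coefficients in front of At_q commute strictly
with g | f. -/
theorem gammaDagger_natural (i : Fin V.n) {p r : ZMod 2} {g : Op Y Y'} {f : Op X X'}
    (hY : HasDeg (M := Y) (N := Y) 1 Y.d) (hY' : HasDeg (M := Y') (N := Y') 1 Y'.d)
    (hg : IsClosedOp r g) (hf : IsClosedOp p f) :
    IsNull (M := cutGr c Y X) (N := cutGr c Y' X') (r + p + 1)
      (c.gammaDagger Y' X' i * c.cutOp p g f -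
        sgn (PolyRing W U) (r + p) • (c.cutOp p g f * c.gammaDagger Y X i)) := by
  have h1 := (lam_comm c i hY hg hf).neg
  have h2 : ∀ s : Finset (Fin V.n), IsNull (M := cutGr c Y X) (N := cutGr c Y' X') (r + p + 1)
      (∑ q ∈ s, c.scalar Y' X' (halfHess V q i) * (c.atiyah Y' X' q * c.cutOp p g f -
        sgn (PolyRing W U) (r + p) • (c.cutOp p g f * c.atiyah Y X q))) := fun s => by
    classical
    induction s using Finset.induction_on with
    | empty => rw [Finset.sum_empty]; exact IsNull.zero _
    | insert a s ha ih =>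
      rw [Finset.sum_insert ha]
      refine IsNull.add ?_ ih
      have := IsNull.mul_left (isClosedOp_scalar c (X := X') hY' (halfHess V a i))
        (atiyah_natural c a hY hg hf)
      rwa [add_zero] at this
  have h3 := h1.sub (h2 Finset.univ)
  refine cast (congrArg _ ?_) h3
  rw [gammaDagger_eq, gammaDagger_eq, Matrix.sub_mul, Matrix.mul_sub, Matrix.sum_mul,
    Matrix.mul_sum]
  have : ∀ q, c.scalar Y' X' (halfHess V q i) * (c.atiyah Y' X' q * c.cutOp p g f -
        sgn (PolyRing W U) (r + p) • (c.cutOp p g f * c.atiyah Y X q)) =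
      c.scalar Y' X' (halfHess V q i) * c.atiyah Y' X' q *
        c.cutOp p g f - sgn (PolyRing W U) (r + p) • (c.cutOp p g f *
          (c.scalar Y X (halfHess V q i) * c.atiyah Y X q)) := fun q => by
    rw [Matrix.mul_sub, Matrix.mul_smul, ← Matrix.mul_assoc, ← Matrix.mul_assoc, ← Matrix.mul_assoc,
      scalar_mul_cutOp]
  simp only [this]
  rw [Finset.sum_sub_distrib, ← Finset.smul_sum, smul_sub, Matrix.mul_neg, Matrix.neg_mul, smul_neg]
  abel

/-- The operators `At_i` and `γ†_i` define an action of the Clifford algebra on the cut. -/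
theorem cliffordRel_cut (hY : IsMF (potDiff V U) Y) (hX : IsMF (potDiff W V) X) :
    CliffordRel (1 : End (cutGr c Y X))
      (fun i => endMk (c.atiyah Y X i)
        (isClosedOp_atiyah c i hY.d_deg hX.d_deg hY.d_sq hX.d_sq).mem)
      (fun i => endMk (c.gammaDagger Y X i) (isClosedOp_gammaDagger c i hY hX).mem) := by
  have ha := fun i => isClosedOp_atiyah c i hY.d_deg hX.d_deg hY.d_sq hX.d_sq
  have hL := fun i => isClosedOp_lam c i hY.d_deg hX.d_deg hX.d_sq
  have hs := fun f => isClosedOp_scalar c (X := X) hY.d_deg f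
  -- The data are a = At, L = λ and s = half of the Hessian; the remaining goals are their pairwise
  -- relations in the endomorphism ring.
  have key := cliffordRel_of_half (fun i => endMk (c.atiyah Y X i) (ha i).mem)
    (fun i => endMk (lam c Y X i) (hL i).mem)
    (fun q i => endMk (c.scalar Y X (halfHess V q i)) (hs _).mem) ?_ ?_ ?_ ?_ ?_ ?_
  · convert key using 2 with i
    refine (endMk_congr (isClosedOp_gammaDagger c i hY hX).mem (add_mem (neg_mem (hL i).mem)
      (neg_mem (sum_mem fun q _ => closedOps_mul (hs (halfHess V q i)).mem (ha q).mem)))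
      ((gammaDagger_eq c i).trans (sub_eq_add_neg _ _))).trans ?_
    have e1 : ∑ q, endMk (c.scalar Y X (halfHess V q i)) (hs _).mem *
        endMk (c.atiyah Y X q) (ha q).mem = endMk _ (sum_mem fun q _ =>
          closedOps_mul (hs (halfHess V q i)).mem (ha q).mem) := endMk_sum _ _ _
    rw [e1, sub_eq_add_neg]
    rfl
  · exact fun i j => endMk_anti_of_null _ _
      (atiyah_atiyah c i j hY.d_deg hX.d_deg hY.d_sq hX.d_sq)
  · intro q i j
    -- Multiplication by a polynomial is itself of the form g | 1 with g closed and even, so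
    -- naturality yields its commutation with At_q.
    have := atiyah_natural c q (p := 0) (r := 0) (X := X) (X' := X) hY.d_deg
      (IsClosedOp.smul (rename Sum.inl (halfHess V i j)) IsClosedOp.one) IsClosedOp.one
    rw [add_zero, sgn_zero, one_smul] at this
    exact (endMk_comm_of_null (ha q).mem (hs _).mem this).symm
  · intro q i j
    have := lam_comm c q (p := 0) (q := 0) (X := X) (X' := X) hY.d_deg
      (IsClosedOp.smul (rename Sum.inl (halfHess V i j)) IsClosedOp.one) IsClosedOp.one
    rw [add_zero, sgn_zero, one_smul] at this
    exact (endMk_comm_of_null (hL q).mem (hs _).mem this).symm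
  · exact fun i j p q => endMk_congr _ _ (scalar_mul_cutOp c (halfHess V i j) 0 _ _)
  · intro i j
    have h := atiyah_lam c i j hY.d_deg hX.d_deg hX.d_sq
    have hc := add_mem (closedOps_mul (ha i).mem (hL j).mem) (closedOps_mul (hL j).mem (ha i).mem)
    by_cases hij : i = j
    · rw [if_pos hij] at h ⊢
      exact h.endMk_eq hc (neg_mem (one_mem_closedOps _))
    · rw [if_neg hij] at h ⊢
      exact h.endMk_eq hc (zero_mem _)
  · intro i j
    have h := lam_lam c i j hY.d_deg hX.d_deg hX.d_sq
    rw [← halfHess_add, scalar_add] at h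
    exact h.endMk_eq (add_mem (closedOps_mul (hL i).mem (hL j).mem)
      (closedOps_mul (hL j).mem (hL i).mem)) (add_mem (hs _).mem (hs _).mem)

end CutClifford

/-! ### Operators that intertwine nested products -/

section Intertwine

variable {R : Type u} [CommRing R] {M N : GradedOp R}

/-- An operator which intertwines two families of generators intertwines the nested products. -/
theorem nest_intertwine {n : ℕ} {γ γd : Fin n → Op M M} {x : Op M M} {γ' γd' : Fin n → Op N N}
    {x' : Op N N} (hγd : ∀ i, IsClosedOp 1 (γd i)) (hγ' : ∀ i, IsClosedOp 1 (γ' i))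
    (hγ : ∀ i, IsClosedOp 1 (γ i)) (hγd' : ∀ i, IsClosedOp 1 (γd' i)) (hx : IsClosedOp 0 x)
    (hx' : IsClosedOp 0 x') {F : Op M N} (h : Htpy 0 (x' * F) (F * x))
    (h1 : ∀ i, Htpy 1 (γ' i * F) (F * γ i)) (h2 : ∀ i, Htpy 1 (γd' i * F) (F * γd i)) :
    Htpy 0 (nest γ' γd' x' * F) (F * nest γ γd x) := by
  unfold nest
  suffices H : ∀ L : List (Fin n), IsClosedOp (M := M) (N := M) 0
      (L.foldr (fun i y => γ i * y * γd i) x) ∧ IsClosedOp (M := N) (N := N) 0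
      (L.foldr (fun i y => γ' i * y * γd' i) x') ∧
      Htpy 0 (L.foldr (fun i y => γ' i * y * γd' i) x' * F)
        (F * L.foldr (fun i y => γ i * y * γd i) x) from (H _).2.2
  intro L
  induction L with
  | nil => exact ⟨hx, hx', h⟩
  | cons i L ih =>
    obtain ⟨c, c', ih⟩ := ih
    simp only [List.foldr_cons]
    generalize L.foldr (fun i y => γ i * y * γd i) x = y at *
    generalize L.foldr (fun i y => γ' i * y * γd' i) x' = y' at *
    refine ⟨IsClosedOp.mul (p := 1) (q := 1) (IsClosedOp.mul (p := 0) (q := 1) (hγ i) c) (hγd i),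
      IsClosedOp.mul (p := 1) (q := 1) (IsClosedOp.mul (p := 0) (q := 1) (hγ' i) c') (hγd' i), ?_⟩
    -- The operator F moves from the right end to the left end: past γd' i, then past the inner
    -- product, then past γ' i.
    have a1 : Htpy 0 (γ' i * y' * (γd' i * F)) (γ' i * y' * (F * γd i)) :=
      Htpy.mul_left (p := 1) (q := 1) (IsClosedOp.mul (p := 0) (q := 1) (hγ' i) c') (h2 i)
    have a2 : Htpy 0 (γ' i * (y' * F * γd i)) (γ' i * (F * y * γd i)) :=
      Htpy.mul_left (p := 1) (q := 1) (hγ' i) (Htpy.mul_right (p := 1) (q := 0) (hγd i) ih)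
    have a3 : Htpy 0 (γ' i * F * (y * γd i)) (F * γ i * (y * γd i)) :=
      Htpy.mul_right (p := 1) (q := 1) (IsClosedOp.mul (p := 1) (q := 0) c (hγd i)) (h1 i)
    simp only [Matrix.mul_assoc] at a1 a2 a3 ⊢
    exact a1.trans (a2.trans a3)

end Intertwine

/-! ### Operators on one factor of a cut -/

section CutRep

variable {k : Type u} [CommRing k] {W V U : Potential k} (c : CutChoice V)

variable {Y : CliffordData (PolyRing V U)} {X : CliffordData (PolyRing W V)}

theorem closed_left (hY : Y.IsRep (potDiff V U)) {p : ZMod 2}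
    {g : Op Y.toGradedOp Y.toGradedOp} (hg : IsClosedOp p g) :
    IsClosedOp (M := cutGr c Y.toGradedOp X.toGradedOp) (N := cutGr c Y.toGradedOp X.toGradedOp) p
      (c.cutOp 0 g (1 : Op X.toGradedOp X.toGradedOp)) := by
  have := IsClosedOp.cut c hY.d_deg hg (IsClosedOp.one (M := X.toGradedOp))
  rwa [add_zero] at this

theorem closed_right (hY : Y.IsRep (potDiff V U)) {p : ZMod 2}
    {f : Op X.toGradedOp X.toGradedOp} (hf : IsClosedOp p f) :
    IsClosedOp (M := cutGr c Y.toGradedOp X.toGradedOp) (N := cutGr c Y.toGradedOp X.toGradedOp) p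
      (c.cutOp p (1 : Op Y.toGradedOp Y.toGradedOp) f) := by
  have := IsClosedOp.cut c hY.d_deg (IsClosedOp.one (M := Y.toGradedOp)) hf
  rwa [zero_add] at this

theorem cutOp_left_mul {q : ZMod 2} {g g' : Op Y.toGradedOp Y.toGradedOp} (hg : HasDeg q g') :
    c.cutOp 0 g (1 : Op X.toGradedOp X.toGradedOp) * c.cutOp 0 g' (1 : Op X.toGradedOp X.toGradedOp)
      = c.cutOp 0 (g * g') (1 : Op X.toGradedOp X.toGradedOp) := by
  rw [cutOp_mul c hg, zero_mul, sgn_zero, one_smul, add_zero, Matrix.mul_one]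

theorem cutOp_right_mul {p q : ZMod 2} {f f' : Op X.toGradedOp X.toGradedOp} :
    c.cutOp p (1 : Op Y.toGradedOp Y.toGradedOp) f * c.cutOp q (1 : Op Y.toGradedOp Y.toGradedOp) f'
      = c.cutOp (p + q) (1 : Op Y.toGradedOp Y.toGradedOp) (f * f') := by
  rw [cutOp_mul c (HasDeg.one (M := Y.toGradedOp)), mul_zero, sgn_zero, one_smul, Matrix.mul_one]

theorem atiyah_left (hY : Y.IsRep (potDiff V U)) (i : Fin V.n) {q : ZMod 2}
    {g : Op Y.toGradedOp Y.toGradedOp} (hg : IsClosedOp q g) :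
    IsNull (M := cutGr c Y.toGradedOp X.toGradedOp) (N := cutGr c Y.toGradedOp X.toGradedOp) (q + 1)
      (c.atiyah Y.toGradedOp X.toGradedOp i * c.cutOp 0 g (1 : Op X.toGradedOp X.toGradedOp) -
        sgn (PolyRing W U) q • (c.cutOp 0 g (1 : Op X.toGradedOp X.toGradedOp) *
          c.atiyah Y.toGradedOp X.toGradedOp i)) := by
  have := atiyah_natural c i hY.d_deg hg (IsClosedOp.one (M := X.toGradedOp))
  rwa [add_zero] at this

theorem atiyah_right (hY : Y.IsRep (potDiff V U)) (i : Fin V.n) {q : ZMod 2}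
    {f : Op X.toGradedOp X.toGradedOp} (hf : IsClosedOp q f) :
    IsNull (M := cutGr c Y.toGradedOp X.toGradedOp) (N := cutGr c Y.toGradedOp X.toGradedOp) (q + 1)
      (c.atiyah Y.toGradedOp X.toGradedOp i * c.cutOp q (1 : Op Y.toGradedOp Y.toGradedOp) f -
        sgn (PolyRing W U) q • (c.cutOp q (1 : Op Y.toGradedOp Y.toGradedOp) f *
          c.atiyah Y.toGradedOp X.toGradedOp i)) := by
  have := atiyah_natural c i hY.d_deg (IsClosedOp.one (M := Y.toGradedOp)) hf
  rwa [zero_add] at this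

theorem cutOp_left_right {p : ZMod 2} (g : Op Y.toGradedOp Y.toGradedOp)
    (f : Op X.toGradedOp X.toGradedOp) :
    c.cutOp 0 g (1 : Op X.toGradedOp X.toGradedOp) * c.cutOp p (1 : Op Y.toGradedOp Y.toGradedOp) f
      = c.cutOp p g f := by
  rw [cutOp_mul c (HasDeg.one (M := Y.toGradedOp)), zero_mul, sgn_zero, one_smul, zero_add,
    Matrix.mul_one, Matrix.one_mul]

theorem cutOp_right_left {p q : ZMod 2} {g : Op Y.toGradedOp Y.toGradedOp}
    (hg : HasDeg q g) (f : Op X.toGradedOp X.toGradedOp) :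
    c.cutOp p (1 : Op Y.toGradedOp Y.toGradedOp) f * c.cutOp 0 g (1 : Op X.toGradedOp X.toGradedOp)
      = sgn (PolyRing W U) (p * q) • c.cutOp p g f := by
  rw [cutOp_mul c hg, add_zero, Matrix.mul_one, Matrix.one_mul]

theorem closed_cut_e (hY : Y.IsRep (potDiff V U)) (hX : X.IsRep (potDiff W V)) :
    IsClosedOp (M := cutGr c Y.toGradedOp X.toGradedOp) (N := cutGr c Y.toGradedOp X.toGradedOp) 0
      (c.cutOp 0 Y.e X.e) :=
  IsClosedOp.cut c hY.d_deg hY.e_closed hX.e_closed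

end CutRep

/-! ### The cut as a representation of C_r ⊗ C_m ⊗ C_s, and its unit -/

section CutRep

variable {k : Type u} [CommRing k] [Algebra ℚ k] {W V U : Potential k} (c : CutChoice V)

variable {Y : CliffordData (PolyRing V U)} {X : CliffordData (PolyRing W V)}

theorem rel_left (hY : Y.IsRep (potDiff V U)) :
    CliffordRel (endMk (M := cutGr c Y.toGradedOp X.toGradedOp)
        (c.cutOp 0 Y.e (1 : Op X.toGradedOp X.toGradedOp)) (closed_left c hY hY.e_closed).mem)
      (fun i => endMk (c.cutOp 0 (Y.γ i) (1 : Op X.toGradedOp X.toGradedOp))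
        (closed_left c hY (hY.γ_closed i)).mem)
      (fun i => endMk (c.cutOp 0 (Y.γd i) (1 : Op X.toGradedOp X.toGradedOp))
        (closed_left c hY (hY.γd_closed i)).mem) :=
  hY.map_rel (P := cutGr c Y.toGradedOp X.toGradedOp)
    (fun _ g => c.cutOp 0 g (1 : Op X.toGradedOp X.toGradedOp))
    (fun _ f g => cutOp_add_left c 0 f g _)
    (fun _ f g => by rw [sub_eq_add_neg, cutOp_add_left, cutOp_neg_left, sub_eq_add_neg])
    (fun _ _ _ _ hg => cutOp_left_mul c hg) (fun _ _ hf => closed_left c hY hf)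
    (fun p f hf => by
      have := IsNull.cut_left c hY.d_deg hf (IsClosedOp.one (M := X.toGradedOp))
      rwa [add_zero] at this)

theorem rel_right (hY : Y.IsRep (potDiff V U)) (hX : X.IsRep (potDiff W V)) :
    CliffordRel (endMk (M := cutGr c Y.toGradedOp X.toGradedOp)
        (c.cutOp 0 (1 : Op Y.toGradedOp Y.toGradedOp) X.e) (closed_right c hY hX.e_closed).mem)
      (fun i => endMk (c.cutOp 1 (1 : Op Y.toGradedOp Y.toGradedOp) (X.γ i))
        (closed_right c hY (hX.γ_closed i)).mem)
      (fun i => endMk (c.cutOp 1 (1 : Op Y.toGradedOp Y.toGradedOp) (X.γd i))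
        (closed_right c hY (hX.γd_closed i)).mem) :=
  hX.map_rel (P := cutGr c Y.toGradedOp X.toGradedOp)
    (fun p f => c.cutOp p (1 : Op Y.toGradedOp Y.toGradedOp) f)
    (fun p f g => cutOp_add_right c p _ f g)
    (fun p f g => cutOp_sub_right c p _ f g)
    (fun _ _ _ _ _ => cutOp_right_mul c) (fun _ _ hf => closed_right c hY hf)
    (fun p f hf => by
      have := IsNull.cut_right c hY.d_deg (IsClosedOp.one (M := Y.toGradedOp)) hf
      rwa [zero_add] at this)

theorem endMk_graded_comm_left {R : Type u} [CommRing R] {M : GradedOp R} {a F : Op M M} {q : ZMod 2}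
    (ha : a ∈ closedOps M M) (hF : F ∈ closedOps M M)
    (h : IsNull (M := M) (N := M) (q + 1) (a * F - sgn R q • (F * a))) :
    (q = 0 → endMk a ha * endMk F hF = endMk F hF * endMk a ha) ∧
      (q = 1 → endMk a ha * endMk F hF + endMk F hF * endMk a ha = 0) := by
  constructor
  · rintro rfl
    rw [sgn_zero, one_smul] at h
    exact endMk_comm_of_null ha hF h
  · rintro rfl
    rw [sgn_one, neg_one_smul, sub_neg_eq_add] at h
    exact endMk_anti_of_null ha hF h

theorem gammaDagger_left (hY : Y.IsRep (potDiff V U)) (i : Fin V.n) {q : ZMod 2}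
    {g : Op Y.toGradedOp Y.toGradedOp} (hg : IsClosedOp q g) :
    IsNull (M := cutGr c Y.toGradedOp X.toGradedOp) (N := cutGr c Y.toGradedOp X.toGradedOp) (q + 1)
      (c.gammaDagger Y.toGradedOp X.toGradedOp i * c.cutOp 0 g (1 : Op X.toGradedOp X.toGradedOp) -
        sgn (PolyRing W U) q • (c.cutOp 0 g (1 : Op X.toGradedOp X.toGradedOp) *
          c.gammaDagger Y.toGradedOp X.toGradedOp i)) := by
  have := gammaDagger_natural c i hY.d_deg hY.d_deg hg (IsClosedOp.one (M := X.toGradedOp))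
  rwa [add_zero] at this

theorem gammaDagger_right (hY : Y.IsRep (potDiff V U)) (i : Fin V.n) {q : ZMod 2}
    {f : Op X.toGradedOp X.toGradedOp} (hf : IsClosedOp q f) :
    IsNull (M := cutGr c Y.toGradedOp X.toGradedOp) (N := cutGr c Y.toGradedOp X.toGradedOp) (q + 1)
      (c.gammaDagger Y.toGradedOp X.toGradedOp i * c.cutOp q (1 : Op Y.toGradedOp Y.toGradedOp) f -
        sgn (PolyRing W U) q • (c.cutOp q (1 : Op Y.toGradedOp Y.toGradedOp) f *
          c.gammaDagger Y.toGradedOp X.toGradedOp i)) := by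
  have := gammaDagger_natural c i hY.d_deg hY.d_deg (IsClosedOp.one (M := Y.toGradedOp)) hf
  rwa [zero_add] at this

/-- An operator on Y gives a cut operator g | 1, so naturality of At and γ† yields all nontrivial
relations. Those with the unit 1 of the C_m-action are trivial. -/
theorem commute_left (hY : Y.IsRep (potDiff V U)) (hX : X.IsRep (potDiff W V)) :
    CliffordCommute (endMk (M := cutGr c Y.toGradedOp X.toGradedOp)
        (c.cutOp 0 Y.e (1 : Op X.toGradedOp X.toGradedOp)) (closed_left c hY hY.e_closed).mem)
      (fun i => endMk (c.cutOp 0 (Y.γ i) (1 : Op X.toGradedOp X.toGradedOp))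
        (closed_left c hY (hY.γ_closed i)).mem)
      (fun i => endMk (c.cutOp 0 (Y.γd i) (1 : Op X.toGradedOp X.toGradedOp))
        (closed_left c hY (hY.γd_closed i)).mem) 1
      (fun i => endMk (c.atiyah Y.toGradedOp X.toGradedOp i)
        (isClosedOp_atiyah c i hY.d_deg hX.d_deg hY.d_sq hX.d_sq).mem)
      (fun i => endMk (c.gammaDagger Y.toGradedOp X.toGradedOp i)
        (isClosedOp_gammaDagger c i hY.isMF hX.isMF).mem) where
  e_e := (mul_one _).trans (one_mul _).symm
  e_γ j := ((endMk_graded_comm_left _ _ (atiyah_left c hY j hY.e_closed)).1 rfl).symm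
  e_γd j := ((endMk_graded_comm_left _ _ (gammaDagger_left c hY j hY.e_closed)).1 rfl).symm
  γ_e _ := (mul_one _).trans (one_mul _).symm
  γd_e _ := (mul_one _).trans (one_mul _).symm
  γ_γ i j := (add_comm _ _).trans
    ((endMk_graded_comm_left _ _ (atiyah_left c hY j (hY.γ_closed i))).2 rfl)
  γ_γd i j := (add_comm _ _).trans
    ((endMk_graded_comm_left _ _ (gammaDagger_left c hY j (hY.γ_closed i))).2 rfl)
  γd_γ i j := (add_comm _ _).trans
    ((endMk_graded_comm_left _ _ (atiyah_left c hY j (hY.γd_closed i))).2 rfl)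
  γd_γd i j := (add_comm _ _).trans
    ((endMk_graded_comm_left _ _ (gammaDagger_left c hY j (hY.γd_closed i))).2 rfl)

theorem commute_right (hY : Y.IsRep (potDiff V U)) (hX : X.IsRep (potDiff W V)) :
    CliffordCommute (1 : End (cutGr c Y.toGradedOp X.toGradedOp))
      (fun i => endMk (c.atiyah Y.toGradedOp X.toGradedOp i)
        (isClosedOp_atiyah c i hY.d_deg hX.d_deg hY.d_sq hX.d_sq).mem)
      (fun i => endMk (c.gammaDagger Y.toGradedOp X.toGradedOp i)
        (isClosedOp_gammaDagger c i hY.isMF hX.isMF).mem)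
      (endMk (M := cutGr c Y.toGradedOp X.toGradedOp)
        (c.cutOp 0 (1 : Op Y.toGradedOp Y.toGradedOp) X.e) (closed_right c hY hX.e_closed).mem)
      (fun i => endMk (c.cutOp 1 (1 : Op Y.toGradedOp Y.toGradedOp) (X.γ i))
        (closed_right c hY (hX.γ_closed i)).mem)
      (fun i => endMk (c.cutOp 1 (1 : Op Y.toGradedOp Y.toGradedOp) (X.γd i))
        (closed_right c hY (hX.γd_closed i)).mem) where
  e_e := (one_mul _).trans (mul_one _).symm
  e_γ _ := (one_mul _).trans (mul_one _).symm
  e_γd _ := (one_mul _).trans (mul_one _).symm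
  γ_e i := (endMk_graded_comm_left _ _ (atiyah_right c hY i hX.e_closed)).1 rfl
  γd_e i := (endMk_graded_comm_left _ _ (gammaDagger_right c hY i hX.e_closed)).1 rfl
  γ_γ i j := (endMk_graded_comm_left _ _ (atiyah_right c hY i (hX.γ_closed j))).2 rfl
  γ_γd i j := (endMk_graded_comm_left _ _ (atiyah_right c hY i (hX.γd_closed j))).2 rfl
  γd_γ i j := (endMk_graded_comm_left _ _ (gammaDagger_right c hY i (hX.γ_closed j))).2 rfl
  γd_γd i j := (endMk_graded_comm_left _ _ (gammaDagger_right c hY i (hX.γd_closed j))).2 rfl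

theorem endMk_left_right_comm {p q : ZMod 2} {g : Op Y.toGradedOp Y.toGradedOp}
    (hg : HasDeg q g) (f : Op X.toGradedOp X.toGradedOp)
    (h1 : c.cutOp 0 g (1 : Op X.toGradedOp X.toGradedOp) ∈ closedOps
      (cutGr c Y.toGradedOp X.toGradedOp) (cutGr c Y.toGradedOp X.toGradedOp))
    (h2 : c.cutOp p (1 : Op Y.toGradedOp Y.toGradedOp) f ∈ closedOps
      (cutGr c Y.toGradedOp X.toGradedOp) (cutGr c Y.toGradedOp X.toGradedOp)) :
    (p * q = 0 → endMk _ h1 * endMk _ h2 = endMk _ h2 * endMk _ h1) ∧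
      (p * q = 1 → endMk _ h1 * endMk _ h2 + endMk _ h2 * endMk _ h1 = 0) := by
  constructor <;> intro h <;> rw [endMk_mul, endMk_mul]
  · refine endMk_congr _ _ ?_
    rw [cutOp_left_right, cutOp_right_left c hg, h, sgn_zero, one_smul]
  · rw [endMk_add, endMk_zero]
    refine endMk_congr _ _ ?_
    rw [cutOp_left_right, cutOp_right_left c hg, h, sgn_one, neg_one_smul, add_neg_cancel]

/-- These relations are strict: the two orders of composition differ by the Koszul sign. -/
theorem commute_left_right (hY : Y.IsRep (potDiff V U)) (hX : X.IsRep (potDiff W V)) :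
    CliffordCommute (endMk (M := cutGr c Y.toGradedOp X.toGradedOp)
        (c.cutOp 0 Y.e (1 : Op X.toGradedOp X.toGradedOp)) (closed_left c hY hY.e_closed).mem)
      (fun i => endMk (c.cutOp 0 (Y.γ i) (1 : Op X.toGradedOp X.toGradedOp))
        (closed_left c hY (hY.γ_closed i)).mem)
      (fun i => endMk (c.cutOp 0 (Y.γd i) (1 : Op X.toGradedOp X.toGradedOp))
        (closed_left c hY (hY.γd_closed i)).mem)
      (endMk (M := cutGr c Y.toGradedOp X.toGradedOp)
        (c.cutOp 0 (1 : Op Y.toGradedOp Y.toGradedOp) X.e) (closed_right c hY hX.e_closed).mem)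
      (fun i => endMk (c.cutOp 1 (1 : Op Y.toGradedOp Y.toGradedOp) (X.γ i))
        (closed_right c hY (hX.γ_closed i)).mem)
      (fun i => endMk (c.cutOp 1 (1 : Op Y.toGradedOp Y.toGradedOp) (X.γd i))
        (closed_right c hY (hX.γd_closed i)).mem) where
  e_e := (endMk_left_right_comm c hY.e_closed.1 X.e _ _).1 (mul_zero _)
  e_γ j := (endMk_left_right_comm c hY.e_closed.1 (X.γ j) _ _).1 (mul_zero _)
  e_γd j := (endMk_left_right_comm c hY.e_closed.1 (X.γd j) _ _).1 (mul_zero _)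
  γ_e i := (endMk_left_right_comm c (hY.γ_closed i).1 X.e _ _).1 (zero_mul _)
  γd_e i := (endMk_left_right_comm c (hY.γd_closed i).1 X.e _ _).1 (zero_mul _)
  γ_γ i j := (endMk_left_right_comm c (hY.γ_closed i).1 (X.γ j) _ _).2 (mul_one _)
  γ_γd i j := (endMk_left_right_comm c (hY.γ_closed i).1 (X.γd j) _ _).2 (mul_one _)
  γd_γ i j := (endMk_left_right_comm c (hY.γd_closed i).1 (X.γ j) _ _).2 (mul_one _)
  γd_γd i j := (endMk_left_right_comm c (hY.γd_closed i).1 (X.γd j) _ _).2 (mul_one _)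

theorem closed_cut_γ (hY : Y.IsRep (potDiff V U)) (hX : X.IsRep (potDiff W V))
    (i : Fin (cut c Y X).n) : IsClosedOp (M := cutGr c Y.toGradedOp X.toGradedOp)
      (N := cutGr c Y.toGradedOp X.toGradedOp) 1 ((cut c Y X).γ i) := by
  revert i
  change ∀ i : Fin (Y.n + V.n + X.n), _
  refine Fin.addCases (fun i => ?_) fun l => ?_
  · revert i
    refine Fin.addCases (fun j => ?_) fun i => ?_
    · simp only [cut, Fin.append_left]
      exact IsClosedOp.cut c (q := 1) (p := 0) hY.d_deg (hY.γ_closed j) hX.e_closed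
    · simp only [cut, Fin.append_left, Fin.append_right]
      exact IsClosedOp.mul (p := 0) (q := 1)
        (isClosedOp_atiyah c i hY.d_deg hX.d_deg hY.d_sq hX.d_sq) (closed_cut_e c hY hX)
  · simp only [cut, Fin.append_right]
    exact IsClosedOp.cut c (q := 0) (p := 1) hY.d_deg hY.e_closed (hX.γ_closed l)

theorem closed_cut_γd (hY : Y.IsRep (potDiff V U)) (hX : X.IsRep (potDiff W V))
    (i : Fin (cut c Y X).n) : IsClosedOp (M := cutGr c Y.toGradedOp X.toGradedOp)
      (N := cutGr c Y.toGradedOp X.toGradedOp) 1 ((cut c Y X).γd i) := by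
  revert i
  change ∀ i : Fin (Y.n + V.n + X.n), _
  refine Fin.addCases (fun i => ?_) fun l => ?_
  · revert i
    refine Fin.addCases (fun j => ?_) fun i => ?_
    · simp only [cut, Fin.append_left]
      exact IsClosedOp.cut c (q := 1) (p := 0) hY.d_deg (hY.γd_closed j) hX.e_closed
    · simp only [cut, Fin.append_left, Fin.append_right]
      exact IsClosedOp.mul (p := 0) (q := 1)
        (isClosedOp_gammaDagger c i hY.isMF hX.isMF) (closed_cut_e c hY hX)
  · simp only [cut, Fin.append_right]
    exact IsClosedOp.cut c (q := 0) (p := 1) hY.d_deg hY.e_closed (hX.γd_closed l)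

/-- The middle factor is the idempotent of the C_m-action. It is kept so that the expression is
literally that of an iterated product of Clifford actions. -/
theorem endMk_cut_e (hY : Y.IsRep (potDiff V U)) (hX : X.IsRep (potDiff W V)) :
    endMk (M := cutGr c Y.toGradedOp X.toGradedOp) (c.cutOp 0 Y.e X.e) (closed_cut_e c hY hX).mem =
      endMk (M := cutGr c Y.toGradedOp X.toGradedOp) _ (closed_left c hY hY.e_closed).mem * 1 *
      endMk (M := cutGr c Y.toGradedOp X.toGradedOp) _ (closed_right c hY hX.e_closed).mem := by
  rw [mul_one, endMk_mul]
  exact endMk_congr _ _ (cutOp_left_right c _ _).symm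

/-- The generators of the cut are those of an iterated product, Y with C_m first and X last. In each
block the idempotents of the other actions have been multiplied into e_Y | e_X or into one of its
two factors. -/
theorem endMk_cut_γ (hY : Y.IsRep (potDiff V U)) (hX : X.IsRep (potDiff W V)) :
    (fun i => endMk (M := cutGr c Y.toGradedOp X.toGradedOp) ((cut c Y X).γ i)
        (closed_cut_γ c hY hX i).mem) =
      prodGen (endMk (M := cutGr c Y.toGradedOp X.toGradedOp) _
          (closed_left c hY hY.e_closed).mem * 1)
        (prodGen (endMk (M := cutGr c Y.toGradedOp X.toGradedOp) _
            (closed_left c hY hY.e_closed).mem)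
          (fun i => endMk _ (closed_left c hY (hY.γ_closed i)).mem) 1
          (fun i => endMk _ (isClosedOp_atiyah c i hY.d_deg hX.d_deg hY.d_sq hX.d_sq).mem))
        (endMk (M := cutGr c Y.toGradedOp X.toGradedOp) _ (closed_right c hY hX.e_closed).mem)
        (fun i => endMk _ (closed_right c hY (hX.γ_closed i)).mem) := by
  funext i
  revert i
  change ∀ i : Fin (Y.n + V.n + X.n), _
  refine Fin.addCases (fun i => ?_) fun l => ?_
  · revert i
    refine Fin.addCases (fun j => ?_) fun i => ?_
    · simp only [prodGen, Fin.append_left]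
      rw [mul_one, endMk_mul]
      refine endMk_congr _ _ ?_
      simp only [cut, Fin.append_left]
      exact (cutOp_left_right c _ _).symm
    · simp only [prodGen, Fin.append_left, Fin.append_right]
      rw [endMk_mul, endMk_mul]
      refine endMk_congr _ _ ?_
      simp only [cut, Fin.append_left, Fin.append_right]
      rw [Matrix.mul_assoc, cutOp_left_right]
  · simp only [prodGen, Fin.append_right]
    rw [mul_one, endMk_mul]
    refine endMk_congr _ _ ?_
    simp only [cut, Fin.append_right]
    rw [cutOp_right_left c hY.e_closed.1, mul_zero, sgn_zero, one_smul]

theorem endMk_cut_γd (hY : Y.IsRep (potDiff V U)) (hX : X.IsRep (potDiff W V)) :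
    (fun i => endMk (M := cutGr c Y.toGradedOp X.toGradedOp) ((cut c Y X).γd i)
        (closed_cut_γd c hY hX i).mem) =
      prodGen (endMk (M := cutGr c Y.toGradedOp X.toGradedOp) _
          (closed_left c hY hY.e_closed).mem * 1)
        (prodGen (endMk (M := cutGr c Y.toGradedOp X.toGradedOp) _
            (closed_left c hY hY.e_closed).mem)
          (fun i => endMk _ (closed_left c hY (hY.γd_closed i)).mem) 1
          (fun i => endMk _ (isClosedOp_gammaDagger c i hY.isMF hX.isMF).mem))
        (endMk (M := cutGr c Y.toGradedOp X.toGradedOp) _ (closed_right c hY hX.e_closed).mem)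
        (fun i => endMk _ (closed_right c hY (hX.γd_closed i)).mem) := by
  funext i
  revert i
  change ∀ i : Fin (Y.n + V.n + X.n), _
  refine Fin.addCases (fun i => ?_) fun l => ?_
  · revert i
    refine Fin.addCases (fun j => ?_) fun i => ?_
    · simp only [prodGen, Fin.append_left]
      rw [mul_one, endMk_mul]
      refine endMk_congr _ _ ?_
      simp only [cut, Fin.append_left]
      exact (cutOp_left_right c _ _).symm
    · simp only [prodGen, Fin.append_left, Fin.append_right]
      rw [endMk_mul, endMk_mul]
      refine endMk_congr _ _ ?_
      simp only [cut, Fin.append_left, Fin.append_right]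
      rw [Matrix.mul_assoc, cutOp_left_right]
  · simp only [prodGen, Fin.append_right]
    rw [mul_one, endMk_mul]
    refine endMk_congr _ _ ?_
    simp only [cut, Fin.append_right]
    rw [cutOp_right_left c hY.e_closed.1, mul_zero, sgn_zero, one_smul]

/-- The cut of two `1`-morphisms is a `1`-morphism. -/
theorem cut_isRep (hY : Y.IsRep (potDiff V U)) (hX : X.IsRep (potDiff W V)) :
    (cut c Y X).IsRep (potDiff W U) := by
  have hMF := hY.isMF.cut c hX.isMF
  refine isRep_of_rel hMF.d_deg hMF.d_sq (closed_cut_e c hY hX) (closed_cut_γ c hY hX)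
    (closed_cut_γd c hY hX) ?_
  have h := (((rel_left c hY).prod (cliffordRel_cut c hY.isMF hX.isMF)
    (commute_left c hY hX)).prod (rel_right c hY hX)
    ((commute_left_right c hY hX).prod_left (commute_right c hY hX)))
  rw [← endMk_cut_e c hY hX, ← endMk_cut_γ c hY hX, ← endMk_cut_γd c hY hX] at h
  exact h

theorem closed_cutIdem {Y : GradedOp (PolyRing V U)} {X : GradedOp (PolyRing W V)}
    (hY : IsMF (potDiff V U) Y) (hX : IsMF (potDiff W V) X) :
    IsClosedOp (M := cutGr c Y X) (N := cutGr c Y X) 0 (c.cutIdem Y X) :=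
  IsClosedOp.nest (M := cutGr c Y X)
    (fun i => isClosedOp_atiyah c i hY.d_deg hX.d_deg hY.d_sq hX.d_sq)
    (fun i => isClosedOp_gammaDagger c i hY hX) IsClosedOp.one

/-- The unit of an iterated product of three actions is the product of their units, the middle one
being e_m. The outer two are cuts of units of Y and X, because g ↦ g | 1 and f ↦ 1 | f are
multiplicative. -/
theorem cut_unit (hY : Y.IsRep (potDiff V U)) (hX : X.IsRep (potDiff W V)) :
    Htpy (M := cutGr c Y.toGradedOp X.toGradedOp) (N := cutGr c Y.toGradedOp X.toGradedOp) 0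
      (cut c Y X).unit (c.cutOp 0 Y.unit (1 : Op X.toGradedOp X.toGradedOp) *
        c.cutIdem Y.toGradedOp X.toGradedOp *
        c.cutOp 0 (1 : Op Y.toGradedOp Y.toGradedOp) X.unit) := by
  have hMF := hY.isMF.cut c hX.isMF
  have h := ringNest_prod ((rel_left c hY).prod (cliffordRel_cut c hY.isMF hX.isMF)
    (commute_left c hY hX)) (rel_right c hY hX)
    ((commute_left_right c hY hX).prod_left (commute_right c hY hX))
  rw [ringNest_prod (rel_left c hY) (cliffordRel_cut c hY.isMF hX.isMF) (commute_left c hY hX),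
    ← endMk_cut_e c hY hX, ← endMk_cut_γ c hY hX, ← endMk_cut_γd c hY hX] at h
  have hu := IsClosedOp.nest (closed_cut_γ c hY hX) (closed_cut_γd c hY hX) (closed_cut_e c hY hX)
  have h1 := IsClosedOp.nest (M := cutGr c Y.toGradedOp X.toGradedOp)
    (fun i => closed_left c (X := X) hY (hY.γ_closed i))
    (fun i => closed_left c hY (hY.γd_closed i)) (closed_left c hY hY.e_closed)
  have h3 := IsClosedOp.nest (M := cutGr c Y.toGradedOp X.toGradedOp)
    (fun i => closed_right c hY (hX.γ_closed i))
    (fun i => closed_right c hY (hX.γd_closed i)) (closed_right c hY hX.e_closed)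
  have h2 := closed_cutIdem c hY.isMF hX.isMF
  have h' := (endMk_nest (M := cutGr c Y.toGradedOp X.toGradedOp)
    (fun i => (closed_cut_γ c hY hX i).mem) (fun i => (closed_cut_γd c hY hX i).mem)
    (closed_cut_e c hY hX).mem hu.mem).trans (h.trans (congrArg₂ (· * ·) (congrArg₂ (· * ·)
      (endMk_nest _ _ _ h1.mem).symm (endMk_nest _ _ _ h2.mem).symm)
      (endMk_nest _ _ _ h3.mem).symm))
  -- A nest of operators g | 1 is the image of the nest formed on Y. The same holds for X below.
  have e1 := map_nest (P := cutGr c Y.toGradedOp X.toGradedOp)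
    (fun _ g => c.cutOp 0 g (1 : Op X.toGradedOp X.toGradedOp))
    (fun _ _ _ _ hg => cutOp_left_mul c hg) (fun i => (hY.γ_closed i).1)
    (fun i => (hY.γd_closed i).1) hY.e_closed.1
  have e3 := map_nest (P := cutGr c Y.toGradedOp X.toGradedOp)
    (fun p f => c.cutOp p (1 : Op Y.toGradedOp Y.toGradedOp) f)
    (fun _ _ _ _ _ => cutOp_right_mul c) (fun i => (hX.γ_closed i).1)
    (fun i => (hX.γd_closed i).1) hX.e_closed.1
  have key := htpy_of_hoMk_eq hMF.d_deg hMF.d_deg hu.1 (IsClosedOp.mul (p := 0) (q := 0)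
    (IsClosedOp.mul (p := 0) (q := 0) h1 h2) h3).1 h'
  rw [show nest _ _ _ = _ from e1, show nest _ _ _ = _ from e3] at key
  exact key

/-- The idempotent of a cut commutes up to homotopy with even closed operators. -/
theorem cutIdem_natural {Y Y' : GradedOp (PolyRing V U)} {X X' : GradedOp (PolyRing W V)}
    (hY : IsMF (potDiff V U) Y) (hX : IsMF (potDiff W V) X) (hY' : IsMF (potDiff V U) Y')
    (hX' : IsMF (potDiff W V) X') {g : Op Y Y'} {f : Op X X'} (hg : IsClosedOp 0 g)
    (hf : IsClosedOp 0 f) : Htpy (M := cutGr c Y X) (N := cutGr c Y' X') 0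
      (c.cutIdem Y' X' * c.cutOp 0 g f) (c.cutOp 0 g f * c.cutIdem Y X) := by
  refine nest_intertwine (M := cutGr c Y X) (N := cutGr c Y' X')
    (fun i => isClosedOp_gammaDagger c i hY hX)
    (fun i => isClosedOp_atiyah c i hY'.d_deg hX'.d_deg hY'.d_sq hX'.d_sq)
    (fun i => isClosedOp_atiyah c i hY.d_deg hX.d_deg hY.d_sq hX.d_sq)
    (fun i => isClosedOp_gammaDagger c i hY' hX') IsClosedOp.one IsClosedOp.one ?_
    (fun i => ?_) fun i => ?_
  · rw [Matrix.one_mul, Matrix.mul_one]; exact Htpy.refl _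
  · have := atiyah_natural c i hY.d_deg hg hf
    rwa [add_zero, sgn_zero, one_smul] at this
  · have := gammaDagger_natural c i hY.d_deg hY'.d_deg hg hf
    rwa [add_zero, sgn_zero, one_smul] at this

end CutRep

/-! ### Operators that commute with the units -/

section LinHom

variable {R : Type u} [CommRing R] {W : R} {M N P : CliffordRep R W}

theorem mem_cycles_of_htpy {f g : Op M.data.toGradedOp N.data.toGradedOp}
    (hf : f ∈ cycles M.data N.data) (hg : IsClosedOp 0 g) (h : Htpy 0 f g) :
    g ∈ cycles M.data N.data := by
  obtain ⟨-, h2, h3, h4, h5⟩ := hf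
  refine ⟨hg, ?_, ?_, fun i => ?_, fun i => ?_⟩
  · exact ((Htpy.mul_right (p := 0) (q := 0) M.isRep.e_closed h).symm.trans h2).trans h
  · exact ((Htpy.mul_left (p := 0) (q := 0) N.isRep.e_closed h).symm.trans h3).trans h
  · exact htpy_zero_iff.1 ((Htpy.mul_right (p := 1) (q := 0) (M.isRep.γd_closed i) h).symm.trans
      (htpy_zero_iff.2 (h4 i)))
  · exact htpy_zero_iff.1 ((Htpy.mul_left (p := 0) (q := 1) (N.isRep.γ_closed i) h).symm.trans
      (htpy_zero_iff.2 (h5 i)))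

theorem mul_unit_htpy {f : Op M.data.toGradedOp N.data.toGradedOp} (hf : f ∈ cycles M.data N.data) :
    Htpy 0 (f * M.data.unit) f :=
  mul_nestList M.isRep hf.1 hf.2.1 hf.2.2.2.1 _ (List.nodup_finRange _)

theorem unit_mul_htpy {f : Op M.data.toGradedOp N.data.toGradedOp} (hf : f ∈ cycles M.data N.data) :
    Htpy 0 (N.data.unit * f) f :=
  nestList_mul N.isRep hf.1 hf.2.2.1 hf.2.2.2.2 _ (List.nodup_finRange _)

/-- An even closed operator which commutes up to homotopy with the units. -/
structure Intertwines (M N : CliffordRep R W) (A : Op M.data.toGradedOp N.data.toGradedOp) :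
    Prop where
  closed : IsClosedOp 0 A
  unit : Htpy 0 (N.data.unit * A) (A * M.data.unit)

theorem Intertwines.one (M : CliffordRep R W) : Intertwines M M 1 :=
  ⟨IsClosedOp.one, by rw [Matrix.one_mul, Matrix.mul_one]; exact Htpy.refl _⟩

theorem Intertwines.mul {A : Op M.data.toGradedOp N.data.toGradedOp}
    {B : Op N.data.toGradedOp P.data.toGradedOp} (hA : Intertwines M N A)
    (hB : Intertwines N P B) : Intertwines M P (B * A : Op M.data.toGradedOp P.data.toGradedOp) := by
  refine ⟨IsClosedOp.mul (p := 0) (q := 0) hB.closed hA.closed, ?_⟩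
  have h1 := Htpy.mul_right (p := 0) (q := 0) hA.closed hB.unit
  have h2 := Htpy.mul_left (p := 0) (q := 0) hB.closed hA.unit
  simp only [Matrix.mul_assoc] at h1 h2 ⊢
  exact h1.trans h2

/-- Closedness and commutation with the units are conjugated by B. Both are compatible with
multiplication by the even operators A and B. -/
theorem Intertwines.inv {A : Op M.data.toGradedOp N.data.toGradedOp}
    {B : Op N.data.toGradedOp M.data.toGradedOp} (hA : Intertwines M N A) (hB : HasDeg 0 B)
    (h1 : (B * A : Op M.data.toGradedOp M.data.toGradedOp) = 1)
    (h2 : (A * B : Op N.data.toGradedOp N.data.toGradedOp) = 1) : Intertwines N M B := by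
  have hc : IsClosedOp 0 B := by
    refine ⟨hB, ?_⟩
    have h3 := hA.closed.2
    rw [sgn_zero, one_smul] at h3 ⊢
    calc M.data.d * B = B * (A * M.data.d) * B := by
          rw [← Matrix.mul_assoc B, h1, Matrix.one_mul]
      _ = B * N.data.d * (A * B) := by rw [← h3]; simp only [Matrix.mul_assoc]
      _ = B * N.data.d := by rw [h2, Matrix.mul_one]
  refine ⟨hc, ?_⟩
  have h3 := Htpy.mul_right (p := 0) (q := 0) hc (Htpy.mul_left (p := 0) (q := 0) hc hA.unit)
  have e1 : B * (N.data.unit * A) * B = B * N.data.unit := by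
    rw [Matrix.mul_assoc, Matrix.mul_assoc, h2, Matrix.mul_one]
  have e2 : B * (A * M.data.unit) * B = M.data.unit * B := by
    rw [← Matrix.mul_assoc B, h1, Matrix.one_mul]
  rw [e1, e2] at h3
  exact h3.symm

theorem nest_cast {ι : Type*} [Fintype ι] {m n : ℕ} (h : m = n) (γ γd : Fin n → Matrix ι ι R)
    (x : Matrix ι ι R) :
    nest (fun i => γ (Fin.cast h i)) (fun i => γd (Fin.cast h i)) x = nest γ γd x := by
  subst h; rfl

/-- The unit is a nested product of the idempotent and the generators, so commutation with these
passes to it. -/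
theorem IsCliffordLinear.intertwines {hn : M.data.n = N.data.n}
    {A : Op M.data.toGradedOp N.data.toGradedOp} (hA : IsCliffordLinear hn A) :
    Intertwines M N A := by
  refine ⟨hA.1, ?_⟩
  rw [CliffordData.unit, ← nest_cast hn]
  exact nest_intertwine (fun i => M.isRep.γd_closed i) (fun i => N.isRep.γ_closed _)
    (fun i => M.isRep.γ_closed i) (fun i => N.isRep.γd_closed _) M.isRep.e_closed N.isRep.e_closed
    hA.2.1.symm (fun i => (hA.2.2.1 i).symm) fun i => (hA.2.2.2 i).symm

/-- The shift of an object. -/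
def CliffordRep.shift (M : CliffordRep R W) : CliffordRep R W := ⟨M.data.shift, M.isRep.shift⟩

theorem Intertwines.shift {A : Op M.data.toGradedOp N.data.toGradedOp} (hA : Intertwines M N A) :
    Intertwines M.shift N.shift A := by
  refine ⟨hA.closed.shift, ?_⟩
  have h : ∀ (u : Matrix N.data.ι N.data.ι R) (v : Matrix M.data.ι M.data.ι R),
      u = N.data.unit → v = M.data.unit →
      IsNull (M := M.data.toGradedOp.shift) (N := N.data.toGradedOp.shift) 0 (u * A - A * v) := by
    rintro _ _ rfl rfl
    exact IsNull.shift hA.unit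
  exact h _ _ (unit_shift _) (unit_shift _)

/-- The identity matrix. -/
def idOp (M : GradedOp R) : Matrix M.ι M.ι R := 1

/-- Shifting twice restores parity and signs. The identity matrix serves as an operator between the
two objects, so no cast along an equality of objects is needed. -/
theorem Intertwines.shiftShift (M : CliffordRep R W) :
    Intertwines M.shift.shift M (idOp M.data.toGradedOp) := by
  refine ⟨⟨?_, ?_⟩, ?_⟩
  · intro i j hij
    refine Matrix.one_apply_ne fun h => hij ?_
    change _ = M.data.par j + 1 + 1 + 0
    rw [zmod_two_add_one_add_one, add_zero, h]
  · have h : ∀ d : Matrix M.data.ι M.data.ι R,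
        d * idOp M.data.toGradedOp = sgn R 0 • (idOp M.data.toGradedOp * (- -d)) := fun d => by
      rw [sgn_zero, one_smul, neg_neg, idOp, Matrix.one_mul, Matrix.mul_one]
    exact h _
  · have h : ∀ u v : Matrix M.data.ι M.data.ι R, v = u →
        u * idOp M.data.toGradedOp = idOp M.data.toGradedOp * v := fun u v e => by
      rw [idOp, Matrix.one_mul, Matrix.mul_one, e]
    exact htpy_of_eq (h _ _ ((unit_shift M.data.shift).trans (unit_shift M.data)))

end LinHom

/-! ### The 2-morphisms induced by such operators -/

section LinHom

variable {R : Type u} [CommRing R] [Algebra ℚ R] {W : R} {M N P : CliffordRep R W}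

theorem CliffordRep.homMk_eq {f g : Op M.data.toGradedOp N.data.toGradedOp}
    {hf : f ∈ cycles M.data N.data} {hg : g ∈ cycles M.data N.data} (h : Htpy 0 f g) :
    CliffordRep.homMk f hf = CliffordRep.homMk g hg := (TwoMor.mk_eq_mk hf hg).2 h

theorem CliffordRep.homMk_ind {Q : (M ⟶ N) → Prop} (h : ∀ f hf, Q (CliffordRep.homMk f hf))
    (x : M ⟶ N) : Q x := TwoMor.ind h x

theorem CliffordRep.homMk_comp {f : Op M.data.toGradedOp N.data.toGradedOp}
    {g : Op N.data.toGradedOp P.data.toGradedOp}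
    (hf : f ∈ cycles M.data N.data) (hg : g ∈ cycles N.data P.data) :
    CliffordRep.homMk f hf ≫ CliffordRep.homMk g hg =
      CliffordRep.homMk (g * f : Op M.data.toGradedOp P.data.toGradedOp)
        (mul_mem_cycles hf hg) := rfl

/-- The conditions on the right are inherited from the unit of M. Those on the left follow after
replacing A u_M by u_N A. Commutation with the individual generators is not needed. -/
theorem Intertwines.mem {A : Op M.data.toGradedOp N.data.toGradedOp} (hA : Intertwines M N A) :
    A * M.data.unit ∈ cycles M.data N.data := by
  have hu := unit_mem_cycles M.isRep
  have hu' := unit_mem_cycles N.isRep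
  have c := IsClosedOp.mul (p := 0) (q := 0) hA.closed hu.1
  refine ⟨c, ?_, ?_, fun i => ?_, fun i => ?_⟩
  · rw [Matrix.mul_assoc]
    exact Htpy.mul_left (p := 0) (q := 0) hA.closed hu.2.1
  · have h1 : Htpy 0 (N.data.e * (N.data.unit * A)) (N.data.unit * A) := by
      rw [← Matrix.mul_assoc]
      exact Htpy.mul_right (p := 0) (q := 0) hA.closed hu'.2.2.1
    exact ((Htpy.mul_left (p := 0) (q := 0) N.isRep.e_closed hA.unit).symm.trans h1).trans hA.unit
  · rw [Matrix.mul_assoc]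
    exact IsNull.mul_left (p := 1) (q := 0) hA.closed (hu.2.2.2.1 i)
  · have h1 : IsNull 1 (N.data.γ i * (N.data.unit * A)) := by
      rw [← Matrix.mul_assoc]
      exact IsNull.mul_right (p := 0) (q := 1) (hu'.2.2.2.2 i) hA.closed
    exact htpy_zero_iff.1 ((Htpy.mul_left (p := 0) (q := 1) (N.isRep.γ_closed i) hA.unit).symm.trans
      (htpy_zero_iff.2 h1))

/-- The `2`-morphism induced by an operator which commutes with the units. -/
def linHom {A : Op M.data.toGradedOp N.data.toGradedOp} (hA : Intertwines M N A) : M ⟶ N :=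
  CliffordRep.homMk _ hA.mem

theorem linHom_one (M : CliffordRep R W) : linHom (Intertwines.one M) = 𝟙 M :=
  CliffordRep.homMk_eq (hg := unit_mem_cycles M.isRep) (htpy_of_eq (Matrix.one_mul _))

/-- The unit inside the induced 2-morphism acts as the identity on f up to homotopy, so composites
are computed with A itself. -/
theorem homMk_comp_linHom {f : Op M.data.toGradedOp N.data.toGradedOp}
    {A : Op N.data.toGradedOp P.data.toGradedOp} (hf : f ∈ cycles M.data N.data)
    (hA : Intertwines N P A) (h : (A * f : Op M.data.toGradedOp P.data.toGradedOp) ∈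
      cycles M.data P.data) :
    CliffordRep.homMk f hf ≫ linHom hA = CliffordRep.homMk (A * f) h := by
  rw [linHom, CliffordRep.homMk_comp]
  refine CliffordRep.homMk_eq ?_
  rw [Matrix.mul_assoc]
  exact Htpy.mul_left (p := 0) (q := 0) hA.closed (unit_mul_htpy hf)

theorem linHom_comp_homMk {A : Op M.data.toGradedOp N.data.toGradedOp}
    {g : Op N.data.toGradedOp P.data.toGradedOp} (hA : Intertwines M N A)
    (hg : g ∈ cycles N.data P.data) (h : (g * A : Op M.data.toGradedOp P.data.toGradedOp) ∈
      cycles M.data P.data) :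
    linHom hA ≫ CliffordRep.homMk g hg = CliffordRep.homMk (g * A) h := by
  rw [linHom, CliffordRep.homMk_comp]
  refine CliffordRep.homMk_eq ?_
  rw [← Matrix.mul_assoc]
  exact mul_unit_htpy h

theorem linHom_congr {A B : Op M.data.toGradedOp N.data.toGradedOp} {hA : Intertwines M N A}
    {hB : Intertwines M N B} (h : A = B) : linHom hA = linHom hB := by subst h; rfl

theorem linHom_comp {A : Op M.data.toGradedOp N.data.toGradedOp}
    {B : Op N.data.toGradedOp P.data.toGradedOp} (hA : Intertwines M N A)
    (hB : Intertwines N P B) : linHom hA ≫ linHom hB = linHom (hA.mul hB) := by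
  have h : (B * (A * M.data.unit) : Op M.data.toGradedOp P.data.toGradedOp) ∈
      cycles M.data P.data := by rw [← Matrix.mul_assoc]; exact (hA.mul hB).mem
  refine (homMk_comp_linHom hA.mem hB h).trans ?_
  exact CliffordRep.homMk_eq (htpy_of_eq (Matrix.mul_assoc _ _ _).symm)

/-- Mutually inverse operators induce an isomorphism. -/
def linIso {A : Op M.data.toGradedOp N.data.toGradedOp} {B : Op N.data.toGradedOp M.data.toGradedOp}
    (hA : Intertwines M N A) (hB : Intertwines N M B)
    (h1 : (B * A : Op M.data.toGradedOp M.data.toGradedOp) = 1)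
    (h2 : (A * B : Op N.data.toGradedOp N.data.toGradedOp) = 1) : M ≅ N where
  hom := linHom hA
  inv := linHom hB
  hom_inv_id := by
    rw [linHom_comp, ← linHom_one]; exact linHom_congr h1
  inv_hom_id := by
    rw [linHom_comp, ← linHom_one]; exact linHom_congr h2

theorem shift_linHom {k : Type u} [CommRing k] [Algebra k R]
    {A : Op M.data.toGradedOp N.data.toGradedOp} (hA : Intertwines M N A) :
    (CutSystem.shift k).map (linHom hA) = linHom hA.shift :=
  CliffordRep.homMk_eq (M := M.shift) (N := N.shift) (hf := shift_mem_cycles hA.mem)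
    (htpy_of_eq (congrArg (fun z => A * z) (unit_shift M.data).symm))

theorem shiftShift_eq {k : Type u} [CommRing k] [Algebra k R] (M : CliffordRep R W) :
    CutSystem.shiftShift k M = linHom (Intertwines.shiftShift M) :=
  CliffordRep.homMk_eq (M := M.shift.shift) (N := M) (hf := (unit_mem_shiftShift M.isRep).1)
    (htpy_of_eq (((unit_shift M.data.shift).trans (unit_shift M.data)).symm.trans
      (Matrix.one_mul _).symm))

end LinHom

/-! ### Homotopies multiplied by operators of known parity -/

section Even

variable {R : Type u} [CommRing R] {M N P : GradedOp R} {p : ZMod 2}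

theorem Htpy.even_mul {g : Op N P} {f f' : Op M N} (hg : IsClosedOp 0 g) (h : Htpy p f f') :
    Htpy p (g * f : Op M P) (g * f') := by
  have := Htpy.mul_left hg h; rwa [add_zero] at this

theorem Htpy.mul_even {g g' : Op N P} {f : Op M N} (hf : IsClosedOp 0 f) (h : Htpy p g g') :
    Htpy p (g * f : Op M P) (g' * f) := by
  have := Htpy.mul_right hf h; rwa [zero_add] at this

theorem IsNull.even_mul {g : Op N P} {f : Op M N} (hg : IsClosedOp 0 g) (h : IsNull p f) :
    IsNull p (g * f : Op M P) := by
  have := IsNull.mul_left hg h; rwa [add_zero] at this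

theorem IsNull.mul_even {g : Op N P} {f : Op M N} (hf : IsClosedOp 0 f) (h : IsNull p g) :
    IsNull p (g * f : Op M P) := by
  have := IsNull.mul_right h hf; rwa [zero_add] at this

theorem IsClosedOp.even_mul {g : Op N P} {f : Op M N} (hg : IsClosedOp 0 g) (h : IsClosedOp p f) :
    IsClosedOp p (g * f : Op M P) := by
  have := IsClosedOp.mul hg h; rwa [add_zero] at this

theorem IsNull.of_htpy {f g : Op M N} (h : Htpy p f g) (hg : IsNull p g) : IsNull p f :=
  htpy_zero_iff.1 (h.trans (htpy_zero_iff.2 hg))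

theorem Htpy.odd_mul {g : Op N P} {f f' : Op M N} (hg : IsClosedOp 1 g) (h : Htpy 0 f f') :
    Htpy 1 (g * f : Op M P) (g * f') := by
  have := Htpy.mul_left hg h; rwa [zero_add] at this

/-- Since I' F ≃ F I, each condition can be tested on the more convenient of the two forms:
annihilation of the γ† of M on I' F, annihilation by the γ of N on F I. -/
theorem mem_cycles_of_natural {M N : CliffordData R} {I : Op M.toGradedOp M.toGradedOp}
    {I' : Op N.toGradedOp N.toGradedOp} {F : Op M.toGradedOp N.toGradedOp}
    (hI' : IsClosedOp 0 I') (hF : IsClosedOp 0 F)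
    (hγ : ∀ i, IsClosedOp 1 (N.γ i)) (nat : Htpy 0 (I' * F) (F * I))
    (he : Htpy 0 (N.e * I') (I' * N.e)) (hFe : Htpy 0 (F * M.e) F) (heF : Htpy 0 (N.e * F) F)
    (h1 : ∀ i, IsNull 1 (I' * (F * M.γd i))) (h2 : ∀ i, IsNull 1 (N.γ i * (F * I))) :
    I' * F ∈ cycles M N := by
  refine ⟨hI'.even_mul hF, ?_, ?_, fun i => ?_, fun i => IsNull.of_htpy (nat.odd_mul (hγ i)) (h2 i)⟩
  · rw [Matrix.mul_assoc]; exact hFe.even_mul hI'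
  · have h3 := he.mul_even hF
    rw [Matrix.mul_assoc, Matrix.mul_assoc] at h3
    exact h3.trans (heF.even_mul hI')
  · rw [Matrix.mul_assoc]; exact h1 i

end Even

/-! ### Homotopies under the cut -/

section CutHtpy

variable {k : Type u} [CommRing k] {W V U : Potential k} (c : CutChoice V)

variable {Y Y' Y'' : GradedOp (PolyRing V U)} {X X' X'' : GradedOp (PolyRing W V)}

/-- The difference splits as (g - g') | f plus g' | (f - f'). For this reason closedness is needed
for g' and f only. -/
theorem Htpy.cut {g g' : Op Y Y'} {f f' : Op X X'} (hY : HasDeg (M := Y) (N := Y) 1 Y.d)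
    (hg : IsClosedOp 0 g') (hf : IsClosedOp 0 f) (h : Htpy 0 g g') (h' : Htpy 0 f f') :
    Htpy (M := cutGr c Y X) (N := cutGr c Y' X') 0 (c.cutOp 0 g f) (c.cutOp 0 g' f') := by
  have h1 : IsNull (M := cutGr c Y X) (N := cutGr c Y' X') 0 _ :=
    IsNull.cut_left (q := 0) (p := 0) c hY h hf
  have h2 : IsNull (M := cutGr c Y X) (N := cutGr c Y' X') 0 _ :=
    IsNull.cut_right (q := 0) (p := 0) c hY hg h'
  have h3 := h1.add h2
  refine cast (congrArg (IsNull (M := cutGr c Y X) (N := cutGr c Y' X') 0) ?_) h3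
  rw [sub_eq_add_neg, sub_eq_add_neg f, cutOp_add_left, cutOp_add_right, cutOp_neg_left,
    cutOp_neg_right]
  abel

theorem cutOp_even_mul {p : ZMod 2} {g : Op Y' Y''} {f : Op X' X''} {g' : Op Y Y'} {f' : Op X X'}
    (hg : HasDeg 0 g') :
    c.cutOp p g f * c.cutOp 0 g' f' = c.cutOp p (g * g' : Op Y Y'') (f * f' : Op X X'') := by
  rw [cutOp_mul c hg, mul_zero, sgn_zero, one_smul, add_zero]

theorem cutOp_mul_odd {p q : ZMod 2} {g : Op Y' Y''} {f : Op X' X''} {g' : Op Y Y'} {f' : Op X X'}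
    (hg : HasDeg q g') :
    c.cutOp 0 g f * c.cutOp p g' f' = c.cutOp p (g * g' : Op Y Y'') (f * f' : Op X X'') := by
  rw [cutOp_mul c hg, zero_mul, sgn_zero, one_smul, zero_add]

end CutHtpy

/-! ### Composition of 2-morphisms -/

section HComp

variable {k : Type u} [CommRing k] [Algebra ℚ k] {W V U : Potential k} (c : CutChoice V)

/-- The action of `C_m` on a cut. -/
noncomputable def cutClifford (Y : GradedOp (PolyRing V U)) (X : GradedOp (PolyRing W V)) :
    CliffordData (PolyRing W U) where
  toGradedOp := cutGr c Y X
  e := (1 : Op (cutGr c Y X) (cutGr c Y X))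
  n := V.n
  γ := c.atiyah Y X
  γd := c.gammaDagger Y X

theorem cutClifford_isRep {Y : GradedOp (PolyRing V U)} {X : GradedOp (PolyRing W V)}
    (hY : IsMF (potDiff V U) Y) (hX : IsMF (potDiff W V) X) :
    (cutClifford c Y X).IsRep (potDiff W U) :=
  isRep_of_rel (hY.cut c hX).d_deg (hY.cut c hX).d_sq (IsClosedOp.one (M := cutGr c Y X))
    (fun i => isClosedOp_atiyah c i hY.d_deg hX.d_deg hY.d_sq hX.d_sq)
    (fun i => isClosedOp_gammaDagger c i hY hX) (cliffordRel_cut c hY hX)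

/-- The cut of `1`-morphisms. -/
noncomputable def cutObj (Y : OneMor V U) (X : OneMor W V) : OneMor W U :=
  ⟨cut c Y.data X.data, cut_isRep c Y.isRep X.isRep⟩

variable {Y Y' Y'' : OneMor V U} {X X' X'' : OneMor W V}

/-- The generators of Y and X are killed because ψ and φ kill them. The generators created by the
cut only commute with ψ | φ and are killed by e_m; this is why e_m is part of the definition. -/
theorem cutIdem_mul_cutOp_mem {ψ : Op Y.data.toGradedOp Y'.data.toGradedOp}
    {φ : Op X.data.toGradedOp X'.data.toGradedOp} (hψ : ψ ∈ cycles Y.data Y'.data)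
    (hφ : φ ∈ cycles X.data X'.data) :
    c.cutIdem Y'.data.toGradedOp X'.data.toGradedOp * c.cutOp 0 ψ φ ∈
      cycles (cut c Y.data X.data) (cut c Y'.data X'.data) := by
  have hY := Y.isRep
  have hX := X.isRep
  have hY' := Y'.isRep
  have hX' := X'.isRep
  have hu := unit_mem_cycles (cutClifford_isRep c hY'.isMF hX'.isMF)
  have hI := closed_cutIdem c hY'.isMF hX'.isMF
  have hI0 := closed_cutIdem c hY.isMF hX.isMF
  have hF := IsClosedOp.cut (q := 0) (p := 0) c hY.d_deg hψ.1 hφ.1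
  rw [add_zero] at hF
  have hnat := cutIdem_natural c hY.isMF hX.isMF hY'.isMF hX'.isMF hψ.1 hφ.1
  have hnat_e := cutIdem_natural c hY'.isMF hX'.isMF hY'.isMF hX'.isMF hY'.e_closed hX'.e_closed
  have hFe := Htpy.cut c hY.d_deg hψ.1 (hφ.1.even_mul hX.e_closed) hψ.2.1 hφ.2.1
  rw [← cutOp_even_mul c hY.e_closed.1] at hFe
  have heF := Htpy.cut c hY.d_deg hψ.1 (hX'.e_closed.even_mul hφ.1) hψ.2.2.1 hφ.2.2.1
  rw [← cutOp_even_mul c hψ.1.1] at heF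
  refine mem_cycles_of_natural (M := cut c Y.data X.data) (N := cut c Y'.data X'.data)
    (I := c.cutIdem Y.data.toGradedOp X.data.toGradedOp) hI hF
    (closed_cut_γ c hY' hX') hnat hnat_e.symm hFe heF ?_ ?_
  · change ∀ i : Fin (Y.data.n + V.n + X.data.n), _
    refine Fin.addCases (fun i => ?_) fun l => ?_
    · revert i
      refine Fin.addCases (fun j => ?_) fun i => ?_
      · have h1 := IsNull.cut_left c (q := 1) (p := 0) hY.d_deg (hψ.2.2.2.1 j)
          (hφ.1.even_mul hX.e_closed)
        rw [← cutOp_mul_odd c (hY.γd_closed j).1, add_zero] at h1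
        have h2 := h1.even_mul hI
        simp only [cut, Fin.append_left]
        exact h2
      · have h1 := gammaDagger_natural c i hY.d_deg hY'.d_deg hψ.1 hφ.1
        rw [add_zero, sgn_zero, one_smul, zero_add] at h1
        have h2 : IsNull (M := cutGr c Y.data.toGradedOp X.data.toGradedOp)
            (N := cutGr c Y'.data.toGradedOp X'.data.toGradedOp) 1
            (c.cutIdem Y'.data.toGradedOp X'.data.toGradedOp *
              c.gammaDagger Y'.data.toGradedOp X'.data.toGradedOp i * c.cutOp 0 ψ φ) :=
          IsNull.mul_even hF (hu.2.2.2.1 i)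
        rw [Matrix.mul_assoc] at h2
        have h3 := (IsNull.of_htpy (Htpy.even_mul hI (Htpy.symm h1)) h2).mul_even
          (closed_cut_e c hY hX)
        rw [Matrix.mul_assoc, Matrix.mul_assoc] at h3
        simp only [cut, Fin.append_left, Fin.append_right]
        exact h3
    · have h1 := IsNull.cut_right c (q := 0) (p := 1) hY.d_deg (hψ.1.even_mul hY.e_closed)
        (hφ.2.2.2.1 l)
      rw [← cutOp_mul_odd c hY.e_closed.1, zero_add] at h1
      have h2 := h1.even_mul hI
      simp only [cut, Fin.append_right]
      exact h2
  · change ∀ i : Fin (Y'.data.n + V.n + X'.data.n), _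
    refine Fin.addCases (fun i => ?_) fun l => ?_
    · revert i
      refine Fin.addCases (fun j => ?_) fun i => ?_
      · have h1 := IsNull.cut_left c (q := 1) (p := 0) hY.d_deg (hψ.2.2.2.2 j)
          (hX'.e_closed.even_mul hφ.1)
        rw [← cutOp_even_mul c hψ.1.1, add_zero] at h1
        have h2 := h1.mul_even hI0
        rw [Matrix.mul_assoc] at h2
        simp only [cut, Fin.append_left]
        exact h2
      · have h1 : IsNull (M := cutGr c Y.data.toGradedOp X.data.toGradedOp)
            (N := cutGr c Y'.data.toGradedOp X'.data.toGradedOp) 1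
            (c.atiyah Y'.data.toGradedOp X'.data.toGradedOp i *
              c.cutIdem Y'.data.toGradedOp X'.data.toGradedOp *
              (c.cutOp 0 Y'.data.e X'.data.e * c.cutOp 0 ψ φ)) :=
          IsNull.mul_even ((closed_cut_e c hY' hX').even_mul hF) (hu.2.2.2.2 i)
        have h2 := (hnat_e.mul_even hF).symm.trans ((Htpy.refl _))
        have h3 := Htpy.even_mul (closed_cut_e c hY' hX') hnat
        rw [← Matrix.mul_assoc] at h3
        have h4 := Htpy.odd_mul (isClosedOp_atiyah c i hY'.d_deg hX'.d_deg hY'.d_sq hX'.d_sq)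
          (h3.symm.trans h2)
        rw [Matrix.mul_assoc (c.cutIdem _ _), ← Matrix.mul_assoc (c.atiyah _ _ _),
          ← Matrix.mul_assoc (c.atiyah _ _ _)] at h4
        have h5 := IsNull.of_htpy h4 h1
        simp only [cut, Fin.append_left, Fin.append_right]
        exact h5
    · have h1 := IsNull.cut_right c (q := 0) (p := 1) hY.d_deg (hY'.e_closed.even_mul hψ.1)
        (hφ.2.2.2.2 l)
      rw [← cutOp_even_mul c hψ.1.1, zero_add] at h1
      have h2 := h1.mul_even hI0
      rw [Matrix.mul_assoc] at h2
      simp only [cut, Fin.append_right]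
      exact h2

theorem cutIdem_mul_cutOp_htpy {Y Y' : GradedOp (PolyRing V U)} {X X' : GradedOp (PolyRing W V)}
    (hY : IsMF (potDiff V U) Y) (hY' : IsMF (potDiff V U) Y') (hX' : IsMF (potDiff W V) X')
    {ψ ψ' : Op Y Y'} {φ φ' : Op X X'} (hψ : IsClosedOp 0 ψ') (hφ : IsClosedOp 0 φ)
    (h : Htpy 0 ψ ψ') (h' : Htpy 0 φ φ') :
    Htpy (M := cutGr c Y X) (N := cutGr c Y' X') 0 (c.cutIdem Y' X' * c.cutOp 0 ψ φ)
      (c.cutIdem Y' X' * c.cutOp 0 ψ' φ') := by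
  have h1 := Htpy.cut c hY.d_deg hψ hφ h h'
  have h2 := closed_cutIdem c hY' hX'
  have h3 := Htpy.even_mul h2 h1
  exact h3

/-- The cut of `2`-morphisms, `([ψ], [φ]) ↦ [e_m (ψ | φ)]`. -/
noncomputable def cutHom (x : Y ⟶ Y') (y : X ⟶ X') : cutObj c Y X ⟶ cutObj c Y' X' :=
  Quotient.map₂ (fun ψ φ => ⟨c.cutIdem Y'.data.toGradedOp X'.data.toGradedOp * c.cutOp 0 ψ.1 φ.1,
      cutIdem_mul_cutOp_mem c ψ.2 φ.2⟩) (by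
    rintro ⟨f, hf⟩ ⟨f', hf'⟩ h ⟨g, hg⟩ ⟨g', hg'⟩ k
    have h : Htpy 0 f f' := (Submodule.quotientRel_def _).1 h
    have k : Htpy 0 g g' := (Submodule.quotientRel_def _).1 k
    exact (Submodule.quotientRel_def _).2 (cutIdem_mul_cutOp_htpy c
      Y.isRep.isMF Y'.isRep.isMF X'.isRep.isMF hf'.1 hg.1 h k)) x y

theorem cutHom_add_left (x x' : Y ⟶ Y') (y : X ⟶ X') :
    cutHom c (x + x') y = cutHom c x y + cutHom c x' y := by
  revert x x' y
  refine CliffordRep.homMk_ind fun f hf => CliffordRep.homMk_ind fun f' hf' =>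
    CliffordRep.homMk_ind fun g hg => ?_
  refine CliffordRep.homMk_eq (M := cutObj c Y X) (N := cutObj c Y' X')
    (hf := cutIdem_mul_cutOp_mem c (add_mem hf hf') hg)
    (hg := add_mem (cutIdem_mul_cutOp_mem c hf hg) (cutIdem_mul_cutOp_mem c hf' hg))
    (htpy_of_eq ?_)
  rw [cutOp_add_left]; exact Matrix.mul_add _ _ _

theorem cutHom_add_right (x : Y ⟶ Y') (y y' : X ⟶ X') :
    cutHom c x (y + y') = cutHom c x y + cutHom c x y' := by
  revert x y y'
  refine CliffordRep.homMk_ind fun f hf => CliffordRep.homMk_ind fun g hg =>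
    CliffordRep.homMk_ind fun g' hg' => ?_
  refine CliffordRep.homMk_eq (M := cutObj c Y X) (N := cutObj c Y' X')
    (hf := cutIdem_mul_cutOp_mem c hf (add_mem hg hg'))
    (hg := add_mem (cutIdem_mul_cutOp_mem c hf hg) (cutIdem_mul_cutOp_mem c hf hg'))
    (htpy_of_eq ?_)
  rw [cutOp_add_right]; exact Matrix.mul_add _ _ _

theorem cutOp_base_smul_left {Y Y' : GradedOp (PolyRing V U)} {X X' : GradedOp (PolyRing W V)}
    (s : k) (p : ZMod 2) (g : Op Y Y') (f : Op X X') :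
    c.cutOp p (s • g) f = s • c.cutOp p g f := by
  have h1 : s • g = (C s : PolyRing V U) • g := by
    ext1 i j; simp [MvPolynomial.smul_eq_C_mul]
  have h2 : s • c.cutOp p g f = (C s : PolyRing W U) • c.cutOp p g f := by
    ext1 i j; simp [MvPolynomial.smul_eq_C_mul]
  rw [h1, h2, cutOp_eq_infl, cutOp_eq_infl, tensorOp_smul_left, ← infl_base_smul c _
    c.hatEntry_base_mul]
  congr 2
  simp [leftScalars, baseScalars]

theorem cutOp_base_smul_right {Y Y' : GradedOp (PolyRing V U)} {X X' : GradedOp (PolyRing W V)}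
    (s : k) (p : ZMod 2) (g : Op Y Y') (f : Op X X') :
    c.cutOp p g (s • f) = s • c.cutOp p g f := by
  have h1 : s • f = (C s : PolyRing W V) • f := by
    ext1 i j; simp [MvPolynomial.smul_eq_C_mul]
  have h2 : s • c.cutOp p g f = (C s : PolyRing W U) • c.cutOp p g f := by
    ext1 i j; simp [MvPolynomial.smul_eq_C_mul]
  rw [h1, h2, cutOp_eq_infl, cutOp_eq_infl, tensorOp_smul_right, ← infl_base_smul c _
    c.hatEntry_base_mul]
  congr 2
  simp [rightScalars, baseScalars]

theorem cutHom_smul_left (s : k) (x : Y ⟶ Y') (y : X ⟶ X') :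
    cutHom c (s • x) y = s • cutHom c x y := by
  revert x y
  refine CliffordRep.homMk_ind fun f hf => CliffordRep.homMk_ind fun g hg => ?_
  refine CliffordRep.homMk_eq (M := cutObj c Y X) (N := cutObj c Y' X')
    (hf := cutIdem_mul_cutOp_mem c (Submodule.smul_of_tower_mem _ s hf) hg)
    (hg := Submodule.smul_of_tower_mem _ s (cutIdem_mul_cutOp_mem c hf hg))
    (htpy_of_eq ?_)
  rw [cutOp_base_smul_left]; exact Matrix.mul_smul _ _ _

theorem cutHom_smul_right (s : k) (x : Y ⟶ Y') (y : X ⟶ X') :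
    cutHom c x (s • y) = s • cutHom c x y := by
  revert x y
  refine CliffordRep.homMk_ind fun f hf => CliffordRep.homMk_ind fun g hg => ?_
  refine CliffordRep.homMk_eq (M := cutObj c Y X) (N := cutObj c Y' X')
    (hf := cutIdem_mul_cutOp_mem c hf (Submodule.smul_of_tower_mem _ s hg))
    (hg := Submodule.smul_of_tower_mem _ s (cutIdem_mul_cutOp_mem c hf hg))
    (htpy_of_eq ?_)
  rw [cutOp_base_smul_right]; exact Matrix.mul_smul _ _ _

theorem cutIdem_idem {Y : GradedOp (PolyRing V U)} {X : GradedOp (PolyRing W V)}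
    (hY : IsMF (potDiff V U) Y) (hX : IsMF (potDiff W V) X) :
    Htpy (M := cutGr c Y X) (N := cutGr c Y X) 0 (c.cutIdem Y X * c.cutIdem Y X)
      (c.cutIdem Y X) := unit_mul_unit (cutClifford_isRep c hY hX)

/-- One of the two copies of e_m is moved through f' | g' by naturality, and the two are then merged
by idempotence. -/
theorem cutIdem_mul_cutOp_comp {Y Y' Y'' : GradedOp (PolyRing V U)}
    {X X' X'' : GradedOp (PolyRing W V)} (hY : IsMF (potDiff V U) Y) (hY' : IsMF (potDiff V U) Y')
    (hY'' : IsMF (potDiff V U) Y'') (hX' : IsMF (potDiff W V) X') (hX'' : IsMF (potDiff W V) X'')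
    {f : Op Y Y'} {f' : Op Y' Y''} {g : Op X X'} {g' : Op X' X''} (hf : IsClosedOp 0 f)
    (hf' : IsClosedOp 0 f') (hg : IsClosedOp 0 g) (hg' : IsClosedOp 0 g') :
    Htpy (M := cutGr c Y X) (N := cutGr c Y'' X'') 0
      (c.cutIdem Y'' X'' * c.cutOp 0 (f' * f : Op Y Y'') (g' * g : Op X X''))
      (c.cutIdem Y'' X'' * c.cutOp 0 f' g' * (c.cutIdem Y' X' * c.cutOp 0 f g)) := by
  rw [← cutOp_even_mul c hf.1]
  have hF := IsClosedOp.cut (q := 0) (p := 0) c hY.d_deg hf hg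
  have hF' := IsClosedOp.cut (q := 0) (p := 0) c hY'.d_deg hf' hg'
  rw [add_zero] at hF hF'
  have hI := closed_cutIdem c hY'' hX''
  have h0 := cutIdem_natural c hY' hX' hY'' hX'' hf' hg'
  have h1 := (h0.mul_even hF).even_mul hI
  have h2 := (cutIdem_idem c hY'' hX'').mul_even (hF'.even_mul hF)
  simp only [Matrix.mul_assoc] at h1 h2 ⊢
  exact h2.symm.trans h1

theorem cutHom_comp (x : Y ⟶ Y') (x' : Y' ⟶ Y'') (y : X ⟶ X') (y' : X' ⟶ X'') :
    cutHom c (x ≫ x') (y ≫ y') = cutHom c x y ≫ cutHom c x' y' := by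
  revert x x' y y'
  refine CliffordRep.homMk_ind fun f hf => CliffordRep.homMk_ind fun f' hf' =>
    CliffordRep.homMk_ind fun g hg => CliffordRep.homMk_ind fun g' hg' => ?_
  refine CliffordRep.homMk_eq (M := cutObj c Y X) (N := cutObj c Y'' X'')
    (hf := cutIdem_mul_cutOp_mem c (mul_mem_cycles hf hf') (mul_mem_cycles hg hg'))
    (hg := mul_mem_cycles (cutIdem_mul_cutOp_mem c hf hg) (cutIdem_mul_cutOp_mem c hf' hg')) ?_
  exact cutIdem_mul_cutOp_comp c Y.isRep.isMF Y'.isRep.isMF Y''.isRep.isMF X'.isRep.isMF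
    X''.isRep.isMF hf.1 hf'.1 hg.1 hg'.1

/-- The unit of a cut. -/
noncomputable def cutUnit (Y : OneMor V U) (X : OneMor W V) :
    Op (cutGr c Y.data.toGradedOp X.data.toGradedOp)
      (cutGr c Y.data.toGradedOp X.data.toGradedOp) := (cut c Y.data X.data).unit

/-- Operators which commute with the units are compatible with the cut. -/
theorem Intertwines.cut {A : Op Y.data.toGradedOp Y'.data.toGradedOp}
    {B : Op X.data.toGradedOp X'.data.toGradedOp} (hA : Intertwines Y Y' A)
    (hB : Intertwines X X' B) : Intertwines (cutObj c Y X) (cutObj c Y' X') (c.cutOp 0 A B) ∧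
    Htpy (M := cutGr c Y.data.toGradedOp X.data.toGradedOp)
      (N := cutGr c Y'.data.toGradedOp X'.data.toGradedOp) 0
      (c.cutIdem Y'.data.toGradedOp X'.data.toGradedOp *
        c.cutOp 0 (A * Y.data.unit : Op Y.data.toGradedOp Y'.data.toGradedOp)
          (B * X.data.unit : Op X.data.toGradedOp X'.data.toGradedOp))
      (c.cutOp 0 A B * cutUnit c Y X) := by
  have hF := IsClosedOp.cut (q := 0) (p := 0) c Y.isRep.d_deg hA.closed hB.closed
  rw [add_zero] at hF
  -- In the three-factor form of the unit, e_m is moved to the front past the unit of Y.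
  have unit_eq : ∀ (Y : OneMor V U) (X : OneMor W V),
      Htpy (M := cutGr c Y.data.toGradedOp X.data.toGradedOp)
      (N := cutGr c Y.data.toGradedOp X.data.toGradedOp) 0 (cutUnit c Y X)
      (c.cutIdem Y.data.toGradedOp X.data.toGradedOp * c.cutOp 0 Y.data.unit X.data.unit) := by
    intro Y X
    have h1 := cut_unit c Y.isRep X.isRep
    have h2 := Htpy.mul_even
      (closed_right c (p := 0) Y.isRep (unit_mem_cycles X.isRep).1)
      (cutIdem_natural c Y.isRep.isMF X.isRep.isMF Y.isRep.isMF X.isRep.isMF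
        (unit_mem_cycles Y.isRep).1 IsClosedOp.one)
    rw [Matrix.mul_assoc (c.cutIdem _ _), cutOp_left_right] at h2
    exact h1.trans h2.symm
  have hu := (unit_mem_cycles Y.isRep).1
  have hv := (unit_mem_cycles X.isRep).1
  have hu' := (unit_mem_cycles Y'.isRep).1
  have hv' := (unit_mem_cycles X'.isRep).1
  have hI := closed_cutIdem c Y'.isRep.isMF X'.isRep.isMF
  have key : Htpy (M := cutGr c Y.data.toGradedOp X.data.toGradedOp)
      (N := cutGr c Y'.data.toGradedOp X'.data.toGradedOp) 0
      (c.cutIdem Y'.data.toGradedOp X'.data.toGradedOp *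
        c.cutOp 0 (A * Y.data.unit : Op Y.data.toGradedOp Y'.data.toGradedOp)
          (B * X.data.unit : Op X.data.toGradedOp X'.data.toGradedOp))
      (c.cutOp 0 A B * cutUnit c Y X) := by
    have huv := IsClosedOp.cut (q := 0) (p := 0) c Y.isRep.d_deg hu hv
    rw [add_zero] at huv
    have h1 := Htpy.mul_even huv (cutIdem_natural c Y.isRep.isMF X.isRep.isMF Y'.isRep.isMF
      X'.isRep.isMF hA.closed hB.closed)
    have h2 := Htpy.even_mul hF (unit_eq Y X)
    rw [Matrix.mul_assoc, Matrix.mul_assoc, cutOp_even_mul c hu.1] at h1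
    exact h1.trans h2.symm
  refine ⟨⟨hF, ?_⟩, key⟩
  -- For the target, the units inside the cut are exchanged with A and B; the preceding computation
  -- then identifies the result with the source unit.
  have h1 := Htpy.mul_even hF (unit_eq Y' X')
  rw [Matrix.mul_assoc, cutOp_even_mul c hA.closed.1] at h1
  have h2 := Htpy.even_mul hI (Htpy.cut c Y.isRep.d_deg
    (IsClosedOp.mul (p := 0) (q := 0) hA.closed hu)
    (IsClosedOp.mul (p := 0) (q := 0) hv' hB.closed) hA.unit hB.unit)
  exact (h1.trans h2).trans key

theorem cutHom_linHom {A : Op Y.data.toGradedOp Y'.data.toGradedOp}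
    {B : Op X.data.toGradedOp X'.data.toGradedOp} (hA : Intertwines Y Y' A)
    (hB : Intertwines X X' B) :
    cutHom c (linHom hA) (linHom hB) = linHom (hA.cut c hB).1 :=
  CliffordRep.homMk_eq (M := cutObj c Y X) (N := cutObj c Y' X')
    (hf := cutIdem_mul_cutOp_mem c hA.mem hB.mem) (hA.cut c hB).2

theorem cutHom_id (Y : OneMor V U) (X : OneMor W V) :
    cutHom c (𝟙 Y) (𝟙 X) = 𝟙 (cutObj c Y X) := by
  rw [← linHom_one, ← linHom_one, cutHom_linHom, ← linHom_one]
  exact linHom_congr (cutOp_one c)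

end HComp

/-! ## Associativity -/

section Contract

variable {k : Type u} [CommRing k]

/-- A monomial is the product of its parts in the two groups of variables. Additive identities may
therefore be checked on products of separate polynomials. -/
theorem sum_polynomial_induction {α β : Type} {P : MvPolynomial (α ⊕ β) k → Prop}
    (hadd : ∀ f g, P f → P g → P (f + g))
    (hmul : ∀ (f : MvPolynomial α k) (g : MvPolynomial β k),
      P (rename Sum.inl f * rename Sum.inr g)) (f : MvPolynomial (α ⊕ β) k) : P f := by
  induction f using MvPolynomial.induction_on' with
  | add f g hf hg => exact hadd f g hf hg
  | monomial s a =>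
    have h : (monomial s a : MvPolynomial (α ⊕ β) k) =
        rename Sum.inl (monomial (s.comapDomain Sum.inl Sum.inl_injective.injOn) a) *
          rename Sum.inr (monomial (s.comapDomain Sum.inr Sum.inr_injective.injOn) (1 : k)) := by
      rw [rename_monomial, rename_monomial, monomial_mul, mul_one]
      refine congrArg (fun t => (monomial t a : MvPolynomial (α ⊕ β) k)) (Finsupp.ext ?_)
      rintro (i | i)
      · rw [Finsupp.add_apply, Finsupp.mapDomain_apply Sum.inl_injective,
          Finsupp.mapDomain_of_notMem_range _ _ (show Sum.inl i ∉ Set.range Sum.inr by simp),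
          add_zero]; rfl
      · rw [Finsupp.add_apply, Finsupp.mapDomain_apply Sum.inr_injective,
          Finsupp.mapDomain_of_notMem_range _ _ (show Sum.inr i ∉ Set.range Sum.inl by simp),
          zero_add]; rfl
    rw [h]; exact hmul _ _

variable {W V U Q : Potential k}

/-- The contraction of the variables `y` by means of an additive map on the completion of `k[y]`. -/
noncomputable def contract (ε : V.Hat →+ k) (g : PolyRing V U) (f : PolyRing W V) : PolyRing W U :=
  coeffMap _ ε (leftScalars W V U (hatMap V) g * rightScalars W V U (hatMap V) f)

variable {ε : V.Hat →+ k}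

theorem contract_add_left (g g' : PolyRing V U) (f : PolyRing W V) :
    contract ε (g + g') f = contract ε g f + contract ε g' f := by
  rw [contract, map_add, add_mul, map_add]; rfl

theorem contract_add_right (g : PolyRing V U) (f f' : PolyRing W V) :
    contract ε g (f + f') = contract ε g f + contract ε g f' := by
  rw [contract, map_add, mul_add, map_add]; rfl

theorem contract_neg_left (g : PolyRing V U) (f : PolyRing W V) :
    contract ε (-g) f = -contract ε g f := by
  rw [contract, map_neg, neg_mul, map_neg]; rfl

theorem contract_neg_right (g : PolyRing V U) (f : PolyRing W V) :
    contract ε g (-f) = -contract ε g f := by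
  rw [contract, map_neg, mul_neg, map_neg]; rfl

theorem contract_sgn_left (p : ZMod 2) (g : PolyRing V U) (f : PolyRing W V) :
    contract ε (sgn _ p * g) f = sgn _ p * contract ε g f := by
  unfold sgn
  split_ifs
  · rw [one_mul, one_mul]
  · rw [neg_one_mul, neg_one_mul, contract_neg_left]

theorem contract_sgn_right (p : ZMod 2) (g : PolyRing V U) (f : PolyRing W V) :
    contract ε g (sgn _ p * f) = sgn _ p * contract ε g f := by
  unfold sgn
  split_ifs
  · rw [one_mul, one_mul]
  · rw [neg_one_mul, neg_one_mul, contract_neg_right]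

/-- Linearity over `k`. -/
def IsBaseLinear (ε : V.Hat →+ k) : Prop :=
  ∀ a s, ε (((hatMap V).comp C) a * s) = a * ε s

/-- When the variables are separated, contraction evaluates ε on the product of the two y-factors
and leaves the other factors alone. -/
theorem contract_prod (hε : IsBaseLinear ε) (b₁ : V.Poly) (b₂ : U.Poly) (a₁ : W.Poly)
    (a₂ : V.Poly) : contract ε (rename Sum.inl b₁ * rename Sum.inr b₂)
      (rename Sum.inl a₁ * rename Sum.inr a₂) =
      rename Sum.inl (C (ε (hatMap V b₁ * hatMap V a₂)) * a₁) * rename Sum.inr b₂ := by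
  rw [contract, map_mul (leftScalars W V U (hatMap V)), map_mul (rightScalars W V U (hatMap V)),
    leftScalars_inl, leftScalars_inr, rightScalars_inl,
    rightScalars_inr]
  have : C (hatMap V b₁) * baseScalars W V U (hatMap V) (rename Sum.inr b₂) *
      (baseScalars W V U (hatMap V) (rename Sum.inl a₁) * C (hatMap V a₂)) =
      baseScalars W V U (hatMap V) (rename Sum.inl a₁ * rename Sum.inr b₂) *
        C (hatMap V b₁ * hatMap V a₂) := by
    rw [map_mul, C_mul]; ring
  have h2 : coeffMap (Fin W.n ⊕ Fin U.n) ε (C (hatMap V b₁ * hatMap V a₂)) =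
      C (ε (hatMap V b₁ * hatMap V a₂)) := coeffMap_monomial _ _ _
  rw [this, coeffMap_base_mul _ _ hε, h2, map_mul (rename Sum.inl), rename_C]; ring

/-- On products with separated variables, both orders apply ε' to a₁ b₂ and ε to b₁ f₂. Each value
is a scalar from k and passes through the other contraction by linearity. -/
theorem contract_assoc {ε' : U.Hat →+ k} (hε : IsBaseLinear ε) (hε' : IsBaseLinear ε')
    (a : PolyRing U Q) (b : PolyRing V U) (f : PolyRing W V) :
    contract ε (contract ε' a b) f = contract ε' a (contract ε b f) := by
  induction a using sum_polynomial_induction with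
  | hadd a a' h h' => rw [contract_add_left, contract_add_left, contract_add_left, h, h']
  | hmul a₁ a₂ =>
  induction b using sum_polynomial_induction with
  | hadd b b' h h' =>
    rw [contract_add_right, contract_add_left, contract_add_left, contract_add_right, h, h']
  | hmul b₁ b₂ =>
  induction f using sum_polynomial_induction with
  | hadd f f' h h' => rw [contract_add_right, contract_add_right, contract_add_right, h, h']
  | hmul f₁ f₂ =>
    have h1 : hatMap V (C (ε' (hatMap U a₁ * hatMap U b₂)) * b₁) * hatMap V f₂ =
        ((hatMap V).comp C) (ε' (hatMap U a₁ * hatMap U b₂)) * (hatMap V b₁ * hatMap V f₂) := by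
      rw [map_mul, mul_assoc]; rfl
    rw [contract_prod hε', contract_prod hε, contract_prod hε, contract_prod hε', h1, hε]
    simp only [map_mul]
    ring

/-- The outgoing variables occur only in the factor from Y and are untouched by ε. -/
theorem pderiv_contract (hε : IsBaseLinear ε) (i : Fin U.n) (g : PolyRing V U)
    (f : PolyRing W V) : pderiv (Sum.inr i) (contract ε g f) =
      contract ε (pderiv (Sum.inr i) g) f := by
  have h0 : ∀ {α β : Type} (i : β) (p : MvPolynomial α k),
      pderiv (Sum.inr i) (rename (Sum.inl : α → α ⊕ β) p) = 0 := fun i p => by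
    refine pderiv_eq_zero_of_notMem_vars fun h => ?_
    classical
    have := vars_rename _ _ h
    simp at this
  induction g using sum_polynomial_induction with
  | hadd a a' h h' => rw [contract_add_left, map_add, map_add, contract_add_left, h, h']
  | hmul b₁ b₂ =>
  induction f using sum_polynomial_induction with
  | hadd f f' h h' => rw [contract_add_right, map_add, contract_add_right, h, h']
  | hmul f₁ f₂ =>
    rw [contract_prod hε, pderiv_mul, pderiv_mul, h0, h0, zero_mul, zero_mul, zero_add, zero_add,
      pderiv_rename Sum.inr_injective, pderiv_rename Sum.inr_injective, contract_prod hε]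

end Contract

/-! ### Tensor operators with arbitrary coefficient maps -/

section CutWith

variable {k : Type u} [CommRing k] {W V U Q : Potential k}

/-- The matrix of `g ⊗ f` over the completion, with coefficients replaced by the matrices `φ`. -/
noncomputable def cutWith (c : CutChoice V) (φ : Fin c.m → Fin c.m → V.Hat →+ k)
    {Y Y' : GradedOp (PolyRing V U)} {X X' : GradedOp (PolyRing W V)} (p : ZMod 2) (g : Op Y Y')
    (f : Op X X') : Op (cutGr c Y X) (cutGr c Y' X') := infl c φ (tensorOp (hatMap V) p g f)

theorem cutWith_apply (c : CutChoice V) (φ : Fin c.m → Fin c.m → V.Hat →+ k)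
    {Y Y' : GradedOp (PolyRing V U)} {X X' : GradedOp (PolyRing W V)} (p : ZMod 2) (g : Op Y Y')
    (f : Op X X') (a : (cutGr c Y' X').ι) (b : (cutGr c Y X).ι) :
    cutWith c φ p g f a b = sgn _ (p * Y.par b.1) *
      contract (φ a.2.1 b.2.1) (g a.1 b.1) (f a.2.2 b.2.2) := by
  change coeffMap _ _ (sgn _ (p * Y.par b.1) * leftScalars W V U (hatMap V) (g a.1 b.1) *
    rightScalars W V U (hatMap V) (f a.2.2 b.2.2)) = _
  rw [mul_assoc, contract]
  unfold sgn
  split_ifs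
  · rw [one_mul, one_mul]
  · rw [neg_one_mul, neg_one_mul, map_neg]

theorem cutOp_eq_cutWith (c : CutChoice V) {Y Y' : GradedOp (PolyRing V U)}
    {X X' : GradedOp (PolyRing W V)} (p : ZMod 2) (g : Op Y Y') (f : Op X X') :
    c.cutOp p g f = cutWith c c.hatEntry p g f := cutOp_eq_infl c p g f

theorem atiyah_eq_cutWith (c : CutChoice V) (Y : GradedOp (PolyRing V U))
    (X : GradedOp (PolyRing W V)) (q : Fin V.n) : c.atiyah Y X q =
      cutWith c (c.commEntry q) 0 Y.d (1 : Op X X) +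
        cutWith c (c.commEntry q) 1 (1 : Op Y Y) X.d := by
  rw [atiyah_eq_infl, tensorD, cutWith, cutWith]
  exact infl_add c _ _ _

/-- The identity has no commutator with ∂_{t_q}. Consequently a connection does not see the
differential of a factor that is not adjacent to its cut. -/
theorem cutWith_comm_one (c : CutChoice V) (Y : GradedOp (PolyRing V U))
    (X : GradedOp (PolyRing W V)) (q : Fin V.n) :
    cutWith c (c.commEntry q) 0 (1 : Op Y Y) (1 : Op X X) = 0 := by
  rw [cutWith, tensorOp_one_one]
  exact infl_comm_one c q

theorem cutWith_add_left (c : CutChoice V) (φ : Fin c.m → Fin c.m → V.Hat →+ k)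
    {Y Y' : GradedOp (PolyRing V U)} {X X' : GradedOp (PolyRing W V)} (p : ZMod 2) (g g' : Op Y Y')
    (f : Op X X') : cutWith c φ p (g + g') f = cutWith c φ p g f + cutWith c φ p g' f := by
  rw [cutWith, tensorOp_add_left]; exact infl_add c _ _ _

theorem cutWith_add_right (c : CutChoice V) (φ : Fin c.m → Fin c.m → V.Hat →+ k)
    {Y Y' : GradedOp (PolyRing V U)} {X X' : GradedOp (PolyRing W V)} (p : ZMod 2) (g : Op Y Y')
    (f f' : Op X X') : cutWith c φ p g (f + f') = cutWith c φ p g f + cutWith c φ p g f' := by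
  rw [cutWith, tensorOp_add_right]; exact infl_add c _ _ _

/-- The bijection of bases underlying `(z ⊗ y) ⊗ x ↦ z ⊗ (y ⊗ x)`. -/
def assocEquiv (α ι β κ γ : Type) : (α × ι × β) × κ × γ ≃ α × ι × (β × κ × γ) where
  toFun b := (b.1.1, b.1.2.1, b.1.2.2, b.2.1, b.2.2)
  invFun a := ((a.1, a.2.1, a.2.2.1), a.2.2.2.1, a.2.2.2.2)
  left_inv _ := rfl
  right_inv _ := rfl

variable {cV : CutChoice V} {cU : CutChoice U} {Z Z' : GradedOp (PolyRing U Q)}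
  {Y Y' : GradedOp (PolyRing V U)} {X X' : GradedOp (PolyRing W V)}

/-- A strict equality of matrices. The entries agree by associativity of contraction, and the
exponent of the Koszul sign is p(|z| + |y|) + p'|z| on both sides. -/
theorem cutWith_assoc {φ : Fin cV.m → Fin cV.m → V.Hat →+ k}
    {φ' : Fin cU.m → Fin cU.m → U.Hat →+ k} (hφ : ∀ i j, IsBaseLinear (φ i j))
    (hφ' : ∀ i j, IsBaseLinear (φ' i j)) (p p' : ZMod 2) (ζ : Op Z Z') (ψ : Op Y Y')
    (f : Op X X') : cutWith cV φ p (cutWith cU φ' p' ζ ψ) f =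
      (cutWith cU φ' (p + p') ζ (cutWith cV φ p ψ f)).submatrix
        (assocEquiv Z'.ι (Fin cU.m) Y'.ι (Fin cV.m) X'.ι)
        (assocEquiv Z.ι (Fin cU.m) Y.ι (Fin cV.m) X.ι) := by
  ext1 a b
  rw [Matrix.submatrix_apply, cutWith_apply, cutWith_apply, cutWith_apply, cutWith_apply,
    contract_sgn_left, contract_sgn_right, contract_assoc (hφ _ _) (hφ' _ _), ← mul_assoc,
    ← mul_assoc, ← sgn_add, ← sgn_add]
  change sgn _ (p * (Z.par b.1.1 + Y.par b.1.2.2) + p' * Z.par b.1.1) * _ =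
    sgn _ ((p + p') * Z.par b.1.1 + p * Y.par b.1.2.2) * _
  congr 2
  ring

end CutWith

/-! ### Strict comparison of iterated cuts -/

section Reassoc

variable {k : Type u} [CommRing k] {W V U Q : Potential k} {cV : CutChoice V} {cU : CutChoice U}

/-- The operator on `(Z | Y) | X` corresponding to an operator on `Z | (Y | X)`. -/
noncomputable def reassoc {Z Z' : GradedOp (PolyRing U Q)} {Y Y' : GradedOp (PolyRing V U)}
    {X X' : GradedOp (PolyRing W V)}
    (A : Op (cutGr cU Z (cutGr cV Y X)) (cutGr cU Z' (cutGr cV Y' X'))) :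
    Op (cutGr cV (cutGr cU Z Y) X) (cutGr cV (cutGr cU Z' Y') X') :=
  A.submatrix (assocEquiv Z'.ι (Fin cU.m) Y'.ι (Fin cV.m) X'.ι)
    (assocEquiv Z.ι (Fin cU.m) Y.ι (Fin cV.m) X.ι)

variable {Z Z' Z'' : GradedOp (PolyRing U Q)} {Y Y' Y'' : GradedOp (PolyRing V U)}
  {X X' X'' : GradedOp (PolyRing W V)}

theorem reassoc_mul (A : Op (cutGr cU Z' (cutGr cV Y' X')) (cutGr cU Z'' (cutGr cV Y'' X'')))
    (B : Op (cutGr cU Z (cutGr cV Y X)) (cutGr cU Z' (cutGr cV Y' X'))) :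
    reassoc (A * B : Op (cutGr cU Z (cutGr cV Y X)) (cutGr cU Z'' (cutGr cV Y'' X''))) =
      reassoc A * reassoc B := (Matrix.submatrix_mul_equiv A B _ _ _).symm

theorem reassoc_add (A B : Op (cutGr cU Z (cutGr cV Y X)) (cutGr cU Z' (cutGr cV Y' X'))) :
    reassoc (A + B) = reassoc A + reassoc B := rfl

theorem reassoc_sub (A B : Op (cutGr cU Z (cutGr cV Y X)) (cutGr cU Z' (cutGr cV Y' X'))) :
    reassoc (A - B) = reassoc A - reassoc B := rfl

theorem reassoc_neg (A : Op (cutGr cU Z (cutGr cV Y X)) (cutGr cU Z' (cutGr cV Y' X'))) :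
    reassoc (-A) = -reassoc A := rfl

theorem reassoc_zero :
    reassoc (0 : Op (cutGr cU Z (cutGr cV Y X)) (cutGr cU Z' (cutGr cV Y' X'))) = 0 := rfl

theorem reassoc_sum {α : Type} (s : Finset α)
    (A : α → Op (cutGr cU Z (cutGr cV Y X)) (cutGr cU Z' (cutGr cV Y' X'))) :
    reassoc (∑ i ∈ s, A i) = ∑ i ∈ s, reassoc (A i) := by
  classical
  induction s using Finset.induction_on with
  | empty => rfl
  | insert i s h ih => rw [Finset.sum_insert h, Finset.sum_insert h, reassoc_add, ih]

theorem reassoc_one : reassoc (1 : Op (cutGr cU Z (cutGr cV Y X)) (cutGr cU Z (cutGr cV Y X))) = 1 :=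
  Matrix.submatrix_one_equiv _

theorem nest_reassoc {n : ℕ}
    (γ γd : Fin n → Op (cutGr cU Z (cutGr cV Y X)) (cutGr cU Z (cutGr cV Y X)))
    (x : Op (cutGr cU Z (cutGr cV Y X)) (cutGr cU Z (cutGr cV Y X))) :
    nest (fun i => reassoc (γ i)) (fun i => reassoc (γd i)) (reassoc x) =
      reassoc (nest γ γd x) := by
  unfold nest
  induction List.finRange n with
  | nil => rfl
  | cons i L ih => rw [List.foldr_cons, ih, List.foldr_cons, reassoc_mul, reassoc_mul]

/-- `g ⊗ f` for the cut at `V` of an operator on `Z | Y`. -/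
noncomputable abbrev cutWithL (φ : Fin cV.m → Fin cV.m → V.Hat →+ k) (p : ZMod 2)
    (g : Op (cutGr cU Z Y) (cutGr cU Z' Y')) (f : Op X X') :
    Op (cutGr cV (cutGr cU Z Y) X) (cutGr cV (cutGr cU Z' Y') X') :=
  cutWith cV φ (Y := cutGr cU Z Y) (Y' := cutGr cU Z' Y') p g f

/-- `g ⊗ f` for the cut at `U` of an operator on `Y | X`. -/
noncomputable abbrev cutWithR (φ : Fin cU.m → Fin cU.m → U.Hat →+ k) (p : ZMod 2) (g : Op Z Z')
    (f : Op (cutGr cV Y X) (cutGr cV Y' X')) :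
    Op (cutGr cU Z (cutGr cV Y X)) (cutGr cU Z' (cutGr cV Y' X')) :=
  cutWith cU φ (X := cutGr cV Y X) (X' := cutGr cV Y' X') p g f

/-- `g | f` for the cut at `V` of an operator on `Z | Y`. -/
noncomputable abbrev cutOpL (p : ZMod 2) (g : Op (cutGr cU Z Y) (cutGr cU Z' Y')) (f : Op X X') :
    Op (cutGr cV (cutGr cU Z Y) X) (cutGr cV (cutGr cU Z' Y') X') :=
  cV.cutOp (Y := cutGr cU Z Y) (Y' := cutGr cU Z' Y') p g f

/-- `g | f` for the cut at `U` of an operator on `Y | X`. -/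
noncomputable abbrev cutOpR (p : ZMod 2) (g : Op Z Z') (f : Op (cutGr cV Y X) (cutGr cV Y' X')) :
    Op (cutGr cU Z (cutGr cV Y X)) (cutGr cU Z' (cutGr cV Y' X')) :=
  cU.cutOp (X := cutGr cV Y X) (X' := cutGr cV Y' X') p g f

theorem cutOp_assoc {p p' q : ZMod 2} (h : p + p' = q) (ζ : Op Z Z') (ψ : Op Y Y') (f : Op X X') :
    cutOpL (cV := cV) p (cU.cutOp p' ζ ψ) f = reassoc (cutOpR q ζ (cV.cutOp p ψ f)) := by
  subst h
  rw [cutOpL, cutOpR, cutOp_eq_cutWith, cutOp_eq_cutWith, cutOp_eq_cutWith, cutOp_eq_cutWith]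
  exact cutWith_assoc (fun i j => cV.hatEntry_base_mul i j) (fun i j => cU.hatEntry_base_mul i j)
    p p' ζ ψ f

theorem cutWith_assoc_left (r : Fin U.n) {p p' q : ZMod 2} (h : p + p' = q) (ζ : Op Z Z')
    (ψ : Op Y Y') (f : Op X X') :
    cutOpL (cV := cV) p (cutWith cU (cU.commEntry r) p' ζ ψ) f =
      reassoc (cutWithR (cU.commEntry r) q ζ (cV.cutOp p ψ f)) := by
  subst h
  rw [cutOpL, cutOp_eq_cutWith, cutOp_eq_cutWith]
  exact cutWith_assoc (fun i j => cV.hatEntry_base_mul i j)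
    (fun i j => cU.commEntry_base_mul r i j) p p' ζ ψ f

theorem cutWith_assoc_right (r : Fin V.n) {p p' q : ZMod 2} (h : p + p' = q) (ζ : Op Z Z')
    (ψ : Op Y Y') (f : Op X X') :
    cutWithL (cV.commEntry r) p (cU.cutOp p' ζ ψ) f =
      reassoc (cutOpR q ζ (cutWith cV (cV.commEntry r) p ψ f)) := by
  subst h
  rw [cutOpR, cutOp_eq_cutWith, cutOp_eq_cutWith]
  exact cutWith_assoc (fun i j => cV.commEntry_base_mul r i j)
    (fun i j => cU.hatEntry_base_mul i j) p p' ζ ψ f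

theorem cutOp_zero_left (p : ZMod 2) (f : Op X X') : cV.cutOp p (0 : Op Y Y') f = 0 := by
  have := cutOp_add_left cV p (0 : Op Y Y') 0 f
  rwa [add_zero, left_eq_add] at this

theorem cutOp_zero_right (p : ZMod 2) (g : Op Y Y') : cV.cutOp p g (0 : Op X X') = 0 := by
  have := cutOp_add_right cV p g (0 : Op X X') 0
  rwa [add_zero, left_eq_add] at this

/-- Both differentials are sums of the contributions of d_Z, d_Y and d_X, which are compared one at
a time. -/
theorem cutGr_assoc_d : (cutGr cV (cutGr cU Z Y) X).d = reassoc (cutGr cU Z (cutGr cV Y X)).d := by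
  have h1 := cutOp_assoc (cV := cV) (cU := cU) (zero_add 0) Z.d (1 : Op Y Y) (1 : Op X X)
  have h2 := cutOp_assoc (cV := cV) (cU := cU) (zero_add 1) (1 : Op Z Z) Y.d (1 : Op X X)
  have h3 := cutOp_assoc (cV := cV) (cU := cU) (add_zero 1) (1 : Op Z Z) (1 : Op Y Y) X.d
  have h4 := congrArg₂ (· + ·) (congrArg₂ (· + ·) h1 h2) h3
  rw [cutOp_one, cutOp_one] at h4
  refine Eq.trans ?_ (h4.trans ?_)
  · exact congrArg (· + _) (cutOp_add_left cV _ _ _ _)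
  · refine (add_assoc _ _ _).trans (congrArg₂ (· + ·) rfl ?_)
    exact congrArg reassoc (cutOp_add_right cU (X := cutGr cV Y X) (X' := cutGr cV Y X) 1
      (1 : Op Z Z) (cV.cutOp 0 Y.d (1 : Op X X)) (cV.cutOp 1 (1 : Op Y Y) X.d)).symm

/-- The term of d_X drops out, because the connection at U is then commuted with the identities of Z
and Y. The terms of d_Z and d_Y agree. -/
theorem atiyah_cut_left (q : Fin U.n) :
    cutOpL (cV := cV) 0 (cU.atiyah Z Y q) (1 : Op X X) = reassoc (cU.atiyah Z (cutGr cV Y X) q) := by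
  have h1 := cutWith_assoc_left (cV := cV) (cU := cU) q (zero_add 0) Z.d (1 : Op Y Y) (1 : Op X X)
  have h2 := cutWith_assoc_left (cV := cV) (cU := cU) q (zero_add 1) (1 : Op Z Z) Y.d (1 : Op X X)
  have h3 := cutWith_assoc_left (cV := cV) (cU := cU) q (add_zero 1) (1 : Op Z Z) (1 : Op Y Y) X.d
  rw [cutWith_comm_one] at h3
  have h3 := (cutOp_zero_left (cV := cV) (Y := cutGr cU Z Y) (Y' := cutGr cU Z Y) 1 X.d).symm.trans h3
  have h4 := congrArg₂ (· + ·) h1 (congrArg₂ (· + ·) h2 h3)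
  rw [cutOp_one] at h4
  simp only [add_zero] at h4
  rw [atiyah_eq_cutWith, atiyah_eq_cutWith]
  refine Eq.trans ?_ (h4.trans ?_)
  · exact cutOp_add_left cV _ _ _ _
  · refine congrArg₂ (· + ·) rfl ?_
    exact congrArg reassoc (cutWith_add_right cU (X := cutGr cV Y X) (X' := cutGr cV Y X) _ 1
      (1 : Op Z Z) (cV.cutOp 0 Y.d (1 : Op X X)) (cV.cutOp 1 (1 : Op Y Y) X.d)).symm

/-- Dually, d_Z contributes nothing to the commutator with the connection at V. -/
theorem atiyah_cut_right (q : Fin V.n) :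
    cV.atiyah (cutGr cU Z Y) X q = reassoc (cutOpR 1 (1 : Op Z Z) (cV.atiyah Y X q)) := by
  have h1 := cutWith_assoc_right (cV := cV) (cU := cU) q (zero_add 0) Z.d (1 : Op Y Y) (1 : Op X X)
  have h2 := cutWith_assoc_right (cV := cV) (cU := cU) q (zero_add 1) (1 : Op Z Z) Y.d (1 : Op X X)
  have h3 := cutWith_assoc_right (cV := cV) (cU := cU) q (add_zero 1) (1 : Op Z Z) (1 : Op Y Y) X.d
  rw [cutWith_comm_one] at h1
  have h1 := h1.trans (congrArg reassoc (cutOp_zero_right (cV := cU) (X := cutGr cV Y X)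
    (X' := cutGr cV Y X) 0 Z.d))
  have h4 := congrArg₂ (· + ·) (congrArg₂ (· + ·) h1 h2) h3
  rw [cutOp_one] at h4
  rw [atiyah_eq_cutWith, atiyah_eq_cutWith]
  refine Eq.trans ?_ (h4.trans ?_)
  · exact congrArg (· + _) (cutWith_add_left cV _ _ _ _ _)
  · rw [reassoc_zero]
    refine (congrArg (· + _) (zero_add _)).trans ?_
    exact congrArg reassoc (cutOp_add_right cU (X := cutGr cV Y X) (X' := cutGr cV Y X) 1
      (1 : Op Z Z) (cutWith cV (cV.commEntry q) 0 Y.d (1 : Op X X))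
      (cutWith cV (cV.commEntry q) 1 (1 : Op Y Y) X.d)).symm

theorem scalar_cut_left (f : U.Poly) :
    cutOpL (cV := cV) 0 (cU.scalar Z Y f) (1 : Op X X) = reassoc (cU.scalar Z (cutGr cV Y X) f) := by
  have h := cutOp_assoc (cV := cV) (cU := cU) (zero_add 0)
    ((rename Sum.inl f : PolyRing U Q) • (1 : Op Z Z)) (1 : Op Y Y) (1 : Op X X)
  rwa [cutOp_one] at h

theorem scalar_cut_right (f : V.Poly) :
    cV.scalar (cutGr cU Z Y) X f = reassoc (cutOpR 0 (1 : Op Z Z) (cV.scalar Y X f)) := by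
  have h := cutOp_assoc (cV := cV) (cU := cU) (zero_add 0) (1 : Op Z Z) (1 : Op Y Y)
    ((rename Sum.inr f : PolyRing W V) • (1 : Op X X))
  rw [cutOp_one, cutOp_scalar] at h
  exact (cutOp_scalar (Y := cutGr cU Z Y) (X := X) cV f).symm.trans h

theorem dOp_one (i : Fin V.n) : dOp (X := X) (X' := X) i 1 = 0 := by
  have h := dOp_smul_one (X := X) i (1 : PolyRing W V)
  rwa [one_smul, ← map_one C, pderiv_C, zero_smul] at h

theorem dOp_cutOp (i : Fin U.n) (p : ZMod 2) (g : Op Y Y') (f : Op X X') :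
    dOp (X := cutGr cV Y X) (X' := cutGr cV Y' X') i (cV.cutOp p g f) =
      cV.cutOp p (dOp i g) f := by
  rw [cutOp_eq_cutWith, cutOp_eq_cutWith]
  ext1 a b
  rw [dOp, Matrix.map_apply, cutWith_apply, cutWith_apply, dOp, Matrix.map_apply,
    ← pderiv_contract (fun a s => cV.hatEntry_base_mul _ _ a s)]
  unfold sgn
  split_ifs
  · rw [one_mul, one_mul]
  · rw [neg_one_mul, neg_one_mul, map_neg]

/-- Of the differential of Y | X only d_Y contains the variables of U; the matrix of d_X does not,
so its contribution to the derivative is zero. -/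
theorem lam_cut_left (i : Fin U.n) :
    cutOpL (cV := cV) 0 (lam cU Z Y i) (1 : Op X X) = reassoc (lam cU Z (cutGr cV Y X) i) := by
  have h := cutOp_assoc (cV := cV) (cU := cU) (zero_add 1) (1 : Op Z Z) (dOp i Y.d) (1 : Op X X)
  have h2 : dOp (X := cutGr cV Y X) (X' := cutGr cV Y X) i (cutGr cV Y X).d =
      cV.cutOp 0 (dOp i Y.d) (1 : Op X X) := by
    refine (dOp_add i _ _).trans ?_
    rw [dOp_cutOp, dOp_cutOp, dOp_one, cutOp_zero_left, add_zero]
  rw [← h2] at h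
  exact h

theorem lam_cut_right (i : Fin V.n) :
    lam cV (cutGr cU Z Y) X i = reassoc (cutOpR 1 (1 : Op Z Z) (lam cV Y X i)) := by
  have h := cutOp_assoc (cV := cV) (cU := cU) (add_zero 1) (1 : Op Z Z) (1 : Op Y Y) (dOp i X.d)
  rw [cutOp_one] at h
  exact h

end Reassoc

/-! ### The Clifford generators and idempotents of iterated cuts -/

section ReassocClifford

variable {k : Type u} [CommRing k] [Algebra ℚ k] {W V U Q : Potential k} {cV : CutChoice V}
  {cU : CutChoice U} {Z Z' : GradedOp (PolyRing U Q)} {Y Y' : GradedOp (PolyRing V U)}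
  {X X' : GradedOp (PolyRing W V)}

theorem cutOpL_mul {p q : ZMod 2} {A B : Op (cutGr cU Z Y) (cutGr cU Z Y)} {f : Op X X}
    (hB : HasDeg (M := cutGr cU Z Y) (N := cutGr cU Z Y) q B) :
    cutOpL (cV := cV) p (A * B) f = cutOpL 0 A (1 : Op X X) * cutOpL p B f := by
  have h := cutOp_mul_odd cV (p := p) (g := A) (f := (1 : Op X X)) (f' := f) hB
  rw [Matrix.one_mul] at h
  exact h.symm

theorem cutOpR_mul {p q : ZMod 2} {A B : Op (cutGr cV Y X) (cutGr cV Y X)} :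
    cutOpR (cU := cU) (p + q) (1 : Op Z Z) (A * B) = cutOpR p 1 A * cutOpR q 1 B := by
  have h := cutOp_mul cU (p := p) (p' := q) (g := (1 : Op Z Z)) (f := A) (f' := B)
    (HasDeg.one (M := Z))
  rw [mul_zero, sgn_zero, one_smul, Matrix.one_mul] at h
  exact h.symm

/-- All constituents λ, the Hessian scalars and At have been compared, and A ↦ A | 1 respects their
sums and products. -/
theorem gammaDagger_cut_left (i : Fin U.n) (hZ : IsMF (potDiff U Q) Z)
    (hY : IsMF (potDiff V U) Y) :
    cutOpL (cV := cV) 0 (cU.gammaDagger Z Y i) (1 : Op X X) =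
      reassoc (cU.gammaDagger Z (cutGr cV Y X) i) := by
  have hs : ∀ s : Finset (Fin U.n), cutOpL (cV := cV) 0
      (∑ q ∈ s, cU.scalar Z Y (halfHess U q i) * cU.atiyah Z Y q) (1 : Op X X) =
      reassoc (∑ q ∈ s, cU.scalar Z (cutGr cV Y X) (halfHess U q i) *
        cU.atiyah Z (cutGr cV Y X) q) := fun s => by
    classical
    induction s using Finset.induction_on with
    | empty => exact cutOp_zero_left _ _
    | insert a s h ih =>
      rw [Finset.sum_insert h, Finset.sum_insert h, reassoc_add, ← ih, reassoc_mul,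
        ← scalar_cut_left, ← atiyah_cut_left,
        ← cutOpL_mul (isClosedOp_atiyah cU a hZ.d_deg hY.d_deg hZ.d_sq hY.d_sq).1]
      exact cutOp_add_left cV _ _ _ _
  rw [gammaDagger_eq, gammaDagger_eq, reassoc_sub, reassoc_neg, ← lam_cut_left, ← hs,
    sub_eq_add_neg, sub_eq_add_neg, ← cutOp_neg_left, ← cutOp_neg_left]
  exact cutOp_add_left cV _ _ _ _

theorem gammaDagger_cut_right (i : Fin V.n) :
    cV.gammaDagger (cutGr cU Z Y) X i = reassoc (cutOpR 1 (1 : Op Z Z) (cV.gammaDagger Y X i)) := by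
  have hs : ∀ s : Finset (Fin V.n), cutOpR (cU := cU) 1 (1 : Op Z Z)
      (∑ q ∈ s, cV.scalar Y X (halfHess V q i) * cV.atiyah Y X q) =
      ∑ q ∈ s, cutOpR 0 1 (cV.scalar Y X (halfHess V q i)) * cutOpR 1 1 (cV.atiyah Y X q) := by
    intro s
    classical
    induction s using Finset.induction_on with
    | empty => exact cutOp_zero_right _ _
    | insert a s h ih =>
      rw [Finset.sum_insert h, Finset.sum_insert h, ← ih, ← cutOpR_mul, zero_add]
      exact cutOp_add_right cU _ _ _ _
  rw [gammaDagger_eq, gammaDagger_eq, sub_eq_add_neg, sub_eq_add_neg]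
  refine Eq.trans ?_ (congrArg reassoc ((cutOp_add_right cU (X := cutGr cV Y X)
    (X' := cutGr cV Y X) 1 (1 : Op Z Z) _ _).trans (congrArg₂ (· + ·)
      (cutOp_neg_right cU _ _ _) ((cutOp_neg_right cU _ _ _).trans (congrArg _ (hs _)))))).symm
  rw [reassoc_add, reassoc_neg, reassoc_neg, reassoc_sum]
  refine congrArg₂ (· + ·) (congrArg _ (lam_cut_right i)) (congrArg _ ?_)
  refine Finset.sum_congr rfl fun q _ => ?_
  rw [reassoc_mul, scalar_cut_right, atiyah_cut_right]

/-- The idempotent is a nest of generators, and both A ↦ A | 1 and reassociation preserve nests. -/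
theorem cutIdem_cut_left (hZ : IsMF (potDiff U Q) Z) (hY : IsMF (potDiff V U) Y) :
    cutOpL (cV := cV) 0 (cU.cutIdem Z Y) (1 : Op X X) = reassoc (cU.cutIdem Z (cutGr cV Y X)) := by
  have h := map_nest (M := cutGr cU Z Y) (P := cutGr cV (cutGr cU Z Y) X)
    (fun _ A => cutOpL 0 A (1 : Op X X)) (fun p q f g hg => (cutOpL_mul hg).symm)
    (fun i => (isClosedOp_atiyah cU i hZ.d_deg hY.d_deg hZ.d_sq hY.d_sq).1)
    (fun i => (isClosedOp_gammaDagger cU i hZ hY).1) HasDeg.one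
  refine h.symm.trans ?_
  simp only [atiyah_cut_left, gammaDagger_cut_left _ hZ hY, cutOpL]
  rw [cutOp_one, ← reassoc_one]
  exact nest_reassoc _ _ _

theorem cutIdem_cut_right (hY : IsMF (potDiff V U) Y) (hX : IsMF (potDiff W V) X) :
    cV.cutIdem (cutGr cU Z Y) X = reassoc (cutOpR 0 (1 : Op Z Z) (cV.cutIdem Y X)) := by
  have h := map_nest (M := cutGr cV Y X) (P := cutGr cU Z (cutGr cV Y X))
    (fun p A => cutOpR p (1 : Op Z Z) A) (fun p q f g hg => cutOpR_mul.symm)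
    (fun i => (isClosedOp_atiyah cV i hY.d_deg hX.d_deg hY.d_sq hX.d_sq).1)
    (fun i => (isClosedOp_gammaDagger cV i hY hX).1) HasDeg.one
  refine Eq.trans ?_ (congrArg reassoc h)
  rw [CutChoice.cutIdem, ← nest_reassoc]
  congr 1
  · exact funext fun i => atiyah_cut_right i
  · exact funext fun i => gammaDagger_cut_right i
  · refine (reassoc_one).symm.trans (congrArg reassoc (cutOp_one cU).symm)

end ReassocClifford

/-! ### The associator as a permutation matrix -/

section Assoc

variable {k : Type u} [CommRing k] {W V U Q : Potential k} {cV : CutChoice V}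
  {cU : CutChoice U}

/-- The matrix of `(z ⊗ y) ⊗ x ↦ z ⊗ (y ⊗ x)`. -/
noncomputable def assocOp (cV : CutChoice V) (cU : CutChoice U) (Z : GradedOp (PolyRing U Q))
    (Y : GradedOp (PolyRing V U)) (X : GradedOp (PolyRing W V)) :
    Op (cutGr cV (cutGr cU Z Y) X) (cutGr cU Z (cutGr cV Y X)) :=
  fun a b => if a = assocEquiv Z.ι (Fin cU.m) Y.ι (Fin cV.m) X.ι b then 1 else 0

/-- The matrix of `z ⊗ (y ⊗ x) ↦ (z ⊗ y) ⊗ x`. -/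
noncomputable def assocInvOp (cV : CutChoice V) (cU : CutChoice U) (Z : GradedOp (PolyRing U Q))
    (Y : GradedOp (PolyRing V U)) (X : GradedOp (PolyRing W V)) :
    Op (cutGr cU Z (cutGr cV Y X)) (cutGr cV (cutGr cU Z Y) X) :=
  fun a b => if assocEquiv Z.ι (Fin cU.m) Y.ι (Fin cV.m) X.ι a = b then 1 else 0

variable {Z Z' : GradedOp (PolyRing U Q)} {Y Y' : GradedOp (PolyRing V U)}
  {X X' : GradedOp (PolyRing W V)}

/-- Reassociation of operators is conjugation by the permutation of basis vectors, so the
permutation matrix intertwines strictly. Every property of the associator rests on this. -/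
theorem assocOp_mul_reassoc (A : Op (cutGr cU Z (cutGr cV Y X)) (cutGr cU Z' (cutGr cV Y' X'))) :
    assocOp cV cU Z' Y' X' * reassoc A = A * assocOp cV cU Z Y X := by
  ext1 a b
  rw [Matrix.mul_apply, Matrix.mul_apply,
    Finset.sum_eq_single ((assocEquiv Z'.ι (Fin cU.m) Y'.ι (Fin cV.m) X'.ι).symm a),
    Finset.sum_eq_single (assocEquiv Z.ι (Fin cU.m) Y.ι (Fin cV.m) X.ι b)]
  · rw [assocOp, if_pos (Equiv.apply_symm_apply _ _).symm, one_mul, assocOp, if_pos rfl, mul_one]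
    rfl
  · intro c _ h
    rw [assocOp, if_neg h, mul_zero]
  · exact fun h => absurd (Finset.mem_univ _) h
  · intro c _ h
    rw [assocOp, if_neg fun e => h (by rw [e, Equiv.symm_apply_apply]), zero_mul]
  · exact fun h => absurd (Finset.mem_univ _) h

theorem assocOp_mul_inv :
    assocOp cV cU Z Y X * assocInvOp cV cU Z Y X = 1 := by
  ext1 a b
  rw [Matrix.mul_apply,
    Finset.sum_eq_single ((assocEquiv Z.ι (Fin cU.m) Y.ι (Fin cV.m) X.ι).symm a)]
  · rw [assocOp, if_pos (Equiv.apply_symm_apply _ _).symm, one_mul, assocInvOp,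
      Equiv.apply_symm_apply, Matrix.one_apply]
  · intro c _ h
    rw [assocOp, if_neg fun e => h (by rw [e, Equiv.symm_apply_apply]), zero_mul]
  · exact fun h => absurd (Finset.mem_univ _) h

theorem assocInvOp_mul :
    assocInvOp cV cU Z Y X * assocOp cV cU Z Y X = 1 := by
  ext1 a b
  rw [Matrix.mul_apply,
    Finset.sum_eq_single (assocEquiv Z.ι (Fin cU.m) Y.ι (Fin cV.m) X.ι b)]
  · rw [assocOp, if_pos rfl, mul_one, assocInvOp, Matrix.one_apply]
    exact if_congr (Equiv.apply_eq_iff_eq _) rfl rfl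
  · intro c _ h
    rw [assocOp, if_neg h, mul_zero]
  · exact fun h => absurd (Finset.mem_univ _) h

theorem hasDeg_assocOp : HasDeg (M := cutGr cV (cutGr cU Z Y) X) (N := cutGr cU Z (cutGr cV Y X)) 0
    (assocOp cV cU Z Y X) := by
  intro a b h
  refine if_neg fun e => h ?_
  subst e
  change Z.par b.1.1 + (Y.par b.1.2.2 + X.par b.2.2) = Z.par b.1.1 + Y.par b.1.2.2 + X.par b.2.2 + 0
  rw [add_zero, add_assoc]

theorem hasDeg_assocInvOp : HasDeg (M := cutGr cU Z (cutGr cV Y X))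
    (N := cutGr cV (cutGr cU Z Y) X) 0 (assocInvOp cV cU Z Y X) := by
  intro b a h
  refine if_neg fun e => h ?_
  subst e
  change Z.par b.1.1 + Y.par b.1.2.2 + X.par b.2.2 = Z.par b.1.1 + (Y.par b.1.2.2 + X.par b.2.2) + 0
  rw [add_zero, add_assoc]

theorem isClosedOp_assocOp : IsClosedOp (M := cutGr cV (cutGr cU Z Y) X)
    (N := cutGr cU Z (cutGr cV Y X)) 0 (assocOp cV cU Z Y X) := by
  refine ⟨hasDeg_assocOp, ?_⟩
  rw [sgn_zero, one_smul, cutGr_assoc_d]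
  exact (assocOp_mul_reassoc _).symm

end Assoc

theorem append_assoc₅ {α : Type*} {a b c d e : ℕ} (A : Fin a → α) (B : Fin b → α) (C : Fin c → α)
    (D : Fin d → α) (E : Fin e → α) (h : a + b + c + d + e = a + b + (c + d + e))
    (i : Fin (a + b + c + d + e)) :
    Fin.append (Fin.append (Fin.append (Fin.append A B) C) D) E i =
      Fin.append (Fin.append A B) (Fin.append (Fin.append C D) E) (Fin.cast h i) := by
  rw [Fin.append_assoc, Fin.append_assoc, Fin.append_assoc C D E, Fin.append_cast_right]
  rfl

theorem map_append {α β : Type*} {a b : ℕ} (F : α → β) (A : Fin a → α) (B : Fin b → α)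
    (i : Fin (a + b)) : F (Fin.append A B i) = Fin.append (fun i => F (A i)) (fun i => F (B i)) i := by
  refine Fin.addCases (fun j => ?_) (fun j => ?_) i
  · rw [Fin.append_left, Fin.append_left]
  · rw [Fin.append_right, Fin.append_right]

/-! ### Clifford linearity of the associator -/

section AssocClifford

variable {k : Type u} [CommRing k] [Algebra ℚ k] {W V U Q : Potential k} (cV : CutChoice V)
  (cU : CutChoice U) (Z : CliffordData (PolyRing U Q)) (Y : CliffordData (PolyRing V U))
  (X : CliffordData (PolyRing W V))

/-- Treats γ and γ† at once. The families z, y, x come from the three factors, u and v from the two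
cuts; on either side they appear as the same five blocks in the order z, u, y, v, x, and only the
bracketing differs. -/
theorem append_cut_assoc (hZ : HasDeg (M := Z.toGradedOp) (N := Z.toGradedOp) 0 Z.e)
    (hY : HasDeg (M := Y.toGradedOp) (N := Y.toGradedOp) 0 Y.e) {a b c d f : ℕ}
    (z : Fin a → Op Z.toGradedOp Z.toGradedOp) (y : Fin c → Op Y.toGradedOp Y.toGradedOp)
    (x : Fin f → Op X.toGradedOp X.toGradedOp)
    (u : Fin b → Op (cutGr cU Z.toGradedOp Y.toGradedOp) (cutGr cU Z.toGradedOp Y.toGradedOp))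
    (u' : Fin b → Op (cutGr cU Z.toGradedOp (cutGr cV Y.toGradedOp X.toGradedOp))
      (cutGr cU Z.toGradedOp (cutGr cV Y.toGradedOp X.toGradedOp)))
    (v : Fin d → Op (cutGr cV Y.toGradedOp X.toGradedOp) (cutGr cV Y.toGradedOp X.toGradedOp))
    (v' : Fin d → Op (cutGr cV (cutGr cU Z.toGradedOp Y.toGradedOp) X.toGradedOp)
      (cutGr cV (cutGr cU Z.toGradedOp Y.toGradedOp) X.toGradedOp))
    (hu : ∀ j, cutOpL 0 (u j) 1 = reassoc (u' j))
    (hv : ∀ j, v' j = reassoc (cutOpR 1 1 (v j)))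
    (h : a + b + c + d + f = a + b + (c + d + f)) (i : Fin (a + b + c + d + f)) :
    Fin.append (Fin.append
      (fun j => cutOpL (cV := cV) 0 (Fin.append (Fin.append (fun j => cU.cutOp 0 (z j) Y.e)
        (fun i => u i * cU.cutOp 0 Z.e Y.e)) (fun l => cU.cutOp 1 Z.e (y l)) j) X.e)
      (fun i => v' i * cutOpL 0 (cU.cutOp 0 Z.e Y.e) X.e))
      (fun l => cutOpL 1 (cU.cutOp 0 Z.e Y.e) (x l)) i =
    reassoc (Fin.append (Fin.append (fun j => cutOpR 0 (z j) (cV.cutOp 0 Y.e X.e))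
      (fun i => u' i * cutOpR 0 Z.e (cV.cutOp 0 Y.e X.e)))
      (fun l => cutOpR 1 Z.e (Fin.append (Fin.append (fun j => cV.cutOp 0 (y j) X.e)
        (fun i => v i * cV.cutOp 0 Y.e X.e)) (fun l => cV.cutOp 1 Y.e (x l)) l)) (Fin.cast h i)) := by
  have e := cutOp_assoc (cV := cV) (cU := cU) (zero_add 0) Z.e Y.e X.e
  have hE : HasDeg (M := cutGr cU Z.toGradedOp Y.toGradedOp)
      (N := cutGr cU Z.toGradedOp Y.toGradedOp) 0 (cU.cutOp 0 Z.e Y.e) := by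
    have := HasDeg.cut cU hZ hY
    rwa [add_zero] at this
  have hA : (fun j => cutOpL (cV := cV) 0 (cU.cutOp 0 (z j) Y.e) X.e) =
      fun j => reassoc (cutOpR 0 (z j) (cV.cutOp 0 Y.e X.e)) :=
    funext fun j => cutOp_assoc (zero_add 0) _ _ _
  have hB : (fun j => cutOpL (cV := cV) 0 (u j * cU.cutOp 0 Z.e Y.e) X.e) =
      fun j => reassoc (u' j * cutOpR 0 Z.e (cV.cutOp 0 Y.e X.e)) := funext fun j => by
    rw [cutOpL_mul hE, reassoc_mul, hu, e]
  have hC : (fun j => cutOpL (cV := cV) 0 (cU.cutOp 1 Z.e (y j)) X.e) =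
      fun j => reassoc (cutOpR 1 Z.e (cV.cutOp 0 (y j) X.e)) :=
    funext fun j => cutOp_assoc (zero_add 1) _ _ _
  have hD : (fun j => v' j * cutOpL 0 (cU.cutOp 0 Z.e Y.e) X.e) =
      fun j => reassoc (cutOpR 1 Z.e (v j * cV.cutOp 0 Y.e X.e)) := funext fun j => by
    have h := cutOp_even_mul cU (p := 1) (g := (1 : Op Z.toGradedOp Z.toGradedOp)) (g' := Z.e)
      (X := cutGr cV Y.toGradedOp X.toGradedOp) (X' := cutGr cV Y.toGradedOp X.toGradedOp)
      (X'' := cutGr cV Y.toGradedOp X.toGradedOp) (f := v j) (f' := cV.cutOp 0 Y.e X.e) hZ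
    rw [Matrix.one_mul] at h
    refine Eq.trans ?_ (congrArg reassoc h)
    rw [hv, e]
    exact (reassoc_mul _ _).symm
  have hF : (fun j => cutOpL (cV := cV) 1 (cU.cutOp 0 Z.e Y.e) (x j)) =
      fun j => reassoc (cutOpR 1 Z.e (cV.cutOp 1 Y.e (x j))) :=
    funext fun j => cutOp_assoc (add_zero 1) _ _ _
  have m1 : (fun j => cutOpL (cV := cV) 0 (Fin.append (Fin.append (fun j => cU.cutOp 0 (z j) Y.e)
      (fun i => u i * cU.cutOp 0 Z.e Y.e)) (fun l => cU.cutOp 1 Z.e (y l)) j) X.e) =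
      Fin.append (Fin.append (fun j => cutOpL (cV := cV) 0 (cU.cutOp 0 (z j) Y.e) X.e)
        (fun j => cutOpL (cV := cV) 0 (u j * cU.cutOp 0 Z.e Y.e) X.e))
        (fun j => cutOpL (cV := cV) 0 (cU.cutOp 1 Z.e (y j)) X.e) :=
    funext fun j => (map_append (fun A => cutOpL (cV := cV) 0 A X.e) _ _ j).trans
      (congrArg (fun t => Fin.append t _ j) (funext fun l =>
        map_append (fun A => cutOpL (cV := cV) 0 A X.e) _ _ l))
  have m2 : (fun l => reassoc (cutOpR (cU := cU) 1 Z.e (Fin.append (Fin.append (fun j => cV.cutOp 0 (y j) X.e)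
      (fun i => v i * cV.cutOp 0 Y.e X.e)) (fun l => cV.cutOp 1 Y.e (x l)) l))) =
      Fin.append (Fin.append (fun j => reassoc (cutOpR (cU := cU) 1 Z.e (cV.cutOp 0 (y j) X.e)))
        (fun i => reassoc (cutOpR (cU := cU) 1 Z.e (v i * cV.cutOp 0 Y.e X.e))))
        (fun l => reassoc (cutOpR (cU := cU) 1 Z.e (cV.cutOp 1 Y.e (x l)))) :=
    funext fun j => (map_append (fun A => reassoc (cutOpR (cU := cU) 1 Z.e A)) _ _ j).trans
      (congrArg (fun t => Fin.append t _ j) (funext fun l =>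
        map_append (fun A => reassoc (cutOpR (cU := cU) 1 Z.e A)) _ _ l))
  rw [m1, hA, hB, hC, hD, hF, append_assoc₅ _ _ _ _ _ h, ← m2]
  refine ((map_append reassoc _ _ _).trans (congrArg (fun t => Fin.append t _ _) (funext fun l =>
    map_append reassoc _ _ l))).symm

theorem cut_assoc_γ (hZ : Z.IsRep (potDiff U Q)) (hY : Y.IsRep (potDiff V U))
    (i : Fin (cut cV (cut cU Z Y) X).n) : (cut cV (cut cU Z Y) X).γ i =
      reassoc ((cut cU Z (cut cV Y X)).γ (Fin.cast (cut_assoc_n cV cU Z Y X) i)) :=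
  append_cut_assoc cV cU Z Y X hZ.e_closed.1 hY.e_closed.1 Z.γ Y.γ X.γ
    (cU.atiyah Z.toGradedOp Y.toGradedOp)
    (cU.atiyah Z.toGradedOp (cutGr cV Y.toGradedOp X.toGradedOp))
    (cV.atiyah Y.toGradedOp X.toGradedOp)
    (cV.atiyah (cutGr cU Z.toGradedOp Y.toGradedOp) X.toGradedOp)
    (fun j => atiyah_cut_left j) (fun j => atiyah_cut_right j) _ i

theorem cut_assoc_γd (hZ : Z.IsRep (potDiff U Q)) (hY : Y.IsRep (potDiff V U))
    (i : Fin (cut cV (cut cU Z Y) X).n) : (cut cV (cut cU Z Y) X).γd i =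
      reassoc ((cut cU Z (cut cV Y X)).γd (Fin.cast (cut_assoc_n cV cU Z Y X) i)) :=
  append_cut_assoc cV cU Z Y X hZ.e_closed.1 hY.e_closed.1 Z.γd Y.γd X.γd
    (cU.gammaDagger Z.toGradedOp Y.toGradedOp)
    (cU.gammaDagger Z.toGradedOp (cutGr cV Y.toGradedOp X.toGradedOp))
    (cV.gammaDagger Y.toGradedOp X.toGradedOp)
    (cV.gammaDagger (cutGr cU Z.toGradedOp Y.toGradedOp) X.toGradedOp)
    (fun j => gammaDagger_cut_left j hZ.isMF hY.isMF) (fun j => gammaDagger_cut_right j) _ i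

/-- The idempotents and generators of the two iterated cuts are reassociations of each other, so the
homotopies are equalities. -/
theorem isCliffordLinear_assoc (hZ : Z.IsRep (potDiff U Q)) (hY : Y.IsRep (potDiff V U)) :
    IsCliffordLinear (cut_assoc_n cV cU Z Y X) (assocMatrix cV cU Z Y X) := by
  have key : ∀ (p : ZMod 2)
      (A : Op (cut cV (cut cU Z Y) X).toGradedOp (cut cV (cut cU Z Y) X).toGradedOp)
      (B : Op (cut cU Z (cut cV Y X)).toGradedOp (cut cU Z (cut cV Y X)).toGradedOp),
      A = reassoc B → Htpy p (assocMatrix cV cU Z Y X * A :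
        Op (cut cV (cut cU Z Y) X).toGradedOp (cut cU Z (cut cV Y X)).toGradedOp)
        (B * assocMatrix cV cU Z Y X) := by
    rintro p _ B rfl
    exact htpy_of_eq (assocOp_mul_reassoc (cV := cV) (cU := cU) (Z := Z.toGradedOp)
      (Y := Y.toGradedOp) (X := X.toGradedOp) (Z' := Z.toGradedOp)
      (Y' := Y.toGradedOp) (X' := X.toGradedOp) B)
  exact ⟨isClosedOp_assocOp, key 0 _ _ (cutOp_assoc (zero_add 0) _ _ _),
    fun i => key 1 _ _ (cut_assoc_γ cV cU Z Y X hZ hY i),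
    fun i => key 1 _ _ (cut_assoc_γd cV cU Z Y X hZ hY i)⟩

end AssocClifford

/-! ### The associator as a 2-morphism -/

section AssocHom

variable {k : Type u} [CommRing k] [Algebra ℚ k] {W V U Q : Potential k} (cV : CutChoice V)
  (cU : CutChoice U)

theorem intertwines_assoc (Z : OneMor U Q) (Y : OneMor V U) (X : OneMor W V) :
    Intertwines (cutObj cV (cutObj cU Z Y) X) (cutObj cU Z (cutObj cV Y X))
      (assocMatrix cV cU Z.data Y.data X.data) :=
  IsCliffordLinear.intertwines (M := cutObj cV (cutObj cU Z Y) X)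
    (N := cutObj cU Z (cutObj cV Y X))
    (isCliffordLinear_assoc cV cU Z.data Y.data X.data Z.isRep Y.isRep)

theorem intertwines_assocInv (Z : OneMor U Q) (Y : OneMor V U) (X : OneMor W V) :
    Intertwines (cutObj cU Z (cutObj cV Y X)) (cutObj cV (cutObj cU Z Y) X)
      (assocInvOp cV cU Z.data.toGradedOp Y.data.toGradedOp X.data.toGradedOp) :=
  (intertwines_assoc cV cU Z Y X).inv hasDeg_assocInvOp assocInvOp_mul assocOp_mul_inv

/-- The associator. -/
noncomputable def assocIso (Z : OneMor U Q) (Y : OneMor V U) (X : OneMor W V) :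
    cutObj cV (cutObj cU Z Y) X ≅ cutObj cU Z (cutObj cV Y X) :=
  linIso (intertwines_assoc cV cU Z Y X) (intertwines_assocInv cV cU Z Y X) assocInvOp_mul
    assocOp_mul_inv

/-- The operator `e_m` on `Y | X`. -/
noncomputable abbrev idemGr (c : CutChoice V) (Y : GradedOp (PolyRing V U))
    (X : GradedOp (PolyRing W V)) : Op (cutGr c Y X) (cutGr c Y X) := c.cutIdem Y X

/-- Composition of operators. -/
abbrev opMul {R : Type u} [CommRing R] {M N P : GradedOp R} (g : Op N P) (f : Op M N) : Op M P :=
  g * f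

/-- After reassociation both sides are products of ζ | (ψ | φ) with the idempotents of the two cuts,
which occur in opposite orders. -/
theorem cutIdem_assoc_htpy {Z Z' : GradedOp (PolyRing U Q)} {Y Y' : GradedOp (PolyRing V U)}
    {X X' : GradedOp (PolyRing W V)} (hZ : IsMF (potDiff U Q) Z) (hY : IsMF (potDiff V U) Y)
    (hZ' : IsMF (potDiff U Q) Z') (hY' : IsMF (potDiff V U) Y') (hX' : IsMF (potDiff W V) X')
    {ζ : Op Z Z'} {ψ : Op Y Y'} {φ : Op X X'} (hζ : IsClosedOp 0 ζ) (hψ : IsClosedOp 0 ψ)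
    (hφ : IsClosedOp 0 φ) :
    Htpy (M := cutGr cV (cutGr cU Z Y) X) (N := cutGr cU Z' (cutGr cV Y' X')) 0
      (opMul (assocOp cV cU Z' Y' X') (opMul (idemGr cV (cutGr cU Z' Y') X')
        (cutOpL 0 (opMul (idemGr cU Z' Y') (cU.cutOp 0 ζ ψ)) φ)))
      (opMul (opMul (idemGr cU Z' (cutGr cV Y' X'))
        (cutOpR 0 ζ (opMul (idemGr cV Y' X') (cV.cutOp 0 ψ φ)))) (assocOp cV cU Z Y X)) := by
  have hζψ := IsClosedOp.cut cU hZ.d_deg hζ hψ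
  have hψφ := IsClosedOp.cut cV hY.d_deg hψ hφ
  rw [add_zero] at hζψ hψφ
  have hT := IsClosedOp.cut cU (X := cutGr cV Y X) (X' := cutGr cV Y' X') hZ.d_deg hζ hψφ
  rw [add_zero] at hT
  have e1 : cutOpL (cV := cV) 0 (opMul (idemGr cU Z' Y') (cU.cutOp 0 ζ ψ)) φ =
      opMul (cutOpL 0 (idemGr cU Z' Y') (1 : Op X' X')) (cutOpL 0 (cU.cutOp 0 ζ ψ) φ) := by
    have h := cutOp_even_mul cV (p := 0) (Y := cutGr cU Z Y) (Y' := cutGr cU Z' Y')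
      (Y'' := cutGr cU Z' Y') (g := cU.cutIdem Z' Y') (f := (1 : Op X' X'))
      (g' := cU.cutOp 0 ζ ψ) (f' := φ) hζψ.1
    rw [Matrix.one_mul] at h
    exact h.symm
  have e2 : cutOpR (cU := cU) 0 ζ (opMul (idemGr cV Y' X') (cV.cutOp 0 ψ φ)) =
      opMul (cutOpR 0 (1 : Op Z' Z') (idemGr cV Y' X')) (cutOpR 0 ζ (cV.cutOp 0 ψ φ)) := by
    have h := cutOp_even_mul cU (p := 0) (X := cutGr cV Y X) (X' := cutGr cV Y' X')
      (X'' := cutGr cV Y' X') (g := (1 : Op Z' Z')) (f := cV.cutIdem Y' X')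
      (g' := ζ) (f' := cV.cutOp 0 ψ φ) hζ.1
    rw [Matrix.one_mul] at h
    exact h.symm
  have e3 : opMul (assocOp cV cU Z' Y' X') (opMul (idemGr cV (cutGr cU Z' Y') X')
        (cutOpL 0 (opMul (idemGr cU Z' Y') (cU.cutOp 0 ζ ψ)) φ)) =
      opMul (opMul (cutOpR 0 (1 : Op Z' Z') (idemGr cV Y' X')) (idemGr cU Z' (cutGr cV Y' X')))
        (opMul (cutOpR 0 ζ (cV.cutOp 0 ψ φ)) (assocOp cV cU Z Y X)) := by
    rw [e1, idemGr, idemGr, cutIdem_cut_right hY' hX', cutIdem_cut_left hZ' hY',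
      cutOp_assoc (zero_add 0)]
    have h1 := assocOp_mul_reassoc (cutOpR (cV := cV) (cU := cU) 0 ζ (cV.cutOp 0 ψ φ))
    have h2 := assocOp_mul_reassoc (cU.cutIdem Z' (cutGr cV Y' X'))
    have h3 := assocOp_mul_reassoc (cutOpR (cU := cU) 0 (1 : Op Z' Z') (cV.cutIdem Y' X'))
    simp only [opMul] at *
    rw [← h1, ← Matrix.mul_assoc, h3, Matrix.mul_assoc, Matrix.mul_assoc]
    refine congrArg (fun t => _ * t) ?_
    rw [← Matrix.mul_assoc, h2, Matrix.mul_assoc]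
  rw [e3, e2]
  -- Naturality of the idempotent at U, applied to 1 | e_m, exchanges the two idempotents; no other
  -- homotopy enters.
  have h1 := cutIdem_natural cU hZ' (hY'.cut cV hX') hZ' (hY'.cut cV hX')
    (IsClosedOp.one (M := Z')) (closed_cutIdem cV hY' hX')
  have h2 := h1.mul_even (hT.even_mul (isClosedOp_assocOp (cV := cV) (cU := cU) (Z := Z) (Y := Y)
    (X := X)))
  have h3 := h2.symm
  simp only [Matrix.mul_assoc, opMul] at h3 ⊢
  exact h3

end AssocHom

section LinHomMem

variable {R : Type u} [CommRing R] [Algebra ℚ R] {W : R} {M N P : CliffordRep R W}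

theorem Intertwines.mul_mem {A : Op N.data.toGradedOp P.data.toGradedOp}
    {f : Op M.data.toGradedOp N.data.toGradedOp} (hA : Intertwines N P A)
    (hf : f ∈ cycles M.data N.data) : opMul A f ∈ cycles M.data P.data := by
  refine mem_cycles_of_htpy (mul_mem_cycles hf hA.mem)
    (IsClosedOp.mul (p := 0) (q := 0) hA.closed hf.1) ?_
  rw [Matrix.mul_assoc]
  exact Htpy.mul_left (p := 0) (q := 0) hA.closed (unit_mul_htpy hf)

theorem Intertwines.mem_mul {A : Op M.data.toGradedOp N.data.toGradedOp}
    {f : Op N.data.toGradedOp P.data.toGradedOp} (hA : Intertwines M N A)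
    (hf : f ∈ cycles N.data P.data) : opMul f A ∈ cycles M.data P.data := by
  refine mem_cycles_of_htpy (mul_mem_cycles hA.mem hf)
    (IsClosedOp.mul (p := 0) (q := 0) hf.1 hA.closed) ?_
  have h1 := Htpy.mul_left (p := 0) (q := 0) hf.1 hA.unit
  have h2 := Htpy.mul_right (p := 0) (q := 0) hA.closed (mul_unit_htpy hf)
  rw [Matrix.mul_assoc] at h2
  exact h1.symm.trans h2

end LinHomMem

/-! ### Signed maps of basis vectors -/

section Monomial

variable {R : Type u} [CommRing R] {M N P : GradedOp R}

/-- The operator which sends the basis vector `b` to `(-1)^(s b)` times the basis vector `u b`. -/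
def monOp (u : M.ι → N.ι) (s : M.ι → ZMod 2) : Op M N :=
  fun a b => if a = u b then sgn R (s b) else 0

theorem monOp_mul (u : N.ι → P.ι) (s : N.ι → ZMod 2) (v : M.ι → N.ι) (t : M.ι → ZMod 2) :
    opMul (monOp u s : Op N P) (monOp v t : Op M N) =
      monOp (fun b => u (v b)) (fun b => s (v b) + t b) := by
  ext1 a b
  change (monOp u s * monOp v t : Matrix P.ι M.ι R) a b = _
  rw [Matrix.mul_apply, Finset.sum_eq_single (v b)]
  · simp only [monOp, if_true]
    split_ifs
    · rw [sgn_add]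
    · rw [zero_mul]
  · intro c _ h
    rw [monOp, monOp, if_neg h, mul_zero]
  · exact fun h => absurd (Finset.mem_univ _) h

theorem one_eq_monOp : (1 : Op M M) = monOp id 0 := by
  ext1 a b
  rw [Matrix.one_apply, monOp, Pi.zero_apply, sgn_zero]; rfl

theorem neg_monOp (u : M.ι → N.ι) (s : M.ι → ZMod 2) :
    -(monOp u s : Op M N) = monOp u (fun b => s b + 1) := by
  ext1 a b
  rw [Matrix.neg_apply, monOp, monOp, sgn_add, sgn_one, mul_neg_one]
  split_ifs
  · rfl
  · rw [neg_zero]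

variable {k : Type u} [CommRing k] {W V U Q : Potential k}

theorem contract_one_one {ε : V.Hat →+ k} (hε : IsBaseLinear ε) :
    contract (W := W) (U := U) ε 1 1 = C (ε 1) := by
  have h := contract_prod (W := W) (U := U) hε 1 1 1 1
  simp only [map_one, mul_one] at h
  rw [h, rename_C]

theorem contract_zero_left {ε : V.Hat →+ k} (f : PolyRing W V) :
    contract (U := U) ε 0 f = 0 := by
  rw [contract, map_zero, zero_mul, map_zero]

theorem contract_zero_right {ε : V.Hat →+ k} (g : PolyRing V U) :
    contract (W := W) ε g 0 = 0 := by
  rw [contract, map_zero, mul_zero, map_zero]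

/-- Together with `monOp_mul`, this reduces each coherence identity to an equality of maps of
indices and an equality of exponents of -1. -/
theorem cutOp_monOp (c : CutChoice V) {Y Y' : GradedOp (PolyRing V U)}
    {X X' : GradedOp (PolyRing W V)} (u : Y.ι → Y'.ι) (s : Y.ι → ZMod 2) (v : X.ι → X'.ι)
    (t : X.ι → ZMod 2) :
    (c.cutOp 0 (monOp u s : Op Y Y') (monOp v t : Op X X') : Op (cutGr c Y X) (cutGr c Y' X')) =
      monOp (M := cutGr c Y X) (N := cutGr c Y' X') (fun b => (u b.1, b.2.1, v b.2.2))
        (fun b => s b.1 + t b.2.2) := by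
  rw [cutOp_eq_cutWith]
  ext1 a b
  rw [cutWith_apply, zero_mul, sgn_zero, one_mul, monOp, monOp, monOp]
  by_cases h1 : a.1 = u b.1
  swap
  · rw [if_neg h1, contract_zero_left, if_neg fun h => h1 (congrArg Prod.fst h)]
  by_cases h3 : a.2.2 = v b.2.2
  swap
  · rw [if_neg h3, contract_zero_right, if_neg fun h => h3 (congrArg (fun x => x.2.2) h)]
  rw [if_pos h1, if_pos h3, ← mul_one (sgn _ (s b.1)), ← mul_one (sgn _ (t b.2.2)),
    contract_sgn_left, contract_sgn_right, contract_one_one fun a s => c.hatEntry_base_mul _ _ a s,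
    c.hatEntry_one, ← mul_assoc, ← sgn_add]
  by_cases h2 : a.2.1 = b.2.1
  · rw [if_pos h2, map_one, mul_one, if_pos (Prod.ext h1 (Prod.ext h2 h3))]
  · rw [if_neg h2, map_zero, mul_zero, if_neg fun h => h2 (congrArg (fun x => x.2.1) h)]

theorem assocOp_eq_monOp (cV : CutChoice V) (cU : CutChoice U) (Z : GradedOp (PolyRing U Q))
    (Y : GradedOp (PolyRing V U)) (X : GradedOp (PolyRing W V)) :
    assocOp cV cU Z Y X = monOp (M := cutGr cV (cutGr cU Z Y) X) (N := cutGr cU Z (cutGr cV Y X))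
      (fun b => (b.1.1, b.1.2.1, b.1.2.2, b.2.1, b.2.2)) 0 := by
  ext1 a b
  rw [monOp, Pi.zero_apply, sgn_zero]; rfl

end Monomial

/-! ### Naturality of the associator and the pentagon -/

section AssocCoherence

variable {k : Type u} [CommRing k] [Algebra ℚ k] {W V U Q S : Potential k} (cV : CutChoice V)
  (cU : CutChoice U) (cQ : CutChoice Q)

theorem assoc_natural {Z Z' : OneMor U Q} {Y Y' : OneMor V U} {X X' : OneMor W V}
    (ζ : Z ⟶ Z') (ψ : Y ⟶ Y') (φ : X ⟶ X') :
    cutHom cV (cutHom cU ζ ψ) φ ≫ (assocIso cV cU Z' Y' X').hom =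
      (assocIso cV cU Z Y X).hom ≫ cutHom cU ζ (cutHom cV ψ φ) := by
  revert ζ ψ φ
  refine CliffordRep.homMk_ind fun ζ hζ => CliffordRep.homMk_ind fun ψ hψ =>
    CliffordRep.homMk_ind fun φ hφ => ?_
  have hA := intertwines_assoc cV cU Z Y X
  have hA' := intertwines_assoc cV cU Z' Y' X'
  have h1 := cutIdem_mul_cutOp_mem cV (Y := cutObj cU Z Y) (Y' := cutObj cU Z' Y')
    (cutIdem_mul_cutOp_mem cU hζ hψ) hφ
  have h2 := cutIdem_mul_cutOp_mem cU (X := cutObj cV Y X) (X' := cutObj cV Y' X') hζ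
    (cutIdem_mul_cutOp_mem cV hψ hφ)
  refine (homMk_comp_linHom (M := cutObj cV (cutObj cU Z Y) X)
    (N := cutObj cV (cutObj cU Z' Y') X') (P := cutObj cU Z' (cutObj cV Y' X')) h1 hA'
    (hA'.mul_mem h1)).trans (Eq.trans ?_ (linHom_comp_homMk hA h2 (hA.mem_mul h2)).symm)
  exact CliffordRep.homMk_eq (M := cutObj cV (cutObj cU Z Y) X)
    (N := cutObj cU Z' (cutObj cV Y' X')) (cutIdem_assoc_htpy cV cU Z.isRep.isMF Y.isRep.isMF
    Z'.isRep.isMF Y'.isRep.isMF X'.isRep.isMF hζ.1 hψ.1 hφ.1)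

/-- No signs occur, and both composites move the brackets of the same indices. -/
theorem pentagon_op (L : GradedOp (PolyRing Q S)) (Z : GradedOp (PolyRing U Q))
    (Y : GradedOp (PolyRing V U)) (X : GradedOp (PolyRing W V)) :
    opMul (cQ.cutOp (X := cutGr cV (cutGr cU Z Y) X) (X' := cutGr cU Z (cutGr cV Y X)) 0
        (1 : Op L L) (assocOp cV cU Z Y X))
      (opMul (assocOp cV cQ L (cutGr cU Z Y) X) (cV.cutOp (Y := cutGr cU (cutGr cQ L Z) Y)
        (Y' := cutGr cQ L (cutGr cU Z Y)) 0 (assocOp cU cQ L Z Y) (1 : Op X X))) =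
    opMul (assocOp cU cQ L Z (cutGr cV Y X)) (assocOp cV cU (cutGr cQ L Z) Y X) := by
  rw [assocOp_eq_monOp, assocOp_eq_monOp, assocOp_eq_monOp, assocOp_eq_monOp, assocOp_eq_monOp,
    one_eq_monOp, one_eq_monOp]
  refine (congrArg₂ opMul (cutOp_monOp cQ (X := cutGr cV (cutGr cU Z Y) X)
    (X' := cutGr cU Z (cutGr cV Y X)) _ _ _ _) (congrArg₂ opMul rfl (cutOp_monOp cV
      (Y := cutGr cU (cutGr cQ L Z) Y) (Y' := cutGr cQ L (cutGr cU Z Y)) _ _ _ _))).trans ?_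
  refine (congrArg₂ opMul rfl (monOp_mul _ _ _ _)).trans ((monOp_mul _ _ _ _).trans
    (Eq.trans ?_ (monOp_mul _ _ _ _).symm))
  refine congrArg₂ monOp rfl (funext fun b => ?_)
  simp only [Pi.zero_apply, add_zero]

theorem pentagon_hom (L : OneMor Q S) (Z : OneMor U Q) (Y : OneMor V U) (X : OneMor W V) :
    cutHom cV (assocIso cU cQ L Z Y).hom (𝟙 X) ≫ (assocIso cV cQ L (cutObj cU Z Y) X).hom ≫
        cutHom cQ (𝟙 L) (assocIso cV cU Z Y X).hom =
      (assocIso cV cU (cutObj cQ L Z) Y X).hom ≫ (assocIso cU cQ L Z (cutObj cV Y X)).hom := by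
  have h1 := cutHom_linHom cV (intertwines_assoc cU cQ L Z Y) (Intertwines.one X)
  have h2 := cutHom_linHom cQ (Intertwines.one L) (intertwines_assoc cV cU Z Y X)
  rw [linHom_one] at h1 h2
  refine (congrArg₂ (· ≫ ·) h1 (congrArg₂ (· ≫ ·) rfl h2)).trans ?_
  refine (congrArg₂ (· ≫ ·) rfl
    (linHom_comp (intertwines_assoc cV cQ L (cutObj cU Z Y) X) _)).trans ?_
  refine (linHom_comp _ _).trans ((linHom_congr ?_).trans (linHom_comp
    (intertwines_assoc cV cU (cutObj cQ L Z) Y X)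
    (intertwines_assoc cU cQ L Z (cutObj cV Y X))).symm)
  exact (Matrix.mul_assoc _ _ _).trans (pentagon_op cV cU cQ _ _ _ _)

end AssocCoherence

/-! ### Operators that intertwine up to the sign -1 -/

section AntiCommute

variable {R : Type u} [CommRing R]

theorem opMul_assoc {M N P Q : GradedOp R} (h : Op P Q) (g : Op N P) (f : Op M N) :
    opMul (opMul h g) f = opMul h (opMul g f) := Matrix.mul_assoc h g f

theorem opMul_neg {M N P : GradedOp R} (g : Op N P) (f : Op M N) :
    opMul g (-f) = -opMul g f := Matrix.mul_neg g f

theorem neg_opMul {M N P : GradedOp R} (g : Op N P) (f : Op M N) :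
    opMul (-g) f = -opMul g f := Matrix.neg_mul g f

theorem opMul_add {M N P : GradedOp R} (g : Op N P) (f f' : Op M N) :
    opMul g (f + f') = opMul g f + opMul g f' := Matrix.mul_add g f f'

theorem add_opMul {M N P : GradedOp R} (g g' : Op N P) (f : Op M N) :
    opMul (g + g') f = opMul g f + opMul g' f := Matrix.add_mul g g' f

theorem opMul_sum {M N P : GradedOp R} {α : Type*} (s : Finset α) (g : Op N P) (f : α → Op M N) :
    opMul g (∑ i ∈ s, f i) = ∑ i ∈ s, opMul g (f i) := Matrix.mul_sum s f g

theorem sum_opMul {M N P : GradedOp R} {α : Type*} (s : Finset α) (g : α → Op N P) (f : Op M N) :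
    opMul (∑ i ∈ s, g i) f = ∑ i ∈ s, opMul (g i) f := Matrix.sum_mul s g f

/-- `F` intertwines `A'` and `-A`. -/
def AntiCommutes {M N : GradedOp R} (F : Op M N) (A' : Op M M) (A : Op N N) : Prop :=
  opMul F A' = -opMul A F

theorem AntiCommutes.opMul_even {M N : GradedOp R} {F : Op M N} {A' B' : Op M M} {A B : Op N N}
    (h : AntiCommutes F A' A) (h' : opMul F B' = opMul B F) :
    AntiCommutes F (opMul A' B') (opMul A B) := by
  unfold AntiCommutes at *
  rw [← opMul_assoc, h, neg_opMul, opMul_assoc, h', opMul_assoc]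

theorem AntiCommutes.even_opMul {M N : GradedOp R} {F : Op M N} {A' B' : Op M M} {A B : Op N N}
    (h : AntiCommutes F A' A) (h' : opMul F B' = opMul B F) :
    AntiCommutes F (opMul B' A') (opMul B A) := by
  unfold AntiCommutes at *
  rw [← opMul_assoc, h', opMul_assoc, h, opMul_neg, opMul_assoc]

theorem AntiCommutes.add {M N : GradedOp R} {F : Op M N} {A' B' : Op M M} {A B : Op N N}
    (h : AntiCommutes F A' A) (h' : AntiCommutes F B' B) : AntiCommutes F (A' + B') (A + B) := by
  unfold AntiCommutes at *
  rw [opMul_add, h, h', add_opMul, neg_add]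

theorem AntiCommutes.neg {M N : GradedOp R} {F : Op M N} {A' : Op M M} {A : Op N N}
    (h : AntiCommutes F A' A) : AntiCommutes F (-A') (-A) := by
  unfold AntiCommutes at *
  rw [opMul_neg, h, neg_opMul]

theorem AntiCommutes.sum {M N : GradedOp R} {F : Op M N} {α : Type*} (s : Finset α)
    {A' : α → Op M M} {A : α → Op N N} (h : ∀ i, AntiCommutes F (A' i) (A i)) :
    AntiCommutes F (∑ i ∈ s, A' i) (∑ i ∈ s, A i) := by
  unfold AntiCommutes at *
  rw [opMul_sum, sum_opMul, ← Finset.sum_neg_distrib]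
  exact Finset.sum_congr rfl fun i _ => h i

/-- Every layer contains two generators, so the signs cancel in pairs. -/
theorem AntiCommutes.nest {M N : GradedOp R} {F : Op M N} {n : ℕ} {γ' γd' : Fin n → Op M M}
    {γ γd : Fin n → Op N N} {x' : Op M M} {x : Op N N} (h : ∀ i, AntiCommutes F (γ' i) (γ i))
    (hd : ∀ i, AntiCommutes F (γd' i) (γd i)) (hx : opMul F x' = opMul x F) :
    opMul F (nest γ' γd' x') = opMul (nest γ γd x) F := by
  unfold CutSystem.nest
  induction List.finRange n with
  | nil => exact hx
  | cons i L ih =>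
    rw [List.foldr_cons, List.foldr_cons]
    have h1 := (h i).opMul_even ih
    unfold AntiCommutes at h1 hd
    change opMul F (opMul (opMul _ _) _) = opMul (opMul (opMul _ _) _) F
    rw [← opMul_assoc, h1, neg_opMul, opMul_assoc, hd, opMul_neg, neg_neg, opMul_assoc, opMul_assoc,
      opMul_assoc]

theorem append_rel {α β : Type*} {r : α → β → Prop} {a b : ℕ} {A : Fin a → α} {B : Fin b → α}
    {A' : Fin a → β} {B' : Fin b → β} (h : ∀ i, r (A i) (A' i)) (h' : ∀ i, r (B i) (B' i))
    (i : Fin (a + b)) : r (Fin.append A B i) (Fin.append A' B' i) := by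
  refine Fin.addCases (fun j => ?_) (fun j => ?_) i
  · rw [Fin.append_left, Fin.append_left]; exact h j
  · rw [Fin.append_right, Fin.append_right]; exact h' j

/-- The shift negates the differential and the generators of N. Anticommuting with the original data
is thus commuting with the shifted data. -/
theorem isCliffordLinear_shift {M N : CliffordData R} (hn : M.n = N.n)
    {F : Op M.toGradedOp N.toGradedOp}
    (hF : HasDeg (M := M.toGradedOp) (N := N.toGradedOp.shift) 0 F) (hd : AntiCommutes F M.d N.d)
    (he : opMul F M.e = opMul N.e F) (hγ : ∀ i, AntiCommutes F (M.γ i) (N.γ (Fin.cast hn i)))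
    (hγd : ∀ i, AntiCommutes F (M.γd i) (N.γd (Fin.cast hn i))) :
    IsCliffordLinear (M := M) (N := N.shift) hn F := by
  refine ⟨⟨hF, ?_⟩, htpy_of_eq he, fun i => htpy_of_eq ?_, fun i => htpy_of_eq ?_⟩
  · rw [sgn_zero, one_smul]
    exact (Matrix.neg_mul N.d F).trans hd.symm
  · exact (hγ i).trans (Matrix.neg_mul _ F).symm
  · exact (hγd i).trans (Matrix.neg_mul _ F).symm

end AntiCommute

/-! ### The shift isomorphisms as operators -/

section ShiftCut

variable {k : Type u} [CommRing k] {W V U : Potential k} (c : CutChoice V)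

/-- The operator `y ⊗ x ↦ y ⊗ x` from `ΨY | X` to `Y | X`. -/
noncomputable def shiftL (Y : GradedOp (PolyRing V U)) (X : GradedOp (PolyRing W V)) :
    Op (cutGr c Y.shift X) (cutGr c Y X) :=
  monOp (M := cutGr c Y.shift X) (N := cutGr c Y X) (fun b => b) 0

/-- The operator `y ⊗ x ↦ (-1)^|y| y ⊗ x` from `Y | ΨX` to `Y | X`. -/
noncomputable def shiftR (Y : GradedOp (PolyRing V U)) (X : GradedOp (PolyRing W V)) :
    Op (cutGr c Y X.shift) (cutGr c Y X) :=
  monOp (M := cutGr c Y X.shift) (N := cutGr c Y X) (fun b => b) (fun b => Y.par b.1)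

theorem monOp_id_opMul {R : Type u} [CommRing R] {L M N : GradedOp R} (u : M.ι → N.ι)
    (u' : N.ι → M.ι) (h1 : ∀ a, u (u' a) = a) (h2 : ∀ a, u' (u a) = a) (s : M.ι → ZMod 2)
    (A : Op L M) (a : N.ι) (b : L.ι) :
    opMul (monOp u s) A a b = sgn R (s (u' a)) * A (u' a) b := by
  change (monOp u s * A : Matrix N.ι L.ι R) a b = _
  rw [Matrix.mul_apply, Finset.sum_eq_single (u' a)]
  · rw [monOp, if_pos (h1 a).symm]
  · intro x _ hx
    rw [monOp, if_neg fun h => hx (by rw [h, h2]), zero_mul]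
  · exact fun h => absurd (Finset.mem_univ _) h

theorem opMul_monOp {R : Type u} [CommRing R] {L M N : GradedOp R} (u : L.ι → M.ι)
    (s : L.ι → ZMod 2) (A : Op M N) (a : N.ι) (b : L.ι) :
    opMul A (monOp u s) a b = A a (u b) * sgn R (s b) := by
  change (A * monOp u s : Matrix N.ι L.ι R) a b = _
  rw [Matrix.mul_apply, Finset.sum_eq_single (u b)]
  · rw [monOp, if_pos rfl]
  · intro x _ hx
    rw [monOp, if_neg hx, mul_zero]
  · exact fun h => absurd (Finset.mem_univ _) h

variable {Y Y' : GradedOp (PolyRing V U)} {X X' : GradedOp (PolyRing W V)}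

theorem shiftL_opMul {L : GradedOp (PolyRing W U)} (A : Op L (cutGr c Y.shift X))
    (a : Y.ι × Fin c.m × X.ι) (b : L.ι) : opMul (shiftL c Y X) A a b = A a b :=
  (monOp_id_opMul (M := cutGr c Y.shift X) (N := cutGr c Y X) _ (fun b => b) (fun _ => rfl)
    (fun _ => rfl) _ A a b).trans (by
    change sgn _ 0 * _ = _; rw [sgn_zero, one_mul])

theorem opMul_shiftL {N : GradedOp (PolyRing W U)} (A : Op (cutGr c Y X) N)
    (a : N.ι) (b : Y.ι × Fin c.m × X.ι) : opMul A (shiftL c Y X) a b = A a b :=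
  (opMul_monOp (L := cutGr c Y.shift X) (M := cutGr c Y X) _ _ A a b).trans
    (by
    change _ * sgn _ 0 = _; rw [sgn_zero, mul_one])

theorem shiftR_opMul {L : GradedOp (PolyRing W U)} (A : Op L (cutGr c Y X.shift))
    (a : Y.ι × Fin c.m × X.ι) (b : L.ι) :
    opMul (shiftR c Y X) A a b = sgn _ (Y.par a.1) * A a b :=
  monOp_id_opMul (M := cutGr c Y X.shift) (N := cutGr c Y X) _ (fun b => b) (fun _ => rfl)
    (fun _ => rfl) _ A a b

theorem opMul_shiftR {N : GradedOp (PolyRing W U)} (A : Op (cutGr c Y X) N)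
    (a : N.ι) (b : Y.ι × Fin c.m × X.ι) :
    opMul A (shiftR c Y X) a b = A a b * sgn _ (Y.par b.1) :=
  opMul_monOp (L := cutGr c Y X.shift) (M := cutGr c Y X) _ _ A a b

/-- Shifting Y changes the Koszul sign (-1)^(p|y|) by the factor (-1)^p. -/
theorem shiftL_cutWith (φ : Fin c.m → Fin c.m → V.Hat →+ k) (p : ZMod 2) (g : Op Y Y')
    (f : Op X X') : opMul (shiftL c Y' X')
      (cutWith c φ (Y := Y.shift) (Y' := Y'.shift) p g f) =
      sgn (PolyRing W U) p • opMul (cutWith c φ p g f) (shiftL c Y X) := by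
  refine Matrix.ext fun (a : Y'.ι × Fin c.m × X'.ι) (b : Y.ι × Fin c.m × X.ι) => ?_
  have e1 := (shiftL_opMul c (L := cutGr c Y.shift X) (Y := Y') (X := X')
    (cutWith c φ (Y := Y.shift) (Y' := Y'.shift) p g f) a b).trans
    (cutWith_apply c φ (Y := Y.shift) (Y' := Y'.shift) p g f a b)
  have e2 := (opMul_shiftL c (cutWith c φ p g f) a b).trans (cutWith_apply c φ p g f a b)
  have key : ∀ z : PolyRing W U, sgn _ (p * (Y.par b.1 + 1)) * z =
      sgn _ p * (sgn _ (p * Y.par b.1) * z) := fun z => by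
    rw [← mul_assoc, ← sgn_add, mul_add, mul_one, add_comm]
  exact e1.trans ((key _).trans (congrArg (fun t => sgn _ p * t) e2).symm)

/-- On the nonzero entries of g the parities of target and source differ by q, so the signs (-1)^|y|
on the two sides differ by (-1)^q. The Koszul sign is unaffected, as Y is not shifted. -/
theorem shiftR_cutWith (φ : Fin c.m → Fin c.m → V.Hat →+ k) (p : ZMod 2) {q : ZMod 2}
    {g : Op Y Y'} (hg : HasDeg q g) (f : Op X X') : opMul (shiftR c Y' X')
      (cutWith c φ (X := X.shift) (X' := X'.shift) p g f) =
      sgn (PolyRing W U) q • opMul (cutWith c φ p g f) (shiftR c Y X) := by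
  refine Matrix.ext fun (a : Y'.ι × Fin c.m × X'.ι) (b : Y.ι × Fin c.m × X.ι) => ?_
  have e1 := (shiftR_opMul c (L := cutGr c Y X.shift) (Y := Y') (X := X')
    (cutWith c φ (X := X.shift) (X' := X'.shift) p g f) a b).trans (congrArg (fun t => sgn _ (Y'.par a.1) * t)
    (cutWith_apply c φ (X := X.shift) (X' := X'.shift) p g f a b))
  have e2 := (opMul_shiftR c (cutWith c φ p g f) a b).trans
    (congrArg (fun t => t * sgn _ (Y.par b.1)) (cutWith_apply c φ p g f a b))
  refine e1.trans (Eq.trans ?_ (congrArg (fun t => sgn _ q * t) e2).symm)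
  by_cases h : Y'.par a.1 = Y.par b.1 + q
  · have key : ∀ z s : PolyRing W U, sgn _ (Y'.par a.1) * (s * z) =
        sgn _ q * (s * z * sgn _ (Y.par b.1)) := fun z s => by
      rw [h, sgn_add]; ring
    exact key _ _
  · have key : ∀ z s t s' t' : PolyRing W U, z = 0 → s * (t * z) = s' * (t * z * t') := by
      rintro _ s t s' t' rfl
      rw [mul_zero, mul_zero, zero_mul, mul_zero]
    refine key _ _ _ _ _ ?_
    rw [hg _ _ h]
    exact contract_zero_left _

theorem antiCommutes_shiftL {φ : Fin c.m → Fin c.m → V.Hat →+ k} (g : Op Y Y) (f : Op X X) :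
    AntiCommutes (shiftL c Y X) (cutWith c φ (Y := Y.shift) (Y' := Y.shift) 1 g f)
      (cutWith c φ 1 g f) := by
  unfold AntiCommutes
  rw [shiftL_cutWith, sgn_one, neg_one_smul]

theorem antiCommutes_shiftR {φ : Fin c.m → Fin c.m → V.Hat →+ k} {p : ZMod 2} {g : Op Y Y}
    (hg : HasDeg 1 g) (f : Op X X) :
    AntiCommutes (shiftR c Y X) (cutWith c φ (X := X.shift) (X' := X.shift) p g f)
      (cutWith c φ p g f) := by
  unfold AntiCommutes
  rw [shiftR_cutWith c φ p hg, sgn_one, neg_one_smul]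

end ShiftCut

theorem AntiCommutes.congr {R : Type u} [CommRing R] {M N : GradedOp R} {F : Op M N} {A' B' : Op M M}
    {A B : Op N N} (h : AntiCommutes F A' A) (e' : B' = A') (e : B = A) : AntiCommutes F B' B := by
  rw [e', e]; exact h

theorem opMul_congr {R : Type u} [CommRing R] {M M' N N' : GradedOp R} {F' : Op M' N'} {F : Op M N}
    {A' B' : Op M M'} {A B : Op N N'} (h : opMul F' A' = opMul A F) (e' : B' = A') (e : B = A) :
    opMul F' B' = opMul B F := by
  rw [e', e]; exact h

/-! ### Generators of the cut under the shifts -/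

section ShiftCut

variable {k : Type u} [CommRing k] {W V U : Potential k} (c : CutChoice V)
  {Y Y' : GradedOp (PolyRing V U)} {X X' : GradedOp (PolyRing W V)}

theorem cutWith_neg_left (φ : Fin c.m → Fin c.m → V.Hat →+ k) (p : ZMod 2) (g : Op Y Y')
    (f : Op X X') : cutWith c φ p (-g) f = -cutWith c φ p g f := by
  ext1 a b
  rw [Matrix.neg_apply, cutWith_apply, cutWith_apply, Matrix.neg_apply, contract_neg_left, mul_neg]

theorem cutWith_neg_right (φ : Fin c.m → Fin c.m → V.Hat →+ k) (p : ZMod 2) (g : Op Y Y')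
    (f : Op X X') : cutWith c φ p g (-f) = -cutWith c φ p g f := by
  ext1 a b
  rw [Matrix.neg_apply, cutWith_apply, cutWith_apply, Matrix.neg_apply, contract_neg_right, mul_neg]

theorem antiCommutes_shiftL_neg {φ : Fin c.m → Fin c.m → V.Hat →+ k} (g : Op Y Y) (f : Op X X) :
    AntiCommutes (shiftL c Y X) (cutWith c φ (Y := Y.shift) (Y' := Y.shift) 0 (-g : Op Y Y) f)
      (cutWith c φ 0 g f) := by
  have h := shiftL_cutWith c φ 0 (-g) f
  rw [sgn_zero, one_smul, cutWith_neg_left c φ 0 g f, neg_opMul] at h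
  exact h

theorem antiCommutes_shiftR_neg {φ : Fin c.m → Fin c.m → V.Hat →+ k} {p : ZMod 2} {g : Op Y Y}
    (hg : HasDeg 0 g) (f : Op X X) :
    AntiCommutes (shiftR c Y X) (cutWith c φ (X := X.shift) (X' := X.shift) p g (-f : Op X X))
      (cutWith c φ p g f) := by
  have h := shiftR_cutWith c φ p hg (-f)
  rw [sgn_zero, one_smul, cutWith_neg_right c φ p g f, neg_opMul] at h
  exact h

/-- The two summands change sign for different reasons: d_Y by definition of the shift, and d_X
through the Koszul sign. -/
theorem antiCommutes_shiftL_d (φ : Fin c.m → Fin c.m → V.Hat →+ k) :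
    AntiCommutes (shiftL c Y X)
      (cutWith c φ (Y := Y.shift) (Y' := Y.shift) 0 Y.shift.d (1 : Op X X) +
        cutWith c φ (Y := Y.shift) (Y' := Y.shift) 1 (1 : Op Y.shift Y.shift) X.d)
      (cutWith c φ 0 Y.d (1 : Op X X) + cutWith c φ 1 (1 : Op Y Y) X.d) :=
  (antiCommutes_shiftL_neg c Y.d (1 : Op X X)).add (antiCommutes_shiftL c (1 : Op Y Y) X.d)

/-- The roles are exchanged: d_X changes sign by definition of the shift, and d_Y because it is odd
and meets the factor (-1)^|y|. -/
theorem antiCommutes_shiftR_d (hY : HasDeg (M := Y) (N := Y) 1 Y.d)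
    (φ : Fin c.m → Fin c.m → V.Hat →+ k) :
    AntiCommutes (shiftR c Y X)
      (cutWith c φ (X := X.shift) (X' := X.shift) 0 Y.d (1 : Op X.shift X.shift) +
        cutWith c φ (X := X.shift) (X' := X.shift) 1 (1 : Op Y Y) X.shift.d)
      (cutWith c φ 0 Y.d (1 : Op X X) + cutWith c φ 1 (1 : Op Y Y) X.d) :=
  (antiCommutes_shiftR c hY (1 : Op X X)).add (antiCommutes_shiftR_neg c HasDeg.one X.d)

theorem shiftL_cutOp (g : Op Y Y') (f : Op X X') : opMul (shiftL c Y' X')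
    (c.cutOp (Y := Y.shift) (Y' := Y'.shift) 0 g f) = opMul (c.cutOp 0 g f) (shiftL c Y X) := by
  have h := shiftL_cutWith c c.hatEntry 0 g f
  rw [sgn_zero, one_smul] at h
  exact opMul_congr h (cutOp_eq_cutWith c (Y := Y.shift) (Y' := Y'.shift) _ _ _) (cutOp_eq_cutWith c _ _ _)

theorem shiftR_cutOp {p : ZMod 2} {g : Op Y Y'} (hg : HasDeg 0 g) (f : Op X X') :
    opMul (shiftR c Y' X') (c.cutOp (X := X.shift) (X' := X'.shift) p g f) =
      opMul (c.cutOp p g f) (shiftR c Y X) := by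
  have h := shiftR_cutWith c c.hatEntry p hg f
  rw [sgn_zero, one_smul] at h
  exact opMul_congr h (cutOp_eq_cutWith c (X := X.shift) (X' := X'.shift) _ _ _) (cutOp_eq_cutWith c _ _ _)

theorem shiftL_atiyah (q : Fin V.n) :
    AntiCommutes (shiftL c Y X) (c.atiyah Y.shift X q) (c.atiyah Y X q) := by
  rw [atiyah_eq_cutWith, atiyah_eq_cutWith]
  exact antiCommutes_shiftL_d c _

theorem shiftR_atiyah (hY : HasDeg (M := Y) (N := Y) 1 Y.d) (q : Fin V.n) :
    AntiCommutes (shiftR c Y X) (c.atiyah Y X.shift q) (c.atiyah Y X q) := by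
  rw [atiyah_eq_cutWith, atiyah_eq_cutWith]
  exact antiCommutes_shiftR_d c hY _

theorem shiftL_d : AntiCommutes (shiftL c Y X) (cutGr c Y.shift X).d (cutGr c Y X).d := by
  have h := antiCommutes_shiftL_d (Y := Y) (X := X) c c.hatEntry
  rw [← cutOp_eq_cutWith, ← cutOp_eq_cutWith, ← cutOp_eq_cutWith, ← cutOp_eq_cutWith] at h
  exact h

theorem shiftR_d (hY : HasDeg (M := Y) (N := Y) 1 Y.d) :
    AntiCommutes (shiftR c Y X) (cutGr c Y X.shift).d (cutGr c Y X).d := by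
  have h := antiCommutes_shiftR_d (X := X) c hY c.hatEntry
  rw [← cutOp_eq_cutWith, ← cutOp_eq_cutWith, ← cutOp_eq_cutWith, ← cutOp_eq_cutWith] at h
  exact h

theorem shiftL_cutOp_odd (g : Op Y Y) (f : Op X X) : AntiCommutes (shiftL c Y X)
    (c.cutOp (Y := Y.shift) (Y' := Y.shift) 1 g f) (c.cutOp 1 g f) :=
  (antiCommutes_shiftL c g f).congr (cutOp_eq_cutWith c (Y := Y.shift) (Y' := Y.shift) _ _ _)
    (cutOp_eq_cutWith c _ _ _)

theorem shiftL_cutOp_neg (g : Op Y Y) (f : Op X X) : AntiCommutes (shiftL c Y X)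
    (c.cutOp (Y := Y.shift) (Y' := Y.shift) 0 (-g : Op Y Y) f) (c.cutOp 0 g f) :=
  (antiCommutes_shiftL_neg c g f).congr (cutOp_eq_cutWith c (Y := Y.shift) (Y' := Y.shift) _ _ _)
    (cutOp_eq_cutWith c _ _ _)

theorem shiftR_cutOp_odd {p : ZMod 2} {g : Op Y Y} (hg : HasDeg 1 g) (f : Op X X) :
    AntiCommutes (shiftR c Y X) (c.cutOp (X := X.shift) (X' := X.shift) p g f) (c.cutOp p g f) :=
  (antiCommutes_shiftR c hg f).congr (cutOp_eq_cutWith c (X := X.shift) (X' := X.shift) _ _ _)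
    (cutOp_eq_cutWith c _ _ _)

theorem shiftR_cutOp_neg {p : ZMod 2} {g : Op Y Y} (hg : HasDeg 0 g) (f : Op X X) :
    AntiCommutes (shiftR c Y X) (c.cutOp (X := X.shift) (X' := X.shift) p g (-f : Op X X))
      (c.cutOp p g f) :=
  (antiCommutes_shiftR_neg c hg f).congr (cutOp_eq_cutWith c (X := X.shift) (X' := X.shift) _ _ _)
    (cutOp_eq_cutWith c _ _ _)

theorem shiftL_lam (i : Fin V.n) :
    AntiCommutes (shiftL c Y X) (lam c Y.shift X i) (lam c Y X i) :=
  shiftL_cutOp_odd c (1 : Op Y Y) (dOp i X.d)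

theorem shiftR_lam (i : Fin V.n) :
    AntiCommutes (shiftR c Y X) (lam c Y X.shift i) (lam c Y X i) := by
  have h : dOp (X := X.shift) (X' := X.shift) i X.shift.d = -dOp (X := X) (X' := X) i X.d := by
    refine Matrix.ext fun a b => ?_
    exact map_neg (pderiv (Sum.inr i)) (X.d a b)
  refine (shiftR_cutOp_neg c (p := 1) (HasDeg.one (M := Y))
    (dOp (X := X) (X' := X) i X.d)).congr ?_ rfl
  exact congrArg (c.cutOp (X := X.shift) (X' := X.shift) 1 (1 : Op Y Y)) h

theorem shiftL_scalar (f : V.Poly) : opMul (shiftL c Y X) (c.scalar Y.shift X f) =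
    opMul (c.scalar Y X f) (shiftL c Y X) := shiftL_cutOp c _ _

theorem shiftR_scalar (f : V.Poly) : opMul (shiftR c Y X) (c.scalar Y X.shift f) =
    opMul (c.scalar Y X f) (shiftR c Y X) := shiftR_cutOp c (HasDeg.one.smul _) _

variable [Algebra ℚ k]

theorem antiCommutes_gammaDagger {Y' : GradedOp (PolyRing V U)} {X' : GradedOp (PolyRing W V)}
    {F : Op (cutGr c Y' X') (cutGr c Y X)}
    (hA : ∀ q, AntiCommutes F (c.atiyah Y' X' q) (c.atiyah Y X q))
    (hL : ∀ i, AntiCommutes F (lam c Y' X' i) (lam c Y X i))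
    (hS : ∀ f, opMul F (c.scalar Y' X' f) = opMul (c.scalar Y X f) F) (i : Fin V.n) :
    AntiCommutes F (c.gammaDagger Y' X' i) (c.gammaDagger Y X i) := by
  rw [gammaDagger_eq, gammaDagger_eq, sub_eq_add_neg, sub_eq_add_neg]
  exact (hL i).neg.add (AntiCommutes.sum _ fun q => (hA q).even_opMul (hS _)).neg

theorem shiftL_gammaDagger (i : Fin V.n) :
    AntiCommutes (shiftL c Y X) (c.gammaDagger Y.shift X i) (c.gammaDagger Y X i) :=
  antiCommutes_gammaDagger c (shiftL_atiyah c) (shiftL_lam c) (shiftL_scalar c) i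

theorem shiftR_gammaDagger (hY : HasDeg (M := Y) (N := Y) 1 Y.d) (i : Fin V.n) :
    AntiCommutes (shiftR c Y X) (c.gammaDagger Y X.shift i) (c.gammaDagger Y X i) :=
  antiCommutes_gammaDagger c (shiftR_atiyah c hY) (shiftR_lam c) (shiftR_scalar c) i

theorem shiftL_cutIdem : opMul (shiftL c Y X) (c.cutIdem Y.shift X) =
    opMul (c.cutIdem Y X) (shiftL c Y X) :=
  AntiCommutes.nest (shiftL_atiyah c) (shiftL_gammaDagger c)
    ((Matrix.mul_one _).trans (Matrix.one_mul _).symm)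

theorem shiftR_cutIdem (hY : HasDeg (M := Y) (N := Y) 1 Y.d) :
    opMul (shiftR c Y X) (c.cutIdem Y X.shift) = opMul (c.cutIdem Y X) (shiftR c Y X) :=
  AntiCommutes.nest (shiftR_atiyah c hY) (shiftR_gammaDagger c hY)
    ((Matrix.mul_one _).trans (Matrix.one_mul _).symm)

end ShiftCut

/-! ### Clifford linearity of the shift isomorphisms -/

section ShiftLinear

variable {k : Type u} [CommRing k] [Algebra ℚ k] {W V U : Potential k} (c : CutChoice V)
  {Y : CliffordData (PolyRing V U)} {X : CliffordData (PolyRing W V)}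

theorem hasDeg_shiftL (Y : GradedOp (PolyRing V U)) (X : GradedOp (PolyRing W V)) :
    HasDeg (M := cutGr c Y.shift X) (N := (cutGr c Y X).shift) 0 (shiftL c Y X) := by
  intro a b h
  refine if_neg fun e => h ?_
  subst e
  change Y.par a.1 + X.par a.2.2 + 1 = Y.par a.1 + 1 + X.par a.2.2 + 0
  ring

theorem hasDeg_shiftR (Y : GradedOp (PolyRing V U)) (X : GradedOp (PolyRing W V)) :
    HasDeg (M := cutGr c Y X.shift) (N := (cutGr c Y X).shift) 0 (shiftR c Y X) := by
  intro a b h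
  refine if_neg fun e => h ?_
  subst e
  change Y.par a.1 + X.par a.2.2 + 1 = Y.par a.1 + (X.par a.2.2 + 1) + 0
  ring

theorem isCliffordLinear_shiftL (Y : CliffordData (PolyRing V U))
    (X : CliffordData (PolyRing W V)) :
    IsCliffordLinear (M := cut c Y.shift X) (N := (cut c Y X).shift) rfl
      (shiftL c Y.toGradedOp X.toGradedOp) := by
  have he := shiftL_cutOp c Y.e X.e
  refine isCliffordLinear_shift (M := cut c Y.shift X) (N := cut c Y X) rfl
    (hasDeg_shiftL c Y.toGradedOp X.toGradedOp) (shiftL_d c) he ?_ ?_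
  · exact append_rel (r := AntiCommutes (shiftL c Y.toGradedOp X.toGradedOp))
      (append_rel (fun j => shiftL_cutOp_neg c (Y.γ j) X.e)
        fun j => (shiftL_atiyah c j).opMul_even he) fun j => shiftL_cutOp_odd c Y.e (X.γ j)
  · exact append_rel (r := AntiCommutes (shiftL c Y.toGradedOp X.toGradedOp))
      (append_rel (fun j => shiftL_cutOp_neg c (Y.γd j) X.e)
        fun j => (shiftL_gammaDagger c j).opMul_even he) fun j => shiftL_cutOp_odd c Y.e (X.γd j)

theorem isCliffordLinear_shiftR {Y : CliffordData (PolyRing V U)} (hY : Y.IsRep (potDiff V U))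
    (X : CliffordData (PolyRing W V)) :
    IsCliffordLinear (M := cut c Y X.shift) (N := (cut c Y X).shift) rfl
      (shiftR c Y.toGradedOp X.toGradedOp) := by
  have he := shiftR_cutOp c (p := 0) hY.e_closed.1 X.e
  refine isCliffordLinear_shift (M := cut c Y X.shift) (N := cut c Y X) rfl
    (hasDeg_shiftR c Y.toGradedOp X.toGradedOp) (shiftR_d c hY.d_deg) he ?_ ?_
  · exact append_rel (r := AntiCommutes (shiftR c Y.toGradedOp X.toGradedOp))
      (append_rel (fun j => shiftR_cutOp_odd c (hY.γ_closed j).1 X.e)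
        fun j => (shiftR_atiyah c hY.d_deg j).opMul_even he)
      fun j => shiftR_cutOp_neg c hY.e_closed.1 (X.γ j)
  · exact append_rel (r := AntiCommutes (shiftR c Y.toGradedOp X.toGradedOp))
      (append_rel (fun j => shiftR_cutOp_odd c (hY.γd_closed j).1 X.e)
        fun j => (shiftR_gammaDagger c hY.d_deg j).opMul_even he)
      fun j => shiftR_cutOp_neg c hY.e_closed.1 (X.γd j)

end ShiftLinear

section MonomialEq

variable {R : Type u} [CommRing R] {M N P : GradedOp R}

theorem opMul_eq_monOp {B : Op N P} {A : Op M N} {u : N.ι → P.ι} {s : N.ι → ZMod 2} {v : M.ι → N.ι}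
    {t : M.ι → ZMod 2} (hB : B = monOp u s) (hA : A = monOp v t) :
    opMul B A = monOp (fun b => u (v b)) (fun b => s (v b) + t b) := by
  rw [hB, hA]; exact monOp_mul u s v t

theorem opMul_intertwine {L : GradedOp R} {F : Op M N} {F' : Op P L} {I' : Op P P} {I : Op L L}
    {A' : Op M P} {A : Op N L} (h1 : opMul F' I' = opMul I F') (h2 : opMul F' A' = opMul A F) :
    opMul F' (opMul I' A') = opMul (opMul I A) F := by
  rw [← opMul_assoc, h1, opMul_assoc, h2, opMul_assoc]

theorem cutOp_eq_monOp {k : Type u} [CommRing k] {W V U : Potential k} (c : CutChoice V)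
    {Y Y' : GradedOp (PolyRing V U)} {X X' : GradedOp (PolyRing W V)} {A : Op Y Y'} {B : Op X X'}
    {u : Y.ι → Y'.ι} {s : Y.ι → ZMod 2} {v : X.ι → X'.ι} {t : X.ι → ZMod 2}
    (hA : A = monOp u s) (hB : B = monOp v t) :
    (c.cutOp 0 A B : Op (cutGr c Y X) (cutGr c Y' X')) =
      monOp (M := cutGr c Y X) (N := cutGr c Y' X') (fun b => (u b.1, b.2.1, v b.2.2))
        (fun b => s b.1 + t b.2.2) := by
  rw [hA, hB]; exact cutOp_monOp c u s v t

theorem zmod_two_add_self (a : ZMod 2) : a + a = 0 := by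
  revert a; decide

end MonomialEq

/-! ### Coherence of the shifts as matrix identities -/

section ShiftOps

variable {k : Type u} [CommRing k] {W V U Q : Potential k} (c : CutChoice V) (cU : CutChoice U)

theorem shiftL_naturality [Algebra ℚ k] {Y Y' : GradedOp (PolyRing V U)}
    {X X' : GradedOp (PolyRing W V)} (g : Op Y Y') (f : Op X X') :
    opMul (shiftL c Y' X') (opMul (idemGr c Y'.shift X')
      (c.cutOp (Y := Y.shift) (Y' := Y'.shift) 0 g f)) =
    opMul (opMul (idemGr c Y' X') (c.cutOp 0 g f)) (shiftL c Y X) :=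
  opMul_intertwine (shiftL_cutIdem c) (shiftL_cutOp c g f)

theorem shiftR_naturality [Algebra ℚ k] {Y Y' : GradedOp (PolyRing V U)}
    {X X' : GradedOp (PolyRing W V)} (hY' : HasDeg (M := Y') (N := Y') 1 Y'.d) {g : Op Y Y'}
    (hg : HasDeg 0 g) (f : Op X X') :
    opMul (shiftR c Y' X') (opMul (idemGr c Y' X'.shift)
      (c.cutOp (X := X.shift) (X' := X'.shift) 0 g f)) =
    opMul (opMul (idemGr c Y' X') (c.cutOp 0 g f)) (shiftR c Y X) :=
  opMul_intertwine (shiftR_cutIdem c hY') (shiftR_cutOp c hg f)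

variable (Z : GradedOp (PolyRing U Q)) (Y : GradedOp (PolyRing V U)) (X : GradedOp (PolyRing W V))

theorem shiftL_shiftShift : opMul (opMul (idOp (cutGr c Y X)) (shiftL c Y X)) (shiftL c Y.shift X) =
    c.cutOp (Y := Y.shift.shift) (Y' := Y) 0 (idOp Y) (1 : Op X X) := by
  refine (opMul_eq_monOp (opMul_eq_monOp one_eq_monOp rfl) rfl).trans
    (Eq.trans ?_ (cutOp_eq_monOp c (Y := Y.shift.shift) (Y' := Y) one_eq_monOp one_eq_monOp).symm)
  refine congrArg₂ monOp rfl (funext fun b => ?_)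
  change (0 : ZMod 2) + 0 + 0 = 0 + 0
  rfl

theorem shiftR_shiftShift : opMul (opMul (idOp (cutGr c Y X)) (shiftR c Y X)) (shiftR c Y X.shift) =
    c.cutOp (X := X.shift.shift) (X' := X) 0 (1 : Op Y Y) (idOp X) := by
  refine (opMul_eq_monOp (opMul_eq_monOp one_eq_monOp rfl) rfl).trans
    (Eq.trans ?_ (cutOp_eq_monOp c (X := X.shift.shift) (X' := X) one_eq_monOp one_eq_monOp).symm)
  refine congrArg₂ monOp rfl (funext fun b => ?_)
  -- The sign (-1)^|y| is applied twice and disappears.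
  change 0 + Y.par b.1 + Y.par b.1 = 0 + 0
  rw [zero_add, zmod_two_add_self, zero_add]

/-- In one order the sign is computed in ΨY, where y has parity |y| + 1; in the other it is computed
in Y. This is the source of the -1. -/
theorem shiftL_mul_shiftR : opMul (shiftL c Y X) (shiftR c Y.shift X) =
    -opMul (shiftR c Y X) (shiftL c Y X.shift) := by
  refine (opMul_eq_monOp rfl rfl).trans (Eq.trans ?_
    ((congrArg Neg.neg (opMul_eq_monOp rfl rfl)).trans (neg_monOp _ _)).symm)
  refine congrArg₂ monOp rfl (funext fun b => ?_)
  change 0 + (Y.par b.1 + 1) = Y.par b.1 + 0 + 1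
  ring

/-- The signs match because |z ⊗ y| = |z| + |y|. -/
theorem assocOp_shift_right : opMul (opMul (shiftR cU Z (cutGr c Y X))
      (cU.cutOp (X := cutGr c Y X.shift) (X' := (cutGr c Y X).shift) 0 (1 : Op Z Z) (shiftR c Y X)))
      (assocOp c cU Z Y X.shift) =
    opMul (assocOp c cU Z Y X) (shiftR c (cutGr cU Z Y) X) := by
  refine (opMul_eq_monOp (opMul_eq_monOp rfl (cutOp_eq_monOp cU (X := cutGr c Y X.shift)
    (X' := (cutGr c Y X).shift) one_eq_monOp rfl)) (assocOp_eq_monOp c cU Z Y X.shift)).trans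
    (Eq.trans ?_ (opMul_eq_monOp (assocOp_eq_monOp c cU Z Y X) rfl).symm)
  refine congrArg₂ monOp rfl (funext fun b => ?_)
  change Z.par b.1.1 + (0 + Y.par b.1.2.2) + 0 = 0 + (Z.par b.1.1 + Y.par b.1.2.2)
  ring

theorem assocOp_shift_middle : opMul (opMul (shiftR cU Z (cutGr c Y X))
      (cU.cutOp (X := cutGr c Y.shift X) (X' := (cutGr c Y X).shift) 0 (1 : Op Z Z) (shiftL c Y X)))
      (assocOp c cU Z Y.shift X) =
    opMul (opMul (assocOp c cU Z Y X) (shiftL c (cutGr cU Z Y) X))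
      (c.cutOp (Y := cutGr cU Z Y.shift) (Y' := (cutGr cU Z Y).shift) 0 (shiftR cU Z Y)
        (1 : Op X X)) := by
  refine (opMul_eq_monOp (opMul_eq_monOp rfl (cutOp_eq_monOp cU (X := cutGr c Y.shift X)
    (X' := (cutGr c Y X).shift) one_eq_monOp rfl)) (assocOp_eq_monOp c cU Z Y.shift X)).trans
    (Eq.trans ?_ (opMul_eq_monOp (opMul_eq_monOp (assocOp_eq_monOp c cU Z Y X) rfl)
      (cutOp_eq_monOp c (Y := cutGr cU Z Y.shift) (Y' := (cutGr cU Z Y).shift) rfl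
        one_eq_monOp)).symm)
  refine congrArg₂ monOp rfl (funext fun b => ?_)
  change Z.par b.1.1 + (0 + 0) + 0 = 0 + 0 + (Z.par b.1.1 + 0)
  ring

theorem assocOp_shift_left : opMul (shiftL cU Z (cutGr c Y X)) (assocOp c cU Z.shift Y X) =
    opMul (opMul (assocOp c cU Z Y X) (shiftL c (cutGr cU Z Y) X))
      (c.cutOp (Y := cutGr cU Z.shift Y) (Y' := (cutGr cU Z Y).shift) 0 (shiftL cU Z Y)
        (1 : Op X X)) := by
  refine (opMul_eq_monOp rfl (assocOp_eq_monOp c cU Z.shift Y X)).trans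
    (Eq.trans ?_ (opMul_eq_monOp (opMul_eq_monOp (assocOp_eq_monOp c cU Z Y X) rfl)
      (cutOp_eq_monOp c (Y := cutGr cU Z.shift Y) (Y' := (cutGr cU Z Y).shift) rfl
        one_eq_monOp)).symm)
  refine congrArg₂ monOp rfl (funext fun b => ?_)
  change (0 : ZMod 2) + 0 = 0 + 0 + (0 + 0)
  rfl

/-- The inverse of `shiftL`. -/
noncomputable def shiftLInv : Op (cutGr c Y X).shift (cutGr c Y.shift X) :=
  monOp (M := (cutGr c Y X).shift) (N := cutGr c Y.shift X) (fun b => b) 0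

/-- The inverse of `shiftR`. -/
noncomputable def shiftRInv : Op (cutGr c Y X).shift (cutGr c Y X.shift) :=
  monOp (M := (cutGr c Y X).shift) (N := cutGr c Y X.shift) (fun b => b) (fun b => Y.par b.1)

theorem hasDeg_shiftLInv : HasDeg 0 (shiftLInv c Y X) := by
  intro a b h
  refine if_neg fun e => h ?_
  subst e
  change Y.par a.1 + 1 + X.par a.2.2 = Y.par a.1 + X.par a.2.2 + 1 + 0
  ring

theorem hasDeg_shiftRInv : HasDeg 0 (shiftRInv c Y X) := by
  intro a b h
  refine if_neg fun e => h ?_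
  subst e
  change Y.par a.1 + (X.par a.2.2 + 1) = Y.par a.1 + X.par a.2.2 + 1 + 0
  ring

theorem shiftLInv_mul : opMul (M := cutGr c Y.shift X) (N := (cutGr c Y X).shift)
    (P := cutGr c Y.shift X) (shiftLInv c Y X) (shiftL c Y X) = 1 := by
  refine (opMul_eq_monOp rfl rfl).trans (Eq.trans ?_ one_eq_monOp.symm)
  refine congrArg₂ monOp rfl (funext fun b => ?_)
  change (0 : ZMod 2) + 0 = 0
  rfl

theorem shiftL_mul_inv : opMul (M := (cutGr c Y X).shift) (N := cutGr c Y.shift X)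
    (P := (cutGr c Y X).shift) (shiftL c Y X) (shiftLInv c Y X) = 1 := by
  refine (opMul_eq_monOp rfl rfl).trans (Eq.trans ?_ one_eq_monOp.symm)
  refine congrArg₂ monOp rfl (funext fun b => ?_)
  change (0 : ZMod 2) + 0 = 0
  rfl

theorem shiftRInv_mul : opMul (M := cutGr c Y X.shift) (N := (cutGr c Y X).shift)
    (P := cutGr c Y X.shift) (shiftRInv c Y X) (shiftR c Y X) = 1 := by
  refine (opMul_eq_monOp rfl rfl).trans (Eq.trans ?_ one_eq_monOp.symm)
  exact congrArg₂ monOp rfl (funext fun b => zmod_two_add_self _)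

theorem shiftR_mul_inv : opMul (M := (cutGr c Y X).shift) (N := cutGr c Y X.shift)
    (P := (cutGr c Y X).shift) (shiftR c Y X) (shiftRInv c Y X) = 1 := by
  refine (opMul_eq_monOp rfl rfl).trans (Eq.trans ?_ one_eq_monOp.symm)
  exact congrArg₂ monOp rfl (funext fun b => zmod_two_add_self _)

end ShiftOps

theorem linHom_eq_neg {R : Type u} [CommRing R] [Algebra ℚ R] {W : R} {M N : CliffordRep R W}
    {A B : Op M.data.toGradedOp N.data.toGradedOp} {hA : Intertwines M N A}
    {hB : Intertwines M N B} (h : A = -B) : linHom hA = -linHom hB :=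
  CliffordRep.homMk_eq (hg := neg_mem hB.mem) (htpy_of_eq (by rw [h, Matrix.neg_mul]))

/-! ### Naturality and coherence of the shift isomorphisms -/

section ShiftHom

variable {k : Type u} [CommRing k] [Algebra ℚ k] {W V U Q : Potential k} (c : CutChoice V)
  (cU : CutChoice U)

theorem intertwines_shiftL (Y : OneMor V U) (X : OneMor W V) :
    Intertwines (cutObj c Y.shift X) (cutObj c Y X).shift
      (shiftL c Y.data.toGradedOp X.data.toGradedOp) :=
  IsCliffordLinear.intertwines (M := cutObj c Y.shift X) (N := (cutObj c Y X).shift)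
    (isCliffordLinear_shiftL c Y.data X.data)

theorem intertwines_shiftR (Y : OneMor V U) (X : OneMor W V) :
    Intertwines (cutObj c Y X.shift) (cutObj c Y X).shift
      (shiftR c Y.data.toGradedOp X.data.toGradedOp) :=
  IsCliffordLinear.intertwines (M := cutObj c Y X.shift) (N := (cutObj c Y X).shift)
    (isCliffordLinear_shiftR c Y.isRep X.data)

/-- The isomorphism `ΨY | X ≅ Ψ(Y | X)`. -/
noncomputable def shiftLIso (Y : OneMor V U) (X : OneMor W V) :
    cutObj c Y.shift X ≅ (cutObj c Y X).shift :=
  linIso (intertwines_shiftL c Y X)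
    ((intertwines_shiftL c Y X).inv (hasDeg_shiftLInv c _ _) (shiftLInv_mul c _ _)
      (shiftL_mul_inv c _ _)) (shiftLInv_mul c _ _) (shiftL_mul_inv c _ _)

/-- The isomorphism `Y | ΨX ≅ Ψ(Y | X)`. -/
noncomputable def shiftRIso (Y : OneMor V U) (X : OneMor W V) :
    cutObj c Y X.shift ≅ (cutObj c Y X).shift :=
  linIso (intertwines_shiftR c Y X)
    ((intertwines_shiftR c Y X).inv (hasDeg_shiftRInv c _ _) (shiftRInv_mul c _ _)
      (shiftR_mul_inv c _ _)) (shiftRInv_mul c _ _) (shiftR_mul_inv c _ _)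

theorem shiftL_natural {Y Y' : OneMor V U} {X X' : OneMor W V} (ψ : Y ⟶ Y') (φ : X ⟶ X') :
    cutHom c ((CutSystem.shift k).map ψ) φ ≫ (shiftLIso c Y' X').hom =
      (shiftLIso c Y X).hom ≫ (CutSystem.shift k).map (cutHom c ψ φ) := by
  revert ψ φ
  refine CliffordRep.homMk_ind fun ψ hψ => CliffordRep.homMk_ind fun φ hφ => ?_
  have hA := intertwines_shiftL c Y X
  have hA' := intertwines_shiftL c Y' X'
  have h1 := cutIdem_mul_cutOp_mem c (Y := Y.shift) (Y' := Y'.shift) (shift_mem_cycles hψ) hφ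
  have h2 := shift_mem_cycles (cutIdem_mul_cutOp_mem c hψ hφ)
  refine (homMk_comp_linHom (M := cutObj c Y.shift X) (N := cutObj c Y'.shift X')
    (P := (cutObj c Y' X').shift) h1 hA' (hA'.mul_mem h1)).trans (Eq.trans ?_
    (linHom_comp_homMk (N := (cutObj c Y X).shift) (P := (cutObj c Y' X').shift) hA h2
      (hA.mem_mul (P := (cutObj c Y' X').shift) h2)).symm)
  exact CliffordRep.homMk_eq (M := cutObj c Y.shift X) (N := (cutObj c Y' X').shift)
    (htpy_of_eq (shiftL_naturality c ψ φ))

theorem shiftR_natural {Y Y' : OneMor V U} {X X' : OneMor W V} (ψ : Y ⟶ Y') (φ : X ⟶ X') :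
    cutHom c ψ ((CutSystem.shift k).map φ) ≫ (shiftRIso c Y' X').hom =
      (shiftRIso c Y X).hom ≫ (CutSystem.shift k).map (cutHom c ψ φ) := by
  revert ψ φ
  refine CliffordRep.homMk_ind fun ψ hψ => CliffordRep.homMk_ind fun φ hφ => ?_
  have hA := intertwines_shiftR c Y X
  have hA' := intertwines_shiftR c Y' X'
  have h1 := cutIdem_mul_cutOp_mem c (X := X.shift) (X' := X'.shift) hψ (shift_mem_cycles hφ)
  have h2 := shift_mem_cycles (cutIdem_mul_cutOp_mem c hψ hφ)
  refine (homMk_comp_linHom (M := cutObj c Y X.shift) (N := cutObj c Y' X'.shift)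
    (P := (cutObj c Y' X').shift) h1 hA' (hA'.mul_mem h1)).trans (Eq.trans ?_
    (linHom_comp_homMk (N := (cutObj c Y X).shift) (P := (cutObj c Y' X').shift) hA h2
      (hA.mem_mul (P := (cutObj c Y' X').shift) h2)).symm)
  exact CliffordRep.homMk_eq (M := cutObj c Y X.shift) (N := (cutObj c Y' X').shift)
    (htpy_of_eq (shiftR_naturality c Y'.isRep.d_deg hψ.1.1 φ))

theorem shiftL_shiftShift_hom (Y : OneMor V U) (X : OneMor W V) :
    (shiftLIso c Y.shift X).hom ≫ (CutSystem.shift k).map (shiftLIso c Y X).hom ≫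
      CutSystem.shiftShift k (cutObj c Y X) = cutHom c (CutSystem.shiftShift k Y) (𝟙 X) := by
  have h1 := cutHom_linHom c (Intertwines.shiftShift Y) (Intertwines.one X)
  rw [linHom_one, ← shiftShift_eq (k := k)] at h1
  refine Eq.trans ?_ h1.symm
  refine (congrArg₂ (· ≫ ·) rfl ((congrArg₂ (· ≫ ·) (shift_linHom (k := k)
    (intertwines_shiftL c Y X)) (shiftShift_eq (cutObj c Y X))).trans
    (linHom_comp (intertwines_shiftL c Y X).shift
      (Intertwines.shiftShift (cutObj c Y X))))).trans ?_
  refine (linHom_comp (intertwines_shiftL c Y.shift X) _).trans (linHom_congr ?_)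
  exact shiftL_shiftShift c Y.data.toGradedOp X.data.toGradedOp

theorem shiftR_shiftShift_hom (Y : OneMor V U) (X : OneMor W V) :
    (shiftRIso c Y X.shift).hom ≫ (CutSystem.shift k).map (shiftRIso c Y X).hom ≫
      CutSystem.shiftShift k (cutObj c Y X) = cutHom c (𝟙 Y) (CutSystem.shiftShift k X) := by
  have h1 := cutHom_linHom c (Intertwines.one Y) (Intertwines.shiftShift X)
  rw [linHom_one, ← shiftShift_eq (k := k)] at h1
  refine Eq.trans ?_ h1.symm
  refine (congrArg₂ (· ≫ ·) rfl ((congrArg₂ (· ≫ ·) (shift_linHom (k := k)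
    (intertwines_shiftR c Y X)) (shiftShift_eq (cutObj c Y X))).trans
    (linHom_comp (intertwines_shiftR c Y X).shift
      (Intertwines.shiftShift (cutObj c Y X))))).trans ?_
  refine (linHom_comp (intertwines_shiftR c Y X.shift) _).trans (linHom_congr ?_)
  exact shiftR_shiftShift c Y.data.toGradedOp X.data.toGradedOp

theorem shiftR_comp_shiftL (Y : OneMor V U) (X : OneMor W V) :
    (shiftRIso c Y.shift X).hom ≫ (CutSystem.shift k).map (shiftLIso c Y X).hom =
      -((shiftLIso c Y X.shift).hom ≫ (CutSystem.shift k).map (shiftRIso c Y X).hom) := by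
  refine ((congrArg₂ (· ≫ ·) rfl (shift_linHom (intertwines_shiftL c Y X))).trans
    (linHom_comp (intertwines_shiftR c Y.shift X) (intertwines_shiftL c Y X).shift)).trans
    (Eq.trans ?_ (congrArg Neg.neg
    ((congrArg₂ (· ≫ ·) rfl (shift_linHom (intertwines_shiftR c Y X))).trans
    (linHom_comp (intertwines_shiftL c Y X.shift) (intertwines_shiftR c Y X).shift))).symm)
  exact linHom_eq_neg (M := cutObj c Y.shift X.shift) (N := (cutObj c Y X).shift.shift)
    (shiftL_mul_shiftR c Y.data.toGradedOp X.data.toGradedOp)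

variable (Z : OneMor U Q) (Y : OneMor V U) (X : OneMor W V)

theorem assoc_shift_right :
    (assocIso c cU Z Y X.shift).hom ≫ cutHom cU (𝟙 Z) (shiftRIso c Y X).hom ≫
      (shiftRIso cU Z (cutObj c Y X)).hom =
    (shiftRIso c (cutObj cU Z Y) X).hom ≫ (CutSystem.shift k).map (assocIso c cU Z Y X).hom := by
  have h1 := cutHom_linHom cU (Intertwines.one Z) (intertwines_shiftR c Y X)
  rw [linHom_one] at h1
  refine (congrArg₂ (· ≫ ·) rfl ((congrArg₂ (· ≫ ·) h1 rfl).trans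
    (linHom_comp _ (intertwines_shiftR cU Z (cutObj c Y X))))).trans ?_
  refine (linHom_comp (intertwines_assoc c cU Z Y X.shift) _).trans (Eq.trans ?_
    ((congrArg₂ (· ≫ ·) rfl (shift_linHom (k := k) (intertwines_assoc c cU Z Y X))).trans
    (linHom_comp (intertwines_shiftR c (cutObj cU Z Y) X) _)).symm)
  refine linHom_congr ?_
  exact assocOp_shift_right c cU Z.data.toGradedOp Y.data.toGradedOp X.data.toGradedOp

theorem assoc_shift_middle :
    (assocIso c cU Z Y.shift X).hom ≫ cutHom cU (𝟙 Z) (shiftLIso c Y X).hom ≫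
      (shiftRIso cU Z (cutObj c Y X)).hom =
    cutHom c (shiftRIso cU Z Y).hom (𝟙 X) ≫ (shiftLIso c (cutObj cU Z Y) X).hom ≫
      (CutSystem.shift k).map (assocIso c cU Z Y X).hom := by
  have h1 := cutHom_linHom cU (Intertwines.one Z) (intertwines_shiftL c Y X)
  have h2 := cutHom_linHom c (intertwines_shiftR cU Z Y) (Intertwines.one X)
  rw [linHom_one] at h1 h2
  refine (congrArg₂ (· ≫ ·) rfl ((congrArg₂ (· ≫ ·) h1 rfl).trans
    (linHom_comp _ (intertwines_shiftR cU Z (cutObj c Y X))))).trans ?_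
  refine (linHom_comp (intertwines_assoc c cU Z Y.shift X) _).trans (Eq.trans ?_
    ((congrArg₂ (· ≫ ·) h2 ((congrArg₂ (· ≫ ·) rfl
      (shift_linHom (k := k) (intertwines_assoc c cU Z Y X))).trans
    (linHom_comp (intertwines_shiftL c (cutObj cU Z Y) X) _))).trans (linHom_comp _ _)).symm)
  refine linHom_congr ?_
  exact assocOp_shift_middle c cU Z.data.toGradedOp Y.data.toGradedOp X.data.toGradedOp

theorem assoc_shift_left :
    (assocIso c cU Z.shift Y X).hom ≫ (shiftLIso cU Z (cutObj c Y X)).hom =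
    cutHom c (shiftLIso cU Z Y).hom (𝟙 X) ≫ (shiftLIso c (cutObj cU Z Y) X).hom ≫
      (CutSystem.shift k).map (assocIso c cU Z Y X).hom := by
  have h2 := cutHom_linHom c (intertwines_shiftL cU Z Y) (Intertwines.one X)
  rw [linHom_one] at h2
  refine (linHom_comp (intertwines_assoc c cU Z.shift Y X)
    (intertwines_shiftL cU Z (cutObj c Y X))).trans (Eq.trans ?_
    ((congrArg₂ (· ≫ ·) h2 ((congrArg₂ (· ≫ ·) rfl
      (shift_linHom (k := k) (intertwines_assoc c cU Z Y X))).trans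
    (linHom_comp (intertwines_shiftL c (cutObj cU Z Y) X) _))).trans (linHom_comp _ _)).symm)
  refine linHom_congr ?_
  exact assocOp_shift_left c cU Z.data.toGradedOp Y.data.toGradedOp X.data.toGradedOp

end ShiftHom

/-! ### Assembly of the superbicategory -/

section Superbicategory

variable {k : Type u} [CommRing k] [Algebra ℚ k]

/-- Restates an induced 2-morphism with a prescribed representative, together with the proof of
membership which that representative requires. -/
theorem linHom_eq_homMk {R : Type u} [CommRing R] [Algebra ℚ R] {W : R} {M N : CliffordRep R W}
    {A B : Op M.data.toGradedOp N.data.toGradedOp} (hA : Intertwines M N A) (h : A = B)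
    {f : Op M.data.toGradedOp N.data.toGradedOp} (hf : B * M.data.unit = f) :
    ∃ h : f ∈ cycles M.data N.data, linHom hA = CliffordRep.homMk f h := by
  subst h hf; exact ⟨hA.mem, rfl⟩

theorem shiftL_eq_one {W V U : Potential k} (c : CutChoice V) (Y : GradedOp (PolyRing V U))
    (X : GradedOp (PolyRing W V)) : shiftL c Y X = idOp (cutGr c Y X) :=
  (one_eq_monOp (M := cutGr c Y X)).symm

theorem shiftR_eq_signMatrix {W V U : Potential k} (c : CutChoice V)
    (Y : CliffordData (PolyRing V U)) (X : CliffordData (PolyRing W V)) :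
    shiftR c Y.toGradedOp X.toGradedOp = signMatrix c Y X := by
  refine Matrix.ext fun (a b : Y.ι × Fin c.m × X.ι) => ?_
  change (if a = b then sgn _ (Y.par b.1) else 0) = if a = b then sgn _ (Y.par a.1) else 0
  split_ifs with h
  · rw [h]
  · rfl

theorem shiftLIso_hom {W V U : Potential k} (c : CutChoice V) (Y : OneMor V U) (X : OneMor W V) :
    ∃ h : (cut c Y.data.shift X.data).unit ∈
      cycles (cut c Y.data.shift X.data) (cut c Y.data X.data).shift,
      (shiftLIso c Y X).hom = CliffordRep.homMk (M := cutObj c Y.shift X)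
        (N := (cutObj c Y X).shift) _ h :=
  linHom_eq_homMk (intertwines_shiftL c Y X) (shiftL_eq_one c _ _) (Matrix.one_mul _)

theorem shiftRIso_hom {W V U : Potential k} (c : CutChoice V) (Y : OneMor V U) (X : OneMor W V) :
    ∃ h : signMatrix c Y.data X.data * (cut c Y.data X.data.shift).unit ∈
      cycles (cut c Y.data X.data.shift) (cut c Y.data X.data).shift,
      (shiftRIso c Y X).hom = CliffordRep.homMk (M := cutObj c Y X.shift)
        (N := (cutObj c Y X).shift) _ h :=
  linHom_eq_homMk (intertwines_shiftR c Y X) (shiftR_eq_signMatrix c _ _) rfl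

/-- The superbicategory without units whose composition is the cut. -/
noncomputable def cutSuperbicategory (c : ∀ V : Potential k, CutChoice V) :
    SuperbicategoryWithoutUnits k (Potential k) (fun W V => OneMor W V)
      (fun {_ V _} Y X => cutObj (c V) Y X) where
  hcomp x y := cutHom (c _) x y
  hcomp_id Y X := cutHom_id (c _) Y X
  hcomp_comp x x' y y' := cutHom_comp (c _) x x' y y'
  hcomp_add_left x x' y := cutHom_add_left (c _) x x' y
  hcomp_add_right x y y' := cutHom_add_right (c _) x y y'
  hcomp_smul_left s x y := cutHom_smul_left (c _) s x y
  hcomp_smul_right s x y := cutHom_smul_right (c _) s x y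
  assoc Z Y X := assocIso (c _) (c _) Z Y X
  assoc_naturality ζ ψ φ := assoc_natural (c _) (c _) ζ ψ φ
  pentagon L Z Y X := pentagon_hom (c _) (c _) (c _) L Z Y X
  τl Y X := shiftLIso (c _) Y X
  τl_naturality ψ φ := shiftL_natural (c _) ψ φ
  τr Y X := shiftRIso (c _) Y X
  τr_naturality ψ φ := shiftR_natural (c _) ψ φ
  τl_ξ Y X := shiftL_shiftShift_hom (c _) Y X
  τr_ξ Y X := shiftR_shiftShift_hom (c _) Y X
  τr_τl Y X := shiftR_comp_shiftL (c _) Y X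
  assoc_τ₁ Z Y X := assoc_shift_right (c _) (c _) Z Y X
  assoc_τ₂ Z Y X := assoc_shift_middle (c _) (c _) Z Y X
  assoc_τ₃ Z Y X := assoc_shift_left (c _) (c _) Z Y X

end Superbicategory

/-! ### Partial sums of power series in a quasi-regular sequence -/

section HomogeneousPart

variable {R : Type u} [CommRing R] {n : ℕ}

/-- The form of degree `d` with coefficients `a u`. -/
noncomputable def homPart (a : (Fin n →₀ ℕ) → R) (d : ℕ) : MvPolynomial (Fin n) R :=
  ∑ u ∈ Finset.univ.finsuppAntidiag d, monomial u (a u)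

theorem coeff_homPart (a : (Fin n →₀ ℕ) → R) (d : ℕ) (u : Fin n →₀ ℕ) :
    coeff u (homPart a d) = if u.degree = d then a u else 0 := by
  rw [homPart, coeff_sum]
  simp only [coeff_monomial]
  rw [Finset.sum_ite_eq' (Finset.univ.finsuppAntidiag d) u]
  refine if_congr ?_ rfl rfl
  rw [Finset.mem_finsuppAntidiag, Finsupp.degree_eq_sum]
  exact and_iff_left (Finset.subset_univ _)

theorem homPart_isHomogeneous (a : (Fin n →₀ ℕ) → R) (d : ℕ) : (homPart a d).IsHomogeneous d := by
  intro u hu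
  rw [coeff_homPart] at hu
  by_contra h
  refine hu (if_neg fun h' => h ?_)
  rw [← h', Finsupp.degree_eq_weight_one]; rfl

theorem homPart_coeff {F : MvPolynomial (Fin n) R} {d : ℕ} (hF : F.IsHomogeneous d) :
    homPart (fun u => coeff u F) d = F := by
  ext u
  rw [coeff_homPart]
  split_ifs with h
  · rfl
  · exact (hF.coeff_eq_zero h).symm

theorem homPart_add (a b : (Fin n →₀ ℕ) → R) (d : ℕ) :
    homPart (a + b) d = homPart a d + homPart b d := by
  ext u
  rw [coeff_add, coeff_homPart, coeff_homPart, coeff_homPart]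
  split_ifs
  · rfl
  · rw [add_zero]

theorem homPart_smul (r : R) (a : (Fin n →₀ ℕ) → R) (d : ℕ) :
    homPart (r • a) d = C r * homPart a d := by
  ext u
  rw [coeff_C_mul, coeff_homPart, coeff_homPart, mul_ite, mul_zero]; rfl

theorem homPart_congr {a b : (Fin n →₀ ℕ) → R} {d : ℕ} (h : ∀ u, u.degree = d → a u = b u) :
    homPart a d = homPart b d := by
  ext u
  rw [coeff_homPart, coeff_homPart]
  split_ifs with hu
  · exact h u hu
  · rfl

/-- The coefficients of a power series multiplied by the `j`-th variable. -/
noncomputable def mulVar {A : Type*} [Zero A] (j : Fin n) (a : (Fin n →₀ ℕ) → A) (u : Fin n →₀ ℕ) : A :=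
  if u j = 0 then 0 else a (u - Finsupp.single j 1)

theorem homPart_mulVar_succ (j : Fin n) (a : (Fin n →₀ ℕ) → R) (d : ℕ) :
    homPart (mulVar j a) (d + 1) = X j * homPart a d := by
  ext u
  rw [coeff_X_mul', coeff_homPart, coeff_homPart, mulVar]
  by_cases h : u j = 0
  · rw [if_pos h, ite_self, if_neg fun h' => Finsupp.mem_support_iff.1 h' h]
  · rw [if_neg h, if_pos (Finsupp.mem_support_iff.2 h)]
    refine if_congr ?_ rfl rfl
    have h1 : Finsupp.single j 1 ≤ u := by
      rw [Finsupp.single_le_iff]; omega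
    have h2 : u.degree = (u - Finsupp.single j 1).degree + 1 := by
      conv_lhs => rw [← tsub_add_cancel_of_le h1, map_add, Finsupp.degree_single]
    omega

theorem homPart_mulVar_zero (j : Fin n) (a : (Fin n →₀ ℕ) → R) : homPart (mulVar j a) 0 = 0 := by
  ext u
  rw [coeff_homPart, coeff_zero]
  split_ifs with h
  · rw [Finsupp.degree_eq_zero_iff] at h
    rw [mulVar, h, Finsupp.zero_apply, if_pos rfl]
  · rfl

/-- The polynomial part of degree less than `N` of the power series with coefficients `a u`,
evaluated at `t`. -/
noncomputable def partialSum (t : Fin n → R) (a : (Fin n →₀ ℕ) → R) (N : ℕ) : R :=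
  ∑ d ∈ Finset.range N, eval t (homPart a d)

variable (t : Fin n → R)

theorem partialSum_add (a b : (Fin n →₀ ℕ) → R) (N : ℕ) :
    partialSum t (a + b) N = partialSum t a N + partialSum t b N := by
  simp only [partialSum, homPart_add, map_add, Finset.sum_add_distrib]

theorem partialSum_smul (r : R) (a : (Fin n →₀ ℕ) → R) (N : ℕ) :
    partialSum t (r • a) N = r * partialSum t a N := by
  simp only [partialSum, homPart_smul, map_mul, eval_C, Finset.mul_sum]

theorem partialSum_congr {a b : (Fin n →₀ ℕ) → R} {N : ℕ} (h : ∀ u, u.degree < N → a u = b u) :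
    partialSum t a N = partialSum t b N :=
  Finset.sum_congr rfl fun d hd => congrArg (eval t)
    (homPart_congr fun u hu => h u (hu ▸ Finset.mem_range.1 hd))

/-- Multiplication by a variable raises degrees by one and leaves nothing in degree zero, so N terms
become N + 1. -/
theorem partialSum_mulVar (j : Fin n) (a : (Fin n →₀ ℕ) → R) (N : ℕ) :
    partialSum t (mulVar j a) (N + 1) = t j * partialSum t a N := by
  rw [partialSum, Finset.sum_range_succ', homPart_mulVar_zero, map_zero, add_zero, partialSum,
    Finset.mul_sum]
  exact Finset.sum_congr rfl fun d _ => by rw [homPart_mulVar_succ, map_mul, eval_X]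

theorem partialSum_succ (a : (Fin n →₀ ℕ) → R) (N : ℕ) :
    partialSum t a (N + 1) = partialSum t a N + eval t (homPart a N) :=
  Finset.sum_range_succ _ _

theorem eval_homPart_mem (a : (Fin n →₀ ℕ) → R) (d : ℕ) :
    eval t (homPart a d) ∈ Ideal.span (Set.range t) ^ d :=
  (Ideal.mem_span_pow_iff_exists_isHomogeneous t _).2 ⟨_, homPart_isHomogeneous a d, rfl⟩

/-- The coefficients supply one further factor from the ideal. -/
theorem eval_homPart_mem_succ {a : (Fin n →₀ ℕ) → R} {d : ℕ}
    (ha : ∀ u, a u ∈ Ideal.span (Set.range t)) :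
    eval t (homPart a d) ∈ Ideal.span (Set.range t) ^ (d + 1) := by
  rw [homPart, map_sum]
  refine Ideal.sum_mem _ fun u hu => ?_
  rw [eval_monomial, pow_succ']
  refine Ideal.mul_mem_mul (ha u) ((Ideal.mem_span_pow_iff_exists_isHomogeneous t _).2
    ⟨monomial u 1, isHomogeneous_monomial _ ?_, by rw [eval_monomial, one_mul]⟩)
  rw [Finset.mem_finsuppAntidiag] at hu
  rw [Finsupp.degree_eq_sum]; exact hu.1

theorem partialSum_sub_mem (a : (Fin n →₀ ℕ) → R) {M N : ℕ} (h : M ≤ N) :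
    partialSum t a N - partialSum t a M ∈ Ideal.span (Set.range t) ^ M := by
  induction N, h using Nat.le_induction with
  | base => rw [sub_self]; exact Ideal.zero_mem _
  | succ N hN ih =>
    rw [partialSum_succ, add_sub_right_comm]
    exact Ideal.add_mem _ ih (Ideal.pow_le_pow_right hN (eval_homPart_mem t a N))

/-- Induction on the degree. Once all lower coefficients vanish, the value of the form of degree d
lies in the power d + 1 of the ideal. Quasi-regularity puts its coefficients into the ideal, and
`h0`, which holds for coefficients chosen by a section, makes them zero. -/
theorem IsQuasiRegular.mem_of_partialSum_mem {t : Fin n → R} (ht : IsQuasiRegular t)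
    {a : (Fin n →₀ ℕ) → R} {N : ℕ} (h0 : ∀ u, a u ∈ Ideal.span (Set.range t) → a u = 0)
    (h : partialSum t a N ∈ Ideal.span (Set.range t) ^ N) (u : Fin n →₀ ℕ) (hu : u.degree < N) :
    a u = 0 := by
  have key : ∀ d, d ≤ N → ∀ u : Fin n →₀ ℕ, u.degree < d → a u = 0 := by
    intro d
    induction d with
    | zero => exact fun _ u hu => absurd hu (Nat.not_lt_zero _)
    | succ d ih =>
      intro hd u hu
      rcases Nat.lt_succ_iff_lt_or_eq.1 hu with hu | hu
      · exact ih (by omega) u hu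
      · have h1 := partialSum_sub_mem t a hd
        have h2 : partialSum t a d = 0 := by
          rw [partialSum_congr t (b := 0) (ih (by omega))]
          simp [partialSum, homPart]
        have h3 := Ideal.sub_mem _ (Ideal.pow_le_pow_right hd h) h1
        rw [sub_sub_cancel, partialSum_succ, h2, zero_add] at h3
        have h4 := ht d _ (homPart_isHomogeneous a d) h3 u
        rw [coeff_homPart, if_pos hu] at h4
        exact h0 u h4
  exact key N le_rfl u hu

end HomogeneousPart

/-! ### The completion as power series over the quotient -/

section Expansion

variable {k R : Type u} [CommRing k] [CommRing R] [Algebra k R] {n : ℕ} {t : Fin n → R} {I : Ideal R}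
  (σ : (R ⧸ I) →ₗ[k] R)

theorem mem_pow_of_eq {I J : Ideal R} (hI : I = J) {r : R} {N : ℕ} (h : r ∈ J ^ N) : r ∈ I ^ N := by
  rw [hI]; exact h

/-- A remainder in I^N is the value of a form of degree N. Replacing its coefficients by the chosen
representatives of their classes changes them by elements of I, so the new remainder lies in
I^(N+1). -/
theorem exists_partialSum (hI : I = Ideal.span (Set.range t))
    (hσ : ∀ x, Ideal.Quotient.mk I (σ x) = x) (r : R) (N : ℕ) :
    ∃ z : (Fin n →₀ ℕ) → R ⧸ I, r - partialSum t (fun u => σ (z u)) N ∈ I ^ N := by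
  induction N with
  | zero => exact ⟨0, by rw [pow_zero, Ideal.one_eq_top]; trivial⟩
  | succ N ih =>
    obtain ⟨z, hz⟩ := ih
    have hz' := mem_pow_of_eq hI.symm hz
    obtain ⟨F, hF, hF'⟩ := (Ideal.mem_span_pow_iff_exists_isHomogeneous t _).1 hz'
    -- Lower coefficients are kept. Beyond degree N the values are irrelevant for the partial sum.
    let z' : (Fin n →₀ ℕ) → R ⧸ I := fun u =>
      if u.degree < N then z u else Ideal.Quotient.mk I (coeff u F)
    refine ⟨z', ?_⟩
    have h1 : partialSum t (fun u => σ (z' u)) N = partialSum t (fun u => σ (z u)) N :=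
      partialSum_congr t fun u hu => congrArg σ (if_pos hu)
    have h2 : eval t (homPart (fun u => σ (z' u)) N) =
        eval t (homPart (fun u => σ (Ideal.Quotient.mk I (coeff u F))) N) :=
      congrArg (eval t) (homPart_congr fun u hu => congrArg σ (if_neg (by omega)))
    have h3 := homPart_add (fun u => σ (Ideal.Quotient.mk I (coeff u F)))
      (fun u => coeff u F - σ (Ideal.Quotient.mk I (coeff u F))) N
    have h4 : (fun u => σ (Ideal.Quotient.mk I (coeff u F))) +
        (fun u => coeff u F - σ (Ideal.Quotient.mk I (coeff u F))) = fun u => coeff u F :=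
      funext fun u => add_sub_cancel _ _
    rw [h4, homPart_coeff hF] at h3
    have h5 := (congrArg (eval t) h3).trans (map_add _ _ _)
    rw [partialSum_succ, h1, h2, ← sub_sub, ← hF', h5, add_sub_cancel_left]
    refine mem_pow_of_eq hI (eval_homPart_mem_succ t fun u => ?_)
    rw [← hI, ← Ideal.Quotient.eq, hσ]

/-- The element `∑ σ (z u) t ^ u` of the completion. -/
noncomputable def expand (hI : I = Ideal.span (Set.range t)) :
    ((Fin n →₀ ℕ) → R ⧸ I) →ₗ[k] AdicCompletion I R :=
  have hc : ∀ (z : (Fin n →₀ ℕ) → R ⧸ I) (N : ℕ), partialSum t (fun u => σ (z u)) N ≡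
      partialSum t (fun u => σ (z u)) (N + 1) [SMOD (I ^ N • ⊤ : Submodule R R)] := fun z N => by
    rw [SModEq.comm, SModEq.sub_mem, smul_eq_mul, Ideal.mul_top]
    exact mem_pow_of_eq hI (partialSum_sub_mem t _ N.le_succ)
  { toFun := fun z => AdicCompletion.mk I R (AdicCompletion.AdicCauchySequence.mk I R _ (hc z))
    map_add' := fun z z' => AdicCompletion.ext_evalₐ fun N => by
      rw [map_add, AdicCompletion.evalₐ_mk, AdicCompletion.evalₐ_mk, AdicCompletion.evalₐ_mk,
        ← map_add]
      refine congrArg _ (Eq.trans ?_ (partialSum_add t _ _ N))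
      exact partialSum_congr t fun u _ => map_add σ _ _
    map_smul' := fun s z => AdicCompletion.ext_evalₐ fun N => by
      rw [RingHom.id_apply, Algebra.smul_def s (AdicCompletion.mk I R _),
        IsScalarTower.algebraMap_apply k R (AdicCompletion I R), map_mul, AlgHom.commutes,
        AdicCompletion.evalₐ_mk, AdicCompletion.evalₐ_mk, Ideal.Quotient.algebraMap_eq, ← map_mul]
      refine congrArg _ (Eq.trans ?_ (partialSum_smul t _ _ N))
      exact partialSum_congr t fun u _ => (map_smul σ _ _).trans (Algebra.smul_def _ _) }

theorem evalₐ_expand (hI : I = Ideal.span (Set.range t)) (z : (Fin n →₀ ℕ) → R ⧸ I) (N : ℕ) :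
    AdicCompletion.evalₐ I N (expand σ hI z) =
      Ideal.Quotient.mk (I ^ N) (partialSum t (fun u => σ (z u)) N) :=
  AdicCompletion.evalₐ_mk _ _ _

theorem partialSum_ext (hI : I = Ideal.span (Set.range t))
    (hσ : ∀ x, Ideal.Quotient.mk I (σ x) = x) (ht : IsQuasiRegular t)
    {z z' : (Fin n →₀ ℕ) → R ⧸ I} {N : ℕ}
    (h : partialSum t (fun u => σ (z u)) N - partialSum t (fun u => σ (z' u)) N ∈ I ^ N)
    (u : Fin n →₀ ℕ) (hu : u.degree < N) : z u = z' u := by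
  have h1 : partialSum t (fun u => σ (z u - z' u)) N + partialSum t (fun u => σ (z' u)) N =
      partialSum t (fun u => σ (z u)) N := by
    rw [← partialSum_add]
    exact partialSum_congr t fun u _ => (map_add σ _ _).symm.trans (by rw [sub_add_cancel])
  rw [← h1, add_sub_cancel_right] at h
  have h2 := ht.mem_of_partialSum_mem (a := fun u => σ (z u - z' u)) (fun u hu => ?_)
    (mem_pow_of_eq hI.symm h) u hu
  · rw [← sub_eq_zero, ← hσ (z u - z' u), h2, map_zero]
  · rw [← hI, ← Ideal.Quotient.eq_zero_iff_mem, hσ] at hu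
    rw [hu, map_zero]

/-- Quasi-regularity makes the coefficients unique at every finite precision, which gives
injectivity. It also makes the coefficients of successive approximations of an element compatible,
and these assemble to a preimage. -/
theorem expand_bijective (hI : I = Ideal.span (Set.range t))
    (hσ : ∀ x, Ideal.Quotient.mk I (σ x) = x) (ht : IsQuasiRegular t) :
    Function.Bijective (expand σ hI) := by
  constructor
  · intro z z' h
    funext u
    have h1 := congrArg (AdicCompletion.evalₐ I (u.degree + 1)) h
    rw [evalₐ_expand, evalₐ_expand, Ideal.Quotient.eq] at h1
    exact partialSum_ext σ hI hσ ht h1 u u.degree.lt_succ_self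
  · intro h
    obtain ⟨f, rfl⟩ := AdicCompletion.mk_surjective I R h
    choose z hz using exists_partialSum σ hI hσ
    have h1 : ∀ (M N : ℕ), M ≤ N → f.val N - f.val M ∈ I ^ M := fun M N hMN => by
      have h2 := f.property hMN
      rw [SModEq.comm, SModEq.sub_mem, smul_eq_mul, Ideal.mul_top] at h2
      exact h2
    -- Precision |u| + 1 is the least at which the coefficient of t^u is determined.
    refine ⟨fun u => z (f.val (u.degree + 1)) (u.degree + 1) u, AdicCompletion.ext_evalₐ
      fun N => ?_⟩
    rw [evalₐ_expand, AdicCompletion.evalₐ_mk, eq_comm, Ideal.Quotient.eq]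
    refine cast (congrArg (fun r => f.val N - r ∈ I ^ N) ?_) (hz (f.val N) N)
    refine partialSum_congr t fun u hu => congrArg σ ?_
    refine partialSum_ext σ hI hσ ht (N := u.degree + 1) ?_ u u.degree.lt_succ_self
    have h2 := hz (f.val (u.degree + 1)) (u.degree + 1)
    have h3 := Ideal.pow_le_pow_right (I := I) hu (hz (f.val N) N)
    have h4 := h1 _ _ hu
    have h5 := mem_pow_of_eq hI (partialSum_sub_mem t (fun v => σ (z (f.val N) N v)) hu)
    have h6 := Ideal.add_mem _ h2 (Ideal.sub_mem _ h4 (Ideal.add_mem _ h3 h5))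
    convert h6 using 1
    simp only [Nat.succ_eq_add_one]
    ring

theorem expand_mulVar (hI : I = Ideal.span (Set.range t)) (j : Fin n)
    (z : (Fin n →₀ ℕ) → R ⧸ I) : expand σ hI (mulVar j z) =
      algebraMap R (AdicCompletion I R) (t j) * expand σ hI z := by
  refine AdicCompletion.ext_evalₐ fun N => ?_
  rw [map_mul, AlgHom.commutes, evalₐ_expand, evalₐ_expand, Ideal.Quotient.algebraMap_eq, ← map_mul,
    ← partialSum_mulVar, Ideal.Quotient.eq]
  -- The product has one term more than the truncation at N. The extra term has degree N and
  -- vanishes modulo I^N.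
  have h := mem_pow_of_eq hI (partialSum_sub_mem t (mulVar j fun u => σ (z u)) N.le_succ)
  rw [← Submodule.neg_mem_iff, neg_sub] at h
  refine cast (congrArg (fun r => r - _ ∈ I ^ N) ?_) h
  refine partialSum_congr t fun u _ => ?_
  rw [mulVar, mulVar, apply_ite σ, map_zero]

end Expansion

/-! ### Partial derivatives of power series -/

section PartialDerivative

variable {k A : Type*} [CommRing k] [AddCommGroup A] [Module k A] {n : ℕ}

/-- The partial derivative of a power series, given by its coefficients. -/
noncomputable def seriesDeriv (k : Type*) {A : Type*} [CommRing k] [AddCommGroup A] [Module k A] {n : ℕ}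
    (i : Fin n) : ((Fin n →₀ ℕ) → A) →ₗ[k] ((Fin n →₀ ℕ) → A) where
  toFun z u := (u i + 1) • z (u + Finsupp.single i 1)
  map_add' _ _ := funext fun _ => smul_add _ _ _
  map_smul' _ _ := funext fun _ => smul_comm _ _ _

theorem seriesDeriv_comm (i j : Fin n) (z : (Fin n →₀ ℕ) → A) :
    seriesDeriv k i (seriesDeriv k j z) = seriesDeriv k j (seriesDeriv k i z) := by
  funext u
  change (u i + 1) • ((u + Finsupp.single i 1 : Fin n →₀ ℕ) j + 1) • z (u + _ + _) =
    (u j + 1) • ((u + Finsupp.single j 1 : Fin n →₀ ℕ) i + 1) • z (u + _ + _)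
  rw [smul_smul, smul_smul, add_right_comm u]
  congr 1
  by_cases h : i = j
  · subst h; rfl
  · rw [Finsupp.add_apply, Finsupp.add_apply, Finsupp.single_eq_of_ne h,
      Finsupp.single_eq_of_ne (Ne.symm h)]
    ring

/-- The product rule, coefficient by coefficient. Exponents that are zero in the j-th place are
treated separately because of the truncated subtraction. -/
theorem seriesDeriv_mulVar (i j : Fin n) (z : (Fin n →₀ ℕ) → A) :
    seriesDeriv k i (mulVar j z) = (if i = j then z else 0) + mulVar j (seriesDeriv k i z) := by
  funext u
  change (u i + 1) • mulVar j z (u + Finsupp.single i 1) = _ + (if u j = 0 then 0 else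
    ((u - Finsupp.single j 1 : Fin n →₀ ℕ) i + 1) • z (u - Finsupp.single j 1 + Finsupp.single i 1))
  by_cases h : i = j
  · subst h
    rw [mulVar, if_neg (by simp), if_pos rfl, add_tsub_cancel_right]
    split_ifs with h0
    · rw [h0, zero_add, one_smul, add_zero]
    · have h1 : Finsupp.single i 1 ≤ u := by rw [Finsupp.single_le_iff]; omega
      rw [tsub_add_cancel_of_le h1, Finsupp.tsub_apply, Finsupp.single_eq_same,
        Nat.sub_add_cancel (by omega), add_smul, one_smul, add_comm]
  · rw [mulVar, if_neg h, Pi.zero_apply, zero_add, Finsupp.add_apply,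
      Finsupp.single_eq_of_ne (Ne.symm h), add_zero]
    split_ifs with h0
    · rw [smul_zero]
    · have h1 : Finsupp.single j 1 ≤ u := by rw [Finsupp.single_le_iff]; omega
      rw [Finsupp.tsub_apply, Finsupp.single_eq_of_ne h, tsub_zero, tsub_add_eq_add_tsub h1]

end PartialDerivative

/-! ### Existence of the basis and the flat connection -/

section ExistsConnection

/-- Differentiation of power series is transported along the expansion isomorphism, under which
multiplication by t_j shifts exponents. The transported operators commute because the partial
derivatives do. -/
theorem exists_flat_connection {k R : Type u} [CommRing k] [CommRing R] [Algebra k R] {n : ℕ}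
    {t : Fin n → R} {I : Ideal R} (hI : I = Ideal.span (Set.range t)) (ht : IsQuasiRegular t)
    (σ : (R ⧸ I) →ₗ[k] R) (hσ : ∀ x, Ideal.Quotient.mk I (σ x) = x) :
    ∃ D : Fin n → AdicCompletion I R →ₗ[k] AdicCompletion I R,
      (∀ i j h, D i (algebraMap R (AdicCompletion I R) (t j) * h) =
        (if i = j then h else 0) + algebraMap R (AdicCompletion I R) (t j) * D i h) ∧
      ∀ i j h, D i (D j h) = D j (D i h) := by
  let E := LinearEquiv.ofBijective (expand σ hI) (expand_bijective σ hI hσ ht)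
  have hE : ∀ z, E z = expand σ hI z := fun _ => rfl
  refine ⟨fun i => E.toLinearMap ∘ₗ seriesDeriv k i ∘ₗ E.symm.toLinearMap, fun i j h => ?_,
    fun i j h => ?_⟩
  · obtain ⟨z, rfl⟩ := E.surjective h
    have h1 : algebraMap R (AdicCompletion I R) (t j) * E z = E (mulVar j z) :=
      (expand_mulVar σ hI j z).symm
    simp only [LinearMap.comp_apply, LinearEquiv.coe_coe]
    rw [h1, E.symm_apply_apply, E.symm_apply_apply, seriesDeriv_mulVar, map_add, apply_ite E,
      map_zero]
    exact congrArg _ (expand_mulVar σ hI j _)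
  · simp only [LinearMap.comp_apply, LinearEquiv.coe_coe, E.symm_apply_apply]
    rw [seriesDeriv_comm]

variable {k : Type u} [CommRing k]

theorem Potential.nonempty_connection (V : Potential k) : Nonempty (Connection V) := by
  have := V.free
  -- A free module is projective, so the quotient map onto J_V has a k-linear section. It need not
  -- be multiplicative.
  obtain ⟨σ, hσ⟩ := Module.projective_lifting_property
    (Ideal.Quotient.mkₐ k (jacobiIdeal V.W)).toLinearMap (LinearMap.id (M := V.Jac))
    Ideal.Quotient.mk_surjective
  obtain ⟨D, h1, h2⟩ := exists_flat_connection (I := jacobiIdeal V.W) rfl V.quasiRegular σ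
    fun x => LinearMap.congr_fun hσ x
  refine ⟨⟨D, fun i f => ?_, h2⟩⟩
  -- The rule for multiplication by a single t_j extends to all polynomials in t; constants are
  -- covered by k-linearity.
  induction f using MvPolynomial.induction_on with
  | C a =>
    intro h
    rw [pderiv_C, map_zero, zero_mul, zero_add, ← algebraMap_eq, AlgHom.commutes,
      ← Algebra.smul_def, ← Algebra.smul_def, map_smul]
  | add p q hp hq =>
    intro h
    rw [map_add, add_mul, map_add, hp, hq, map_add, map_add, add_mul, add_mul]
    abel
  | mul_X p j hp =>
    intro h
    have hX : V.evalT (X j) = algebraMap V.Poly V.Hat (pderiv j V.W) := aeval_X _ _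
    have hm : V.evalT (p * X j) = V.evalT p * algebraMap V.Poly V.Hat (pderiv j V.W) :=
      (map_mul _ _ _).trans (congrArg _ hX)
    rw [hm, mul_assoc, hp, h1, Derivation.leibniz, pderiv_X, map_add, smul_eq_mul,
      smul_eq_mul, map_mul, map_mul, hX]
    by_cases hij : i = j
    · subst hij
      rw [if_pos rfl, Pi.single_eq_same, map_one]
      ring
    · rw [if_neg hij, Pi.single_eq_of_ne (Ne.symm hij), map_zero]
      ring

theorem Potential.nonempty_cutChoice (V : Potential k) : Nonempty (CutChoice V) := by
  have := V.free
  have := V.finite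
  obtain ⟨D⟩ := V.nonempty_connection
  exact ⟨⟨_, (Module.Free.chooseBasis k V.Jac).reindex (Fintype.equivFin _), D⟩⟩

end ExistsConnection

end CutSystem

theorem mainTheorem5 (k : Type u) [CommRing k] [Algebra ℚ k] :
    -- every potential admits the choices which enter the definition of the cut
    (∀ V : Potential k, Nonempty (CutChoice V)) ∧
    -- whatever the choices, the cut of two `1`-morphisms is a `1`-morphism ...
    ∀ c : ∀ V : Potential k, CutChoice V,
    ∃ hcut : ∀ {W V U : Potential k} (Y : OneMor V U) (X : OneMor W V),
      (cut (c V) Y.data X.data).IsRep (potDiff W U),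
    -- ... and is the composition of a superbicategory without units, in which
    ∃ S : SuperbicategoryWithoutUnits k (Potential k) (fun W V => OneMor W V)
        (fun {_ V _} Y X => ⟨cut (c V) Y.data X.data, hcut Y X⟩),
      -- composition of `2`-morphisms is induced by `(ψ, φ) ↦ ψ | φ`
      (∀ {W V U : Potential k} (Y Y' : OneMor V U) (X X' : OneMor W V)
        (ψ : Op Y.data.toGradedOp Y'.data.toGradedOp) (hψ : ψ ∈ cycles Y.data Y'.data)
        (φ : Op X.data.toGradedOp X'.data.toGradedOp) (hφ : φ ∈ cycles X.data X'.data),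
        ∃ h : (c V).cutIdem Y'.data.toGradedOp X'.data.toGradedOp * (c V).cutOp 0 ψ φ ∈
            cycles (cut (c V) Y.data X.data) (cut (c V) Y'.data X'.data),
          S.hcomp (CliffordRep.homMk ψ hψ) (CliffordRep.homMk φ hφ) = CliffordRep.homMk _ h) ∧
      -- the associator is `(z ⊗ y) ⊗ x ↦ z ⊗ (y ⊗ x)`
      (∀ {W V U Q : Potential k} (Z : OneMor U Q) (Y : OneMor V U) (X : OneMor W V),
        ∃ h : assocMatrix (c V) (c U) Z.data Y.data X.data *
              (cut (c V) (cut (c U) Z.data Y.data) X.data).unit ∈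
            cycles (cut (c V) (cut (c U) Z.data Y.data) X.data)
              (cut (c U) Z.data (cut (c V) Y.data X.data)),
          (S.assoc Z Y X).hom = CliffordRep.homMk _ h) ∧
      -- this map is linear, up to homotopy, for all generators of the Clifford algebras, in particular
      -- for the generators of `C_m` and `C_p` whose action comes from the two cuts
      (∀ {W V U Q : Potential k} (Z : OneMor U Q) (Y : OneMor V U) (X : OneMor W V),
        IsCliffordLinear (cut_assoc_n (c V) (c U) Z.data Y.data X.data)
          (assocMatrix (c V) (c U) Z.data Y.data X.data)) ∧
      -- and `ΨY | X ≅ Ψ(Y | X)` is `y ⊗ x ↦ y ⊗ x`, while `Y | ΨX ≅ Ψ(Y | X)` is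
      -- `y ⊗ x ↦ (-1)^|y| y ⊗ x`
      (∀ {W V U : Potential k} (Y : OneMor V U) (X : OneMor W V),
        (∃ h : (cut (c V) Y.data.shift X.data).unit ∈
            cycles (cut (c V) Y.data.shift X.data) (cut (c V) Y.data X.data).shift,
          (S.τl Y X).hom = CliffordRep.homMk _ h) ∧
        ∃ h : signMatrix (c V) Y.data X.data * (cut (c V) Y.data X.data.shift).unit ∈
            cycles (cut (c V) Y.data X.data.shift) (cut (c V) Y.data X.data).shift,
          (S.τr Y X).hom = CliffordRep.homMk _ h) := by
  refine ⟨fun V => Potential.nonempty_cutChoice V, fun c => ?_⟩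
  -- The objects formed with this proof are definitionally those of `cutObj`, so the representatives
  -- of the 2-morphisms can be read off from the construction.
  refine ⟨fun {W V U} Y X => cut_isRep (c V) Y.isRep X.isRep, cutSuperbicategory c, ?_, ?_, ?_, ?_⟩
  · exact fun Y Y' X X' ψ hψ φ hφ => ⟨cutIdem_mul_cutOp_mem (c _) hψ hφ, rfl⟩
  · exact fun Z Y X => ⟨(intertwines_assoc (c _) (c _) Z Y X).mem, rfl⟩
  · exact fun Z Y X => isCliffordLinear_assoc (c _) (c _) Z.data Y.data X.data Z.isRep Y.isRep
  · exact fun Y X => ⟨shiftLIso_hom (c _) Y X, shiftRIso_hom (c _) Y X⟩
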